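/- **Setting.** Let $f:\mathbb R^d\to\mathbb R$ ($d\ge 1$) be twice differentiable with $|f(x)-f(y)|\le f_{\max}$, $\|\nabla f(x)-\nabla f(y)\|\le L\|x-y\|$ and $\|\nabla^2 f(x)-\nabla^2 f(y)\|\le\rho\|x-y\|$ for all $x,y$ ($\rho>0$). Let $\nabla F(x,\theta)$, $\theta\sim\mathcal D$, be an unbiased stochastic gradient: $\mathbb E_\theta\nabla F(x,\theta)=\nabla f(x)$, $\mathbb E_\theta\|\nabla F(x,\theta)-\nabla f(x)\|^2\le\sigma^2$. In the *Lipschitz setting* we assume moreover $\|\nabla F(x,\theta)-\nabla F(y,\theta)\|\le\tilde\ell\|x-y\|$ for all $x,y,\theta$; the *non-Lipschitz setting* is the one without this assumption. A point $x$ is an $\varepsilon$-SOSP if $\|\nabla f(x)\|\le\varepsilon$ and $\lambda_{\min}(\nabla^2 f(x))\ge-\sqrt{\rho\varepsilon}$. A (randomized, measurable) map $\mathcal C(x,\tilde\theta)$, $\tilde\theta\sim\tilde{\mathcal D}$, provides a $\mu$-compression of $x$ if $\mathbb E_{\tilde\theta}\|x-\mathcal C(x,\tilde\theta)\|^2\le(1-\mu)\|x\|^2$;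 it is a $\mu$-compressor if it does so for every $x$. **Algorithm** (compressed SGD with parameters $\eta>0$, $T$, $r\ge 0$, a flag $reset\_error$, $\mathcal I$, $\mathcal R$). Start from any $x_0$ with $e_0=0$, $t'=0$. For $t=0,\dots,T-1$: if $reset\_error$ is set and ($t-t'>\mathcal I$ or $\|x_{t'}-(x_t-\eta e_t)\|>\mathcal R$), then put $t'\leftarrow t$, $x_t\leftarrow x_t-\eta e_t$, $e_t\leftarrow 0$ (a *reset*). Then sample independently $\xi_t\sim N(0,\frac{r^2}{d}I_d)$ (total variance $r^2$), $\theta_t\sim\mathcal D$, $\tilde\theta_t\sim\tilde{\mathcal D}$, and put $G_t=e_t+\nabla F(x_t,\theta_t)+\xi_t$, $g_t=\mathcal C(G_t,\tilde\theta_t)$, $x_{t+1}=x_t-\eta g_t$, $e_{t+1}=G_t-g_t$. The communication per worker is the number of symbols (numbers or bits) in the messages that encode the $g_t$, plus $d$ for each reset. We say that the algorithm *converges to an $\varepsilon$-SOSP with communication $M$* if, with probability at least $1-\delta$, both of the following hold: the total communication per worker is at most $M$; and at least half of the points $x_t$, $0\le t<T$, are $\varepsilon$-SOSP (if $reset\_error$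 is not set), respectively there is at least one reset and at least half of the points $x_t$ (after the reset) at iterations $t<T$ with a reset are $\varepsilon$-SOSP (if $reset\_error$ is set). **Statement.** Let $\delta\in(0,1)$ and $0<\varepsilon\le 1$. Below, $\tilde O(B)$ means at most $K\,s^p(1+\log\frac d\varepsilon)^p\,B$, where $K,p$ depend only on $\delta$ and $s=1+f_{\max}+L+\rho+\rho^{-1}+\sigma+\tilde\ell$ (without $\tilde\ell$ in the non-Lipschitz setting, and with the further summand $c^{-1}$ in part 3). In each part, parameters $\eta,T,r,\mathcal I,\mathcal R$ exist that depend only on $\delta,d,\varepsilon,f_{\max},L,\rho,\sigma,\tilde\ell$ and the setting (and on $c$ in part 3) such that $T$ is bounded as stated and, for every $f$, $\nabla F$, $\mathcal D$, $x_0$ as above, the algorithm converges to an $\varepsilon$-SOSP with communication as stated. 1. *Sketch-based TopK* ($reset\_error$ set). Let $\mu=\sqrt d\,\varepsilon^{3/4}$ in the Lipschitz and $\mu=\varepsilon^{3/4}$ in the non-Lipschitz setting, assume $\frac1d\le\mu\le1$ and put $k=\lceil d\mu\rceil$. Then $T=\tilde O(\frac1{\varepsilon^4})$ with communication $b\cdot\tilde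 O\big(\frac{d\sqrt d}{\varepsilon^{3+1/4}}\big)$ in the Lipschitz setting, and $T=\tilde O(\frac d{\varepsilon^4})$ with communication $b\cdot\tilde O\big(\frac{d^2}{\varepsilon^{3+1/4}}\big)$ in the non-Lipschitz setting, both for (a) sketch-based TopK with a Count Sketch of $m\ge\kappa(1+\log d)$ rows and $B\ge\kappa k$ buckets per row, $mB\le bk$, $b\ge1$, where $\kappa>0$ depends only on $\delta$, and (b) any $\frac kd$-compressor whose messages have at most $bk$ symbols, $b\ge1$. Here sketch-based TopK sends the $m\times B$ Count Sketch of the vector (each row has a uniformly random hash function and uniformly random signs), estimates the coordinates $\hat x_i$ and the squared norm $\hat\ell^2$ by medians over the rows, lists the coordinates with $\hat x_i^2\ge\hat\ell^2/k$ first and the others after them, each group in a uniformly random order, and keeps exactly the first $k$ coordinates of this list, whose true values are sent in a second round. 2. *RandomK*, which keeps $k$ uniformly random coordinates and sends them ($reset\_error$ not set). Let $\mu=\varepsilon^{3/4}$ in the Lipschitz and $\mu=\varepsilon^{3/4}/\sqrt d$ in the non-Lipschitz setting, assume $\mu\ge\frac1d$ and put $k=\lceil d\mu\rceil$. Then $T=\tilde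 O(\frac1{\varepsilon^4})$ with communication $\tilde O\big(\frac d{\varepsilon^{3+1/4}}\big)$ in the Lipschitz setting, and $T=\tilde O(\frac d{\varepsilon^4})$ with communication $\tilde O\big(\frac{d\sqrt d}{\varepsilon^{3+1/4}}\big)$ in the non-Lipschitz setting. 3. *Constant $c$-compressor*, $0<c<1$ ($reset\_error$ set). Let $\mathcal C$ be such that, almost surely, for all $t<T$, $\mathcal C$ provides a $c$-compression of $G_t$ and the message in iteration $t$ has at most $b$ symbols, $b\ge1$. Then $T=\tilde O\big(\frac1{\varepsilon^4}+\frac d{\varepsilon^2\sqrt\varepsilon}\big)$ with communication $b\cdot\tilde O\big(\frac1{\varepsilon^4}+\frac d{\varepsilon^2\sqrt\varepsilon}\big)$ in the Lipschitz setting, and $T=\tilde O(\frac d{\varepsilon^4})$ with communication $b\cdot\tilde O(\frac d{\varepsilon^4})$ in the non-Lipschitz setting. -/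

import Mathlib

open MeasureTheory ProbabilityTheory
open scoped ENNReal RealInnerProductSpace

universe u v w

namespace CompressedSGD

/-- The parameter space `ℝ^d` with the Euclidean norm. -/
abbrev Vec (d : ℕ) : Type := EuclideanSpace ℝ (Fin d)

/-! ### Objective and stochastic gradient -/

/-- The Hessian of `f`, as a linear operator. -/
noncomputable def hessian {d : ℕ} (f : Vec d → ℝ) (x : Vec d) : Vec d →L[ℝ] Vec d :=
  fderiv ℝ (gradient f) x

/-- `f` is twice (continuously) differentiable, `fmax`-bounded, `L`-smooth and has a `ρ`-Lipschitz
Hessian. -/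
structure IsSmoothObjective {d : ℕ} (f : Vec d → ℝ) (fmax L ρ : ℝ) : Prop where
  contDiff : ContDiff ℝ 2 f
  bounded : ∀ x y, |f x - f y| ≤ fmax
  smooth : ∀ x y, ‖gradient f x - gradient f y‖ ≤ L * ‖x - y‖
  hessianLipschitz : ∀ x y, ‖hessian f x - hessian f y‖ ≤ ρ * ‖x - y‖

/-- `g x θ`, `θ ∼ D`, is an unbiased stochastic gradient of `f` with variance at most `σ²`. -/
structure IsStochasticGradient {d : ℕ} {Θ : Type u} [MeasurableSpace Θ] (D : Measure Θ)
    (g : Vec d → Θ → Vec d) (f : Vec d → ℝ) (σ : ℝ) : Prop where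
  measurable : Measurable (fun p : Vec d × Θ => g p.1 p.2)
  integrable : ∀ x, Integrable (g x) D
  unbiased : ∀ x, ∫ θ, g x θ ∂D = gradient f x
  variance : ∀ x, ∫⁻ θ, ‖g x θ - gradient f x‖ₑ ^ 2 ∂D ≤ ENNReal.ofReal (σ ^ 2)

/-- The stochastic gradient is `ℓ`-Lipschitz for every value of its randomness. -/
def IsLipschitzGradient {d : ℕ} {Θ : Type u} (g : Vec d → Θ → Vec d) (ℓ : ℝ) : Prop :=
  ∀ x y θ, ‖g x θ - g y θ‖ ≤ ℓ * ‖x - y‖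

/-- `ε`-second-order stationary point: the gradient has norm at most `ε` and every eigenvalue of
the Hessian is at least `-√(ρ ε)`. -/
def IsSOSP {d : ℕ} (f : Vec d → ℝ) (ρ ε : ℝ) (x : Vec d) : Prop :=
  ‖gradient f x‖ ≤ ε ∧
    ∀ lam : ℝ, Module.End.HasEigenvalue (hessian f x : Vec d →ₗ[ℝ] Vec d) lam →
      -√(ρ * ε) ≤ lam

/-! ### Compressors -/

/-- A randomized compressor together with the message by which a compressed vector is
communicated. The seed is shared randomness; a message is a word over the alphabet `Sym`
(bits for `Sym = Bool`, numbers for `Sym = ℝ`). -/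
structure Compressor (d : ℕ) where
  Seed : Type v
  seedSpace : MeasurableSpace Seed
  law : Measure Seed
  isProb : IsProbabilityMeasure law
  Sym : Type w
  encode : Vec d → Seed → List Sym
  decode : List Sym → Seed → Vec d

attribute [instance] Compressor.seedSpace Compressor.isProb

namespace Compressor

/-- The compressed vector `C(x, s)`. -/
def apply {d : ℕ} (C : Compressor.{v, w} d) (x : Vec d) (s : C.Seed) : Vec d :=
  C.decode (C.encode x s) s

/-- The number of symbols that a worker sends to communicate `C(x, s)`. -/
def cost {d : ℕ} (C : Compressor.{v, w} d) (x : Vec d) (s : C.Seed) : ℕ :=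
  (C.encode x s).length

/-- Joint measurability of the compression map. -/
def IsMeasurable {d : ℕ} (C : Compressor.{v, w} d) : Prop :=
  Measurable (fun p : Vec d × C.Seed => C.apply p.1 p.2)

/-- `C` provides a `μ`-compression of the vector `x`. -/
def CompressesAt {d : ℕ} (C : Compressor.{v, w} d) (μ : ℝ) (x : Vec d) : Prop :=
  ∫⁻ s, ‖x - C.apply x s‖ₑ ^ 2 ∂C.law ≤ ENNReal.ofReal (1 - μ) * ‖x‖ₑ ^ 2

end Compressor

/-- RandomK: a uniformly random permutation `π` is drawn, and the `k` coordinates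
`π 0, …, π (k - 1)` are sent; all other coordinates become zero. -/
noncomputable def randomK (d k : ℕ) : Compressor.{0, 0} d where
  Seed := Equiv.Perm (Fin d)
  seedSpace := ⊤
  law := @PMF.toMeasure _ ⊤ (PMF.uniformOfFintype (Equiv.Perm (Fin d)))
  isProb := @PMF.toMeasure.isProbabilityMeasure _ ⊤ _
  Sym := ℝ
  encode x π := ((List.finRange d).take k).map (fun r : Fin d => x (π r))
  decode l π := WithLp.toLp 2 (fun i => l.getD (π.symm i : ℕ) 0)

/-- The (upper) median of finitely many real numbers. -/
noncomputable def median {m : ℕ} (a : Fin m → ℝ) : ℝ :=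
  ((List.ofFn a).mergeSort (fun s t => decide (s ≤ t))).getD (m / 2) 0

/-- The randomness of sketch-based TopK: a hash function and a sign function for each of the `m`
rows of the Count Sketch with `B` buckets per row, and a random order of the coordinates. -/
structure SketchSeed (d m B : ℕ) where
  hash : Fin m → Fin d → Fin B
  sign : Fin m → Fin d → Bool
  order : Equiv.Perm (Fin d)

/-- A sketch seed is a triple of its components. -/
def sketchSeedEquiv (d m B : ℕ) : SketchSeed d m B ≃
    (Fin m → Fin d → Fin B) × (Fin m → Fin d → Bool) × Equiv.Perm (Fin d) where
  toFun s := (s.hash, s.sign, s.order)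
  invFun p := ⟨p.1, p.2.1, p.2.2⟩
  left_inv _ := rfl
  right_inv _ := rfl

instance (d m B : ℕ) : Fintype (SketchSeed d m B) :=
  Fintype.ofEquiv _ (sketchSeedEquiv d m B).symm

instance (d m B : ℕ) [NeZero B] : Nonempty (SketchSeed d m B) :=
  ⟨⟨fun _ _ => 0, fun _ _ => true, 1⟩⟩

namespace SketchSeed

variable {d m B : ℕ}

/-- The random sign `±1` of coordinate `i` in row `a`. -/
def sgn (s : SketchSeed d m B) (a : Fin m) (i : Fin d) : ℝ := if s.sign a i then 1 else -1

/-- The Count Sketch of `x`, a linear function of `x`: bucket `β` of row `a` holds the signed sum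
of the coordinates that are hashed to it. -/
noncomputable def sketch (s : SketchSeed d m B) (x : Vec d) (a : Fin m) (β : Fin B) : ℝ :=
  ∑ i, if s.hash a i = β then s.sgn a i * x i else 0

/-- The estimate of coordinate `i` that is recovered from the sketch `S`. -/
noncomputable def estimate (s : SketchSeed d m B) (S : Fin m → Fin B → ℝ) (i : Fin d) : ℝ :=
  median (fun a => s.sgn a i * S a (s.hash a i))

/-- The estimate of the squared norm that is recovered from the sketch `S`. -/
noncomputable def normSqEstimate (S : Fin m → Fin B → ℝ) : ℝ :=
  median (fun a => ∑ β, S a β ^ 2)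

/-- Coordinate `i` is recognized as heavy: its estimated square is at least a `1/k` fraction of
the estimated squared norm. -/
def Heavy (s : SketchSeed d m B) (k : ℕ) (S : Fin m → Fin B → ℝ) (i : Fin d) : Prop :=
  normSqEstimate S / k ≤ s.estimate S i ^ 2

open Classical in
/-- The position of coordinate `i` when the heavy coordinates are listed first and all the others
after them, either group in the random order. -/
noncomputable def rank (s : SketchSeed d m B) (k : ℕ) (S : Fin m → Fin B → ℝ) (i : Fin d) : ℕ :=
  (Finset.univ.filter (fun j : Fin d =>
    (s.Heavy k S j ∧ ¬ s.Heavy k S i) ∨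
      ((s.Heavy k S j ↔ s.Heavy k S i) ∧ s.order j < s.order i))).card

/-- Reads a sketch from the first `m * B` entries of a message. -/
noncomputable def readSketch (m B : ℕ) (l : List ℝ) (a : Fin m) (β : Fin B) : ℝ :=
  l.getD (finProdFinEquiv (a, β) : ℕ) 0

end SketchSeed

/-- Sketch-based TopK: the worker sends the `m × B` Count Sketch of its vector; from the sketch,
the heavy coordinates are recovered, and they are completed by random coordinates to a set of `k`
coordinates; in a second round the exact values of these `k` coordinates are sent. All other
coordinates become zero. -/
noncomputable def sketchTopK (d k m B : ℕ) [NeZero B] : Compressor.{0, 0} d where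
  Seed := SketchSeed d m B
  seedSpace := ⊤
  law := @PMF.toMeasure _ ⊤ (PMF.uniformOfFintype (SketchSeed d m B))
  isProb := @PMF.toMeasure.isProbabilityMeasure _ ⊤ _
  Sym := ℝ
  encode x s :=
    List.ofFn (fun q : Fin (m * B) =>
      s.sketch x (finProdFinEquiv.symm q).1 (finProdFinEquiv.symm q).2) ++
    ((List.finRange d).take k).map (fun r : Fin d =>
      ∑ i, if s.rank k (s.sketch x) i = (r : ℕ) then x i else 0)
  decode l s := WithLp.toLp 2 (fun i =>
    (l.drop (m * B)).getD (s.rank k (SketchSeed.readSketch m B l) i) 0)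

/-! ### The algorithm -/

/-- Parameters of the algorithm: step size, number of iterations, standard deviation of the
artificial noise, the flag for resetting the error, the number of iterations and the radius after
which the error is reset. -/
structure Params where
  η : ℝ
  T : ℕ
  r : ℝ
  resetError : Bool
  I : ℕ
  R : ℝ

/-- The law `N_d(0, r²)` of the artificial noise: a centred isotropic Gaussian vector of total
variance `r²`, that is, of variance `r² / d` in each coordinate. -/
noncomputable def noiseLaw (d : ℕ) (r : ℝ) : Measure (Vec d) :=
  (stdGaussian (Vec d)).map (fun z => (r / √d) • z)

/-- The variables of the algorithm: the iterate `x`, the error `e`, the iteration `t'` of the last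
reset and the iterate `x_{t'}` at that time. -/
structure State (d : ℕ) where
  x : Vec d
  e : Vec d
  lastReset : ℕ
  anchor : Vec d

section Run

variable {d : ℕ} {Θ : Type u} (A : Params) (C : Compressor.{v, w} d) (g : Vec d → Θ → Vec d)

/-- The condition for resetting the error at iteration `t`. -/
def ResetCond (t : ℕ) (S : State d) : Prop :=
  A.resetError = true ∧
    (S.lastReset + A.I < t ∨ A.R < ‖S.anchor - (S.x - A.η • S.e)‖)

open Classical in
/-- The state after the possible reset at the beginning of iteration `t`. -/
noncomputable def resetStep (t : ℕ) (S : State d) : State d :=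
  if ResetCond A t S then
    { x := S.x - A.η • S.e, e := 0, lastReset := t, anchor := S.x - A.η • S.e }
  else S

/-- The vector `e_t + ∇F(x_t, θ_t) + ξ_t` that is compressed. -/
noncomputable def compressInput (S : State d) (ξ : Vec d) (θ : Θ) : Vec d :=
  S.e + g S.x θ + ξ

/-- Compressed gradient step and update of the error. -/
noncomputable def gradStep (S : State d) (n : Vec d × Θ × C.Seed) : State d :=
  let G := compressInput g S n.1 n.2.1
  let c := C.apply G n.2.2
  { S with x := S.x - A.η • c, e := G - c }

/-- The state at the beginning of iteration `t`, before the possible reset, started at `x₀`, when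
`ω t = (ξ_t, θ_t, θ̃_t)` are the random samples. -/
noncomputable def run (x₀ : Vec d) (ω : ℕ → Vec d × Θ × C.Seed) : ℕ → State d
  | 0 => { x := x₀, e := 0, lastReset := 0, anchor := x₀ }
  | t + 1 => gradStep A C g (resetStep A t (run x₀ ω t)) (ω t)

/-- The state in iteration `t`, after the possible reset. -/
noncomputable def stateAt (x₀ : Vec d) (ω : ℕ → Vec d × Θ × C.Seed) (t : ℕ) : State d :=
  resetStep A t (run A C g x₀ ω t)

/-- The vector that is compressed in iteration `t`. -/
noncomputable def inputAt (x₀ : Vec d) (ω : ℕ → Vec d × Θ × C.Seed) (t : ℕ) : Vec d :=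
  compressInput g (stateAt A C g x₀ ω t) (ω t).1 (ω t).2.1

open Classical in
/-- The iterations at which the error is reset. -/
noncomputable def resetTimes (x₀ : Vec d) (ω : ℕ → Vec d × Θ × C.Seed) : Finset ℕ :=
  (Finset.range A.T).filter (fun t => ResetCond A t (run A C g x₀ ω t))

/-- The iterations whose points are considered: the reset iterations if errors are reset, and all
iterations otherwise. -/
noncomputable def candidateTimes (x₀ : Vec d) (ω : ℕ → Vec d × Θ × C.Seed) : Finset ℕ :=
  if A.resetError = true then resetTimes A C g x₀ ω else Finset.range A.T

open Classical in
/-- The candidate points exist, and at least half of them are `ε`-SOSP of `f`. -/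
def HalfSOSP (f : Vec d → ℝ) (ρ ε : ℝ) (x₀ : Vec d) (ω : ℕ → Vec d × Θ × C.Seed) : Prop :=
  0 < (candidateTimes A C g x₀ ω).card ∧
    (candidateTimes A C g x₀ ω).card ≤
      2 * ((candidateTimes A C g x₀ ω).filter
        (fun t => IsSOSP f ρ ε (stateAt A C g x₀ ω t).x)).card

/-- The total communication per worker: the messages of the compressor in all iterations, and the
`d` coordinates of the error for each reset. -/
noncomputable def totalComm (x₀ : Vec d) (ω : ℕ → Vec d × Θ × C.Seed) : ℕ :=
  (∑ t ∈ Finset.range A.T, C.cost (inputAt A C g x₀ ω t) (ω t).2.2) +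
    d * (resetTimes A C g x₀ ω).card

/-- The law of the samples `(ξ_t, θ_t, θ̃_t)`, `t = 0, 1, …`: all of them are independent, with
`ξ_t ∼ N_d(0, r²)`, `θ_t ∼ D` and `θ̃_t` distributed as the seed of the compressor. -/
noncomputable def sampleLaw [MeasurableSpace Θ] (D : Measure Θ) :
    Measure (ℕ → Vec d × Θ × C.Seed) :=
  Measure.infinitePi (fun _ : ℕ => (noiseLaw d A.r).prod (D.prod C.law))

/-- With probability at least `1 - δ`, at least half of the candidate points are `ε`-SOSP and the
total communication per worker is at most `comm`. -/
def Converges [MeasurableSpace Θ] (D : Measure Θ) (f : Vec d → ℝ) (ρ ε : ℝ) (x₀ : Vec d)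
    (δ comm : ℝ) : Prop :=
  ENNReal.ofReal (1 - δ) ≤ sampleLaw A C D
    {ω | HalfSOSP A C g f ρ ε x₀ ω ∧ (totalComm A C g x₀ ω : ℝ) ≤ comm}

end Run

/-- The objective, the oracle and, in the Lipschitz setting `lip = true`, its Lipschitz constant
satisfy the assumptions. -/
def IsProblem {d : ℕ} {Θ : Type u} [MeasurableSpace Θ] (D : Measure Θ)
    (g : Vec d → Θ → Vec d) (f : Vec d → ℝ) (lip : Bool) (fmax L ρ σ ℓ : ℝ) : Prop :=
  IsSmoothObjective f fmax L ρ ∧ IsStochasticGradient D g f σ ∧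
    (lip = true → IsLipschitzGradient g ℓ)

/-- The factor hidden in `Õ`: a constant, a power of the size `s` of the problem constants, and a
power of the logarithm of the dimension and the accuracy. -/
noncomputable def softFactor (K : ℝ) (p : ℕ) (s : ℝ) (d : ℕ) (ε : ℝ) : ℝ :=
  K * s ^ p * (1 + Real.log (d / ε)) ^ p

/-- The size of the problem constants; `ℓ` matters only in the Lipschitz setting. -/
noncomputable def problemSize (lip : Bool) (fmax L ρ σ ℓ : ℝ) : ℝ :=
  1 + fmax + L + ρ + ρ⁻¹ + σ + (if lip then ℓ else 0)

end CompressedSGD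

/-! # Compressed stochastic gradient descent escapes saddle points -/

namespace CompressedSGD

/-! ### Upper bounds for expectations -/

/-- `φ` is integrable and its expectation is at most `c`. -/
def Bd {Ω : Type*} [MeasurableSpace Ω] (μ : Measure Ω) (φ : Ω → ℝ) (c : ℝ) : Prop :=
  Integrable φ μ ∧ ∫ ω, φ ω ∂μ ≤ c

namespace Bd

variable {Ω : Type*} [MeasurableSpace Ω] {μ : Measure Ω} {φ ψ : Ω → ℝ} {a b : ℝ}

lemma mono (h : Bd μ ψ a) (hm : Measurable φ) (h0 : ∀ ω, 0 ≤ φ ω) (hle : ∀ ω, φ ω ≤ ψ ω)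
    (hab : a ≤ b) : Bd μ φ b := by
  have hi : Integrable φ μ := h.1.mono' hm.aestronglyMeasurable
    (Filter.Eventually.of_forall fun ω => by rw [Real.norm_of_nonneg (h0 ω)]; exact hle ω)
  exact ⟨hi, (integral_mono hi h.1 hle).trans (h.2.trans hab)⟩

lemma weaken (h : Bd μ φ a) (hab : a ≤ b) : Bd μ φ b := ⟨h.1, h.2.trans hab⟩

lemma add (h : Bd μ φ a) (h' : Bd μ ψ b) : Bd μ (fun ω => φ ω + ψ ω) (a + b) :=
  ⟨h.1.add h'.1, by rw [integral_add h.1 h'.1]; exact add_le_add h.2 h'.2⟩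

lemma const_mul (h : Bd μ φ a) {k : ℝ} (hk : 0 ≤ k) : Bd μ (fun ω => k * φ ω) (k * a) :=
  ⟨h.1.const_mul k, by rw [integral_const_mul]; exact mul_le_mul_of_nonneg_left h.2 hk⟩

lemma const [IsProbabilityMeasure μ] (k : ℝ) : Bd μ (fun _ => k) k :=
  ⟨integrable_const k, by simp⟩

lemma sum {ι : Type*} {s : Finset ι} {φ : ι → Ω → ℝ} {a : ι → ℝ} (h : ∀ i ∈ s, Bd μ (φ i) (a i)) :
    Bd μ (fun ω => ∑ i ∈ s, φ i ω) (∑ i ∈ s, a i) :=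
  ⟨integrable_finsetSum _ fun i hi => (h i hi).1, by
    rw [integral_finsetSum _ fun i hi => (h i hi).1]
    exact Finset.sum_le_sum fun i hi => (h i hi).2⟩

lemma congr (h : Bd μ φ a) (he : ∀ ω, ψ ω = φ ω) : Bd μ ψ a := by
  rwa [show ψ = φ from funext he]

lemma of_lintegral (hm : Measurable φ) (h0 : ∀ ω, 0 ≤ φ ω) (ha : 0 ≤ a)
    (h : ∫⁻ ω, ENNReal.ofReal (φ ω) ∂μ ≤ ENNReal.ofReal a) : Bd μ φ a := by
  refine ⟨⟨hm.aestronglyMeasurable, ?_⟩, ?_⟩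
  · rw [hasFiniteIntegral_iff_ofReal (Filter.Eventually.of_forall h0)]
    exact h.trans_lt ENNReal.ofReal_lt_top
  · rw [integral_eq_lintegral_of_nonneg_ae (Filter.Eventually.of_forall h0)
      hm.aestronglyMeasurable]
    exact ENNReal.toReal_le_of_le_ofReal ha h

lemma comp {Ω' : Type*} [MeasurableSpace Ω'] {μ' : Measure Ω'} {X : Ω' → Ω}
    (h : Bd μ φ a) (hX : MeasurePreserving X μ' μ) : Bd μ' (fun ω => φ (X ω)) a := by
  have h1 := h.1
  rw [← hX.map_eq] at h1
  refine ⟨h1.comp_measurable hX.measurable, ?_⟩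
  rw [← integral_map hX.measurable.aemeasurable h1.aestronglyMeasurable, hX.map_eq]
  exact h.2

/-- Markov's inequality. -/
lemma measure_le [IsFiniteMeasure μ] (h : Bd μ φ a) (h0 : ∀ ω, 0 ≤ φ ω) {k : ℝ} (hk : 0 < k) :
    μ {ω | k ≤ φ ω} ≤ ENNReal.ofReal (a / k) := by
  have := mul_meas_ge_le_integral_of_nonneg (Filter.Eventually.of_forall h0) h.1 k
  rw [← ENNReal.ofReal_toReal (measure_ne_top μ _)]
  apply ENNReal.ofReal_le_ofReal
  rw [le_div_iff₀ hk, mul_comm]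
  exact this.trans h.2

lemma prod {Ω' : Type*} [MeasurableSpace Ω'] {ν : Measure Ω'} [SFinite μ] [SFinite ν]
    {F : Ω → Ω' → ℝ} (hF : Measurable (Function.uncurry F)) (h0 : ∀ x n, 0 ≤ F x n)
    {Φ : Ω → ℝ} (hb : ∀ x, Bd ν (F x) (Φ x)) (h : Bd μ Φ a) :
    Bd (μ.prod ν) (fun p => F p.1 p.2) a := by
  have hi : Integrable (Function.uncurry F) (μ.prod ν) := by
    rw [integrable_prod_iff hF.aestronglyMeasurable]
    refine ⟨Filter.Eventually.of_forall fun x => (hb x).1, h.1.mono' ?_ ?_⟩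
    · exact (hF.norm.stronglyMeasurable.integral_prod_right (ν := ν)).aestronglyMeasurable
    · refine Filter.Eventually.of_forall fun x => ?_
      simp only [Function.uncurry_apply_pair, Real.norm_of_nonneg (h0 _ _)]
      rw [Real.norm_of_nonneg (integral_nonneg (h0 x))]
      exact (hb x).2
  refine ⟨hi, ?_⟩
  have := integral_prod _ hi
  simp only [Function.uncurry] at this
  rw [this]
  exact (integral_mono hi.integral_prod_left h.1 fun x => (hb x).2).trans h.2

end Bd

/-! ### Chains driven by independent samples -/

section ChainDef

variable {N S : Type*}

/-- The first `t` terms of the first sequence followed by the second sequence. -/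
def splice (t : ℕ) (p : (ℕ → N) × (ℕ → N)) (s : ℕ) : N := if s < t then p.1 s else p.2 (s - t)

/-- The chain `X_{t+1} = step t X_t ω_t` started at `z`. -/
def chain (step : ℕ → S → N → S) (z : S) (ω : ℕ → N) : ℕ → S
  | 0 => z
  | t + 1 => step t (chain step z ω t) (ω t)

variable {step : ℕ → S → N → S}

lemma chain_congr (z : S) (t : ℕ) (ω ω' : ℕ → N) (h : ∀ s < t, ω s = ω' s) :
    chain step z ω t = chain step z ω' t := by
  induction t with
  | zero => rfl
  | succ t ih =>
    simp only [chain]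
    rw [ih fun s hs => h s (hs.trans t.lt_succ_self), h t t.lt_succ_self]

lemma chain_splice (z : S) (t j : ℕ) (p : (ℕ → N) × (ℕ → N)) :
    chain step z (splice t p) (t + j) =
      chain (fun i => step (t + i)) (chain step z p.1 t) p.2 j := by
  induction j with
  | zero => exact chain_congr z t _ _ fun s hs => by simp [splice, hs]
  | succ j ih =>
    rw [← add_assoc]
    simp only [chain]
    rw [ih]
    simp [splice]

end ChainDef

section Chain

variable {N : Type*} [MeasurableSpace N] (ν : Measure N) [IsProbabilityMeasure ν]
variable {S : Type*} [MeasurableSpace S]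

/-- The law of a sequence of independent samples of `ν`. -/
noncomputable abbrev iidLaw : Measure (ℕ → N) := Measure.infinitePi (fun _ : ℕ => ν)

lemma measurePreserving_splice (t : ℕ) :
    MeasurePreserving (splice t) ((iidLaw ν).prod (iidLaw ν)) (iidLaw ν) := by
  have hm : Measurable (splice (N := N) t) := by
    refine measurable_pi_lambda _ fun s => ?_
    unfold splice
    by_cases h : s < t
    · simp only [h, if_true]; fun_prop
    · simp only [h, if_false]; fun_prop
  refine ⟨hm, Measure.eq_infinitePi _ fun s A hA => ?_⟩
  rw [Measure.map_apply hm (MeasurableSet.pi s.countable_toSet fun i hi => hA i)]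
  set s₂ : Finset ℕ := (s.filter (fun i => ¬ i < t)).image (fun i => i - t)
  have hinj : Set.InjOn (fun i => i - t) (s.filter (fun i => ¬ i < t) : Finset ℕ) := by
    intro i hi j hj hij
    simp only [Finset.coe_filter, Set.mem_ofPred_eq, not_lt] at hi hj hij
    omega
  have hpre : splice t ⁻¹' (Set.pi s A) =
      (Set.pi (s.filter (· < t)) A) ×ˢ (Set.pi s₂ fun j => A (j + t)) := by
    ext p
    simp only [Set.mem_preimage, Set.mem_pi, Finset.mem_coe, Set.mem_prod, Finset.mem_filter, s₂,
      Finset.mem_image, splice]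
    constructor
    · intro h
      refine ⟨fun i hi => by simpa [hi.2] using h i hi.1, ?_⟩
      rintro j ⟨i, ⟨hi, hit⟩, rfl⟩
      have := h i hi
      rw [if_neg hit] at this
      rwa [Nat.sub_add_cancel (not_lt.1 hit)]
    · rintro ⟨h1, h2⟩ i hi
      by_cases hit : i < t
      · simpa [hit] using h1 i ⟨hi, hit⟩
      · have := h2 (i - t) ⟨i, ⟨hi, hit⟩, rfl⟩
        rw [if_neg hit]
        rwa [Nat.sub_add_cancel (not_lt.1 hit)] at this
  rw [hpre, Measure.prod_prod, Measure.infinitePi_pi _ fun i _ => hA i,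
    Measure.infinitePi_pi _ fun i _ => hA (i + t), Finset.prod_image hinj,
    ← Finset.prod_filter_mul_prod_filter_not s (· < t)]
  congr 1
  refine Finset.prod_congr rfl fun i hi => ?_
  rw [Nat.sub_add_cancel (not_lt.1 (Finset.mem_filter.1 hi).2)]

lemma measurePreserving_splice_eval (t : ℕ) {X : (ℕ → N) → S} (hX : Measurable X)
    (hd : ∀ ω ω' : ℕ → N, (∀ s < t, ω s = ω' s) → X ω = X ω') :
    (iidLaw ν).map (fun ω => (X ω, ω t)) = ((iidLaw ν).map X).prod ν := by
  have h1 : (iidLaw ν).map (fun ω => (X ω, ω t)) =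
      ((iidLaw ν).prod (iidLaw ν)).map (Prod.map X (fun ω => ω 0)) := by
    conv_lhs => rw [← (measurePreserving_splice ν t).map_eq, Measure.map_map (by fun_prop)
      (measurePreserving_splice ν t).measurable]
    congr 1
    ext p
    · refine hd _ _ fun s hs => by simp [splice, hs]
    · simp [splice]
  rw [h1, ← Measure.map_prod_map _ _ hX (by fun_prop)]
  congr 1
  exact Measure.infinitePi_map_eval _ 0

lemma Bd.step {t : ℕ} {X : (ℕ → N) → S} (hX : Measurable X)
    (hd : ∀ ω ω' : ℕ → N, (∀ s < t, ω s = ω' s) → X ω = X ω')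
    {F : S → N → ℝ} (hF : Measurable (Function.uncurry F)) (h0 : ∀ x n, 0 ≤ F x n)
    {Φ : S → ℝ} (hΦ : Measurable Φ) (hb : ∀ x, Bd ν (F x) (Φ x)) {c : ℝ}
    (h : Bd (iidLaw ν) (fun ω => Φ (X ω)) c) :
    Bd (iidLaw ν) (fun ω => F (X ω) (ω t)) c := by
  have h' : Bd ((iidLaw ν).map X) Φ c := by
    refine ⟨(integrable_map_measure hΦ.aestronglyMeasurable hX.aemeasurable).2 h.1, ?_⟩
    rw [integral_map hX.aemeasurable hΦ.aestronglyMeasurable]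
    exact h.2
  have : IsProbabilityMeasure ((iidLaw ν).map X) := Measure.isProbabilityMeasure_map hX.aemeasurable
  have h2 := Bd.prod hF h0 hb h'
  refine h2.comp (X := fun ω => (X ω, ω t)) ⟨by fun_prop, ?_⟩
  exact measurePreserving_splice_eval ν t hX hd

variable {step : ℕ → S → N → S}

lemma measurable_chain_prod (hs : ∀ t, Measurable (Function.uncurry (step t))) (t : ℕ) :
    Measurable (fun p : S × (ℕ → N) => chain step p.1 p.2 t) := by
  induction t with
  | zero => exact measurable_fst
  | succ t ih =>
    exact (hs t).comp (ih.prodMk ((measurable_pi_apply t).comp measurable_snd))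

lemma measurable_chain (hs : ∀ t, Measurable (Function.uncurry (step t))) (z : S) (t : ℕ) :
    Measurable (fun ω : ℕ → N => chain step z ω t) :=
  (measurable_chain_prod hs t).comp (measurable_const.prodMk measurable_id)

lemma Bd.chain_succ (hs : ∀ t, Measurable (Function.uncurry (step t))) (z : S) (t : ℕ)
    {φ Φ : S → ℝ} (hφ : Measurable φ) (h0 : ∀ x, 0 ≤ φ x) (hΦ : Measurable Φ)
    (hb : ∀ x, Bd ν (fun n => φ (step t x n)) (Φ x)) {c : ℝ}
    (h : Bd (iidLaw ν) (fun ω => Φ (chain step z ω t)) c) :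
    Bd (iidLaw ν) (fun ω => φ (chain step z ω (t + 1))) c :=
  Bd.step ν (F := fun x n => φ (step t x n)) (measurable_chain hs z t) (chain_congr z t)
    (hφ.comp (hs t)) (fun _ _ => h0 _) hΦ hb h

/-- The Markov property. -/
lemma Bd.chain_add (hs : ∀ t, Measurable (Function.uncurry (step t))) (z : S) (t j : ℕ)
    {φ Φ : S → ℝ} (hφ : Measurable φ) (h0 : ∀ x, 0 ≤ φ x)
    (hb : ∀ x, Bd (iidLaw ν) (fun ω => φ (chain (fun i => step (t + i)) x ω j)) (Φ x)) {c : ℝ}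
    (h : Bd (iidLaw ν) (fun ω => Φ (chain step z ω t)) c) :
    Bd (iidLaw ν) (fun ω => φ (chain step z ω (t + j))) c := by
  have hs' : ∀ i, Measurable (Function.uncurry (step (t + i))) := fun i => hs (t + i)
  have hm := measurable_chain_prod (step := fun i => step (t + i)) hs' j
  have hX := measurable_chain hs z t
  have h2 := Bd.prod (μ := iidLaw ν) (ν := iidLaw ν)
    (F := fun ω ω' => φ (chain (fun i => step (t + i)) (chain step z ω t) ω' j))
    (hφ.comp (hm.comp ((hX.comp measurable_fst).prodMk measurable_snd)))
    (fun _ _ => h0 _) (fun ω => hb _) h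
  have hpm := measurePreserving_splice ν t
  have hint : AEStronglyMeasurable (fun ω => φ (chain step z ω (t + j))) (iidLaw ν) :=
    (hφ.comp (measurable_chain hs z (t + j))).aestronglyMeasurable
  constructor
  · rw [← hpm.map_eq] at hint ⊢
    rw [integrable_map_measure hint hpm.measurable.aemeasurable]
    refine h2.1.congr (Filter.Eventually.of_forall fun p => ?_)
    simp only [Function.comp]
    rw [chain_splice]
  · rw [← hpm.map_eq] at hint ⊢
    rw [integral_map hpm.measurable.aemeasurable hint]
    refine le_trans (le_of_eq (integral_congr_ae (Filter.Eventually.of_forall fun p => ?_))) h2.2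
    simp only
    rw [chain_splice]

end Chain

/-! ### The artificial noise -/

lemma gaussian_integrable_pow (n : ℕ) : Integrable (fun z : ℝ => z ^ n) (gaussianReal 0 1) := by
  have h := (memLp_id_gaussianReal (μ := 0) (v := 1) (n : NNReal))
  rcases Nat.eq_zero_or_pos n with rfl | hn
  · simp
  · have := h.integrable_norm_pow (p := n) (by omega)
    refine this.mono' (by fun_prop) (Filter.Eventually.of_forall fun z => ?_)
    simp

lemma gaussian_integral_sq : ∫ z, z ^ 2 ∂(gaussianReal 0 1) = 1 := by
  have h := variance_id_gaussianReal (μ := 0) (v := 1)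
  rw [variance_eq_integral (by fun_prop)] at h
  simpa using h

lemma gaussian_integral_cube : ∫ z, z ^ 3 ∂(gaussianReal 0 1) = 0 := by
  have h : (gaussianReal 0 1).map (fun z => -z) = gaussianReal 0 1 := by
    simpa using gaussianReal_map_neg (μ := 0) (v := 1)
  have h2 : ∫ z, z ^ 3 ∂((gaussianReal 0 1).map (fun z => -z)) =
      ∫ z, (-z) ^ 3 ∂(gaussianReal 0 1) :=
    integral_map (by fun_prop) (by fun_prop)
  rw [h] at h2
  have h3 : ∀ z : ℝ, (-z) ^ 3 = -(z ^ 3) := fun z => by ring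
  simp only [h3, integral_neg] at h2
  linarith

lemma gaussian_integral_four_le : ∫ z, z ^ 4 ∂(gaussianReal 0 1) ≤ 80 := by
  have hb : ∀ z : ℝ, z ^ 4 ≤ 24 * (Real.exp (1 * z) + Real.exp (-1 * z)) := by
    intro z
    have h := Real.pow_div_factorial_le_exp |z| (abs_nonneg z) 4
    have h2 : Real.exp |z| ≤ Real.exp (1 * z) + Real.exp (-1 * z) := by
      rcases abs_cases z with h | h <;> rw [h.1] <;> simp <;> positivity
    have h3 : |z| ^ 4 = z ^ 4 := by rw [← abs_pow, abs_of_nonneg (by positivity)]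
    rw [h3] at h
    norm_num [Nat.factorial] at h
    linarith
  have h1 := integrable_exp_mul_gaussianReal (μ := 0) (v := 1) 1
  have h2 := integrable_exp_mul_gaussianReal (μ := 0) (v := 1) (-1)
  have hm : ∀ t : ℝ, ∫ z, Real.exp (t * z) ∂(gaussianReal 0 1) = Real.exp (t ^ 2 / 2) := by
    intro t
    have := congrFun (mgf_id_gaussianReal (μ := 0) (v := 1)) t
    simpa [mgf] using this
  refine (integral_mono (gaussian_integrable_pow 4) ((h1.add h2).const_mul 24) hb).trans ?_
  simp only [Pi.add_apply]
  rw [integral_const_mul, integral_add h1 h2, hm, hm]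
  have he : Real.exp (1 / 2) ≤ 5 / 3 := by
    have h := Real.exp_one_lt_d9
    have h' : Real.exp (1 / 2) * Real.exp (1 / 2) = Real.exp 1 := by
      rw [← Real.exp_add]; norm_num
    by_contra! hc
    nlinarith [Real.exp_pos (1 / 2)]
  norm_num at he ⊢
  linarith

lemma gaussian_affine_sq (a k : ℝ) : Integrable (fun z => (a + k * z) ^ 2) (gaussianReal 0 1) ∧
    ∫ z, (a + k * z) ^ 2 ∂(gaussianReal 0 1) = a ^ 2 + k ^ 2 := by
  have e : ∀ z : ℝ, (a + k * z) ^ 2 = a ^ 2 + (2 * a * k * z ^ 1 + k ^ 2 * z ^ 2) := fun z => by ring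
  simp only [e]
  have i1 := (gaussian_integrable_pow 1).const_mul (2 * a * k)
  have i2 := (gaussian_integrable_pow 2).const_mul (k ^ 2)
  have i12 : Integrable (fun z : ℝ => 2 * a * k * z ^ 1 + k ^ 2 * z ^ 2) (gaussianReal 0 1) :=
    i1.add i2
  refine ⟨(integrable_const _).add i12, ?_⟩
  rw [integral_add (integrable_const _) i12, integral_add i1 i2, integral_const_mul,
    integral_const_mul, gaussian_integral_sq]
  simp

lemma gaussian_affine_four (a k : ℝ) :
    Bd (gaussianReal 0 1) (fun z => (a + k * z) ^ 4) (a ^ 4 + 6 * a ^ 2 * k ^ 2 + 80 * k ^ 4) := by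
  have e : ∀ z : ℝ, (a + k * z) ^ 4 = a ^ 4 + (4 * a ^ 3 * k * z ^ 1 + (6 * a ^ 2 * k ^ 2 * z ^ 2 +
    (4 * a * k ^ 3 * z ^ 3 + k ^ 4 * z ^ 4))) := fun z => by ring
  simp only [e]
  have i1 := (gaussian_integrable_pow 1).const_mul (4 * a ^ 3 * k)
  have i2 := (gaussian_integrable_pow 2).const_mul (6 * a ^ 2 * k ^ 2)
  have i3 := (gaussian_integrable_pow 3).const_mul (4 * a * k ^ 3)
  have i4 := (gaussian_integrable_pow 4).const_mul (k ^ 4)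
  have i34 : Integrable (fun z : ℝ => 4 * a * k ^ 3 * z ^ 3 + k ^ 4 * z ^ 4) (gaussianReal 0 1) :=
    i3.add i4
  have i24 : Integrable (fun z : ℝ => 6 * a ^ 2 * k ^ 2 * z ^ 2 +
    (4 * a * k ^ 3 * z ^ 3 + k ^ 4 * z ^ 4)) (gaussianReal 0 1) := i2.add i34
  have i14 : Integrable (fun z : ℝ => 4 * a ^ 3 * k * z ^ 1 + (6 * a ^ 2 * k ^ 2 * z ^ 2 +
    (4 * a * k ^ 3 * z ^ 3 + k ^ 4 * z ^ 4))) (gaussianReal 0 1) := i1.add i24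
  refine ⟨(integrable_const _).add i14, ?_⟩
  beta_reduce
  rw [integral_add (integrable_const _) i14, integral_add i1 i24, integral_add i2 i34,
    integral_add i3 i4,
    integral_const_mul, integral_const_mul, integral_const_mul, integral_const_mul,
    gaussian_integral_sq, gaussian_integral_cube]
  have := mul_le_mul_of_nonneg_left gaussian_integral_four_le (by positivity : 0 ≤ k ^ 4)
  simp
  linarith

section Noise

variable {d : ℕ} (r : ℝ)

instance : IsProbabilityMeasure (noiseLaw d r) :=
  Measure.isProbabilityMeasure_map (by fun_prop)

lemma noise_map_inner {v : Vec d} (hv : ‖v‖ = 1) :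
    (noiseLaw d r).map (fun ξ => ⟪v, ξ⟫) = (gaussianReal 0 1).map (fun z => r / √d * z) := by
  have h1 : (stdGaussian (Vec d)).map (fun ξ => ⟪v, ξ⟫) = gaussianReal 0 1 := by
    have h := IsGaussian.map_eq_gaussianReal (μ := stdGaussian (Vec d)) (innerSL ℝ v)
    rw [variance_dual_stdGaussian] at h
    have h0 : ∫ x, (innerSL ℝ v) x ∂(stdGaussian (Vec d)) = 0 :=
      integral_strongDual_stdGaussian _
    rw [h0] at h
    simpa [innerSL_apply_norm, hv] using h
  rw [← h1, noiseLaw, Measure.map_map (by fun_prop) (by fun_prop),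
    Measure.map_map (by fun_prop) (by fun_prop)]
  congr 1
  ext ξ
  simp [real_inner_smul_right]

lemma noise_comp_inner {v : Vec d} (hv : ‖v‖ = 1) {φ : ℝ → ℝ} (hφ : Measurable φ) :
    (Integrable (fun ξ => φ ⟪v, ξ⟫) (noiseLaw d r) ↔
      Integrable (fun z => φ (r / √d * z)) (gaussianReal 0 1)) ∧
    ∫ ξ, φ ⟪v, ξ⟫ ∂(noiseLaw d r) = ∫ z, φ (r / √d * z) ∂(gaussianReal 0 1) := by
  have h := noise_map_inner r hv
  constructor
  · have h1 := integrable_map_measure (μ := noiseLaw d r) (f := fun ξ => ⟪v, ξ⟫) (g := φ)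
      (by fun_prop) (by fun_prop)
    have h2 := integrable_map_measure (μ := gaussianReal 0 1) (f := fun z => r / √d * z) (g := φ)
      (by fun_prop) (by fun_prop)
    rw [h] at h1
    exact h1.symm.trans h2
  · have h1 := integral_map (μ := noiseLaw d r) (φ := fun ξ => ⟪v, ξ⟫) (f := φ)
      (by fun_prop) (by fun_prop)
    have h2 := integral_map (μ := gaussianReal 0 1) (φ := fun z => r / √d * z) (f := φ)
      (by fun_prop) (by fun_prop)
    rw [h] at h1
    exact h1.symm.trans h2

lemma noise_affine_sq {v : Vec d} (hv : ‖v‖ = 1) (a k : ℝ) :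
    Integrable (fun ξ => (a + k * ⟪v, ξ⟫) ^ 2) (noiseLaw d r) ∧
    ∫ ξ, (a + k * ⟪v, ξ⟫) ^ 2 ∂(noiseLaw d r) = a ^ 2 + k ^ 2 * (r ^ 2 / d) := by
  have h := noise_comp_inner r hv (φ := fun z => (a + k * z) ^ 2) (by fun_prop)
  have h2 := gaussian_affine_sq a (k * (r / √d))
  simp only [mul_assoc] at h2
  refine ⟨h.1.2 h2.1, h.2.trans (h2.2.trans ?_)⟩
  rw [mul_pow, div_pow, Real.sq_sqrt (by positivity)]

lemma noise_affine_four {v : Vec d} (hv : ‖v‖ = 1) (a k : ℝ) :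
    Bd (noiseLaw d r) (fun ξ => (a + k * ⟪v, ξ⟫) ^ 4)
      (a ^ 4 + 6 * a ^ 2 * (k ^ 2 * (r ^ 2 / d)) + 80 * (k ^ 2 * (r ^ 2 / d)) ^ 2) := by
  have h := noise_comp_inner r hv (φ := fun z => (a + k * z) ^ 4) (by fun_prop)
  have h2 := gaussian_affine_four a (k * (r / √d))
  simp only [mul_assoc] at h2
  refine ⟨h.1.2 h2.1, (h.2.trans_le h2.2).trans (le_of_eq ?_)⟩
  have e : (k * (r / √d)) ^ 2 = k ^ 2 * (r ^ 2 / d) := by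
    rw [mul_pow, div_pow, Real.sq_sqrt (by positivity)]
  have e4 : (k * (r / √d)) ^ 4 = (k ^ 2 * (r ^ 2 / d)) ^ 2 := by rw [← e]; ring
  rw [e4, e]; ring

lemma noise_normSq (hd : 1 ≤ d) : Integrable (fun ξ => ‖ξ‖ ^ 2) (noiseLaw d r) ∧
    ∫ ξ, ‖ξ‖ ^ 2 ∂(noiseLaw d r) = r ^ 2 := by
  have e : ∀ ξ : Vec d, ‖ξ‖ ^ 2 = ∑ i, (0 + 1 * ⟪EuclideanSpace.basisFun (Fin d) ℝ i, ξ⟫) ^ 2 := by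
    intro ξ
    rw [← (EuclideanSpace.basisFun (Fin d) ℝ).sum_sq_norm_inner_right ξ]
    simp
  have hv : ∀ i, ‖EuclideanSpace.basisFun (Fin d) ℝ i‖ = 1 := fun i => by simp
  simp only [e]
  refine ⟨integrable_finsetSum _ fun i _ => (noise_affine_sq r (hv i) 0 1).1, ?_⟩
  rw [integral_finsetSum _ fun i _ => (noise_affine_sq r (hv i) 0 1).1,
    Finset.sum_congr rfl fun i _ => (noise_affine_sq r (hv i) 0 1).2]
  simp
  have : (d : ℝ) ≠ 0 := by positivity
  field_simp

lemma noise_integrable : Integrable (fun ξ : Vec d => ξ) (noiseLaw d r) := by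
  rw [noiseLaw, integrable_map_measure (by fun_prop) (by fun_prop)]
  exact (IsGaussian.integrable_id (μ := stdGaussian (Vec d))).smul (r / √d)

lemma noise_integral : ∫ ξ : Vec d, ξ ∂(noiseLaw d r) = 0 := by
  rw [noiseLaw, integral_map (by fun_prop) (by fun_prop), integral_smul,
    integral_id_stdGaussian, smul_zero]

/-- Reflection of the noise along the direction `v`. -/
noncomputable def reflect (v : Vec d) : Vec d ≃ₗᵢ[ℝ] Vec d := (Submodule.span ℝ {v})ᗮ.reflection

lemma reflect_apply {v : Vec d} (hv : ‖v‖ = 1) (ξ : Vec d) :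
    reflect v ξ = ξ - (2 * ⟪v, ξ⟫) • v := by
  rw [reflect, Submodule.reflection_orthogonal_apply, Submodule.reflection_singleton_apply, hv]
  simp [two_smul, two_mul, add_smul]

lemma measurePreserving_reflect (v : Vec d) :
    MeasurePreserving (reflect v) (noiseLaw d r) (noiseLaw d r) := by
  refine ⟨(reflect v).continuous.measurable, ?_⟩
  have h := stdGaussian_map (reflect v)
  conv_rhs => rw [noiseLaw, ← h, Measure.map_map (by fun_prop) (reflect v).continuous.measurable]
  rw [noiseLaw, Measure.map_map (reflect v).continuous.measurable (by fun_prop)]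
  congr 1
  ext1 ξ
  simp

end Noise

/-! ### Smooth objectives -/

section Objective

variable {d : ℕ} {f : Vec d → ℝ}

lemma gradient_eq_comp (f : Vec d → ℝ) :
    gradient f = (InnerProductSpace.toDual ℝ (Vec d)).symm ∘ fderiv ℝ f := rfl

lemma contDiff_gradient (hf : ContDiff ℝ 2 f) : ContDiff ℝ 1 (gradient f) := by
  rw [gradient_eq_comp]
  exact ((InnerProductSpace.toDual ℝ (Vec d)).symm.contDiff).comp
    (hf.fderiv_right (m := 1) (by norm_num))

lemma hasFDerivAt_gradient (hf : ContDiff ℝ 2 f) (x : Vec d) :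
    HasFDerivAt (gradient f) (hessian f x) x :=
  ((contDiff_gradient hf).differentiable one_ne_zero x).hasFDerivAt

lemma continuous_hessian (hf : ContDiff ℝ 2 f) : Continuous (hessian f) :=
  (contDiff_gradient hf).continuous_fderiv one_ne_zero

lemma hessian_isSymmetric (hf : ContDiff ℝ 2 f) (x : Vec d) :
    (hessian f x : Vec d →ₗ[ℝ] Vec d).IsSymmetric := by
  have hsymm : IsSymmSndFDerivAt ℝ f x := hf.contDiffAt.isSymmSndFDerivAt (by simp)
  have hd : DifferentiableAt ℝ (fderiv ℝ f) x :=
    (hf.fderiv_right (m := 1) (by norm_num)).differentiable one_ne_zero x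
  have key : ∀ u w : Vec d, ⟪hessian f x u, w⟫ = fderiv ℝ (fderiv ℝ f) x u w := by
    intro u w
    have h1 : HasFDerivAt (fun z => innerSL ℝ w (gradient f z))
        ((innerSL ℝ w).comp (hessian f x)) x :=
      (innerSL ℝ w).hasFDerivAt.comp x (hasFDerivAt_gradient hf x)
    have h2 : HasFDerivAt (fun z => fderiv ℝ f z w)
        ((ContinuousLinearMap.apply ℝ ℝ w).comp (fderiv ℝ (fderiv ℝ f) x)) x :=
      (ContinuousLinearMap.apply ℝ ℝ w).hasFDerivAt.comp x hd.hasFDerivAt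
    have h3 : (fun z => innerSL ℝ w (gradient f z)) = fun z => fderiv ℝ f z w := by
      ext z
      rw [innerSL_apply_apply, real_inner_comm, inner_gradient_left]
    rw [h3] at h1
    have := DFunLike.congr_fun (h1.unique h2) u
    simpa [real_inner_comm] using this
  intro u w
  simp only [ContinuousLinearMap.coe_coe]
  rw [key, real_inner_comm, key]
  exact hsymm u w

lemma descent_inequality {L : ℝ} (hf : ContDiff ℝ 2 f) (hL0 : 0 ≤ L)
    (hL : ∀ x y, ‖gradient f x - gradient f y‖ ≤ L * ‖x - y‖) (y w : Vec d) :
    f (y + w) ≤ f y + ⟪gradient f y, w⟫ + L * ‖w‖ ^ 2 := by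
  have hd : Differentiable ℝ f := hf.differentiable two_ne_zero
  have h := Convex.norm_image_sub_le_of_norm_hasFDerivWithin_le' (f := f) (𝕜 := ℝ)
    (s := segment ℝ y (y + w)) (x := y) (y := y + w) (f' := fderiv ℝ f) (φ := fderiv ℝ f y)
    (C := L * ‖w‖) (fun x _ => (hd x).hasFDerivAt.hasFDerivWithinAt) ?_ (convex_segment _ _)
    (left_mem_segment _ _ _) (right_mem_segment _ _ _)
  · rw [add_sub_cancel_left, Real.norm_eq_abs, ← inner_gradient_left] at h
    have := (abs_le.1 h).2
    nlinarith
  · intro z hz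
    have h1 : ‖fderiv ℝ f z - fderiv ℝ f y‖ = ‖gradient f z - gradient f y‖ := by
      rw [gradient_eq_comp, Function.comp, Function.comp, ← map_sub, LinearIsometryEquiv.norm_map]
    rw [h1]
    refine (hL z y).trans (mul_le_mul_of_nonneg_left ?_ hL0)
    have := norm_sub_le_of_mem_segment hz
    simpa using this

lemma gradient_normSq_le {fmax L : ℝ} (hf : ContDiff ℝ 2 f) (hL0 : 0 < L)
    (hb : ∀ x y, |f x - f y| ≤ fmax)
    (hL : ∀ x y, ‖gradient f x - gradient f y‖ ≤ L * ‖x - y‖) (x : Vec d) :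
    ‖gradient f x‖ ^ 2 ≤ 4 * L * fmax := by
  have h := descent_inequality hf hL0.le hL x (-(1 / (2 * L)) • gradient f x)
  rw [real_inner_smul_right, real_inner_self_eq_norm_sq, norm_smul, mul_pow] at h
  have h2 := (abs_le.1 (hb (x + -(1 / (2 * L)) • gradient f x) x)).1
  have h3 : L * (‖-(1 / (2 * L))‖ ^ 2 * ‖gradient f x‖ ^ 2) =
      1 / (4 * L) * ‖gradient f x‖ ^ 2 := by
    rw [norm_neg, Real.norm_of_nonneg (by positivity)]
    field_simp; ring
  rw [h3] at h
  have h4 : -(1 / (2 * L)) * ‖gradient f x‖ ^ 2 =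
    -(1 / (4 * L) * ‖gradient f x‖ ^ 2) - 1 / (4 * L) * ‖gradient f x‖ ^ 2 := by field_simp; ring
  rw [h4] at h
  have h5 : 1 / (4 * L) * ‖gradient f x‖ ^ 2 ≤ fmax := by linarith
  rw [one_div, inv_mul_le_iff₀ (by positivity)] at h5
  linarith

lemma gradient_sub_linear_le {ρ : ℝ} (hf : ContDiff ℝ 2 f) (hρ0 : 0 ≤ ρ)
    (hρ : ∀ x y, ‖hessian f x - hessian f y‖ ≤ ρ * ‖x - y‖) (x₀ x x' : Vec d) :
    ‖gradient f x - gradient f x' - hessian f x₀ (x - x')‖ ≤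
      ρ * (‖x - x₀‖ + ‖x' - x₀‖) * ‖x - x'‖ := by
  refine Convex.norm_image_sub_le_of_norm_hasFDerivWithin_le' (f := gradient f) (𝕜 := ℝ)
    (s := segment ℝ x' x) (f' := hessian f)
    (fun z _ => (hasFDerivAt_gradient hf z).hasFDerivWithinAt) ?_ (convex_segment _ _)
    (left_mem_segment _ _ _) (right_mem_segment _ _ _)
  intro z hz
  refine (hρ z x₀).trans (mul_le_mul_of_nonneg_left ?_ hρ0)
  obtain ⟨a, b, ha, hb, hab, rfl⟩ := hz
  have e : a • x' + b • x - x₀ = a • (x' - x₀) + b • (x - x₀) := by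
    obtain rfl : b = 1 - a := by linarith
    module
  rw [e]
  refine (norm_add_le _ _).trans ?_
  rw [norm_smul, norm_smul, Real.norm_of_nonneg ha, Real.norm_of_nonneg hb]
  have h1 : a ≤ 1 := by linarith
  have h2 : b ≤ 1 := by linarith
  nlinarith [norm_nonneg (x' - x₀), norm_nonneg (x - x₀)]

lemma norm_hessian_le {L : ℝ} (hL0 : 0 ≤ L)
    (hL : ∀ x y, ‖gradient f x - gradient f y‖ ≤ L * ‖x - y‖) (x : Vec d) :
    ‖hessian f x‖ ≤ L := by
  have : LipschitzWith L.toNNReal (gradient f) :=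
    LipschitzWith.of_dist_le_mul fun x y => by
      simpa [dist_eq_norm, Real.coe_toNNReal L hL0] using hL x y
  exact (norm_fderiv_le_of_lipschitz ℝ this).trans (le_of_eq (Real.coe_toNNReal L hL0))

/-- The Hessian of `f` at `x` has a direction of curvature less than `-γ`. -/
def IsSaddle (f : Vec d → ℝ) (γ : ℝ) (x : Vec d) : Prop :=
  ∃ v : Vec d, ‖v‖ = 1 ∧ ⟪v, hessian f x v⟫ < -γ

lemma isOpen_isSaddle (hf : ContDiff ℝ 2 f) (γ : ℝ) : IsOpen {x | IsSaddle f γ x} := by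
  have : {x | IsSaddle f γ x} = ⋃ v : {v : Vec d // ‖v‖ = 1}, {x | ⟪v.1, hessian f x v.1⟫ < -γ} := by
    ext x
    simp [IsSaddle]
  rw [this]
  refine isOpen_iUnion fun v => isOpen_lt ?_ continuous_const
  exact continuous_const.inner ((continuous_hessian hf).clm_apply continuous_const)

lemma isSOSP_of_not_saddle {ρ ε : ℝ} {x : Vec d} (h1 : ‖gradient f x‖ ≤ ε)
    (h2 : ¬ IsSaddle f (√(ρ * ε)) x) : IsSOSP f ρ ε x := by
  refine ⟨h1, fun lam hlam => ?_⟩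
  by_contra! hc
  obtain ⟨v, hv⟩ := hlam.exists_hasEigenvector
  have hv0 : ‖v‖ ≠ 0 := norm_ne_zero_iff.2 hv.2
  refine h2 ⟨‖v‖⁻¹ • v, ?_, ?_⟩
  · rw [norm_smul, norm_inv, norm_norm, inv_mul_cancel₀ hv0]
  · have h3 : hessian f x v = lam • v := hv.apply_eq_smul
    rw [map_smul, h3, real_inner_smul_left, real_inner_smul_right, real_inner_smul_right,
      real_inner_self_eq_norm_sq]
    have : ‖v‖⁻¹ * (‖v‖⁻¹ * (lam * ‖v‖ ^ 2)) = lam := by field_simp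
    rwa [this]

lemma IsSaddle.exists_min_eigenvector {γ : ℝ} {x : Vec d} (hf : ContDiff ℝ 2 f)
    (h : IsSaddle f γ x) :
    ∃ (g : ℝ) (v : Vec d), γ < g ∧ ‖v‖ = 1 ∧ hessian f x v = -g • v ∧
      ∀ w, -g * ‖w‖ ^ 2 ≤ ⟪w, hessian f x w⟫ := by
  obtain ⟨u, hu, hus⟩ := h
  obtain ⟨v, hv, hmin⟩ := (isCompact_sphere (0 : Vec d) 1).exists_isMinOn
    ⟨u, by simpa using hu⟩ (f := (hessian f x).reApplyInnerSelf)
    (hessian f x).reApplyInnerSelf_continuous.continuousOn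
  have hv1 : ‖v‖ = 1 := by simpa using hv
  have hsym := (hessian_isSymmetric hf x).isSelfAdjoint
  have heig := hsym.eq_smul_self_of_isLocalExtrOn_real (x₀ := v)
    (Or.inl (by rw [hv1]; exact hmin.localize))
  have hR : (hessian f x).rayleighQuotient v = ⟪v, hessian f x v⟫ := by
    simp [ContinuousLinearMap.rayleighQuotient, ContinuousLinearMap.reApplyInnerSelf_apply, hv1,
      real_inner_comm]
  rw [hR] at heig
  have hle : ∀ w : Vec d, ‖w‖ = 1 → ⟪v, hessian f x v⟫ ≤ ⟪w, hessian f x w⟫ := by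
    intro w hw
    have := hmin (show w ∈ Metric.sphere (0 : Vec d) 1 by simpa using hw)
    simpa [ContinuousLinearMap.reApplyInnerSelf_apply, real_inner_comm] using this
  refine ⟨-⟪v, hessian f x v⟫, v, by linarith [hle u hu], hv1, by rw [neg_neg]; exact heig, ?_⟩
  intro w
  rw [neg_neg]
  by_cases hw : w = 0
  · simp [hw]
  have hw0 : ‖w‖ ≠ 0 := norm_ne_zero_iff.2 hw
  have := hle (‖w‖⁻¹ • w) (by rw [norm_smul, norm_inv, norm_norm, inv_mul_cancel₀ hw0])
  rw [map_smul, real_inner_smul_left, real_inner_smul_right] at this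
  have h2 := mul_le_mul_of_nonneg_right this (sq_nonneg ‖w‖)
  have h3 : ‖w‖⁻¹ * (‖w‖⁻¹ * ⟪w, hessian f x w⟫) * ‖w‖ ^ 2 = ⟪w, hessian f x w⟫ := by field_simp
  rwa [h3] at h2

/-- `I - η H` expands by at most `1 + η g` if all eigenvalues of `H` are between `-g` and `1 / η`. -/
lemma norm_sub_smul_le {H : Vec d →L[ℝ] Vec d} (hH : (H : Vec d →ₗ[ℝ] Vec d).IsSymmetric)
    {η g L : ℝ} (hη : 0 ≤ η) (hg : 0 ≤ g) (hL : ‖H‖ ≤ L) (hηL : η * L ≤ 1)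
    (hmin : ∀ w, -g * ‖w‖ ^ 2 ≤ ⟪w, H w⟫) (w : Vec d) : ‖w - η • H w‖ ≤ (1 + η * g) * ‖w‖ := by
  set A : Vec d →L[ℝ] Vec d := ContinuousLinearMap.id ℝ (Vec d) - η • H with hA
  have hAw : ∀ w, A w = w - η • H w := fun w => by simp [hA]
  have hsym : (A : Vec d →ₗ[ℝ] Vec d).IsSymmetric := by
    intro u w
    simp only [ContinuousLinearMap.coe_coe, hAw, inner_sub_left, inner_sub_right,
      real_inner_smul_left, real_inner_smul_right]
    have := hH u w
    simp only [ContinuousLinearMap.coe_coe] at this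
    rw [this]
  have hnorm : ‖A‖ ≤ 1 + η * g := by
    rw [A.norm_eq_iSup_rayleighQuotient hsym]
    refine ciSup_le fun u => ?_
    rw [ContinuousLinearMap.rayleighQuotient, ContinuousLinearMap.reApplyInnerSelf_apply, hAw,
      inner_sub_left, real_inner_smul_left, real_inner_self_eq_norm_sq, real_inner_comm]
    simp only [RCLike.re_to_real]
    rw [abs_div, abs_of_nonneg (sq_nonneg ‖u‖)]
    refine div_le_of_le_mul₀ (sq_nonneg _) (by positivity) ?_
    have h1 := hmin u
    have h2 : ⟪u, H u⟫ ≤ L * ‖u‖ ^ 2 := by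
      refine (real_inner_le_norm _ _).trans ?_
      have := (H.le_opNorm u).trans (mul_le_mul_of_nonneg_right hL (norm_nonneg _))
      nlinarith [norm_nonneg u]
    have h3 := mul_le_mul_of_nonneg_left h2 hη
    have h4 := mul_le_mul_of_nonneg_left h1 hη
    have h5 : 0 ≤ η * g * ‖u‖ ^ 2 := by positivity
    have h6 := mul_le_mul_of_nonneg_right hηL (sq_nonneg ‖u‖)
    rw [abs_le]
    constructor <;> nlinarith [sq_nonneg ‖u‖]
  rw [← hAw]
  exact (A.le_opNorm w).trans (mul_le_mul_of_nonneg_right hnorm (norm_nonneg _))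

end Objective

/-! ### One step of the algorithm -/

lemma Bd.fst {Ω Ω' : Type*} [MeasurableSpace Ω] [MeasurableSpace Ω'] {μ : Measure Ω}
    [IsProbabilityMeasure μ] {ν : Measure Ω'} [IsProbabilityMeasure ν] {φ : Ω → ℝ} {c : ℝ}
    (h : Bd μ φ c) : Bd (μ.prod ν) (fun p => φ p.1) c := h.comp measurePreserving_fst

lemma Bd.snd {Ω Ω' : Type*} [MeasurableSpace Ω] [MeasurableSpace Ω'] {μ : Measure Ω}
    [IsProbabilityMeasure μ] {ν : Measure Ω'} [IsProbabilityMeasure ν] {φ : Ω' → ℝ} {c : ℝ}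
    (h : Bd ν φ c) : Bd (μ.prod ν) (fun p => φ p.2) c := h.comp measurePreserving_snd

lemma Bd.add_centered {Ω E : Type*} [MeasurableSpace Ω] {μ : Measure Ω} [IsProbabilityMeasure μ]
    [NormedAddCommGroup E] [InnerProductSpace ℝ E] [CompleteSpace E]
    {X : Ω → E} (hX : Integrable X μ) (h0 : ∫ ω, X ω ∂μ = 0) {c : ℝ}
    (hb : Bd μ (fun ω => ‖X ω‖ ^ 2) c) (w : E) (k : ℝ) :
    Bd μ (fun ω => ‖w + k • X ω‖ ^ 2) (‖w‖ ^ 2 + k ^ 2 * c) := by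
  have e : ∀ ω, ‖w + k • X ω‖ ^ 2 = (‖w‖ ^ 2 + 2 * k * ⟪w, X ω⟫) + k ^ 2 * ‖X ω‖ ^ 2 := by
    intro ω
    rw [norm_add_sq_real, real_inner_smul_right, norm_smul, mul_pow, Real.norm_eq_abs, sq_abs]
    ring
  have hi : Bd μ (fun ω => 2 * k * ⟪w, X ω⟫) 0 := by
    refine ⟨(hX.const_inner w).const_mul _, ?_⟩
    rw [integral_const_mul, integral_inner hX, h0, inner_zero_right, mul_zero]
  refine ((((Bd.const (μ := μ) (‖w‖ ^ 2)).add hi).add (hb.const_mul (sq_nonneg k))).congr e).weaken ?_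
  simp

lemma norm_add_sq_le {E : Type*} [SeminormedAddCommGroup E] (a b : E) {k : ℝ} (hk : 0 < k) :
    ‖a + b‖ ^ 2 ≤ (1 + k) * ‖a‖ ^ 2 + (1 + 1 / k) * ‖b‖ ^ 2 := by
  have h := norm_add_le a b
  have h1 : ‖a + b‖ ^ 2 ≤ (‖a‖ + ‖b‖) ^ 2 := by gcongr
  have h2 : 0 ≤ (k * ‖a‖ - ‖b‖) ^ 2 / k := by positivity
  have h3 : (k * ‖a‖ - ‖b‖) ^ 2 / k = k * ‖a‖ ^ 2 - 2 * ‖a‖ * ‖b‖ + 1 / k * ‖b‖ ^ 2 := by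
    field_simp
    ring
  rw [h3] at h2
  linarith [add_sq ‖a‖ ‖b‖]

lemma norm_add_sq_le_two {E : Type*} [SeminormedAddCommGroup E] (a b : E) :
    ‖a + b‖ ^ 2 ≤ 2 * ‖a‖ ^ 2 + 2 * ‖b‖ ^ 2 := by
  have := norm_add_sq_le a b one_pos
  linarith

lemma norm_sub_sq_le_two {E : Type*} [SeminormedAddCommGroup E] (a b : E) :
    ‖a - b‖ ^ 2 ≤ 2 * ‖a‖ ^ 2 + 2 * ‖b‖ ^ 2 := by
  simpa [sub_eq_add_neg] using norm_add_sq_le_two a (-b)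

lemma norm_add_three_sq_le {E : Type*} [SeminormedAddCommGroup E] (a b c : E) :
    ‖a + b + c‖ ^ 2 ≤ 3 * ‖a‖ ^ 2 + 3 * ‖b‖ ^ 2 + 3 * ‖c‖ ^ 2 := by
  have h := (norm_add_le (a + b) c).trans (add_le_add_left (norm_add_le a b) _)
  have h1 : ‖a + b + c‖ ^ 2 ≤ (‖a‖ + ‖b‖ + ‖c‖) ^ 2 := by gcongr
  nlinarith [sq_nonneg (‖a‖ - ‖b‖), sq_nonneg (‖a‖ - ‖c‖), sq_nonneg (‖b‖ - ‖c‖)]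

/-- A smooth bounded objective with a stochastic gradient, a compression map, a step size `η`, the
noise level `r`, and a schedule of the iterations at which the error is erased. The constants
`G`, `s`, `n`, `τ` bound the squared norm of the gradient, the variance of the stochastic gradient,
and the variance of its increments. -/
structure Setting (d : ℕ) (Θ : Type u) (Z : Type v) [MeasurableSpace Θ] [MeasurableSpace Z] where
  f : Vec d → ℝ
  g : Vec d → Θ → Vec d
  comp : Vec d → Z → Vec d
  D : Measure Θ
  Q : Measure Z
  probD : IsProbabilityMeasure D
  probQ : IsProbabilityMeasure Q
  (η r μ L ρ fmax G s n τ : ℝ)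
  rst : ℕ → Bool
  hd : 1 ≤ d
  hη : 0 < η
  hμ : 0 < μ
  hμ1 : μ ≤ 1
  hL : 0 < L
  hρ : 0 ≤ ρ
  hηL : η * L ≤ 1
  hG : 0 ≤ G
  hs : 0 ≤ s
  hn : 0 ≤ n
  hτ : 0 ≤ τ
  contDiff : ContDiff ℝ 2 f
  f_nonneg : ∀ x, 0 ≤ f x
  f_le : ∀ x, f x ≤ fmax
  smooth : ∀ x y, ‖gradient f x - gradient f y‖ ≤ L * ‖x - y‖
  hessLip : ∀ x y, ‖hessian f x - hessian f y‖ ≤ ρ * ‖x - y‖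
  gradBound : ∀ x, ‖gradient f x‖ ^ 2 ≤ G
  measurable_g : Measurable (fun p : Vec d × Θ => g p.1 p.2)
  integrable_g : ∀ x, Integrable (g x) D
  unbiased : ∀ x, ∫ θ, g x θ ∂D = gradient f x
  variance : ∀ x, Bd D (fun θ => ‖g x θ - gradient f x‖ ^ 2) s
  increment : ∀ x y, Bd D (fun θ => ‖(g x θ - gradient f x) - (g y θ - gradient f y)‖ ^ 2)
    (n * ‖x - y‖ ^ 2 + τ)
  measurable_comp : Measurable (fun p : Vec d × Z => comp p.1 p.2)
  compress : ∀ x, Bd Q (fun s => ‖x - comp x s‖ ^ 2) ((1 - μ) * ‖x‖ ^ 2)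

attribute [instance] Setting.probD Setting.probQ

namespace Setting

variable {d : ℕ} {Θ : Type u} {Z : Type v} [MeasurableSpace Θ] [MeasurableSpace Z]
  (S : Setting d Θ Z)

/-- The law of one sample. -/
noncomputable def law : Measure (Vec d × Θ × Z) := (noiseLaw d S.r).prod (S.D.prod S.Q)

instance : IsProbabilityMeasure S.law := by unfold law; infer_instance

/-- Bound for the second moment of the perturbed stochastic gradient. -/
noncomputable def N : ℝ := S.G + S.s + S.r ^ 2

/-- Bound for the second moment of the error. -/
noncomputable def V : ℝ := 4 * S.N / S.μ ^ 2

lemma N_nonneg : 0 ≤ S.N := by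
  have := S.hG; have := S.hs; unfold N; positivity

lemma V_nonneg : 0 ≤ S.V := by
  have := S.N_nonneg; unfold V; positivity

lemma measurable_gradient : Measurable (gradient S.f) :=
  (contDiff_gradient S.contDiff).continuous.measurable

lemma measurable_f : Measurable S.f := S.contDiff.continuous.measurable

lemma measurable_g_comp {α : Type*} [MeasurableSpace α] {x : α → Vec d} {θ : α → Θ}
    (hx : Measurable x) (hθ : Measurable θ) : Measurable (fun a => S.g (x a) (θ a)) :=
  S.measurable_g.comp (hx.prodMk hθ)

lemma measurable_comp_comp {α : Type*} [MeasurableSpace α] {x : α → Vec d} {z : α → Z}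
    (hx : Measurable x) (hz : Measurable z) : Measurable (fun a => S.comp (x a) (z a)) :=
  S.measurable_comp.comp (hx.prodMk hz)

lemma bd_gradient_add (x w : Vec d) (k : ℝ) :
    Bd S.D (fun θ => ‖w + k • (S.g x θ - gradient S.f x)‖ ^ 2) (‖w‖ ^ 2 + k ^ 2 * S.s) := by
  refine Bd.add_centered (X := fun θ => S.g x θ - gradient S.f x)
    ((S.integrable_g x).sub (integrable_const _)) ?_ (S.variance x) w k
  rw [integral_sub (S.integrable_g x) (integrable_const _), S.unbiased]
  simp

lemma bd_noise_add (w : Vec d) (k : ℝ) :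
    Bd (noiseLaw d S.r) (fun ξ => ‖w + k • ξ‖ ^ 2) (‖w‖ ^ 2 + k ^ 2 * S.r ^ 2) :=
  Bd.add_centered (noise_integrable S.r) (noise_integral S.r)
    ⟨(noise_normSq S.r S.hd).1, (noise_normSq S.r S.hd).2.le⟩ w k

lemma bd_sample_add (x w : Vec d) (k : ℝ) :
    Bd S.law (fun m => ‖w + k • (S.g x m.2.1 + m.1)‖ ^ 2)
      (‖w + k • gradient S.f x‖ ^ 2 + k ^ 2 * (S.s + S.r ^ 2)) := by
  have hm : Measurable (fun p : Vec d × Θ × Z => S.g x p.2.1) :=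
    S.measurable_g_comp (by fun_prop) (by fun_prop)
  have hF : Measurable (Function.uncurry fun (ξ : Vec d) (m : Θ × Z) => ‖w + k • (S.g x m.1 + ξ)‖ ^ 2) := by
    have : Measurable (fun p : Vec d × Θ × Z => ‖w + k • (S.g x p.2.1 + p.1)‖ ^ 2) := by fun_prop
    exact this
  have hin : ∀ ξ : Vec d, Bd (S.D.prod S.Q) (fun m => ‖w + k • (S.g x m.1 + ξ)‖ ^ 2)
      (‖(w + k • gradient S.f x) + k • ξ‖ ^ 2 + k ^ 2 * S.s) := fun ξ =>
    ((S.bd_gradient_add x ((w + k • gradient S.f x) + k • ξ) k).fst (ν := S.Q)).congr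
      fun m => by congr 2; module
  have hout : Bd (noiseLaw d S.r)
      (fun ξ => ‖(w + k • gradient S.f x) + k • ξ‖ ^ 2 + k ^ 2 * S.s)
      (‖w + k • gradient S.f x‖ ^ 2 + k ^ 2 * (S.s + S.r ^ 2)) :=
    ((S.bd_noise_add (w + k • gradient S.f x) k).add (Bd.const _)).weaken (by linarith)
  exact Bd.prod hF (fun _ _ => by positivity) hin hout

lemma bd_sample_normSq (x : Vec d) : Bd S.law (fun m => ‖S.g x m.2.1 + m.1‖ ^ 2) S.N := by
  refine ((S.bd_sample_add x 0 1).congr fun m => by simp).weaken ?_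
  have := S.gradBound x
  simp [N]; linarith

lemma bd_error {u : Vec d → Θ → Vec d} (hu : Measurable (fun p : Vec d × Θ => u p.1 p.2))
    {c : ℝ} (hc : Bd S.law (fun m => ‖u m.1 m.2.1‖ ^ 2) c) (e : Vec d) {R : Vec d → Vec d → Z → Vec d}
    (hR : Measurable (fun p : Vec d × Vec d × Z => R p.1 p.2.1 p.2.2))
    (hb : ∀ ξ x, Bd S.Q (fun s => ‖R ξ x s‖ ^ 2) ((1 - S.μ) * ‖x‖ ^ 2)) :
    Bd S.law (fun m => ‖R m.1 (e + u m.1 m.2.1) m.2.2‖ ^ 2)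
      ((1 - S.μ / 2) * ‖e‖ ^ 2 + 2 / S.μ * c) := by
  have h1 := S.hμ
  have h2 := S.hμ1
  have hk : 0 < S.μ / 2 := by positivity
  have key : Bd S.law (fun m => (1 - S.μ) * ‖e + u m.1 m.2.1‖ ^ 2)
      ((1 - S.μ / 2) * ‖e‖ ^ 2 + 2 / S.μ * c) := by
    have hB : Bd S.law (fun m => (1 - S.μ / 2) * ‖e‖ ^ 2 + 2 / S.μ * ‖u m.1 m.2.1‖ ^ 2)
        ((1 - S.μ / 2) * ‖e‖ ^ 2 + 2 / S.μ * c) :=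
      (Bd.const _).add (hc.const_mul (by positivity))
    have hmu : Measurable (fun m : Vec d × Θ × Z => u m.1 m.2.1) :=
      hu.comp (by fun_prop : Measurable fun m : Vec d × Θ × Z => (m.1, m.2.1))
    refine hB.mono (by fun_prop) (fun m => mul_nonneg (by linarith) (by positivity)) (fun m => ?_)
      le_rfl
    have h3 := mul_le_mul_of_nonneg_left (norm_add_sq_le e (u m.1 m.2.1) hk)
      (by linarith : 0 ≤ 1 - S.μ)
    refine h3.trans ?_
    have h4 : (1 - S.μ) * (1 + S.μ / 2) ≤ 1 - S.μ / 2 := by nlinarith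
    have h5 : (1 - S.μ) * (1 + 1 / (S.μ / 2)) ≤ 2 / S.μ := by
      have : (1 - S.μ) * (1 + 1 / (S.μ / 2)) = 2 / S.μ - 1 - S.μ := by field_simp; ring
      linarith
    rw [mul_add, ← mul_assoc, ← mul_assoc]
    gcongr
  have key2 : Bd ((noiseLaw d S.r).prod S.D) (fun p => (1 - S.μ) * ‖e + u p.1 p.2‖ ^ 2)
      ((1 - S.μ / 2) * ‖e‖ ^ 2 + 2 / S.μ * c) := by
    have hmp : MeasurePreserving (fun m : Vec d × Θ × Z => (m.1, m.2.1)) S.law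
        ((noiseLaw d S.r).prod S.D) :=
      (MeasurePreserving.id _).prod measurePreserving_fst
    have hmeas : AEStronglyMeasurable (fun p : Vec d × Θ => (1 - S.μ) * ‖e + u p.1 p.2‖ ^ 2)
        ((noiseLaw d S.r).prod S.D) := by
      have : Measurable (fun p : Vec d × Θ => (1 - S.μ) * ‖e + u p.1 p.2‖ ^ 2) := by fun_prop
      exact this.aestronglyMeasurable
    rw [← hmp.map_eq] at hmeas ⊢
    refine ⟨(integrable_map_measure hmeas hmp.measurable.aemeasurable).2 key.1, ?_⟩
    rw [integral_map hmp.measurable.aemeasurable hmeas]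
    exact key.2
  have h6 := Bd.prod (μ := (noiseLaw d S.r).prod S.D) (ν := S.Q)
    (F := fun p z => ‖R p.1 (e + u p.1 p.2) z‖ ^ 2) (Φ := fun p => (1 - S.μ) * ‖e + u p.1 p.2‖ ^ 2)
    (by
      have : Measurable (fun q : (Vec d × Θ) × Z => R q.1.1 (e + u q.1.1 q.1.2) q.2) := by
        have hq : Measurable (fun q : (Vec d × Θ) × Z => u q.1.1 q.1.2) := hu.comp measurable_fst
        exact hR.comp (by fun_prop :
          Measurable fun q : (Vec d × Θ) × Z => (q.1.1, e + u q.1.1 q.1.2, q.2))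
      exact (this.norm.pow_const 2 : _))
    (fun _ _ => by positivity) (fun p => hb _ _) key2
  exact h6.comp (X := fun m : Vec d × Θ × Z => ((m.1, m.2.1), m.2.2))
    (measurePreserving_prodAssoc _ _ _).symm

lemma bd_error_step (x e : Vec d) :
    Bd S.law (fun m => ‖e + (S.g x m.2.1 + m.1) - S.comp (e + (S.g x m.2.1 + m.1)) m.2.2‖ ^ 2)
      ((1 - S.μ / 2) * ‖e‖ ^ 2 + 2 / S.μ * S.N) := by
  refine S.bd_error (u := fun ξ θ => S.g x θ + ξ) (R := fun _ w z => w - S.comp w z) ?_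
    (S.bd_sample_normSq x) e ?_ fun _ w => S.compress w
  · have := S.measurable_g_comp (x := fun _ : Vec d × Θ => x) measurable_const measurable_snd
    exact this.add measurable_fst
  · have := S.measurable_comp_comp (x := fun p : Vec d × Vec d × Z => p.2.1) (by fun_prop)
      (z := fun p => p.2.2) (by fun_prop)
    exact (measurable_fst.comp measurable_snd).sub this

lemma bd_descent (x y : Vec d) :
    Bd S.law (fun m => S.f (y - S.η • (S.g x m.2.1 + m.1)))
      (S.f y - S.η / 2 * ‖gradient S.f x‖ ^ 2 + S.η / 2 * S.L ^ 2 * ‖x - y‖ ^ 2 +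
        S.L * S.η ^ 2 * S.N) := by
  have hL := S.hL
  have hη := S.hη
  set a := gradient S.f y
  have h1 := (S.bd_sample_add x (-(1 / (2 * S.L * S.η)) • a) 1).const_mul
    (by positivity : 0 ≤ S.L * S.η ^ 2)
  have h2 := (Bd.const (μ := S.law) (S.f y - 1 / (4 * S.L) * ‖a‖ ^ 2)).add h1
  have hm : Measurable (fun p : Vec d × Θ × Z => S.g x p.2.1) :=
    S.measurable_g_comp (by fun_prop) (by fun_prop)
  have hexp : ∀ b : Vec d, S.L * S.η ^ 2 * ‖-(1 / (2 * S.L * S.η)) • a + (1 : ℝ) • b‖ ^ 2 =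
      1 / (4 * S.L) * ‖a‖ ^ 2 - S.η * ⟪a, b⟫ + S.L * S.η ^ 2 * ‖b‖ ^ 2 := by
    intro b
    rw [one_smul, norm_add_sq_real, real_inner_smul_left, norm_smul, mul_pow, Real.norm_eq_abs,
      sq_abs]
    field_simp
    ring
  refine h2.mono (S.measurable_f.comp (by fun_prop)) (fun m => S.f_nonneg _) (fun m => ?_) ?_
  · have := descent_inequality S.contDiff S.hL.le S.smooth y (-(S.η • (S.g x m.2.1 + m.1)))
    rw [← sub_eq_add_neg, inner_neg_right, real_inner_smul_right, norm_neg, norm_smul, mul_pow,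
      Real.norm_of_nonneg hη.le] at this
    rw [hexp]
    linarith
  · rw [mul_add, hexp]
    have h3 : ‖gradient S.f x - a‖ ≤ S.L * ‖x - y‖ := S.smooth x y
    have h4 : ‖gradient S.f x - a‖ ^ 2 ≤ S.L ^ 2 * ‖x - y‖ ^ 2 := by rw [← mul_pow]; gcongr
    have h5 := norm_sub_sq_real (gradient S.f x) a
    rw [real_inner_comm] at h5
    have h6 := S.gradBound x
    have h7 : 0 ≤ S.L * S.η ^ 2 := by positivity
    have h8 : S.L * S.η ^ 2 * ‖gradient S.f x‖ ^ 2 ≤ S.L * S.η ^ 2 * S.G := by gcongr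
    have h9 : -(S.η * ⟪a, gradient S.f x⟫) ≤
        S.η / 2 * (S.L ^ 2 * ‖x - y‖ ^ 2) - S.η / 2 * ‖gradient S.f x‖ ^ 2 := by
      have h10 : -⟪a, gradient S.f x⟫ ≤ (S.L ^ 2 * ‖x - y‖ ^ 2 - ‖gradient S.f x‖ ^ 2) / 2 := by
        nlinarith [sq_nonneg ‖a‖]
      nlinarith
    unfold N
    nlinarith

end Setting

lemma Bd.le_of_forall_le {Ω : Type*} [MeasurableSpace Ω] {μ : Measure Ω} [IsProbabilityMeasure μ]
    {φ : Ω → ℝ} {a c : ℝ} (h : Bd μ φ c) (ha : ∀ ω, a ≤ φ ω) : a ≤ c := by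
  have := integral_mono (integrable_const a) h.1 ha
  simp only [integral_const, probReal_univ, smul_eq_mul, one_mul] at this
  exact this.trans h.2

lemma one_add_inv_pow_le_three {W t : ℕ} (h : t ≤ W) : (1 + 1 / (W : ℝ)) ^ t ≤ 3 := by
  rcases Nat.eq_zero_or_pos t with rfl | ht
  · norm_num
  have hW : (0 : ℝ) < W := by exact_mod_cast ht.trans_le h
  have h1 : 1 + 1 / (W : ℝ) ≤ Real.exp (1 / W) := by linarith [Real.add_one_le_exp (1 / (W : ℝ))]
  calc (1 + 1 / (W : ℝ)) ^ t ≤ (Real.exp (1 / W)) ^ t := by gcongr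
    _ = Real.exp (t * (1 / W)) := by rw [← Real.exp_nat_mul]
    _ ≤ Real.exp 1 := by
      apply Real.exp_le_exp.2
      rw [mul_one_div]
      exact div_le_one_of_le₀ (by exact_mod_cast h) hW.le
    _ ≤ 3 := by linarith [Real.exp_one_lt_d9]

namespace Setting

variable {d : ℕ} {Θ : Type u} {Z : Type v} [MeasurableSpace Θ] [MeasurableSpace Z]
  (S : Setting d Θ Z)

/-! ### The chain with a periodic schedule of resets -/

/-- The iterate `x` that belongs to the pair of `y = x - η e` and the error `e`. -/
noncomputable def pt (z : Vec d × Vec d) : Vec d := z.1 + S.η • z.2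

/-- One step of the algorithm in terms of `y = x - η e` and `e`. -/
noncomputable def step (t : ℕ) (z : Vec d × Vec d) (m : Vec d × Θ × Z) : Vec d × Vec d :=
  (z.1 - S.η • (S.g (S.pt z) m.2.1 + m.1),
    if S.rst (t + 1) then 0 else
      z.2 + (S.g (S.pt z) m.2.1 + m.1) - S.comp (z.2 + (S.g (S.pt z) m.2.1 + m.1)) m.2.2)

lemma measurable_pt : Measurable S.pt := by unfold pt; fun_prop

lemma measurable_step (t : ℕ) : Measurable (Function.uncurry (S.step t)) := by
  have h1 : Measurable (fun p : (Vec d × Vec d) × Vec d × Θ × Z => S.g (S.pt p.1) p.2.2.1) :=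
    S.measurable_g_comp (S.measurable_pt.comp measurable_fst) (by fun_prop)
  have h2 : Measurable (fun p : (Vec d × Vec d) × Vec d × Θ × Z =>
      S.comp (p.1.2 + (S.g (S.pt p.1) p.2.2.1 + p.2.1)) p.2.2.2) :=
    S.measurable_comp_comp (by fun_prop) (by fun_prop)
  unfold step Function.uncurry
  cases S.rst (t + 1) <;> simp <;> fun_prop

/-- The chain started at `z`. -/
noncomputable abbrev path (z : Vec d × Vec d) (ω : ℕ → Vec d × Θ × Z) (t : ℕ) : Vec d × Vec d :=
  chain S.step z ω t

lemma measurable_path (z : Vec d × Vec d) (t : ℕ) : Measurable (fun ω => S.path z ω t) :=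
  measurable_chain S.measurable_step z t

lemma measurable_pt_path (z : Vec d × Vec d) (t : ℕ) : Measurable (fun ω => S.pt (S.path z ω t)) :=
  S.measurable_pt.comp (S.measurable_path z t)

lemma bd_step_error (t : ℕ) (z : Vec d × Vec d) :
    Bd S.law (fun m => ‖(S.step t z m).2‖ ^ 2) ((1 - S.μ / 2) * ‖z.2‖ ^ 2 + 2 / S.μ * S.N) := by
  have hm : Measurable (fun m => (S.step t z m)) :=
    (S.measurable_step t).comp (measurable_const.prodMk measurable_id)
  refine (S.bd_error_step (S.pt z) z.2).mono (hm.snd.norm.pow_const 2) (fun _ => by positivity) (fun m => ?_)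
    le_rfl
  by_cases h : S.rst (t + 1) <;> simp only [step, h, if_true]
  · simp
  · simp

/-- The second moment of the error stays bounded. -/
lemma bd_err (z : Vec d × Vec d) (t : ℕ) :
    Bd (iidLaw S.law) (fun ω => ‖(S.path z ω t).2‖ ^ 2) (‖z.2‖ ^ 2 + S.V) := by
  have hμ := S.hμ
  have hμ1 := S.hμ1
  induction t with
  | zero =>
    refine (Bd.const (μ := iidLaw S.law) (‖z.2‖ ^ 2)).weaken ?_
    linarith [S.V_nonneg]
  | succ t ih =>
    refine Bd.chain_succ S.law S.measurable_step z t (φ := fun z => ‖z.2‖ ^ 2)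
      (Φ := fun z => (1 - S.μ / 2) * ‖z.2‖ ^ 2 + 2 / S.μ * S.N) (by fun_prop)
      (fun _ => by positivity) (by fun_prop) (S.bd_step_error t) ?_
    refine ((ih.const_mul (by linarith)).add (Bd.const _)).weaken ?_
    have : S.μ / 2 * S.V = 2 / S.μ * S.N := by unfold V; field_simp; ring
    nlinarith [sq_nonneg ‖z.2‖]

/-- The expected value of the objective after `t` steps. -/
noncomputable def Ef (z : Vec d × Vec d) (t : ℕ) : ℝ := ∫ ω, S.f (S.path z ω t).1 ∂(iidLaw S.law)

/-- The expected squared gradient after `t` steps. -/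
noncomputable def Eg (z : Vec d × Vec d) (t : ℕ) : ℝ :=
  ∫ ω, ‖gradient S.f (S.pt (S.path z ω t))‖ ^ 2 ∂(iidLaw S.law)

/-- The possible increase of the objective in one step. -/
noncomputable def slack (e : ℝ) : ℝ := S.η / 2 * S.L ^ 2 * S.η ^ 2 * (e + S.V) + S.L * S.η ^ 2 * S.N

lemma bd_Ef (z : Vec d × Vec d) (t : ℕ) :
    Bd (iidLaw S.law) (fun ω => S.f (S.path z ω t).1) (S.Ef z t) := by
  refine ⟨Integrable.of_bound (C := S.fmax)
    (S.measurable_f.comp (S.measurable_path z t).fst).aestronglyMeasurable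
    (Filter.Eventually.of_forall fun ω => ?_), le_rfl⟩
  rw [Real.norm_of_nonneg (S.f_nonneg _)]
  exact S.f_le _

lemma bd_Eg (z : Vec d × Vec d) (t : ℕ) :
    Bd (iidLaw S.law) (fun ω => ‖gradient S.f (S.pt (S.path z ω t))‖ ^ 2) (S.Eg z t) := by
  have hm := (S.measurable_gradient.comp (S.measurable_pt_path z t)).norm.pow_const 2
  refine ⟨Integrable.of_bound (C := S.G) hm.aestronglyMeasurable
    (Filter.Eventually.of_forall fun ω => ?_), le_rfl⟩
  rw [Real.norm_of_nonneg (by positivity)]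
  exact S.gradBound _

lemma Ef_nonneg (z : Vec d × Vec d) (t : ℕ) : 0 ≤ S.Ef z t :=
  integral_nonneg fun _ => S.f_nonneg _

lemma Ef_le (z : Vec d × Vec d) (t : ℕ) : S.Ef z t ≤ S.fmax := by
  have := integral_mono (S.bd_Ef z t).1 (integrable_const S.fmax) fun ω => S.f_le _
  simpa [Ef] using this

lemma Ef_zero (z : Vec d × Vec d) : S.Ef z 0 = S.f z.1 := by simp [Ef, chain]

lemma Eg_nonneg (z : Vec d × Vec d) (t : ℕ) : 0 ≤ S.Eg z t :=
  integral_nonneg fun _ => by positivity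

lemma Eg_le (z : Vec d × Vec d) (t : ℕ) : S.Eg z t ≤ S.G := by
  have := integral_mono (S.bd_Eg z t).1 (integrable_const S.G) fun ω => S.gradBound _
  simpa [Eg] using this

lemma slack_nonneg {e : ℝ} (he : 0 ≤ e) : 0 ≤ S.slack e := by
  have := S.V_nonneg; have := S.N_nonneg; have := S.hη; have := S.hL
  unfold slack; positivity

lemma pt_sub (z : Vec d × Vec d) : S.pt z - z.1 = S.η • z.2 := by simp [pt]

lemma norm_pt_sub_sq (z : Vec d × Vec d) : ‖S.pt z - z.1‖ ^ 2 = S.η ^ 2 * ‖z.2‖ ^ 2 := by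
  rw [pt_sub, norm_smul, mul_pow, Real.norm_of_nonneg S.hη.le]

lemma Ef_succ_le (z : Vec d × Vec d) (t : ℕ) :
    S.Ef z (t + 1) ≤ S.Ef z t - S.η / 2 * S.Eg z t + S.slack (‖z.2‖ ^ 2) := by
  have hη := S.hη
  have hg := S.measurable_gradient.comp S.measurable_pt
  have hmf := S.measurable_f
  set Φ : Vec d × Vec d → ℝ := fun z => (S.f z.1 - S.η / 2 * ‖gradient S.f (S.pt z)‖ ^ 2) +
    (S.η / 2 * S.L ^ 2 * (S.η ^ 2 * ‖z.2‖ ^ 2) + S.L * S.η ^ 2 * S.N) with hΦ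
  have hΦm : Measurable Φ := by
    have h1 : Measurable fun z : Vec d × Vec d => ‖gradient S.f (S.pt z)‖ ^ 2 :=
      hg.norm.pow_const 2
    have h2 : Measurable fun z : Vec d × Vec d => S.f z.1 := hmf.comp measurable_fst
    rw [hΦ]; fun_prop
  have h0 : Bd (iidLaw S.law) (fun ω => S.f (S.path z ω t).1 -
      S.η / 2 * ‖gradient S.f (S.pt (S.path z ω t))‖ ^ 2) (S.Ef z t - S.η / 2 * S.Eg z t) := by
    refine ⟨(S.bd_Ef z t).1.sub ((S.bd_Eg z t).1.const_mul _), ?_⟩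
    rw [integral_sub (S.bd_Ef z t).1 ((S.bd_Eg z t).1.const_mul _), integral_const_mul]
    rfl
  have h1 : Bd (iidLaw S.law) (fun ω => Φ (S.path z ω t))
      (S.Ef z t - S.η / 2 * S.Eg z t + S.slack (‖z.2‖ ^ 2)) := by
    refine (h0.add ((((S.bd_err z t).const_mul (sq_nonneg S.η)).const_mul
      (by positivity : 0 ≤ S.η / 2 * S.L ^ 2)).add (Bd.const (S.L * S.η ^ 2 * S.N)))).weaken ?_
    unfold slack
    linarith
  have h2 := Bd.chain_succ S.law S.measurable_step z t (φ := fun z => S.f z.1)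
    (hmf.comp measurable_fst) (fun _ => S.f_nonneg _) hΦm (fun z => ?_) h1
  · exact h2.2
  · refine (S.bd_descent (S.pt z) z.1).weaken ?_
    rw [norm_pt_sub_sq, hΦ]
    linarith

lemma Ef_add_sum_le (z : Vec d × Vec d) (t : ℕ) :
    S.Ef z t + S.η / 2 * ∑ i ∈ Finset.range t, S.Eg z i ≤ S.f z.1 + t * S.slack (‖z.2‖ ^ 2) := by
  induction t with
  | zero => simp [Ef_zero]
  | succ t ih =>
    rw [Finset.sum_range_succ]
    push_cast
    linarith [S.Ef_succ_le z t]

/-- Mean square displacement after at most `W` steps. -/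
lemma bd_displacement (z : Vec d × Vec d) {W t : ℕ} (hW : 1 ≤ W) (ht : t ≤ W) :
    Bd (iidLaw S.law) (fun ω => ‖(S.path z ω t).1 - z.1‖ ^ 2)
      (3 * ((1 + W) * S.η ^ 2 * ∑ i ∈ Finset.range t, S.Eg z i + t * (S.η ^ 2 * S.N))) := by
  have hη := S.hη
  have hN := S.N_nonneg
  have hW0 : (0 : ℝ) < W := by exact_mod_cast hW
  have hg := S.measurable_gradient.comp S.measurable_pt
  have key : ∀ t, Bd (iidLaw S.law) (fun ω => ‖(S.path z ω t).1 - z.1‖ ^ 2)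
      ((1 + 1 / W) ^ t *
        ((1 + W) * S.η ^ 2 * ∑ i ∈ Finset.range t, S.Eg z i + t * (S.η ^ 2 * S.N))) := by
    intro t
    induction t with
    | zero => exact (Bd.const (μ := iidLaw S.law) 0).congr (fun ω => by simp [chain]) |>.weaken (by simp)
    | succ t ih =>
      have hΦm : Measurable fun z' : Vec d × Vec d => (1 + 1 / (W : ℝ)) * ‖z'.1 - z.1‖ ^ 2 +
          ((1 + W) * S.η ^ 2 * ‖gradient S.f (S.pt z')‖ ^ 2 + S.η ^ 2 * S.N) := by
        have h1 : Measurable fun z : Vec d × Vec d => ‖gradient S.f (S.pt z)‖ ^ 2 :=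
          hg.norm.pow_const 2
        fun_prop
      refine Bd.chain_succ S.law S.measurable_step z t (φ := fun z' => ‖z'.1 - z.1‖ ^ 2)
        (Φ := fun z' => (1 + 1 / (W : ℝ)) * ‖z'.1 - z.1‖ ^ 2 +
          ((1 + W) * S.η ^ 2 * ‖gradient S.f (S.pt z')‖ ^ 2 + S.η ^ 2 * S.N)) (by fun_prop)
        (fun _ => by positivity) hΦm (fun z' => ?_) ?_
      · have h := S.bd_sample_add (S.pt z') (z'.1 - z.1) (-S.η)
        refine (h.congr fun m => ?_).weaken ?_
        · congr 2
          simp only [step]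
          module
        · have h3 := norm_add_sq_le (z'.1 - z.1) ((-S.η) • gradient S.f (S.pt z'))
            (k := 1 / W) (by positivity)
          rw [norm_smul, mul_pow, norm_neg, Real.norm_of_nonneg hη.le, one_div_one_div] at h3
          have h4 : S.s + S.r ^ 2 ≤ S.N := by unfold N; linarith [S.hG]
          have h5 : (-S.η) ^ 2 * (S.s + S.r ^ 2) ≤ S.η ^ 2 * S.N := by rw [neg_sq]; gcongr
          linarith
      · refine ((ih.const_mul (by positivity)).add (((S.bd_Eg z t).const_mul
          (by positivity)).add (Bd.const _))).weaken ?_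
        rw [Finset.sum_range_succ, pow_succ (1 + 1 / (W : ℝ)) t]
        have h6 : 1 ≤ (1 + 1 / (W : ℝ)) ^ t * (1 + 1 / W) := by
          rw [← pow_succ (1 + 1 / (W : ℝ)) t]
          exact one_le_pow₀ (by linarith [show 0 ≤ 1 / (W : ℝ) by positivity])
        have h7 := S.Eg_nonneg z t
        have h8 : 0 ≤ (1 + W) * S.η ^ 2 * S.Eg z t + S.η ^ 2 * S.N := by positivity
        push_cast
        linarith [mul_le_mul_of_nonneg_right h6 h8]
  refine (key t).weaken (mul_le_mul_of_nonneg_right (one_add_inv_pow_le_three ht) ?_)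
  have := Finset.sum_nonneg fun i (_ : i ∈ Finset.range t) => S.Eg_nonneg z i
  positivity

lemma sum_Eg_mono (z : Vec d × Vec d) {t W : ℕ} (h : t ≤ W) :
    ∑ i ∈ Finset.range t, S.Eg z i ≤ ∑ i ∈ Finset.range W, S.Eg z i :=
  Finset.sum_le_sum_of_subset_of_nonneg (Finset.range_mono h) fun _ _ _ => S.Eg_nonneg _ _

/-- Mean square displacement of the iterate `x` after at most `W` steps. -/
lemma bd_pt_displacement (z : Vec d × Vec d) {W t : ℕ} (hW : 1 ≤ W) (ht : t ≤ W) :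
    Bd (iidLaw S.law) (fun ω => ‖S.pt (S.path z ω t) - S.pt z‖ ^ 2)
      (9 * ((1 + W) * S.η ^ 2 * ∑ i ∈ Finset.range W, S.Eg z i + W * (S.η ^ 2 * S.N)) +
        3 * S.η ^ 2 * (2 * ‖z.2‖ ^ 2 + S.V)) := by
  have hη := S.hη
  have hN := S.N_nonneg
  have h1 := (S.bd_displacement z hW ht).const_mul (by norm_num : (0 : ℝ) ≤ 3)
  have h2 := (S.bd_err z t).const_mul (by positivity : 0 ≤ 3 * S.η ^ 2)
  have hm := S.measurable_pt_path z t
  refine ((h1.add h2).add (Bd.const (3 * S.η ^ 2 * ‖z.2‖ ^ 2))).mono (by fun_prop)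
    (fun _ => by positivity) (fun ω => ?_) ?_
  · have h3 := norm_add_three_sq_le ((S.path z ω t).1 - z.1)
      (S.pt (S.path z ω t) - (S.path z ω t).1) (-(S.pt z - z.1))
    rw [norm_neg, norm_pt_sub_sq, norm_pt_sub_sq] at h3
    have e : (S.path z ω t).1 - z.1 + (S.pt (S.path z ω t) - (S.path z ω t).1) +
      -(S.pt z - z.1) = S.pt (S.path z ω t) - S.pt z := by abel
    rw [e] at h3
    linarith
  · have h4 := S.sum_Eg_mono z ht
    have h5 : (t : ℝ) ≤ W := by exact_mod_cast ht
    have h6 : (1 + (W : ℝ)) * S.η ^ 2 * ∑ i ∈ Finset.range t, S.Eg z i ≤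
      (1 + W) * S.η ^ 2 * ∑ i ∈ Finset.range W, S.Eg z i := by gcongr
    have h7 : (t : ℝ) * (S.η ^ 2 * S.N) ≤ W * (S.η ^ 2 * S.N) := by gcongr
    linarith

/-- A large gradient leads to a decrease of the objective in the next `P` steps. -/
lemma Ef_le_of_gradient (z : Vec d × Vec d) {P : ℕ} (hP : 1 ≤ P) (hPη : 6 * (S.η * S.L * P) ≤ 1) :
    S.Ef z P ≤ S.f z.1 - S.η * P / 8 * ‖gradient S.f (S.pt z)‖ ^ 2 +
      P * (S.slack (‖z.2‖ ^ 2) +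
        S.η ^ 3 * S.L ^ 2 * (3 * (P * S.N) + 2 * ‖z.2‖ ^ 2 + S.V)) := by
  have hη := S.hη
  have hL := S.hL
  have hN := S.N_nonneg
  have hV := S.V_nonneg
  have hP0 : (1 : ℝ) ≤ P := by exact_mod_cast hP
  set Sg := ∑ i ∈ Finset.range P, S.Eg z i with hSg
  have hSg0 : 0 ≤ Sg := Finset.sum_nonneg fun i _ => S.Eg_nonneg z i
  set c := 9 * ((1 + P) * S.η ^ 2 * Sg + P * (S.η ^ 2 * S.N)) +
        3 * S.η ^ 2 * (2 * ‖z.2‖ ^ 2 + S.V) with hc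
  have h1 : ∀ i ∈ Finset.range P, ‖gradient S.f (S.pt z)‖ ^ 2 ≤ 2 * S.Eg z i + 2 * S.L ^ 2 * c := by
    intro i hi
    refine (((S.bd_Eg z i).const_mul (by norm_num : (0 : ℝ) ≤ 2)).add
      ((S.bd_pt_displacement z hP (Finset.mem_range.1 hi).le).const_mul
        (by positivity : 0 ≤ 2 * S.L ^ 2))).le_of_forall_le fun ω => ?_
    have h2 := norm_sub_sq_le_two (gradient S.f (S.pt (S.path z ω i)))
      (gradient S.f (S.pt (S.path z ω i)) - gradient S.f (S.pt z))
    rw [sub_sub_cancel] at h2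
    have h3 : ‖gradient S.f (S.pt (S.path z ω i)) - gradient S.f (S.pt z)‖ ^ 2 ≤
        S.L ^ 2 * ‖S.pt (S.path z ω i) - S.pt z‖ ^ 2 := by
      rw [← mul_pow]
      gcongr
      exact S.smooth _ _
    linarith
  have h2 := Finset.sum_le_sum h1
  rw [Finset.sum_const, Finset.card_range, nsmul_eq_mul, Finset.sum_add_distrib, Finset.sum_const,
    Finset.card_range, nsmul_eq_mul, ← Finset.mul_sum, ← hSg] at h2
  have h3 := S.Ef_add_sum_le z P
  rw [← hSg] at h3
  have h4 : (S.η * S.L * P) ^ 2 ≤ 1 / 36 := by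
    have : 0 ≤ S.η * S.L * P := by positivity
    nlinarith
  have h5 : (P : ℝ) * (2 * S.L ^ 2 * c) ≤ 2 * Sg +
      P * (S.η ^ 2 * S.L ^ 2 * 18 * (P * S.N) + 6 * S.η ^ 2 * S.L ^ 2 * (2 * ‖z.2‖ ^ 2 + S.V)) := by
    have h6 : (P : ℝ) * (18 * S.L ^ 2 * S.η ^ 2 * (1 + P)) ≤ 36 * (S.η * S.L * P) ^ 2 := by
      have : (P : ℝ) * (1 + P) ≤ 2 * P ^ 2 := by nlinarith
      have := mul_le_mul_of_nonneg_left this (by positivity : 0 ≤ 18 * S.L ^ 2 * S.η ^ 2)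
      linarith
    have h7 : (P : ℝ) * (18 * S.L ^ 2 * S.η ^ 2 * (1 + P)) * Sg ≤ 2 * Sg := by
      apply mul_le_mul_of_nonneg_right _ hSg0
      linarith
    rw [hc]
    linarith
  have h8 : (P : ℝ) * ‖gradient S.f (S.pt z)‖ ^ 2 ≤ 4 * Sg +
      P * (S.η ^ 2 * S.L ^ 2 * 18 * (P * S.N) + 6 * S.η ^ 2 * S.L ^ 2 * (2 * ‖z.2‖ ^ 2 + S.V)) := by
    linarith
  have h9 := mul_le_mul_of_nonneg_left h8 (by positivity : 0 ≤ S.η / 8)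
  have h10 : 0 ≤ P * (S.η ^ 3 * S.L ^ 2 * (3 * (P * S.N) + 2 * ‖z.2‖ ^ 2 + S.V)) := by positivity
  linarith

end Setting

lemma integral_chain_succ {N : Type*} [MeasurableSpace N] (ν : Measure N) [IsProbabilityMeasure ν]
    {S : Type*} [MeasurableSpace S] {step : ℕ → S → N → S}
    (hs : ∀ t, Measurable (Function.uncurry (step t))) (z : S) (t : ℕ)
    {φ Φ : S → ℝ} (hφ : Measurable φ) (h0 : ∀ x, 0 ≤ φ x) (hΦ : Measurable Φ)
    (hb : ∀ x, Integrable (fun n => φ (step t x n)) ν ∧ ∫ n, φ (step t x n) ∂ν = Φ x)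
    (h : Integrable (fun ω => Φ (chain step z ω t)) (iidLaw ν)) :
    ∫ ω, φ (chain step z ω (t + 1)) ∂(iidLaw ν) = ∫ ω, Φ (chain step z ω t) ∂(iidLaw ν) := by
  have hX := measurable_chain hs z t
  have hm : Measurable (fun ω : ℕ → N => (chain step z ω t, ω t)) := by fun_prop
  have heq := measurePreserving_splice_eval ν t hX (chain_congr z t)
  have : IsProbabilityMeasure ((iidLaw ν).map fun ω => chain step z ω t) :=
    Measure.isProbabilityMeasure_map hX.aemeasurable
  have hF : Measurable (fun p : S × N => φ (step t p.1 p.2)) := hφ.comp (hs t)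
  have hΦi : Integrable Φ ((iidLaw ν).map fun ω => chain step z ω t) :=
    (integrable_map_measure hΦ.aestronglyMeasurable hX.aemeasurable).2 h
  have hint := (Bd.prod (F := fun x n => φ (step t x n)) hF (fun _ _ => h0 _)
    (fun x => ⟨(hb x).1, (hb x).2.le⟩) ⟨hΦi, le_rfl⟩).1
  have h1 : ∫ ω, φ (chain step z ω (t + 1)) ∂(iidLaw ν) =
      ∫ p, φ (step t p.1 p.2) ∂((iidLaw ν).map fun ω => (chain step z ω t, ω t)) :=
    (integral_map hm.aemeasurable hF.aestronglyMeasurable).symm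
  rw [h1, heq, integral_prod _ hint]
  simp only [(hb _).2]
  exact integral_map hX.aemeasurable hΦ.aestronglyMeasurable

/-- The indicator of `x ≤ q`. -/
noncomputable def cut (q x : ℝ) : ℝ := if x ≤ q then 1 else 0

lemma cut_nonneg (q x : ℝ) : 0 ≤ cut q x := by unfold cut; split_ifs <;> norm_num

lemma cut_le_one (q x : ℝ) : cut q x ≤ 1 := by unfold cut; split_ifs <;> norm_num

lemma cut_anti (q : ℝ) {x y : ℝ} (h : x ≤ y) : cut q y ≤ cut q x := by
  unfold cut
  split_ifs <;> first | (exfalso; linarith) | norm_num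

@[fun_prop]
lemma measurable_cut (q : ℝ) : Measurable (cut q) :=
  Measurable.ite measurableSet_Iic measurable_const measurable_const

lemma cauchy_schwarz_step {A c K j α X w q lam : ℝ} (hA : 0 ≤ A) (hc : 0 ≤ c) (hK : 0 ≤ K)
    (hw : 0 < w) (hq : 0 < q) (h : A ^ 2 ≤ c * K) (hlam : 0 ≤ lam) (hj : 0 ≤ j) (hα : 0 ≤ α)
    (hX : 0 ≤ X) :
    (lam * A + j + α * X) ^ 2 ≤ (c + 1 / w + α ^ 2 / q) * (lam ^ 2 * K + w * j ^ 2 + q * X ^ 2) := by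
  have hA' : A ≤ √c * √K := by
    rw [← Real.sqrt_mul hc]
    exact Real.le_sqrt_of_sq_le h
  have h1 : lam * A + j + α * X ≤
      √c * (lam * √K) + 1 / √w * (√w * j) + α / √q * (√q * X) := by
    have e1 : 1 / √w * (√w * j) = j := by field_simp
    have e2 : α / √q * (√q * X) = α * X := by field_simp
    rw [e1, e2]
    nlinarith [mul_le_mul_of_nonneg_left hA' hlam]
  have h2 : c + 1 / w + α ^ 2 / q = √c ^ 2 + (1 / √w) ^ 2 + (α / √q) ^ 2 := by
    rw [div_pow, div_pow, Real.sq_sqrt hc, Real.sq_sqrt hw.le, Real.sq_sqrt hq.le, one_pow]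
  have h3 : lam ^ 2 * K + w * j ^ 2 + q * X ^ 2 =
      (lam * √K) ^ 2 + (√w * j) ^ 2 + (√q * X) ^ 2 := by
    rw [mul_pow, mul_pow, mul_pow, Real.sq_sqrt hK, Real.sq_sqrt hw.le, Real.sq_sqrt hq.le]
  rw [h2, h3]
  refine (pow_le_pow_left₀ (by positivity) h1 2).trans ?_
  generalize √c = a₁, 1 / √w = a₂, α / √q = a₃, lam * √K = b₁, √w * j = b₂, √q * X = b₃
  nlinarith [sq_nonneg (a₁ * b₂ - a₂ * b₁), sq_nonneg (a₁ * b₃ - a₃ * b₁),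
    sq_nonneg (a₂ * b₃ - a₃ * b₂)]

/-! ### Coupling of two runs -/

/-- The sequence `β_t = ∑_{s < t} λ^{2 s}`. -/
noncomputable def growth (lam : ℝ) : ℕ → ℝ
  | 0 => 0
  | t + 1 => lam ^ 2 * growth lam t + 1

lemma growth_nonneg (lam : ℝ) (t : ℕ) : 0 ≤ growth lam t := by
  induction t with
  | zero => exact le_rfl
  | succ t ih => simp only [growth]; positivity

lemma growth_mono {lam : ℝ} (h : 1 ≤ lam) : Monotone (growth lam) := by
  refine monotone_nat_of_le_succ fun t => ?_
  simp only [growth]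
  have := growth_nonneg lam t
  have h2 : 1 ≤ lam ^ 2 := one_le_pow₀ h
  nlinarith

lemma pow_le_growth (lam : ℝ) (t : ℕ) : lam ^ (2 * t) ≤ growth lam (t + 1) := by
  induction t with
  | zero => simp [growth]
  | succ t ih =>
    rw [growth]
    have := mul_le_mul_of_nonneg_left ih (sq_nonneg lam)
    have e : lam ^ (2 * (t + 1)) = lam ^ 2 * lam ^ (2 * t) := by ring
    rw [e]; linarith

/-- The data of a coupling: the reference point and its Hessian, the direction of reflection, the
growth factor in this direction, the threshold for stopping and the length of the coupling. -/
structure Frame (d : ℕ) where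
  x₀ : Vec d
  v : Vec d
  H : Vec d →L[ℝ] Vec d
  (lam q w : ℝ)

/-- The two coupled runs, the difference along `v` that is caused by the artificial noise, the
part of the difference that is caused by the stochastic gradient, and the two quantities that
control the remaining part of the difference. -/
abbrev CState (d : ℕ) : Type := (Vec d × Vec d) × (Vec d × Vec d) × ℝ × Vec d × ℝ × ℝ

namespace Setting

variable {d : ℕ} {Θ : Type u} {Z : Type v} [MeasurableSpace Θ] [MeasurableSpace Z]
  (S : Setting d Θ Z) (F : Frame d)

/-- The sample with reflected noise. -/
noncomputable def flip (v : Vec d) (m : Vec d × Θ × Z) : Vec d × Θ × Z := (reflect v m.1, m.2)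

lemma measurePreserving_flip (v : Vec d) : MeasurePreserving (flip v) S.law S.law :=
  (measurePreserving_reflect S.r v).prod (MeasurePreserving.id _)

lemma measurePreserving_flip_iid (v : Vec d) :
    MeasurePreserving (fun (ω : ℕ → Vec d × Θ × Z) i => flip v (ω i)) (iidLaw S.law)
      (iidLaw S.law) := by
  have h := S.measurePreserving_flip v
  refine ⟨measurable_pi_lambda _ fun i => h.measurable.comp (measurable_pi_apply i), ?_⟩
  rw [Measure.infinitePi_map_pi _ fun _ => h.measurable]
  simp only [h.map_eq]

/-- The noise part of the difference of the stochastic gradients. -/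
noncomputable def dz (c : CState d) (θ : Θ) : Vec d :=
  (S.g (S.pt c.1) θ - gradient S.f (S.pt c.1)) - (S.g (S.pt c.2.1) θ - gradient S.f (S.pt c.2.1))

/-- Sum of the distances of the coupled iterates from the reference point. -/
noncomputable def far (c : CState d) : ℝ := ‖S.pt c.1 - F.x₀‖ + ‖S.pt c.2.1 - F.x₀‖

/-- One step of the coupled chain. -/
noncomputable def couple (t : ℕ) (c : CState d) (m : Vec d × Θ × Z) : CState d :=
  (S.step t c.1 m, S.step t c.2.1 (flip F.v m), F.lam * c.2.2.1 + (-(2 * S.η)) * ⟪F.v, m.1⟫,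
    (c.2.2.2.1 - S.η • F.H c.2.2.2.1) + (-S.η) • S.dz c m.2.1,
    c.2.2.2.2.1 + (S.η * S.ρ * S.far F c) ^ 2,
    F.lam ^ 2 * c.2.2.2.2.2 + F.w * (S.η * S.L * ‖S.η • (c.1.2 - c.2.1.2)‖) ^ 2 +
      F.q * ‖S.pt c.1 - S.pt c.2.1‖ ^ 2)

@[fun_prop]
lemma measurable_far : Measurable (S.far F) := by
  have := S.measurable_pt
  unfold far; fun_prop

lemma measurable_dz {α : Type*} [MeasurableSpace α] {c : α → CState d} {θ : α → Θ}
    (hc : Measurable c) (hθ : Measurable θ) : Measurable (fun a => S.dz (c a) (θ a)) := by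
  have hp1 : Measurable (fun a => S.pt (c a).1) := S.measurable_pt.comp hc.fst
  have hp2 : Measurable (fun a => S.pt (c a).2.1) := S.measurable_pt.comp hc.snd.fst
  exact ((S.measurable_g_comp hp1 hθ).sub (S.measurable_gradient.comp hp1)).sub
    ((S.measurable_g_comp hp2 hθ).sub (S.measurable_gradient.comp hp2))

lemma measurable_flip (v : Vec d) : Measurable (flip (Θ := Θ) (Z := Z) v) := by
  have := (reflect v).continuous.measurable
  unfold flip; fun_prop

lemma measurable_couple (t : ℕ) : Measurable (Function.uncurry (S.couple F t)) := by
  have hp := S.measurable_pt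
  have h1 : Measurable (fun p : CState d × Vec d × Θ × Z => S.step t p.1.1 p.2) :=
    (S.measurable_step t).comp (measurable_fst.fst.prodMk measurable_snd)
  have h2 : Measurable (fun p : CState d × Vec d × Θ × Z => S.step t p.1.2.1 (flip F.v p.2)) :=
    (S.measurable_step t).comp
      (measurable_fst.snd.fst.prodMk ((measurable_flip F.v).comp measurable_snd))
  have h3 : Measurable (fun p : CState d × Vec d × Θ × Z => S.dz p.1 p.2.2.1) :=
    S.measurable_dz measurable_fst measurable_snd.snd.fst
  have h4 : Measurable (fun p : CState d × Vec d × Θ × Z => ⟪F.v, p.2.1⟫) :=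
    measurable_const.inner measurable_snd.fst
  have h5 : Measurable (fun p : CState d × Vec d × Θ × Z => S.far F p.1) :=
    (S.measurable_far F).comp measurable_fst
  have hp1 : Measurable (fun p : CState d × Vec d × Θ × Z => S.pt p.1.1) :=
    hp.comp measurable_fst.fst
  have hp2 : Measurable (fun p : CState d × Vec d × Θ × Z => S.pt p.1.2.1) :=
    hp.comp measurable_fst.snd.fst
  have hM : Measurable (fun p : CState d × Vec d × Θ × Z => p.1.2.2.2.1) :=
    measurable_fst.snd.snd.snd.fst
  have hHM : Measurable (fun p : CState d × Vec d × Θ × Z => F.H p.1.2.2.2.1) :=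
    F.H.measurable.comp hM
  have he : Measurable (fun p : CState d × Vec d × Θ × Z => p.1.1.2 - p.1.2.1.2) :=
    measurable_fst.fst.snd.sub measurable_fst.snd.fst.snd
  have e3 : Measurable (fun p : CState d × Vec d × Θ × Z =>
      F.lam * p.1.2.2.1 + (-(2 * S.η)) * ⟪F.v, p.2.1⟫) :=
    (measurable_fst.snd.snd.fst.const_mul _).add (h4.const_mul _)
  have e4 : Measurable (fun p : CState d × Vec d × Θ × Z =>
      (p.1.2.2.2.1 - S.η • F.H p.1.2.2.2.1) + (-S.η) • S.dz p.1 p.2.2.1) :=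
    (hM.sub (hHM.const_smul S.η)).add (h3.const_smul (-S.η))
  have e5 : Measurable (fun p : CState d × Vec d × Θ × Z =>
      p.1.2.2.2.2.1 + (S.η * S.ρ * S.far F p.1) ^ 2) :=
    measurable_fst.snd.snd.snd.snd.fst.add ((h5.const_mul _).pow_const 2)
  have e6 : Measurable (fun p : CState d × Vec d × Θ × Z => F.lam ^ 2 * p.1.2.2.2.2.2 +
      F.w * (S.η * S.L * ‖S.η • (p.1.1.2 - p.1.2.1.2)‖) ^ 2 +
      F.q * ‖S.pt p.1.1 - S.pt p.1.2.1‖ ^ 2) :=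
    ((measurable_fst.snd.snd.snd.snd.snd.const_mul _).add
      ((((he.const_smul S.η).norm.const_mul _).pow_const 2).const_mul _)).add
      (((hp1.sub hp2).norm.pow_const 2).const_mul _)
  exact h1.prodMk (h2.prodMk (e3.prodMk (e4.prodMk (e5.prodMk e6))))

/-- The coupled chain from a common initial state. -/
noncomputable abbrev cpath (z : Vec d × Vec d) (ω : ℕ → Vec d × Θ × Z) (t : ℕ) : CState d :=
  chain (S.couple F) (z, z, 0, 0, 0, 0) ω t

lemma cpath_fst (z : Vec d × Vec d) (ω : ℕ → Vec d × Θ × Z) (t : ℕ) :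
    (S.cpath F z ω t).1 = S.path z ω t := by
  induction t with
  | zero => rfl
  | succ t ih => simp only [chain, couple]; rw [ih]

lemma cpath_snd (z : Vec d × Vec d) (ω : ℕ → Vec d × Θ × Z) (t : ℕ) :
    (S.cpath F z ω t).2.1 = S.path z (fun i => flip F.v (ω i)) t := by
  induction t with
  | zero => rfl
  | succ t ih => simp only [chain, couple]; rw [ih]

lemma bd_cpath_fst (z : Vec d × Vec d) (t : ℕ) {φ : Vec d × Vec d → ℝ} {c : ℝ}
    (h : Bd (iidLaw S.law) (fun ω => φ (S.path z ω t)) c) :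
    Bd (iidLaw S.law) (fun ω => φ (S.cpath F z ω t).1) c := by
  simpa only [cpath_fst] using h

lemma bd_cpath_snd (z : Vec d × Vec d) (t : ℕ) {φ : Vec d × Vec d → ℝ} {c : ℝ}
    (h : Bd (iidLaw S.law) (fun ω => φ (S.path z ω t)) c) :
    Bd (iidLaw S.law) (fun ω => φ (S.cpath F z ω t).2.1) c := by
  simp only [cpath_snd]
  exact h.comp (S.measurePreserving_flip_iid F.v)

/-- The direction of reflection is an eigenvector of the Hessian at the reference point for its
least eigenvalue. -/
structure IsFrame (γ : ℝ) : Prop where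
  γ_nonneg : 0 ≤ γ
  norm_v : ‖F.v‖ = 1
  H_eq : F.H = hessian S.f F.x₀
  H_v : F.H F.v = -γ • F.v
  lam_eq : F.lam = 1 + S.η * γ
  q_pos : 0 < F.q
  w_pos : 0 < F.w
  contract : ∀ w, ‖w - S.η • F.H w‖ ≤ F.lam * ‖w‖

/-- The remaining part of the difference of the coupled runs. -/
noncomputable def rest (c : CState d) : Vec d := c.1.1 - c.2.1.1 - c.2.2.1 • F.v - c.2.2.2.1

variable {S F}

lemma IsFrame.one_le_lam {γ : ℝ} (hF : S.IsFrame F γ) : 1 ≤ F.lam := by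
  rw [hF.lam_eq]
  have := mul_nonneg S.hη.le hF.γ_nonneg
  linarith

lemma IsFrame.norm_rest_couple_le {γ : ℝ} (hF : S.IsFrame F γ) (t : ℕ) (c : CState d)
    (m : Vec d × Θ × Z) :
    ‖rest F (S.couple F t c m)‖ ≤ F.lam * ‖rest F c‖ + S.η * S.L * ‖S.η • (c.1.2 - c.2.1.2)‖ +
      S.η * S.ρ * S.far F c * ‖S.pt c.1 - S.pt c.2.1‖ := by
  have hη := S.hη
  set Δ := gradient S.f (S.pt c.1) - gradient S.f (S.pt c.2.1) - F.H (S.pt c.1 - S.pt c.2.1)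
    with hΔ
  have e1 : F.H (S.pt c.1 - S.pt c.2.1) = F.H (rest F c) + c.2.2.1 • (-γ • F.v) + F.H c.2.2.2.1 +
      F.H (S.η • (c.1.2 - c.2.1.2)) := by
    rw [← hF.H_v, ← map_smul, ← map_add, ← map_add, ← map_add]
    congr 1
    simp only [pt, rest]
    module
  have e : rest F (S.couple F t c m) = (rest F c - S.η • F.H (rest F c)) -
      S.η • F.H (S.η • (c.1.2 - c.2.1.2)) - S.η • Δ := by
    rw [hΔ, e1]
    simp only [rest, couple, step, flip, dz, reflect_apply hF.norm_v, hF.lam_eq, map_sub, map_smul]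
    module
  rw [e]
  refine (norm_sub_le _ _).trans (add_le_add ((norm_sub_le _ _).trans
    (add_le_add (hF.contract _) ?_)) ?_)
  · rw [norm_smul, Real.norm_of_nonneg hη.le, mul_assoc]
    refine mul_le_mul_of_nonneg_left ((F.H.le_opNorm _).trans
      (mul_le_mul_of_nonneg_right ?_ (norm_nonneg _))) hη.le
    rw [hF.H_eq]
    exact norm_hessian_le S.hL.le S.smooth _
  · rw [norm_smul, Real.norm_of_nonneg hη.le, mul_assoc, mul_assoc]
    refine mul_le_mul_of_nonneg_left ?_ hη.le
    rw [hΔ, hF.H_eq, ← mul_assoc]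
    exact gradient_sub_linear_le S.contDiff S.hρ S.hessLip F.x₀ _ _

lemma IsFrame.cpath_bounds {γ : ℝ} (hF : S.IsFrame F γ) (z : Vec d × Vec d)
    (ω : ℕ → Vec d × Θ × Z) (t : ℕ) :
    0 ≤ (S.cpath F z ω t).2.2.2.2.1 ∧ 0 ≤ (S.cpath F z ω t).2.2.2.2.2 ∧
    ‖rest F (S.cpath F z ω t)‖ ^ 2 ≤
      (t / F.w + (S.cpath F z ω t).2.2.2.2.1 / F.q) * (S.cpath F z ω t).2.2.2.2.2 := by
  have hη := S.hη
  have hL := S.hL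
  have hρ := S.hρ
  have hq := hF.q_pos
  have hw := hF.w_pos
  have hlam := hF.one_le_lam
  induction t with
  | zero => simp [chain, rest]
  | succ t ih =>
    obtain ⟨hQ, hK, hD⟩ := ih
    have hstep := hF.norm_rest_couple_le t (S.cpath F z ω t) (ω t)
    have hsucc : S.cpath F z ω (t + 1) = S.couple F t (S.cpath F z ω t) (ω t) := rfl
    rw [hsucc]
    generalize S.cpath F z ω t = c at *
    have hfar : 0 ≤ S.far F c := by unfold far; positivity
    refine ⟨?_, ?_, ?_⟩
    · simp only [couple]; positivity
    · simp only [couple]; positivity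
    · have hcs := cauchy_schwarz_step (norm_nonneg (rest F c)) (by positivity) hK hw hq hD
        (by linarith : 0 ≤ F.lam)
        (by positivity : 0 ≤ S.η * S.L * ‖S.η • (c.1.2 - c.2.1.2)‖)
        (by positivity : 0 ≤ S.η * S.ρ * S.far F c) (norm_nonneg (S.pt c.1 - S.pt c.2.1))
      refine (pow_le_pow_left₀ (norm_nonneg _) hstep 2).trans (hcs.trans (le_of_eq ?_))
      simp only [couple]
      push_cast
      ring

lemma IsFrame.cut_rest_le {γ : ℝ} (hF : S.IsFrame F γ) (z : Vec d × Vec d)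
    (ω : ℕ → Vec d × Θ × Z) {t : ℕ} (ht : (t : ℝ) ≤ F.w) :
    cut F.q (S.cpath F z ω t).2.2.2.2.1 * ‖rest F (S.cpath F z ω t)‖ ^ 2 ≤
      2 * (cut F.q (S.cpath F z ω t).2.2.2.2.1 * (S.cpath F z ω t).2.2.2.2.2) := by
  obtain ⟨hQ, hK, hD⟩ := hF.cpath_bounds z ω t
  have hq := hF.q_pos
  have hw := hF.w_pos
  unfold cut
  split_ifs with h
  · have h1 : t / F.w ≤ 1 := (div_le_one hw).2 ht
    have h2 : (S.cpath F z ω t).2.2.2.2.1 / F.q ≤ 1 := (div_le_one hq).2 h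
    nlinarith
  · simp

end Setting

namespace Setting

variable {d : ℕ} {Θ : Type u} {Z : Type v} [MeasurableSpace Θ] [MeasurableSpace Z]
  {S : Setting d Θ Z} {F : Frame d}

variable (S) in
/-- Variance in one coordinate of the difference of the artificial noises. -/
noncomputable def B : ℝ := (-(2 * S.η)) ^ 2 * (S.r ^ 2 / d)

lemma B_nonneg : 0 ≤ S.B := by unfold B; positivity

variable (S) in
lemma law_fst {φ : Vec d → ℝ} (h : Integrable φ (noiseLaw d S.r)) :
    Integrable (fun m => φ m.1) S.law ∧ ∫ m, φ m.1 ∂S.law = ∫ ξ, φ ξ ∂(noiseLaw d S.r) := by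
  have hmp : MeasurePreserving Prod.fst S.law (noiseLaw d S.r) := measurePreserving_fst
  refine ⟨hmp.integrable_comp_of_integrable h, ?_⟩
  rw [← integral_map hmp.measurable.aemeasurable (by rw [hmp.map_eq]; exact h.1), hmp.map_eq]

lemma integral_noise_part (hv : ‖F.v‖ = 1) (z : Vec d × Vec d) (t : ℕ) :
    Integrable (fun ω => (S.cpath F z ω t).2.2.1 ^ 2) (iidLaw S.law) ∧
    ∫ ω, (S.cpath F z ω t).2.2.1 ^ 2 ∂(iidLaw S.law) = S.B * growth F.lam t := by
  induction t with
  | zero => simp [chain, growth]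
  | succ t ih =>
    have hb : ∀ c : CState d, Integrable (fun m => (S.couple F t c m).2.2.1 ^ 2) S.law ∧
        ∫ m, (S.couple F t c m).2.2.1 ^ 2 ∂S.law = F.lam ^ 2 * c.2.2.1 ^ 2 + S.B := by
      intro c
      have h := noise_affine_sq S.r hv (F.lam * c.2.2.1) (-(2 * S.η))
      have h2 := S.law_fst h.1
      refine ⟨h2.1, h2.2.trans (h.2.trans ?_)⟩
      unfold B; ring
    have hi : Integrable (fun ω => F.lam ^ 2 * (S.cpath F z ω t).2.2.1 ^ 2 + S.B)
      (iidLaw S.law) := (ih.1.const_mul _).add (integrable_const _)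
    refine ⟨(Bd.chain_succ S.law (S.measurable_couple F) _ t (φ := fun c => c.2.2.1 ^ 2)
      (Φ := fun c => F.lam ^ 2 * c.2.2.1 ^ 2 + S.B) (by fun_prop) (fun _ => by positivity)
      (by fun_prop) (fun c => ⟨(hb c).1, (hb c).2.le⟩) ⟨hi, le_rfl⟩).1, ?_⟩
    refine (integral_chain_succ S.law (S.measurable_couple F) _ t (φ := fun c => c.2.2.1 ^ 2)
      (Φ := fun c => F.lam ^ 2 * c.2.2.1 ^ 2 + S.B) (by fun_prop) (fun _ => by positivity)
      (by fun_prop) hb hi).trans ?_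
    rw [integral_add (ih.1.const_mul _) (integrable_const _), integral_const_mul]
    have := ih.2
    unfold cpath at this
    rw [this, growth]
    simp
    ring

lemma bd_noise_part_four (hv : ‖F.v‖ = 1) (z : Vec d × Vec d) (t : ℕ) :
    Bd (iidLaw S.law) (fun ω => (S.cpath F z ω t).2.2.1 ^ 4)
      (80 * (S.B * growth F.lam t) ^ 2) := by
  induction t with
  | zero =>
    exact (Bd.const (μ := iidLaw S.law) ((0 : ℝ) ^ 4)).weaken (by norm_num; positivity)
  | succ t ih =>
    have h2 := integral_noise_part (S := S) hv z t
    have hB := B_nonneg (S := S)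
    have hβ := growth_nonneg F.lam t
    refine Bd.chain_succ S.law (S.measurable_couple F) _ t (φ := fun c => c.2.2.1 ^ 4)
      (Φ := fun c => F.lam ^ 4 * c.2.2.1 ^ 4 + (6 * F.lam ^ 2 * S.B * c.2.2.1 ^ 2 + 80 * S.B ^ 2))
      (by fun_prop) (fun _ => by positivity) (by fun_prop) (fun c => ?_) ?_
    · refine ((noise_affine_four S.r hv (F.lam * c.2.2.1) (-(2 * S.η))).fst
        (ν := S.D.prod S.Q)).weaken (le_of_eq ?_)
      unfold B
      ring
    · refine ((ih.const_mul (by positivity)).add (Bd.add ((show Bd (iidLaw S.law) _ _ from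
        ⟨h2.1, h2.2.le⟩).const_mul (by positivity)) (Bd.const _))).weaken ?_
      rw [growth]
      have : 0 ≤ F.lam ^ 2 * S.B ^ 2 * growth F.lam t := by positivity
      nlinarith

lemma cut_couple_le (t : ℕ) (c : CState d) (m : Vec d × Θ × Z) :
    cut F.q (S.couple F t c m).2.2.2.2.1 ≤ cut F.q c.2.2.2.2.1 :=
  cut_anti _ (by simp only [couple]; nlinarith [sq_nonneg (S.η * S.ρ * S.far F c)])

lemma measurable_cut_control : Measurable (fun c : CState d => cut F.q c.2.2.2.2.1) :=
  (measurable_cut F.q).comp measurable_snd.snd.snd.snd.fst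

lemma measurable_cut_martingale :
    Measurable (fun c : CState d => cut F.q c.2.2.2.2.1 * ‖c.2.2.2.1‖ ^ 2) :=
  measurable_cut_control.mul (measurable_snd.snd.snd.fst.norm.pow_const 2)

variable (S) in
lemma measurable_cut_diff :
    Measurable (fun c : CState d => cut F.q c.2.2.2.2.1 * ‖S.pt c.1 - S.pt c.2.1‖ ^ 2) := by
  have h1 : Measurable (fun c : CState d => S.pt c.1) := S.measurable_pt.comp measurable_fst
  have h2 : Measurable (fun c : CState d => S.pt c.2.1) := S.measurable_pt.comp measurable_snd.fst
  exact measurable_cut_control.mul ((h1.sub h2).norm.pow_const 2)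

variable (S) in
lemma bd_dz (c : CState d) (a : Vec d) (k : ℝ) :
    Bd S.D (fun θ => ‖a + k • S.dz c θ‖ ^ 2)
      (‖a‖ ^ 2 + k ^ 2 * (S.n * ‖S.pt c.1 - S.pt c.2.1‖ ^ 2 + S.τ)) := by
  have i1 : ∀ x, Integrable (fun θ => S.g x θ - gradient S.f x) S.D := fun x =>
    (S.integrable_g x).sub (integrable_const _)
  have i2 : ∀ x, ∫ θ, (S.g x θ - gradient S.f x) ∂S.D = 0 := fun x => by
    rw [integral_sub (S.integrable_g x) (integrable_const _), S.unbiased]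
    simp
  have i3 : Integrable (fun θ => S.dz c θ) S.D := (i1 (S.pt c.1)).sub (i1 (S.pt c.2.1))
  have i4 : ∫ θ, S.dz c θ ∂S.D = 0 := by
    unfold dz
    rw [integral_sub (i1 _) (i1 _), i2, i2, sub_zero]
  exact Bd.add_centered i3 i4 (S.increment _ _) _ _

lemma bd_cut_martingale {γ : ℝ} (hF : S.IsFrame F γ) (t : ℕ) (c : CState d) :
    Bd S.law (fun m => cut F.q (S.couple F t c m).2.2.2.2.1 * ‖(S.couple F t c m).2.2.2.1‖ ^ 2)
      (F.lam ^ 2 * (cut F.q c.2.2.2.2.1 * ‖c.2.2.2.1‖ ^ 2) +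
        S.η ^ 2 * S.n * (cut F.q c.2.2.2.2.1 * ‖S.pt c.1 - S.pt c.2.1‖ ^ 2) + S.η ^ 2 * S.τ) := by
  have hn := S.hn
  have hτ := S.hτ
  have hcut := cut_nonneg F.q c.2.2.2.2.1
  have h1 := S.bd_dz c (c.2.2.2.1 - S.η • F.H c.2.2.2.1) (-S.η)
  have h2 := (((h1.fst (ν := S.Q)).snd (μ := noiseLaw d S.r))).const_mul hcut
  have hm : Measurable (fun m => S.couple F t c m) :=
    (S.measurable_couple F t).comp (measurable_const.prodMk measurable_id)
  have hm' : Measurable (fun m => cut F.q (S.couple F t c m).2.2.2.2.1 *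
      ‖(S.couple F t c m).2.2.2.1‖ ^ 2) :=
    Measurable.comp (g := fun c : CState d => cut F.q c.2.2.2.2.1 * ‖c.2.2.2.1‖ ^ 2)
      measurable_cut_martingale hm
  refine Bd.mono h2 hm' (fun _ => mul_nonneg (cut_nonneg _ _) (by positivity)) (fun m => ?_) ?_
  · exact mul_le_mul_of_nonneg_right (cut_couple_le (S := S) (F := F) t c m) (by positivity)
  · have h3 : ‖c.2.2.2.1 - S.η • F.H c.2.2.2.1‖ ^ 2 ≤ F.lam ^ 2 * ‖c.2.2.2.1‖ ^ 2 := by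
      rw [← mul_pow]
      exact pow_le_pow_left₀ (norm_nonneg _) (hF.contract _) 2
    have h4 := mul_le_mul_of_nonneg_left h3 hcut
    have h5 := mul_le_mul_of_nonneg_right (cut_le_one F.q c.2.2.2.2.1)
      (by positivity : 0 ≤ S.η ^ 2 * S.τ)
    rw [neg_sq]
    linarith

lemma bd_martingale_succ {γ : ℝ} (hF : S.IsFrame F γ) (z : Vec d × Vec d) (t : ℕ) {a b : ℝ}
    (ha : Bd (iidLaw S.law) (fun ω => cut F.q (S.cpath F z ω t).2.2.2.2.1 *
      ‖(S.cpath F z ω t).2.2.2.1‖ ^ 2) a)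
    (hb : Bd (iidLaw S.law) (fun ω => cut F.q (S.cpath F z ω t).2.2.2.2.1 *
      ‖S.pt (S.cpath F z ω t).1 - S.pt (S.cpath F z ω t).2.1‖ ^ 2) b) :
    Bd (iidLaw S.law) (fun ω => cut F.q (S.cpath F z ω (t + 1)).2.2.2.2.1 *
      ‖(S.cpath F z ω (t + 1)).2.2.2.1‖ ^ 2) (F.lam ^ 2 * a + S.η ^ 2 * S.n * b + S.η ^ 2 * S.τ) := by
  have hn := S.hn
  have h := ((ha.const_mul (sq_nonneg F.lam)).add (hb.const_mul
    (by positivity : 0 ≤ S.η ^ 2 * S.n))).add (Bd.const (μ := iidLaw S.law) (S.η ^ 2 * S.τ))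
  exact Bd.chain_succ S.law (S.measurable_couple F) (z, z, 0, 0, 0, 0) t
    (φ := fun c => cut F.q c.2.2.2.2.1 * ‖c.2.2.2.1‖ ^ 2)
    (Φ := fun c => F.lam ^ 2 * (cut F.q c.2.2.2.2.1 * ‖c.2.2.2.1‖ ^ 2) +
      S.η ^ 2 * S.n * (cut F.q c.2.2.2.2.1 * ‖S.pt c.1 - S.pt c.2.1‖ ^ 2) + S.η ^ 2 * S.τ)
    measurable_cut_martingale (fun _ => mul_nonneg (cut_nonneg _ _) (by positivity))
    (((measurable_cut_martingale.const_mul _).add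
      (S.measurable_cut_diff.const_mul _)).add measurable_const)
    (bd_cut_martingale hF t) h

lemma bd_control_succ {γ : ℝ} (hF : S.IsFrame F γ) (z : Vec d × Vec d) (t : ℕ) {a b c : ℝ}
    (ha : Bd (iidLaw S.law) (fun ω => cut F.q (S.cpath F z ω t).2.2.2.2.1 *
      (S.cpath F z ω t).2.2.2.2.2) a)
    (hb : Bd (iidLaw S.law) (fun ω => cut F.q (S.cpath F z ω t).2.2.2.2.1 *
      ‖S.pt (S.cpath F z ω t).1 - S.pt (S.cpath F z ω t).2.1‖ ^ 2) b)
    (hc : Bd (iidLaw S.law) (fun ω => cut F.q (S.cpath F z ω t).2.2.2.2.1 *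
      ‖S.η • ((S.cpath F z ω t).1.2 - (S.cpath F z ω t).2.1.2)‖ ^ 2) c) :
    Bd (iidLaw S.law) (fun ω => cut F.q (S.cpath F z ω (t + 1)).2.2.2.2.1 *
      (S.cpath F z ω (t + 1)).2.2.2.2.2)
      (F.lam ^ 2 * a + F.w * (S.η * S.L) ^ 2 * c + F.q * b) := by
  have hw := hF.w_pos
  have hq := hF.q_pos
  have hm : Measurable (fun ω => S.cpath F z ω (t + 1)) :=
    measurable_chain (S.measurable_couple F) _ _
  refine (((ha.const_mul (sq_nonneg F.lam)).add (hc.const_mul (by positivity :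
    0 ≤ F.w * (S.η * S.L) ^ 2))).add (hb.const_mul hq.le)).mono ?_
    (fun ω => mul_nonneg (cut_nonneg _ _) (hF.cpath_bounds z ω (t + 1)).2.1) (fun ω => ?_) le_rfl
  · exact ((measurable_cut F.q).comp hm.snd.snd.snd.snd.fst).mul hm.snd.snd.snd.snd.snd
  · have hsucc : S.cpath F z ω (t + 1) = S.couple F t (S.cpath F z ω t) (ω t) := rfl
    have hK := (hF.cpath_bounds z ω (t + 1)).2.1
    have h1 := mul_le_mul_of_nonneg_right (cut_couple_le (S := S) (F := F) t (S.cpath F z ω t) (ω t)) hK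
    rw [hsucc] at h1 ⊢
    refine h1.trans (le_of_eq ?_)
    simp only [couple, mul_pow]
    ring

lemma bd_far {z : Vec d × Vec d} {W : ℕ} {b : ℝ} (hx : F.x₀ = S.pt z)
    (h : ∀ t ≤ W, Bd (iidLaw S.law) (fun ω => ‖S.pt (S.path z ω t) - S.pt z‖ ^ 2) b) (t : ℕ)
    (ht : t ≤ W) :
    Bd (iidLaw S.law) (fun ω => (S.cpath F z ω t).2.2.2.2.1) (t * ((S.η * S.ρ) ^ 2 * (4 * b))) := by
  induction t with
  | zero => exact (Bd.const (μ := iidLaw S.law) (0 : ℝ)).weaken (by simp)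
  | succ t ih =>
    have h1 := h t (by omega)
    have h2 := S.bd_cpath_fst F z t (φ := fun z' => ‖S.pt z' - S.pt z‖ ^ 2) h1
    have h3 := S.bd_cpath_snd F z t (φ := fun z' => ‖S.pt z' - S.pt z‖ ^ 2) h1
    have hm : Measurable (fun ω => S.cpath F z ω t) := measurable_chain (S.measurable_couple F) _ _
    have hfar : Bd (iidLaw S.law) (fun ω => (S.η * S.ρ * S.far F (S.cpath F z ω t)) ^ 2)
        ((S.η * S.ρ) ^ 2 * (4 * b)) := by
      refine (((h2.const_mul (by norm_num : (0 : ℝ) ≤ 2)).add (h3.const_mul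
        (by norm_num : (0 : ℝ) ≤ 2))).const_mul (sq_nonneg (S.η * S.ρ))).mono ?_
        (fun _ => by positivity) (fun ω => ?_) (by linarith)
      · exact (((S.measurable_far F).comp hm).const_mul _).pow_const 2
      · rw [mul_pow]
        refine mul_le_mul_of_nonneg_left ?_ (sq_nonneg _)
        rw [far, hx]
        nlinarith [sq_nonneg (‖S.pt (S.cpath F z ω t).1 - S.pt z‖ -
          ‖S.pt (S.cpath F z ω t).2.1 - S.pt z‖)]
    refine (((ih (by omega)).add hfar).congr fun ω => ?_).weaken (by push_cast; linarith)
    rfl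

lemma diff_eq (c : CState d) :
    c.1.1 - c.2.1.1 = c.2.2.1 • F.v + (c.2.2.2.1 + rest F c) := by
  unfold rest; abel

lemma bd_diff {γ : ℝ} (hF : S.IsFrame F γ) (z : Vec d × Vec d) {t : ℕ} (ht : (t : ℝ) ≤ F.w)
    (hM : Bd (iidLaw S.law) (fun ω => cut F.q (S.cpath F z ω t).2.2.2.2.1 *
      ‖(S.cpath F z ω t).2.2.2.1‖ ^ 2) (S.B * growth F.lam t * (1 / 64)))
    (hK : Bd (iidLaw S.law) (fun ω => cut F.q (S.cpath F z ω t).2.2.2.2.1 *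
      (S.cpath F z ω t).2.2.2.2.2) (S.B * growth F.lam t * (1 / 128))) :
    Bd (iidLaw S.law) (fun ω => cut F.q (S.cpath F z ω t).2.2.2.2.1 *
      ‖(S.cpath F z ω t).1.1 - (S.cpath F z ω t).2.1.1‖ ^ 2) (3 * (S.B * growth F.lam t)) := by
  have hp := integral_noise_part (S := S) hF.norm_v z t
  have hm : Measurable (fun ω => S.cpath F z ω t) := measurable_chain (S.measurable_couple F) _ _
  have hBβ := mul_nonneg (B_nonneg (S := S)) (growth_nonneg F.lam t)
  refine ((((show Bd (iidLaw S.law) _ _ from ⟨hp.1, hp.2.le⟩).const_mul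
    (by norm_num : (0 : ℝ) ≤ 2)).add (hM.const_mul (by norm_num : (0 : ℝ) ≤ 4))).add
    (hK.const_mul (by norm_num : (0 : ℝ) ≤ 8))).mono ?_
    (fun ω => mul_nonneg (cut_nonneg _ _) (by positivity)) (fun ω => ?_) (by linarith)
  · exact ((measurable_cut F.q).comp hm.snd.snd.snd.snd.fst).mul
      ((hm.fst.fst.sub hm.snd.fst.fst).norm.pow_const 2)
  · have h1 := hF.cut_rest_le z ω ht
    generalize S.cpath F z ω t = c at *
    have h2 : ‖c.1.1 - c.2.1.1‖ ^ 2 ≤ 2 * c.2.2.1 ^ 2 + 4 * ‖c.2.2.2.1‖ ^ 2 + 4 * ‖rest F c‖ ^ 2 := by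
      rw [diff_eq (F := F) c]
      have h3 := norm_add_sq_le_two (c.2.2.1 • F.v) (c.2.2.2.1 + rest F c)
      have h4 := norm_add_sq_le_two c.2.2.2.1 (rest F c)
      rw [norm_smul, hF.norm_v, mul_one, Real.norm_eq_abs, sq_abs] at h3
      linarith
    have h5 := cut_nonneg F.q c.2.2.2.2.1
    have h6 := mul_le_mul_of_nonneg_left h2 h5
    have h7 := mul_le_mul_of_nonneg_right (cut_le_one F.q c.2.2.2.2.1) (sq_nonneg c.2.2.1)
    nlinarith

end Setting

namespace Setting

variable {d : ℕ} {Θ : Type u} {Z : Type v} [MeasurableSpace Θ] [MeasurableSpace Z]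
  {S : Setting d Θ Z} {F : Frame d}

/-- Bounds for the difference of the iterates until time `t`. -/
def DiffBound (S : Setting d Θ Z) (F : Frame d) (z : Vec d × Vec d) (t : ℕ) : Prop :=
  Bd (iidLaw S.law) (fun ω => cut F.q (S.cpath F z ω t).2.2.2.2.1 *
    ‖(S.cpath F z ω t).1.1 - (S.cpath F z ω t).2.1.1‖ ^ 2) (3 * (S.B * growth F.lam t))

/-- Bounds for the difference of the errors at time `t`. -/
def ErrBound (S : Setting d Θ Z) (F : Frame d) (z : Vec d × Vec d) (Aa Dd : ℝ) (t : ℕ) : Prop :=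
  Bd (iidLaw S.law) (fun ω => cut F.q (S.cpath F z ω t).2.2.2.2.1 *
    ‖S.η • ((S.cpath F z ω t).1.2 - (S.cpath F z ω t).2.1.2)‖ ^ 2)
    (S.B * (Aa + Dd * growth F.lam t))

lemma bd_pt_diff {z : Vec d × Vec d} {Aa Dd : ℝ} {t : ℕ} (hDd : Dd ≤ 1)
    (h1 : DiffBound S F z t) (h2 : ErrBound S F z Aa Dd t) :
    Bd (iidLaw S.law) (fun ω => cut F.q (S.cpath F z ω t).2.2.2.2.1 *
      ‖S.pt (S.cpath F z ω t).1 - S.pt (S.cpath F z ω t).2.1‖ ^ 2)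
      (8 * (S.B * growth F.lam t) + 2 * S.B * Aa) := by
  have hm : Measurable (fun ω => S.cpath F z ω t) := measurable_chain (S.measurable_couple F) _ _
  have hB := B_nonneg (S := S)
  have hβ := growth_nonneg F.lam t
  have hmm : Measurable (fun ω => cut F.q (S.cpath F z ω t).2.2.2.2.1 *
      ‖S.pt (S.cpath F z ω t).1 - S.pt (S.cpath F z ω t).2.1‖ ^ 2) :=
    Measurable.comp (g := fun c : CState d => cut F.q c.2.2.2.2.1 * ‖S.pt c.1 - S.pt c.2.1‖ ^ 2)
      S.measurable_cut_diff hm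
  refine Bd.mono ((Bd.const_mul h1 (by norm_num : (0 : ℝ) ≤ 2)).add
    (Bd.const_mul h2 (by norm_num : (0 : ℝ) ≤ 2))) hmm
    (fun ω => mul_nonneg (cut_nonneg _ _) (by positivity)) (fun ω => ?_) ?_
  · generalize S.cpath F z ω t = c
    have e : S.pt c.1 - S.pt c.2.1 = (c.1.1 - c.2.1.1) + S.η • (c.1.2 - c.2.1.2) := by
      simp only [pt]; module
    rw [e]
    have h := mul_le_mul_of_nonneg_left
      (norm_add_sq_le_two (c.1.1 - c.2.1.1) (S.η • (c.1.2 - c.2.1.2)))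
      (cut_nonneg F.q c.2.2.2.2.1)
    linarith
  · have := mul_le_mul_of_nonneg_left (mul_le_mul_of_nonneg_right hDd hβ) hB
    linarith

/-- Smallness of the parameters of the coupling of length `W`. -/
structure IsTuned (S : Setting d Θ Z) (F : Frame d) (W : ℕ) (Aa Dd : ℝ) : Prop where
  W_pos : 1 ≤ W
  w_eq : F.w = W
  q_eq : F.q = 1 / (4096 * W)
  Aa_nonneg : 0 ≤ Aa
  Dd_nonneg : 0 ≤ Dd
  Dd_le : Dd ≤ 1
  Aa_le : Aa ≤ 2 * W
  oracle_const : 256 * (S.η ^ 2 * S.τ) ≤ S.B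
  oracle_init : 512 * (S.η ^ 2 * S.n * Aa) ≤ 1
  oracle_lip : 1024 * (S.η ^ 2 * S.n * W) ≤ 1
  smooth_init : 1024 * (W * (S.η * S.L) ^ 2 * Aa) ≤ 1
  smooth_growth : 1024 * (W ^ 2 * (S.η * S.L) ^ 2 * Dd) ≤ 1

lemma coupling_bounds {γ : ℝ} (hF : S.IsFrame F γ) (z : Vec d × Vec d) {W : ℕ} {Aa Dd : ℝ}
    (hT : IsTuned S F W Aa Dd)
    (herr : ∀ t ≤ W, (∀ i < t, DiffBound S F z i) → ErrBound S F z Aa Dd t) (t : ℕ) (ht : t ≤ W) :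
    Bd (iidLaw S.law) (fun ω => cut F.q (S.cpath F z ω t).2.2.2.2.1 *
      ‖(S.cpath F z ω t).2.2.2.1‖ ^ 2) (S.B * growth F.lam t * (1 / 64)) ∧
    Bd (iidLaw S.law) (fun ω => cut F.q (S.cpath F z ω t).2.2.2.2.1 *
      (S.cpath F z ω t).2.2.2.2.2) (S.B * growth F.lam t * (1 / 128)) := by
  have hB := B_nonneg (S := S)
  have hn := S.hn
  have hτ := S.hτ
  have hlam := hF.one_le_lam
  have hW : (1 : ℝ) ≤ W := by exact_mod_cast hT.W_pos
  have hDd := hT.Dd_nonneg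
  have hAa := hT.Aa_nonneg
  have hq := hF.q_pos
  have hqW : F.q * W = 1 / 4096 := by rw [hT.q_eq]; field_simp
  have key : ∀ t ≤ W, (∀ i < t, DiffBound S F z i) ∧
      Bd (iidLaw S.law) (fun ω => cut F.q (S.cpath F z ω t).2.2.2.2.1 *
        ‖(S.cpath F z ω t).2.2.2.1‖ ^ 2)
        (S.B * growth F.lam t * (1 / 128 + 8 * (S.η ^ 2 * S.n) * t)) ∧
      Bd (iidLaw S.law) (fun ω => cut F.q (S.cpath F z ω t).2.2.2.2.1 *
        (S.cpath F z ω t).2.2.2.2.2)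
        (S.B * growth F.lam t * (1 / 512 + (W * (S.η * S.L) ^ 2 * Dd + 8 * F.q) * t)) ∧
      Bd (iidLaw S.law) (fun ω => cut F.q (S.cpath F z ω t).2.2.2.2.1 *
        ‖(S.cpath F z ω t).2.2.2.1‖ ^ 2) (S.B * growth F.lam t * (1 / 64)) ∧
      Bd (iidLaw S.law) (fun ω => cut F.q (S.cpath F z ω t).2.2.2.2.1 *
        (S.cpath F z ω t).2.2.2.2.2) (S.B * growth F.lam t * (1 / 128)) := by
    have fin : ∀ t ≤ W, S.B * growth F.lam t * (1 / 128 + 8 * (S.η ^ 2 * S.n) * t) ≤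
          S.B * growth F.lam t * (1 / 64) ∧
        S.B * growth F.lam t * (1 / 512 + (W * (S.η * S.L) ^ 2 * Dd + 8 * F.q) * t) ≤
          S.B * growth F.lam t * (1 / 128) := by
      intro t ht
      have hβ := growth_nonneg F.lam t
      have htW : (t : ℝ) ≤ W := by exact_mod_cast ht
      have h1 := hT.oracle_lip
      have h2 := hT.smooth_growth
      have h3 : S.η ^ 2 * S.n * t ≤ S.η ^ 2 * S.n * W := by gcongr
      have h4 : (W * (S.η * S.L) ^ 2 * Dd + 8 * F.q) * t ≤
          (W * (S.η * S.L) ^ 2 * Dd + 8 * F.q) * W := by gcongr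
      refine ⟨mul_le_mul_of_nonneg_left ?_ (by positivity),
        mul_le_mul_of_nonneg_left ?_ (by positivity)⟩ <;> nlinarith
    intro t
    induction t with
    | zero =>
      intro _
      have hz : ∀ a : ℝ, Bd (iidLaw S.law) (fun ω => cut F.q (S.cpath F z ω 0).2.2.2.2.1 * a) a ∨
        True := fun _ => Or.inr trivial
      have h0 : Bd (iidLaw S.law) (fun _ : ℕ → Vec d × Θ × Z => (0 : ℝ)) 0 := Bd.const _
      have hM : Bd (iidLaw S.law) (fun ω => cut F.q (S.cpath F z ω 0).2.2.2.2.1 *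
          ‖(S.cpath F z ω 0).2.2.2.1‖ ^ 2) 0 := h0.congr fun ω => by simp [chain]
      have hK : Bd (iidLaw S.law) (fun ω => cut F.q (S.cpath F z ω 0).2.2.2.2.1 *
          (S.cpath F z ω 0).2.2.2.2.2) 0 := h0.congr fun ω => by simp [chain]
      refine ⟨by simp, hM.weaken ?_, hK.weaken ?_, hM.weaken ?_, hK.weaken ?_⟩ <;> simp [growth]
    | succ t ih =>
      intro ht
      obtain ⟨hd, hM, hK, hM', hK'⟩ := ih (by omega)
      have htw : (t : ℝ) ≤ F.w := by
        rw [hT.w_eq]; exact_mod_cast (by omega : t ≤ W)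
      have hψ : DiffBound S F z t := bd_diff hF z htw hM' hK'
      have hE := herr t (by omega) hd
      have hX := bd_pt_diff hT.Dd_le hψ hE
      have hβ := growth_nonneg F.lam t
      have hl : F.lam ^ 2 * growth F.lam t + 1 = growth F.lam (t + 1) := rfl
      have hl2 : 1 ≤ F.lam ^ 2 := one_le_pow₀ hlam
      have hM1 := (bd_martingale_succ hF z t hM hX).weaken
        (show _ ≤ S.B * growth F.lam (t + 1) *
          (1 / 128 + 8 * (S.η ^ 2 * S.n) * ((t + 1 : ℕ) : ℝ)) by
        have h1 := hT.oracle_const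
        have h2 := mul_le_mul_of_nonneg_left hT.oracle_init hB
        rw [← hl]
        push_cast
        have h3 : 0 ≤ S.B * (S.η ^ 2 * S.n) * ((F.lam ^ 2 - 1) * growth F.lam t) :=
          mul_nonneg (by positivity) (mul_nonneg (by linarith) hβ)
        have h4 : 0 ≤ S.B * (S.η ^ 2 * S.n) * (t + 1) := by positivity
        nlinarith)
      have hK1 := (bd_control_succ hF z t hK hX hE).weaken
        (show _ ≤ S.B * growth F.lam (t + 1) *
          (1 / 512 + (W * (S.η * S.L) ^ 2 * Dd + 8 * F.q) * ((t + 1 : ℕ) : ℝ)) by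
        have h1 := mul_le_mul_of_nonneg_left hT.smooth_init hB
        have h2 : F.q * Aa ≤ 1 / 2048 := by
          have := mul_le_mul_of_nonneg_left hT.Aa_le hq.le
          linarith
        have h2 := mul_le_mul_of_nonneg_left h2 hB
        rw [← hl, hT.w_eq]
        push_cast
        have h3 : 0 ≤ S.B * (W * (S.η * S.L) ^ 2 * Dd + 8 * F.q) *
            ((F.lam ^ 2 - 1) * growth F.lam t) :=
          mul_nonneg (by positivity) (mul_nonneg (by linarith) hβ)
        have h4 : 0 ≤ S.B * (W * (S.η * S.L) ^ 2 * Dd + 8 * F.q) * (t + 1) := by positivity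
        nlinarith)
      refine ⟨fun i hi => ?_, hM1, hK1, hM1.weaken (fin (t + 1) ht).1,
        hK1.weaken (fin (t + 1) ht).2⟩
      rcases Nat.lt_succ_iff_lt_or_eq.1 hi with h | rfl
      · exact hd i h
      · exact hψ
  exact ⟨(key t ht).2.2.2.1, (key t ht).2.2.2.2⟩

/-- Runs that stay close to their start cannot be separated by the artificial noise. -/
lemma coupling_growth_le {γ : ℝ} (hF : S.IsFrame F γ) (z : Vec d × Vec d) {W : ℕ} {Aa Dd Zx Zy : ℝ}
    (hT : IsTuned S F W Aa Dd) (hx₀ : F.x₀ = S.pt z)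
    (herr : ∀ t ≤ W, (∀ i < t, DiffBound S F z i) → ErrBound S F z Aa Dd t)
    (hZx : ∀ t ≤ W, Bd (iidLaw S.law) (fun ω => ‖S.pt (S.path z ω t) - S.pt z‖ ^ 2) Zx)
    (hZy : Bd (iidLaw S.law) (fun ω => ‖(S.path z ω W).1 - z.1‖ ^ 2) Zy)
    (hsmall : 16384 * 1280 * (W ^ 2 * (S.η * S.ρ) ^ 2 * Zx) ≤ 1) :
    S.B * growth F.lam W ≤ 16 * Zy := by
  have hW : (1 : ℝ) ≤ W := by exact_mod_cast hT.W_pos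
  have hq := hF.q_pos
  have hB := B_nonneg (S := S)
  have hβ := growth_nonneg F.lam W
  have hqW : F.q * (4096 * W) = 1 := by rw [hT.q_eq]; field_simp
  set T₀ := S.B * growth F.lam W with hT₀
  have hZy0 : 0 ≤ Zy := le_trans (integral_nonneg fun _ => by positivity) hZy.2
  rcases (mul_nonneg hB hβ).eq_or_lt with h0 | hpos
  · rw [hT₀, ← h0]; positivity
  rw [← hT₀] at hpos
  obtain ⟨hM, hK⟩ := coupling_bounds hF z hT herr W le_rfl
  rw [← hT₀] at hM hK
  have h1 := S.bd_cpath_fst F z W (φ := fun z' => ‖z'.1 - z.1‖ ^ 2) hZy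
  have h2 := S.bd_cpath_snd F z W (φ := fun z' => ‖z'.1 - z.1‖ ^ 2) hZy
  have hQ := bd_far hx₀ hZx W le_rfl
  have h4 := bd_noise_part_four (S := S) hF.norm_v z W
  rw [← hT₀] at h4
  have hp := integral_noise_part (S := S) hF.norm_v z W
  rw [← hT₀] at hp
  have hsum := (((((h1.const_mul (by norm_num : (0 : ℝ) ≤ 4)).add
    (h2.const_mul (by norm_num : (0 : ℝ) ≤ 4))).add
    (hM.const_mul (by norm_num : (0 : ℝ) ≤ 4))).add
    (hK.const_mul (by norm_num : (0 : ℝ) ≤ 8))).add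
    (hQ.const_mul (by positivity : 0 ≤ 160 * T₀ / F.q))).add
    (h4.const_mul (by positivity : 0 ≤ 1 / (640 * T₀)))
  have hle : T₀ ≤ _ := hp.2.ge.trans ((integral_mono hp.1 hsum.1 fun ω => ?_).trans hsum.2)
  · have e1 : 160 * T₀ / F.q * (W * ((S.η * S.ρ) ^ 2 * (4 * Zx))) ≤ T₀ / 8 := by
      have e2 : 1 / F.q = 4096 * W := by
        rw [div_eq_iff hq.ne']; linarith
      have e3 : 160 * T₀ / F.q = 160 * T₀ * (4096 * W) := by rw [← e2]; ring
      rw [e3]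
      nlinarith [mul_le_mul_of_nonneg_left hsmall hpos.le]
    have e4 : 1 / (640 * T₀) * (80 * T₀ ^ 2) = T₀ / 8 := by field_simp; norm_num
    linarith
  · have hbd := hF.cpath_bounds z ω W
    have hrest := hF.cut_rest_le z ω (t := W) hT.w_eq.ge
    dsimp only
    generalize S.cpath F z ω W = c at *
    obtain ⟨hQ0, hK0, -⟩ := hbd
    by_cases hc : c.2.2.2.2.1 ≤ F.q
    · have hχ : cut F.q c.2.2.2.2.1 = 1 := if_pos hc
      rw [hχ] at hrest ⊢
      have e : c.2.2.1 • F.v = (c.1.1 - z.1) - (c.2.1.1 - z.1) - (c.2.2.2.1 + rest F c) := by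
        unfold rest; abel
      have e1 : c.2.2.1 ^ 2 = ‖c.2.2.1 • F.v‖ ^ 2 := by
        rw [norm_smul, hF.norm_v, mul_one, Real.norm_eq_abs, sq_abs]
      have e2 := norm_sub_sq_le_two (c.1.1 - z.1 - (c.2.1.1 - z.1)) (c.2.2.2.1 + rest F c)
      have e3 := norm_sub_sq_le_two (c.1.1 - z.1) (c.2.1.1 - z.1)
      have e4 := norm_add_sq_le_two c.2.2.2.1 (rest F c)
      rw [← e] at e2
      have e5 : 0 ≤ 160 * T₀ / F.q * c.2.2.2.2.1 := by positivity
      have e6 : 0 ≤ 1 / (640 * T₀) * c.2.2.1 ^ 4 := by positivity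
      linarith
    · have hχ : cut F.q c.2.2.2.2.1 = 0 := if_neg hc
      rw [hχ]
      have e5 : 160 * T₀ ≤ 160 * T₀ / F.q * c.2.2.2.2.1 := by
        rw [div_mul_eq_mul_div, le_div_iff₀ hq]
        exact mul_le_mul_of_nonneg_left (not_le.1 hc).le (by positivity)
      have e6 : c.2.2.1 ^ 2 ≤ 160 * T₀ + 1 / (640 * T₀) * c.2.2.1 ^ 4 := by
        have : 0 ≤ (c.2.2.1 ^ 2 - 320 * T₀) ^ 2 / (640 * T₀) := by positivity
        have e7 : (c.2.2.1 ^ 2 - 320 * T₀) ^ 2 / (640 * T₀) =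
            1 / (640 * T₀) * c.2.2.1 ^ 4 - c.2.2.1 ^ 2 + 160 * T₀ := by field_simp; ring
        linarith
      have e8 : 0 ≤ ‖c.1.1 - z.1‖ ^ 2 := by positivity
      have e9 : 0 ≤ ‖c.2.1.1 - z.1‖ ^ 2 := by positivity
      linarith

end Setting

namespace Setting

variable {d : ℕ} {Θ : Type u} {Z : Type v} [MeasurableSpace Θ] [MeasurableSpace Z]
  {S : Setting d Θ Z} {F : Frame d}

lemma measurable_cut_err :
    Measurable (fun c : CState d => cut F.q c.2.2.2.2.1 * ‖S.η • (c.1.2 - c.2.1.2)‖ ^ 2) := by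
  have h : Measurable (fun c : CState d => c.1.2 - c.2.1.2) :=
    measurable_fst.snd.sub measurable_snd.fst.snd
  exact measurable_cut_control.mul ((h.const_smul S.η).norm.pow_const 2)

lemma measurable_cut_psi :
    Measurable (fun c : CState d => cut F.q c.2.2.2.2.1 * ‖c.1.1 - c.2.1.1‖ ^ 2) := by
  have h : Measurable (fun c : CState d => c.1.1 - c.2.1.1) :=
    measurable_fst.fst.sub measurable_snd.fst.fst
  exact measurable_cut_control.mul (h.norm.pow_const 2)

/-- The errors of the two runs are bounded separately. -/
lemma errBound_of_bd_err (hr : S.r ≠ 0) (z : Vec d × Vec d) (t : ℕ) :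
    ErrBound S F z ((‖z.2‖ ^ 2 + S.V) * d / S.r ^ 2) 0 t := by
  have hd : (d : ℝ) ≠ 0 := by have := S.hd; positivity
  have h1 := S.bd_cpath_fst F z t (φ := fun z' => ‖z'.2‖ ^ 2) (S.bd_err z t)
  have h2 := S.bd_cpath_snd F z t (φ := fun z' => ‖z'.2‖ ^ 2) (S.bd_err z t)
  have hm : Measurable (fun ω => S.cpath F z ω t) := measurable_chain (S.measurable_couple F) _ _
  have hmm : Measurable (fun ω => cut F.q (S.cpath F z ω t).2.2.2.2.1 *
      ‖S.η • ((S.cpath F z ω t).1.2 - (S.cpath F z ω t).2.1.2)‖ ^ 2) :=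
    Measurable.comp (g := fun c : CState d => cut F.q c.2.2.2.2.1 *
      ‖S.η • (c.1.2 - c.2.1.2)‖ ^ 2) measurable_cut_err hm
  refine Bd.mono ((h1.add h2).const_mul (by positivity : 0 ≤ 2 * S.η ^ 2)) hmm
    (fun ω => mul_nonneg (cut_nonneg _ _) (by positivity)) (fun ω => ?_) (le_of_eq ?_)
  · generalize S.cpath F z ω t = c
    have h3 := norm_sub_sq_le_two c.1.2 c.2.1.2
    have h4 : ‖S.η • (c.1.2 - c.2.1.2)‖ ^ 2 = S.η ^ 2 * ‖c.1.2 - c.2.1.2‖ ^ 2 := by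
      rw [norm_smul, mul_pow, Real.norm_eq_abs, sq_abs]
    rw [h4]
    have h5 := mul_le_of_le_one_left (by positivity : 0 ≤ S.η ^ 2 * ‖c.1.2 - c.2.1.2‖ ^ 2)
      (cut_le_one F.q c.2.2.2.2.1)
    nlinarith [sq_nonneg S.η]
  · unfold B
    field_simp
    ring

variable (S) in
lemma bd_input_diff {v : Vec d} (hv : ‖v‖ = 1) (x x' : Vec d) :
    Bd S.law (fun m => ‖(S.g x m.2.1 + m.1) - (S.g x' m.2.1 + reflect v m.1)‖ ^ 2)
      (3 * (S.L ^ 2 + S.n) * ‖x - x'‖ ^ 2 + (3 * S.τ + 12 * (S.r ^ 2 / d))) := by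
  have h1 := ((S.increment x x').fst (ν := S.Q)).snd (μ := noiseLaw d S.r)
  have h2 := noise_affine_sq S.r hv 0 2
  have h3 := S.law_fst h2.1
  have h4 : Bd S.law (fun m => (0 + 2 * ⟪v, m.1⟫) ^ 2) (0 ^ 2 + 2 ^ 2 * (S.r ^ 2 / d)) :=
    ⟨h3.1, (h3.2.trans h2.2).le⟩
  have hg : ∀ x, Measurable (fun m : Vec d × Θ × Z => S.g x m.2.1) := fun x =>
    S.measurable_g_comp measurable_const measurable_snd.fst
  have hr : Measurable (fun m : Vec d × Θ × Z => reflect v m.1) :=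
    (reflect v).continuous.measurable.comp measurable_fst
  refine (((Bd.const (‖gradient S.f x - gradient S.f x'‖ ^ 2)).add (h1.add h4)).const_mul
    (by norm_num : (0 : ℝ) ≤ 3)).mono ?_ (fun _ => by positivity) (fun m => ?_) ?_
  · exact ((((hg x).add measurable_fst).sub ((hg x').add hr)).norm.pow_const 2)
  · have e : (S.g x m.2.1 + m.1) - (S.g x' m.2.1 + reflect v m.1) =
        (gradient S.f x - gradient S.f x') + ((S.g x m.2.1 - gradient S.f x) -
          (S.g x' m.2.1 - gradient S.f x')) + (2 * ⟪v, m.1⟫) • v := by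
      rw [reflect_apply hv]
      module
    have h5 := norm_add_three_sq_le (gradient S.f x - gradient S.f x')
      ((S.g x m.2.1 - gradient S.f x) - (S.g x' m.2.1 - gradient S.f x')) ((2 * ⟪v, m.1⟫) • v)
    rw [← e, norm_smul, hv, mul_one, Real.norm_eq_abs, sq_abs] at h5
    linarith
  · have h6 : ‖gradient S.f x - gradient S.f x'‖ ^ 2 ≤ S.L ^ 2 * ‖x - x'‖ ^ 2 := by
      rw [← mul_pow]
      gcongr
      exact S.smooth x x'
    linarith

lemma bd_err_diff_succ (hrst : ∀ t, S.rst t = false)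
    (hlin : ∀ x y s, S.comp (x - y) s = S.comp x s - S.comp y s) (hv : ‖F.v‖ = 1)
    (hη : 48 * (S.L ^ 2 + S.n) * S.η ^ 2 ≤ S.μ ^ 2) (t : ℕ) (c : CState d) :
    Bd S.law (fun m => cut F.q (S.couple F t c m).2.2.2.2.1 *
        ‖S.η • ((S.couple F t c m).1.2 - (S.couple F t c m).2.1.2)‖ ^ 2)
      ((1 - S.μ / 4) * (cut F.q c.2.2.2.2.1 * ‖S.η • (c.1.2 - c.2.1.2)‖ ^ 2) +
        12 * (S.L ^ 2 + S.n) * S.η ^ 2 / S.μ * (cut F.q c.2.2.2.2.1 * ‖c.1.1 - c.2.1.1‖ ^ 2) +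
        2 / S.μ * (3 * (S.η ^ 2 * S.τ) + 3 * S.B)) := by
  have hμ := S.hμ
  have hn := S.hn
  have hτ := S.hτ
  have hcut := cut_nonneg F.q c.2.2.2.2.1
  have hcut1 := cut_le_one F.q c.2.2.2.2.1
  set X := S.pt c.1 - S.pt c.2.1 with hX
  have hu : Measurable (fun p : Vec d × Θ =>
      (S.g (S.pt c.1) p.2 + p.1) - (S.g (S.pt c.2.1) p.2 + reflect F.v p.1)) := by
    have hg : ∀ x, Measurable (fun m : Vec d × Θ => S.g x m.2) := fun x =>
      S.measurable_g_comp measurable_const measurable_snd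
    exact ((hg _).add measurable_fst).sub
      ((hg _).add ((reflect F.v).continuous.measurable.comp measurable_fst))
  have hR : Measurable (fun p : Vec d × Vec d × Z => p.2.1 - S.comp p.2.1 p.2.2) :=
    measurable_snd.fst.sub (S.measurable_comp_comp measurable_snd.fst measurable_snd.snd)
  have h1 := S.bd_error (u := fun ξ θ =>
    (S.g (S.pt c.1) θ + ξ) - (S.g (S.pt c.2.1) θ + reflect F.v ξ)) hu
    (S.bd_input_diff hv (S.pt c.1) (S.pt c.2.1)) (c.1.2 - c.2.1.2)
    (R := fun _ w z => w - S.comp w z) hR fun _ w => S.compress w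
  have h2 := h1.const_mul (by positivity : 0 ≤ cut F.q c.2.2.2.2.1 * S.η ^ 2)
  have hm : Measurable (fun m => S.couple F t c m) :=
    (S.measurable_couple F t).comp (measurable_const.prodMk measurable_id)
  have hm' : Measurable (fun m => cut F.q (S.couple F t c m).2.2.2.2.1 *
      ‖S.η • ((S.couple F t c m).1.2 - (S.couple F t c m).2.1.2)‖ ^ 2) :=
    Measurable.comp (g := fun c : CState d => cut F.q c.2.2.2.2.1 *
      ‖S.η • (c.1.2 - c.2.1.2)‖ ^ 2) measurable_cut_err hm
  refine Bd.mono h2 hm' (fun _ => mul_nonneg (cut_nonneg _ _) (by positivity)) (fun m => ?_) ?_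
  · have e : (S.couple F t c m).1.2 - (S.couple F t c m).2.1.2 =
        (c.1.2 - c.2.1.2 + ((S.g (S.pt c.1) m.2.1 + m.1) -
          (S.g (S.pt c.2.1) m.2.1 + reflect F.v m.1))) -
        S.comp (c.1.2 - c.2.1.2 + ((S.g (S.pt c.1) m.2.1 + m.1) -
          (S.g (S.pt c.2.1) m.2.1 + reflect F.v m.1))) m.2.2 := by
      have e1 : c.1.2 - c.2.1.2 + ((S.g (S.pt c.1) m.2.1 + m.1) -
          (S.g (S.pt c.2.1) m.2.1 + reflect F.v m.1)) =
          (c.1.2 + (S.g (S.pt c.1) m.2.1 + m.1)) -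
          (c.2.1.2 + (S.g (S.pt c.2.1) m.2.1 + reflect F.v m.1)) := by abel
      rw [e1, hlin]
      simp only [couple, step, flip, hrst, Bool.false_eq_true, if_false]
      abel
    rw [e, norm_smul, mul_pow, Real.norm_eq_abs, sq_abs, ← mul_assoc]
    exact mul_le_mul_of_nonneg_right (mul_le_mul_of_nonneg_right
      (cut_couple_le (S := S) (F := F) t c m) (sq_nonneg _)) (by positivity)
  · have e : X = (c.1.1 - c.2.1.1) + S.η • (c.1.2 - c.2.1.2) := by
      rw [hX]; simp only [pt]; module
    have h3 := norm_add_sq_le_two (c.1.1 - c.2.1.1) (S.η • (c.1.2 - c.2.1.2))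
    rw [← e] at h3
    have h4 : ‖S.η • (c.1.2 - c.2.1.2)‖ ^ 2 = S.η ^ 2 * ‖c.1.2 - c.2.1.2‖ ^ 2 := by
      rw [norm_smul, mul_pow, Real.norm_eq_abs, sq_abs]
    rw [h4] at h3 ⊢
    rw [← hX]
    have hB : S.B = 4 * (S.η ^ 2 * (S.r ^ 2 / d)) := by unfold B; ring
    rw [hB]
    have hk : 0 ≤ 3 * (S.L ^ 2 + S.n) * S.η ^ 2 * (2 / S.μ) := by positivity
    have h5 := mul_le_mul_of_nonneg_left h3 (mul_nonneg hcut hk)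
    have h6 : 12 * (S.L ^ 2 + S.n) * S.η ^ 2 / S.μ ≤ S.μ / 4 := by
      rw [div_le_iff₀ hμ]; linarith
    have h7 := mul_le_mul_of_nonneg_right h6
      (mul_nonneg hcut (by positivity : 0 ≤ S.η ^ 2 * ‖c.1.2 - c.2.1.2‖ ^ 2))
    have h8 := mul_le_mul_of_nonneg_right hcut1
      (by positivity : 0 ≤ S.η ^ 2 * (2 / S.μ) * (3 * S.τ + 12 * (S.r ^ 2 / d)))
    have e9 : 12 * (S.L ^ 2 + S.n) * S.η ^ 2 / S.μ =
        2 * (3 * (S.L ^ 2 + S.n) * S.η ^ 2 * (2 / S.μ)) := by ring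
    rw [e9] at h7 ⊢
    linarith

/-- For a linear compressor, the error of the difference is the difference of the errors. -/
lemma errBound_of_linear {γ : ℝ} (hF : S.IsFrame F γ) (hrst : ∀ t, S.rst t = false)
    (hlin : ∀ x y s, S.comp (x - y) s = S.comp x s - S.comp y s)
    (hη : 48 * (S.L ^ 2 + S.n) * S.η ^ 2 ≤ S.μ ^ 2) (hτ : 256 * (S.η ^ 2 * S.τ) ≤ S.B)
    (z : Vec d × Vec d) (t : ℕ) (h : ∀ i < t, DiffBound S F z i) :
    ErrBound S F z (32 / S.μ ^ 2) (144 * (S.L ^ 2 + S.n) * S.η ^ 2 / S.μ ^ 2) t := by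
  have hμ := S.hμ
  have hμ1 := S.hμ1
  have hn := S.hn
  have hB := B_nonneg (S := S)
  induction t with
  | zero =>
    have h0 : Bd (iidLaw S.law) (fun _ : ℕ → Vec d × Θ × Z => (0 : ℝ)) 0 := Bd.const _
    exact Bd.weaken (h0.congr fun ω => by simp [chain]) (by simp [growth]; positivity)
  | succ t ih =>
    have h1 : ErrBound S F z _ _ t := ih fun i hi => h i (by omega)
    have h2 : DiffBound S F z t := h t (by omega)
    unfold ErrBound DiffBound at *
    have h3 := ((h1.const_mul (by linarith : 0 ≤ 1 - S.μ / 4)).add (h2.const_mul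
      (by positivity : 0 ≤ 12 * (S.L ^ 2 + S.n) * S.η ^ 2 / S.μ))).add
      (Bd.const (μ := iidLaw S.law) (2 / S.μ * (3 * (S.η ^ 2 * S.τ) + 3 * S.B)))
    refine (Bd.chain_succ S.law (S.measurable_couple F) (z, z, 0, 0, 0, 0) t
      (φ := fun c => cut F.q c.2.2.2.2.1 * ‖S.η • (c.1.2 - c.2.1.2)‖ ^ 2)
      (Φ := fun c => (1 - S.μ / 4) * (cut F.q c.2.2.2.2.1 * ‖S.η • (c.1.2 - c.2.1.2)‖ ^ 2) +
        12 * (S.L ^ 2 + S.n) * S.η ^ 2 / S.μ * (cut F.q c.2.2.2.2.1 * ‖c.1.1 - c.2.1.1‖ ^ 2) +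
        2 / S.μ * (3 * (S.η ^ 2 * S.τ) + 3 * S.B))
      measurable_cut_err (fun _ => mul_nonneg (cut_nonneg _ _) (by positivity))
      (((measurable_cut_err.const_mul _).add (measurable_cut_psi.const_mul _)).add
        measurable_const) (bd_err_diff_succ hrst hlin hF.norm_v hη t) h3).weaken ?_
    have hβ := growth_nonneg F.lam t
    have hmono := growth_mono hF.one_le_lam (Nat.le_succ t)
    have e1 : (1 - S.μ / 4) * (S.B * (32 / S.μ ^ 2 +
        144 * (S.L ^ 2 + S.n) * S.η ^ 2 / S.μ ^ 2 * growth F.lam t)) +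
        12 * (S.L ^ 2 + S.n) * S.η ^ 2 / S.μ * (3 * (S.B * growth F.lam t)) =
        S.B * (32 / S.μ ^ 2 + 144 * (S.L ^ 2 + S.n) * S.η ^ 2 / S.μ ^ 2 * growth F.lam t) -
          8 / S.μ * S.B := by field_simp; ring
    have e2 : 2 / S.μ * (3 * (S.η ^ 2 * S.τ) + 3 * S.B) ≤ 2 / S.μ * (4 * S.B) := by
      gcongr
      linarith
    have e3 : S.B * (32 / S.μ ^ 2 + 144 * (S.L ^ 2 + S.n) * S.η ^ 2 / S.μ ^ 2 * growth F.lam t) ≤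
        S.B * (32 / S.μ ^ 2 + 144 * (S.L ^ 2 + S.n) * S.η ^ 2 / S.μ ^ 2 * growth F.lam (t + 1)) := by
      gcongr
    have e4 : 2 / S.μ * (4 * S.B) = 8 / S.μ * S.B := by ring
    linarith

end Setting

lemma exp_half_le_one_add {x : ℝ} (h0 : 0 ≤ x) (h1 : x ≤ 1) : Real.exp (x / 2) ≤ 1 + x := by
  have h := Real.add_one_le_exp (-(x / 2))
  rw [Real.exp_neg, ← one_div, le_div_iff₀ (Real.exp_pos _)] at h
  nlinarith [Real.exp_pos (x / 2)]

lemma exp_le_growth {lam x : ℝ} {W : ℕ} (h0 : 0 ≤ x) (h1 : x ≤ 1) (h : 1 + x ≤ lam) (hW : 2 ≤ W) :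
    Real.exp (W * x / 2) ≤ growth lam W := by
  obtain ⟨t, rfl⟩ : ∃ t, W = t + 1 := ⟨W - 1, by omega⟩
  refine le_trans ?_ (pow_le_growth lam t)
  calc Real.exp ((t + 1 : ℕ) * x / 2) = Real.exp (x / 2) ^ (t + 1) := by
        rw [← Real.exp_nat_mul]; congr 1; ring
    _ ≤ lam ^ (t + 1) := by
        gcongr
        exact (exp_half_le_one_add h0 h1).trans h
    _ ≤ lam ^ (2 * t) := pow_le_pow_right₀ (by linarith) (by omega)

namespace Setting

variable {d : ℕ} {Θ : Type u} {Z : Type v} [MeasurableSpace Θ] [MeasurableSpace Z]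

section Escape

variable {S : Setting d Θ Z}

variable (S) in
/-- Bound for the mean square displacement in `W` steps that decrease the objective by at most
`Φ`, started with an error of squared norm at most `e`. -/
noncomputable def spread (W : ℕ) (Φ e : ℝ) : ℝ :=
  9 * ((1 + W) * S.η ^ 2 * (2 / S.η * (Φ + W * S.slack e)) + W * (S.η ^ 2 * S.N)) +
    3 * S.η ^ 2 * (2 * e + S.V)

/-- A saddle point leads to a decrease of the objective. -/
lemma Ef_le_of_isSaddle {z : Vec d × Vec d} {γ Φ Aa Dd : ℝ} {W : ℕ}
    (hsad : IsSaddle S.f γ (S.pt z)) (hγ : 0 ≤ γ) (hηγ : S.η * γ ≤ 1) (hW : 2 ≤ W)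
    (hT : ∀ F : Frame d, F.w = W → F.q = 1 / (4096 * W) → IsTuned S F W Aa Dd)
    (herr : ∀ (F : Frame d) (γ' : ℝ), S.IsFrame F γ' → ∀ t, (∀ i < t, DiffBound S F z i) →
      ErrBound S F z Aa Dd t)
    (hnear : 16384 * 1280 * (W ^ 2 * (S.η * S.ρ) ^ 2 * S.spread W Φ (‖z.2‖ ^ 2)) ≤ 1)
    (hfar : 1 < 1024 * 1280 * (W ^ 2 * (S.η * S.ρ) ^ 2 *
      (S.B * Real.exp (W * (S.η * γ) / 2)))) :
    S.Ef z W ≤ S.f z.1 - Φ := by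
  by_contra! hcon
  have hη := S.hη
  have hN := S.N_nonneg
  have hV := S.V_nonneg
  have hB := B_nonneg (S := S)
  have hW0 : (0 : ℝ) < W := by exact_mod_cast (by omega : 0 < W)
  obtain ⟨g, v, hg, hv, hHv, hmin⟩ := hsad.exists_min_eigenvector S.contDiff
  have hg0 : 0 ≤ g := by linarith
  set F : Frame d := ⟨S.pt z, v, hessian S.f (S.pt z), 1 + S.η * g, 1 / (4096 * W), W⟩ with hFdef
  have hF : S.IsFrame F g :=
    { γ_nonneg := hg0
      norm_v := hv
      H_eq := rfl
      H_v := hHv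
      lam_eq := rfl
      q_pos := by simp only [hFdef]; positivity
      w_pos := hW0
      contract := norm_sub_smul_le (hessian_isSymmetric S.contDiff _) hη.le hg0
        (norm_hessian_le S.hL.le S.smooth _) S.hηL hmin }
  have hsum : ∑ i ∈ Finset.range W, S.Eg z i ≤ 2 / S.η * (Φ + W * S.slack (‖z.2‖ ^ 2)) := by
    have h := S.Ef_add_sum_le z W
    rw [div_mul_eq_mul_div, le_div_iff₀ hη]
    linarith
  have hZ : ∀ t ≤ W, Bd (iidLaw S.law) (fun ω => ‖S.pt (S.path z ω t) - S.pt z‖ ^ 2)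
      (S.spread W Φ (‖z.2‖ ^ 2)) := fun t ht => by
    refine (S.bd_pt_displacement z (by omega) ht).weaken ?_
    unfold spread
    gcongr
  have hZy : Bd (iidLaw S.law) (fun ω => ‖(S.path z ω W).1 - z.1‖ ^ 2)
      (S.spread W Φ (‖z.2‖ ^ 2)) := by
    refine (S.bd_displacement z (by omega) le_rfl).weaken ?_
    have h1 : (1 + (W : ℝ)) * S.η ^ 2 * ∑ i ∈ Finset.range W, S.Eg z i ≤
      (1 + W) * S.η ^ 2 * (2 / S.η * (Φ + W * S.slack (‖z.2‖ ^ 2))) := by gcongr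
    have h2 : 0 ≤ ∑ i ∈ Finset.range W, S.Eg z i := Finset.sum_nonneg fun i _ => S.Eg_nonneg z i
    have h3 : 0 ≤ (1 + (W : ℝ)) * S.η ^ 2 * ∑ i ∈ Finset.range W, S.Eg z i := by positivity
    have h4 : 0 ≤ (W : ℝ) * (S.η ^ 2 * S.N) := by positivity
    have h5 : 0 ≤ 3 * S.η ^ 2 * (2 * ‖z.2‖ ^ 2 + S.V) := by positivity
    unfold spread
    linarith
  have hgrow := coupling_growth_le hF z (hT F rfl rfl) rfl (fun t _ h => herr F g hF t h) hZ hZy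
    hnear
  have hexp : Real.exp (W * (S.η * γ) / 2) ≤ growth F.lam W := by
    refine exp_le_growth (by positivity) hηγ ?_ hW
    rw [hF.lam_eq]
    have := mul_le_mul_of_nonneg_left hg.le hη.le
    linarith
  have h1 := mul_le_mul_of_nonneg_left hexp hB
  have h2 := mul_le_mul_of_nonneg_left (h1.trans hgrow)
    (by positivity : 0 ≤ (W : ℝ) ^ 2 * (S.η * S.ρ) ^ 2)
  linarith

end Escape

variable (S : Setting d Θ Z)

lemma sum_telescope_ge {a : ℕ → ℝ} {m : ℝ} (h0 : ∀ i, 0 ≤ a i) (h1 : ∀ i, a i ≤ m) (w n : ℕ) :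
    ∑ i ∈ Finset.range n, (a i - a (i + w)) ≤ w * m := by
  have h2 : ∑ i ∈ Finset.range n, a (i + w) + ∑ i ∈ Finset.range w, a i =
      ∑ i ∈ Finset.range n, a i + ∑ i ∈ Finset.range w, a (n + i) := by
    have e1 := Finset.sum_range_add a w n
    have e2 := Finset.sum_range_add a n w
    rw [add_comm n w] at e2
    simp only [add_comm _ w]
    linarith
  have h3 : ∑ i ∈ Finset.range w, a i ≤ w * m := by
    simpa using Finset.sum_le_sum fun i (_ : i ∈ Finset.range w) => h1 i
  have h4 : 0 ≤ ∑ i ∈ Finset.range w, a (n + i) := Finset.sum_nonneg fun i _ => h0 _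
  rw [Finset.sum_sub_distrib]
  linarith

lemma Ef_mul_add_le {P w : ℕ} (hper : ∀ t, S.rst (t + P) = S.rst t) (z₀ : Vec d × Vec d)
    {Φ : Vec d × Vec d → ℝ} (h : ∀ z, S.Ef z (w * P) ≤ Φ z) (i : ℕ) {c : ℝ}
    (hΦ : Bd (iidLaw S.law) (fun ω => Φ (S.path z₀ ω (i * P))) c) :
    S.Ef z₀ ((i + w) * P) ≤ c := by
  have hshift : ∀ t, S.rst (t + i * P) = S.rst t := by
    intro t
    clear hΦ
    induction i with
    | zero => simp
    | succ i ih =>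
      rw [add_mul, one_mul, ← add_assoc, hper]
      exact ih
  have hstep : (fun t => S.step (i * P + t)) = S.step := by
    funext t z m
    simp only [step]
    rw [show i * P + t + 1 = (t + 1) + i * P by ring, hshift]
  have h2 := Bd.chain_add S.law S.measurable_step z₀ (i * P) (w * P) (φ := fun z => S.f z.1)
    (S.measurable_f.comp measurable_fst) (fun _ => S.f_nonneg _)
    (Φ := Φ) (fun z => by rw [hstep]; exact (S.bd_Ef z (w * P)).weaken (h z)) hΦ
  rw [add_mul]
  exact h2.2

/-- If the objective decreases by `F` in `w * P` steps from all states in `A`, then few of the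
states at multiples of `P` are in `A`. -/
lemma sum_measure_le {P w : ℕ} (hper : ∀ t, S.rst (t + P) = S.rst t) {z₀ : Vec d × Vec d}
    (hz₀ : z₀.2 = 0) {A : Set (Vec d × Vec d)} (hA : MeasurableSet A) {F b c : ℝ}
    (hb : 0 ≤ b)
    (h : ∀ z, S.Ef z (w * P) ≤ S.f z.1 - F * A.indicator 1 z + (b * ‖z.2‖ ^ 2 + c)) (n : ℕ) :
    F * ∑ i ∈ Finset.range n, (iidLaw S.law).real {ω | S.path z₀ ω (i * P) ∈ A} ≤
      w * S.fmax + n * (b * S.V + c) := by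
  have key : ∀ i, F * (iidLaw S.law).real {ω | S.path z₀ ω (i * P) ∈ A} ≤
      (S.Ef z₀ (i * P) - S.Ef z₀ ((i + w) * P)) + (b * S.V + c) := by
    intro i
    have hAm : MeasurableSet {ω | S.path z₀ ω (i * P) ∈ A} := S.measurable_path z₀ (i * P) hA
    have e : ∀ ω, A.indicator (1 : Vec d × Vec d → ℝ) (S.path z₀ ω (i * P)) =
        {ω | S.path z₀ ω (i * P) ∈ A}.indicator 1 ω := fun ω => rfl
    have h1 : Integrable (fun ω => A.indicator (1 : Vec d × Vec d → ℝ) (S.path z₀ ω (i * P)))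
        (iidLaw S.law) := by
      simp only [e]
      exact (integrable_const (1 : ℝ)).indicator hAm
    have h2 : ∫ ω, A.indicator (1 : Vec d × Vec d → ℝ) (S.path z₀ ω (i * P)) ∂(iidLaw S.law) =
        (iidLaw S.law).real {ω | S.path z₀ ω (i * P) ∈ A} := by
      simp only [e]
      exact integral_indicator_one hAm
    have h3 := S.bd_Ef z₀ (i * P)
    have h4 : Bd (iidLaw S.law) (fun ω => S.f (S.path z₀ ω (i * P)).1 -
        F * A.indicator 1 (S.path z₀ ω (i * P)))
        (S.Ef z₀ (i * P) - F * (iidLaw S.law).real {ω | S.path z₀ ω (i * P) ∈ A}) := by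
      refine ⟨h3.1.sub (h1.const_mul F), ?_⟩
      rw [integral_sub h3.1 (h1.const_mul F), integral_const_mul, h2]
      exact le_rfl
    have h5 := S.bd_err z₀ (i * P)
    rw [hz₀, norm_zero] at h5
    have h6 := S.Ef_mul_add_le hper z₀ h i (h4.add ((h5.const_mul hb).add (Bd.const c)))
    have h7 : b * (0 ^ 2 + S.V) = b * S.V := by ring
    linarith
  have h1 := Finset.sum_le_sum fun i (_ : i ∈ Finset.range n) => key i
  rw [Finset.sum_add_distrib, Finset.sum_const, Finset.card_range, nsmul_eq_mul,
    ← Finset.mul_sum] at h1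
  have h2 := sum_telescope_ge (a := fun i => S.Ef z₀ (i * P)) (fun i => S.Ef_nonneg _ _)
    (fun i => S.Ef_le _ _) w n
  linarith

/-- The probability that at least half of `n` events occur. -/
lemma measure_half_le {Ω : Type*} [MeasurableSpace Ω] (μ : Measure Ω) [IsProbabilityMeasure μ]
    {E : ℕ → Set Ω} (hE : ∀ i, MeasurableSet (E i)) {n : ℕ} (hn : 1 ≤ n) {p : ℝ}
    (h : ∑ i ∈ Finset.range n, μ.real (E i) ≤ n * p) :
    μ {ω | (n : ℝ) / 2 ≤ ∑ i ∈ Finset.range n, (E i).indicator 1 ω} ≤ ENNReal.ofReal (2 * p) := by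
  have hn0 : (0 : ℝ) < n := by exact_mod_cast hn
  have h1 : Bd μ (fun ω => ∑ i ∈ Finset.range n, (E i).indicator (1 : Ω → ℝ) ω) (n * p) := by
    refine (Bd.sum (a := fun i => μ.real (E i)) fun i _ => ⟨?_, ?_⟩).weaken h
    · exact (integrable_const (1 : ℝ)).indicator (hE i)
    · exact (integral_indicator_one (hE i)).le
  refine (h1.measure_le (fun ω => Finset.sum_nonneg fun i _ =>
    Set.indicator_nonneg (fun _ _ => zero_le_one) _) (by positivity)).trans (le_of_eq ?_)
  congr 1
  field_simp

end Setting

lemma mul_pow_le_of_le {x y U : ℝ} {a b : ℕ} (hx : 0 ≤ x) (hU : 1 ≤ U) (hab : a ≤ b)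
    (h : x * U ^ b ≤ y) : x * U ^ a ≤ y :=
  (mul_le_mul_of_nonneg_left (pow_le_pow_right₀ hU hab) hx).trans h

lemma mul_pow_le_of_succ {x y U c : ℝ} {a : ℕ} (hU : 0 < U) (hc : c ≤ U) (hy : 0 ≤ y)
    (h : x * U ^ (a + 1) ≤ c * y) : x * U ^ a ≤ y := by
  refine le_of_mul_le_mul_right ?_ hU
  calc x * U ^ a * U = x * U ^ (a + 1) := by ring
    _ ≤ c * y := h
    _ ≤ y * U := by rw [mul_comm]; gcongr

namespace Setting

variable {d : ℕ} {Θ : Type u} {Z : Type v} [MeasurableSpace Θ] [MeasurableSpace Z]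

lemma mu_sq_le (S : Setting d Θ Z) : S.μ ^ 2 ≤ 1 := pow_le_one₀ S.hμ.le S.hμ1

/-- The choice of the parameters: `U` dominates all constants and logarithms, `D` is the factor
by which the variance of the artificial noise exceeds a constant, `ε = q²` is the accuracy, and
errors may be erased every `P` steps. -/
structure Regime (S : Setting d Θ Z) (P : ℕ) (U D q : ℝ) : Prop where
  U_ge : 2 ^ 20 ≤ U
  q_pos : 0 < q
  q_le : q ≤ 1
  D_ge : 1 ≤ D
  P_pos : 1 ≤ P
  L_eq : S.L = U
  fmax_le : S.fmax ≤ U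
  ρ_le : S.ρ ≤ U
  ρ_ge : 1 ≤ U * S.ρ
  G_le : S.G ≤ 4 * U ^ 2
  s_le : S.s ≤ U ^ 2
  r_sq : S.r ^ 2 = D * U ^ 4
  n_le : S.n ≤ U ^ 2
  τ_le : 64 * S.τ ≤ S.r ^ 2 / d
  step_noise : S.η * D * U ^ 40 ≤ q ^ 4
  step_err : S.η * P * U ^ 40 ≤ q * S.μ ^ 2
  step_ge : q ^ 4 ≤ S.η * d * U ^ 42
  exp_ge : (d : ℝ) ^ 3 * U ^ 84 ≤ q ^ 8 * Real.exp (U / 2)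
  periodic : ∀ t, S.rst (t + P) = S.rst t
  kind : d ≤ P ∨ ((∀ t, S.rst t = false) ∧ ∀ x y s, S.comp (x - y) s = S.comp x s - S.comp y s)

lemma spread_nonneg (S : Setting d Θ Z) (W : ℕ) {Φ e : ℝ} (hΦ : 0 ≤ Φ) (he : 0 ≤ e) :
    0 ≤ S.spread W Φ e := by
  have := S.slack_nonneg he
  have := S.hη
  have := S.N_nonneg
  have := S.V_nonneg
  unfold spread
  positivity

namespace Regime

variable {S : Setting d Θ Z} {P : ℕ} {U D q : ℝ}

section

variable (R : S.Regime P U D q)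

include R

lemma U_pos : 0 < U := by linarith [R.U_ge]

lemma one_le_U : 1 ≤ U := by linarith [R.U_ge]

lemma one_le_pow (k : ℕ) : 1 ≤ U ^ k := one_le_pow₀ R.one_le_U

lemma N_le : S.N ≤ 2 * (D * U ^ 4) := by
  have h1 := R.G_le
  have h2 := R.s_le
  have h3 := R.r_sq
  have h4 : 5 * U ^ 2 ≤ U ^ 4 := by
    have h : 5 ≤ U ^ 2 := by
      have := R.U_ge
      nlinarith
    have := mul_le_mul_of_nonneg_right h (sq_nonneg U)
    linarith
  have h5 : U ^ 4 ≤ D * U ^ 4 := le_mul_of_one_le_left (by have := R.U_pos; positivity) R.D_ge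
  unfold N
  linarith

lemma N_pos : 0 < S.N := by
  have h3 := R.r_sq
  have : 0 < D * U ^ 4 := by have := R.U_pos; have := R.D_ge; positivity
  have := S.hG
  have := S.hs
  unfold N
  linarith

lemma V_pos : 0 < S.V := by
  have := R.N_pos
  have := S.hμ
  unfold V
  positivity

lemma eta_N_le : S.η * S.N * U ^ 35 ≤ q ^ 4 := by
  refine mul_pow_le_of_succ R.U_pos (c := 2) (by linarith [R.U_ge]) (by have := R.q_pos; positivity) ?_
  have h1 := mul_le_mul_of_nonneg_left R.N_le S.hη.le
  have h2 := mul_le_mul_of_nonneg_right h1 (by have := R.U_pos; positivity : 0 ≤ U ^ (35 + 1))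
  have h3 := R.step_noise
  calc S.η * S.N * U ^ (35 + 1) ≤ S.η * (2 * (D * U ^ 4)) * U ^ (35 + 1) := h2
    _ = 2 * (S.η * D * U ^ 40) := by ring
    _ ≤ 2 * q ^ 4 := by linarith

lemma eta_le : S.η * U ^ 40 ≤ q * S.μ ^ 2 := by
  have hP : (1 : ℝ) ≤ P := by exact_mod_cast R.P_pos
  have := S.hη
  have := R.U_pos
  refine le_trans ?_ R.step_err
  gcongr
  exact le_mul_of_one_le_right S.hη.le hP

lemma eta_P_le : S.η * P * U ^ 40 ≤ 1 := by
  refine R.step_err.trans ?_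
  have := S.mu_sq_le
  have h1 := R.q_le
  have h2 := R.q_pos
  calc q * S.μ ^ 2 ≤ 1 * 1 := by gcongr
    _ = 1 := one_mul 1

lemma eta_U_le (k : ℕ) (hk : k ≤ 40) : S.η * U ^ k ≤ 1 := by
  refine mul_pow_le_of_le S.hη.le R.one_le_U hk (R.eta_le.trans ?_)
  have := S.mu_sq_le
  have h1 := R.q_le
  have h2 := R.q_pos
  calc q * S.μ ^ 2 ≤ 1 * 1 := by gcongr
    _ = 1 := one_mul 1

lemma eta_sq_V_le : S.η ^ 2 * S.V * U ^ 74 ≤ q ^ 4 := by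
  have h1 := R.eta_N_le
  have h2 := R.eta_le
  have hμ := S.hμ
  have hη := S.hη
  have hU := R.U_pos
  have hq := R.q_pos
  have hN := S.N_nonneg
  refine mul_pow_le_of_succ hU (c := 4) (by linarith [R.U_ge]) (by positivity) ?_
  have h3 : S.η ^ 2 * S.V * U ^ (74 + 1) = 4 * ((S.η * S.N * U ^ 35) * (S.η * U ^ 40) / S.μ ^ 2) := by
    unfold V; field_simp
  rw [h3]
  have h4 : (S.η * S.N * U ^ 35) * (S.η * U ^ 40) / S.μ ^ 2 ≤ q ^ 4 := by
    rw [div_le_iff₀ (by positivity)]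
    calc (S.η * S.N * U ^ 35) * (S.η * U ^ 40) ≤ q ^ 4 * (q * S.μ ^ 2) := by gcongr
      _ ≤ q ^ 4 * (1 * S.μ ^ 2) := by
        gcongr
        exact R.q_le
      _ = q ^ 4 * S.μ ^ 2 := by ring
  linarith

lemma slack_le {e : ℝ} (he : e ≤ U * S.V) : S.slack e * U ^ 33 ≤ S.η * q ^ 4 := by
  have h1 := R.eta_N_le
  have h2 := R.eta_sq_V_le
  have hη := S.hη
  have hU := R.U_pos
  have hq := R.q_pos
  have hN := S.N_nonneg
  have hV := S.V_nonneg
  refine mul_pow_le_of_succ hU (c := 2) (by linarith [R.U_ge]) (by positivity) ?_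
  have h3 : S.η ^ 2 * S.V * U ^ 37 ≤ q ^ 4 :=
    mul_pow_le_of_le (by positivity) R.one_le_U (by norm_num) h2
  have h4 : e + S.V ≤ 2 * (U * S.V) := by
    have := le_mul_of_one_le_left hV R.one_le_U
    linarith
  have h5 : S.slack e ≤ S.η * (U ^ 3 * (S.η ^ 2 * S.V)) + S.η * (U * (S.η * S.N)) := by
    unfold slack
    rw [R.L_eq]
    have := mul_le_mul_of_nonneg_left h4 (by positivity : 0 ≤ S.η / 2 * U ^ 2 * S.η ^ 2)
    linarith
  calc S.slack e * U ^ (33 + 1)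
      ≤ (S.η * (U ^ 3 * (S.η ^ 2 * S.V)) + S.η * (U * (S.η * S.N))) * U ^ (33 + 1) := by gcongr
    _ = S.η * (S.η ^ 2 * S.V * U ^ 37) + S.η * (S.η * S.N * U ^ 35) := by ring
    _ ≤ S.η * q ^ 4 + S.η * q ^ 4 := by gcongr
    _ = 2 * (S.η * q ^ 4) := by ring

/-- The length of the windows in which saddle points are left. -/
lemma exists_window : ∃ j : ℕ, U ^ 2 ≤ (j * P : ℕ) * S.η * q ∧
    ((j * P : ℕ) : ℝ) * S.η * q ≤ 2 * U ^ 2 := by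
  have hη := S.hη
  have hU := R.U_pos
  have hq := R.q_pos
  have hP : (0 : ℝ) < P := by exact_mod_cast R.P_pos
  refine ⟨⌈U ^ 2 / (S.η * q * P)⌉₊, ?_, ?_⟩
  · have := Nat.le_ceil (U ^ 2 / (S.η * q * P))
    rw [div_le_iff₀ (by positivity)] at this
    push_cast
    linarith
  · have := (Nat.ceil_lt_add_one (by positivity : 0 ≤ U ^ 2 / (S.η * q * P))).le
    have h2 := mul_le_mul_of_nonneg_right this (by positivity : 0 ≤ S.η * q * P)
    rw [add_mul, div_mul_cancel₀ _ (by positivity)] at h2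
    have h3 : S.η * P ≤ 1 := by
      have := mul_pow_le_of_le (a := 0) (by positivity) R.one_le_U (by norm_num) R.eta_P_le
      simpa using this
    have h4 : S.η * q * P ≤ 1 := by
      calc S.η * q * P = S.η * P * q := by ring
        _ ≤ 1 * 1 := by have := R.q_le; gcongr
        _ = 1 := one_mul 1
    have h5 := R.one_le_pow 2
    push_cast
    linarith

variable {W : ℕ} (hW1 : U ^ 2 ≤ W * S.η * q) (hW2 : W * S.η * q ≤ 2 * U ^ 2)

include hW1

lemma two_le_window : 2 ≤ W := by
  have hη := S.hη
  have hq := R.q_pos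
  have h1 := R.eta_U_le 0 (by norm_num)
  have h2 := R.q_le
  have h3 : S.η * q ≤ 1 * 1 := by gcongr; simpa using h1
  have h4 : (W : ℝ) * (S.η * q) ≤ W * 1 := by gcongr; linarith
  have h5 : (2 : ℝ) ≤ U ^ 2 := by have := R.U_ge; nlinarith
  have : (2 : ℝ) ≤ W := by linarith
  exact_mod_cast this

lemma far : 1 < 1024 * 1280 * (W ^ 2 * (S.η * S.ρ) ^ 2 *
    (S.B * Real.exp (W * (S.η * √(S.ρ * q ^ 2)) / 2))) := by
  have hη := S.hη
  have hU := R.U_pos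
  have hU1 := R.one_le_U
  have hq := R.q_pos
  have hq1 := R.q_le
  have hρ := S.hρ
  have hd : (0 : ℝ) < d := by have := S.hd; positivity
  have hρU := R.ρ_ge
  have hρ0 : 0 < S.ρ := by
    rcases hρ.eq_or_lt with h | h
    · rw [← h] at hρU; linarith
    · exact h
  have h1 : 1 ≤ U ^ 2 * √S.ρ * 1 := by
    have h2 : 1 / U ≤ √S.ρ := by
      apply Real.le_sqrt_of_sq_le
      rw [div_pow, one_pow, div_le_iff₀ (by positivity)]
      calc 1 ≤ U * S.ρ := hρU
        _ ≤ U * S.ρ * U := le_mul_of_one_le_right (by positivity) hU1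
        _ = _ := by ring
    rw [div_le_iff₀ hU] at h2
    have h3 : 0 ≤ √S.ρ := Real.sqrt_nonneg _
    nlinarith
  have h2 : U / 2 ≤ W * (S.η * √(S.ρ * q ^ 2)) / 2 := by
    rw [Real.sqrt_mul hρ, Real.sqrt_sq hq.le]
    have h3 : 1 / U ≤ √S.ρ := by
      apply Real.le_sqrt_of_sq_le
      rw [div_pow, one_pow, div_le_iff₀ (by positivity)]
      calc 1 ≤ U * S.ρ := hρU
        _ ≤ U * S.ρ * U := le_mul_of_one_le_right (by positivity) hU1
        _ = _ := by ring
    have h4 : U ≤ W * S.η * q * √S.ρ :=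
      calc U = U ^ 2 * (1 / U) := by field_simp
        _ ≤ W * S.η * q * √S.ρ := by gcongr
    linarith
  have h3 := Real.exp_le_exp.2 h2
  have h4 : 1 ≤ (W : ℝ) ^ 2 * (S.η * S.ρ) ^ 2 := by
    have h5 : 1 ≤ W * S.η * S.ρ := by
      have h6 : U ≤ W * S.η := by
        have h7 : W * S.η * q ≤ W * S.η * 1 := by gcongr
        nlinarith
      calc 1 ≤ U * S.ρ := hρU
        _ ≤ W * S.η * S.ρ := by gcongr
    calc 1 ≤ (W * S.η * S.ρ) ^ 2 := one_le_pow₀ h5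
      _ = _ := by ring
  have h5 : 4 ≤ S.B * Real.exp (U / 2) := by
    have h6 := R.exp_ge
    have h7 := pow_le_pow_left₀ (by positivity) R.step_ge 2
    have hB : S.B = 4 * S.η ^ 2 * (D * U ^ 4) / d := by
      unfold B; rw [R.r_sq]; ring
    rw [hB, div_mul_eq_mul_div, le_div_iff₀ hd]
    refine le_of_mul_le_mul_right ?_ (by positivity : 0 < (d : ℝ) ^ 2 * U ^ 84)
    calc 4 * (d : ℝ) * ((d : ℝ) ^ 2 * U ^ 84) = 4 * ((d : ℝ) ^ 3 * U ^ 84) := by ring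
      _ ≤ 4 * (q ^ 8 * Real.exp (U / 2)) := by gcongr
      _ = 4 * ((q ^ 4) ^ 2 * Real.exp (U / 2)) := by ring
      _ ≤ 4 * ((S.η * d * U ^ 42) ^ 2 * Real.exp (U / 2)) := by gcongr
      _ = 4 * S.η ^ 2 * (1 * 1) * Real.exp (U / 2) * ((d : ℝ) ^ 2 * U ^ 84) := by ring
      _ ≤ 4 * S.η ^ 2 * (D * U ^ 4) * Real.exp (U / 2) * ((d : ℝ) ^ 2 * U ^ 84) := by
        have := R.D_ge
        have := R.one_le_pow 4
        gcongr
  have hB := B_nonneg (S := S)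
  have h6 : 4 ≤ S.B * Real.exp (W * (S.η * √(S.ρ * q ^ 2)) / 2) :=
    h5.trans (mul_le_mul_of_nonneg_left h3 hB)
  have h7 : 1 * 4 ≤ (W : ℝ) ^ 2 * (S.η * S.ρ) ^ 2 *
    (S.B * Real.exp (W * (S.η * √(S.ρ * q ^ 2)) / 2)) := by gcongr
  linarith

include hW2

lemma spread_le {e : ℝ} (he0 : 0 ≤ e) (he : e ≤ U * S.V) :
    S.spread W (q ^ 3 / U ^ 12) e * U ^ 9 ≤ q ^ 2 := by
  have hη := S.hη
  have hU := R.U_pos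
  have hq := R.q_pos
  have hq1 := R.q_le
  have hN := S.N_nonneg
  have hV := S.V_nonneg
  have hW0 : (1 : ℝ) ≤ W := by exact_mod_cast (by have := R.two_le_window hW1; omega : 1 ≤ W)
  have hs := R.slack_le he
  have hq4 : q ^ 4 ≤ q ^ 2 := pow_le_pow_of_le_one hq.le hq1 (by norm_num)
  refine mul_pow_le_of_succ hU (c := 400) (by linarith [R.U_ge]) (by positivity) ?_
  have hpow : ∀ a : ℕ, 0 < U ^ a := fun a => by positivity
  have e1 : W * S.η * (q ^ 3 / U ^ 12) * U ^ 10 ≤ 2 * q ^ 2 := by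
    have : W * S.η * (q ^ 3 / U ^ 12) * U ^ 10 = (W * S.η * q) * q ^ 2 / U ^ 2 := by
      field_simp
    rw [this, div_le_iff₀ (hpow 2)]
    calc W * S.η * q * q ^ 2 ≤ 2 * U ^ 2 * q ^ 2 := by gcongr
      _ = _ := by ring
  have e2 : (W : ℝ) ^ 2 * S.η * S.slack e * U ^ 10 ≤ 4 * q ^ 2 := by
    refine le_of_mul_le_mul_right ?_ (hpow 23)
    calc (W : ℝ) ^ 2 * S.η * S.slack e * U ^ 10 * U ^ 23
        = (W : ℝ) ^ 2 * S.η * (S.slack e * U ^ 33) := by ring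
      _ ≤ (W : ℝ) ^ 2 * S.η * (S.η * q ^ 4) := by gcongr
      _ = (W * S.η * q) ^ 2 * q ^ 2 := by ring
      _ ≤ (2 * U ^ 2) ^ 2 * q ^ 2 := by gcongr
      _ = 4 * q ^ 2 * U ^ 4 := by ring
      _ ≤ 4 * q ^ 2 * U ^ 23 := by gcongr; exact R.one_le_U; norm_num
  have e3 : W * S.η * (S.η * S.N) * U ^ 10 ≤ 2 * q ^ 2 := by
    refine le_of_mul_le_mul_right ?_ (hpow 25)
    calc W * S.η * (S.η * S.N) * U ^ 10 * U ^ 25 = W * S.η * (S.η * S.N * U ^ 35) := by ring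
      _ ≤ W * S.η * q ^ 4 := by gcongr; exact R.eta_N_le
      _ = (W * S.η * q) * q ^ 3 := by ring
      _ ≤ (2 * U ^ 2) * q ^ 2 := by
        gcongr ?_ * ?_
        exact pow_le_pow_of_le_one hq.le hq1 (by norm_num)
      _ = 2 * q ^ 2 * U ^ 2 := by ring
      _ ≤ 2 * q ^ 2 * U ^ 25 := by gcongr; exact R.one_le_U; norm_num
  have e4 : U * (S.η ^ 2 * S.V) * U ^ 10 ≤ q ^ 2 := by
    have := mul_pow_le_of_le (a := 11) (by positivity) R.one_le_U (by norm_num) R.eta_sq_V_le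
    calc U * (S.η ^ 2 * S.V) * U ^ 10 = S.η ^ 2 * S.V * U ^ 11 := by ring
      _ ≤ q ^ 2 := this.trans hq4
  have e5 : S.spread W (q ^ 3 / U ^ 12) e ≤ 36 * (W * S.η * (q ^ 3 / U ^ 12)) +
      36 * ((W : ℝ) ^ 2 * S.η * S.slack e) + 9 * (W * S.η * (S.η * S.N)) +
      9 * (U * (S.η ^ 2 * S.V)) := by
    unfold spread
    have hsl := S.slack_nonneg he0
    have f1 : S.η ^ 2 * (2 / S.η * (q ^ 3 / U ^ 12 + W * S.slack e)) =
        2 * S.η * (q ^ 3 / U ^ 12 + W * S.slack e) := by field_simp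
    have f2 : 0 ≤ S.η * (q ^ 3 / U ^ 12 + W * S.slack e) := by positivity
    have f3 := mul_le_mul_of_nonneg_right hW0 f2
    have f4 : S.η ^ 2 * (2 * e + S.V) ≤ S.η ^ 2 * (3 * (U * S.V)) := by
      have := le_mul_of_one_le_left hV R.one_le_U
      gcongr
      linarith
    rw [mul_assoc (1 + (W : ℝ)), f1]
    linarith
  have := mul_le_mul_of_nonneg_right e5 (hpow 10).le
  norm_num only
  linarith [sq_nonneg q]

lemma near {e : ℝ} (he0 : 0 ≤ e) (he : e ≤ U * S.V) :
    16384 * 1280 * (W ^ 2 * (S.η * S.ρ) ^ 2 * S.spread W (q ^ 3 / U ^ 12) e) ≤ 1 := by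
  have hη := S.hη
  have hU := R.U_pos
  have hq := R.q_pos
  have hρ := S.hρ
  have h1 := R.spread_le hW1 hW2 he0 he
  have h2 : (W : ℝ) ^ 2 * (S.η * S.ρ) ^ 2 * S.spread W (q ^ 3 / U ^ 12) e * U ^ 3 ≤ 4 := by
    refine le_of_mul_le_mul_right ?_ (by positivity : 0 < U ^ 6)
    calc (W : ℝ) ^ 2 * (S.η * S.ρ) ^ 2 * S.spread W (q ^ 3 / U ^ 12) e * U ^ 3 * U ^ 6
        = (W * S.η) ^ 2 * S.ρ ^ 2 * (S.spread W (q ^ 3 / U ^ 12) e * U ^ 9) := by ring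
      _ ≤ (W * S.η) ^ 2 * U ^ 2 * q ^ 2 := by
        have := S.spread_nonneg W (by positivity : 0 ≤ q ^ 3 / U ^ 12) he0
        gcongr
        exact R.ρ_le
      _ = (W * S.η * q) ^ 2 * U ^ 2 := by ring
      _ ≤ (2 * U ^ 2) ^ 2 * U ^ 2 := by gcongr
      _ = 4 * U ^ 6 := by ring
  have h3 : (16384 * 1280 * 4 : ℝ) ≤ U ^ 3 :=
    le_trans (by norm_num) (pow_le_pow_left₀ (by norm_num) R.U_ge 3)
  refine le_of_mul_le_mul_right ?_ (by positivity : 0 < U ^ 3)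
  linarith

lemma isTuned {Aa Dd : ℝ} (hA0 : 0 ≤ Aa) (hD0 : 0 ≤ Dd) (hA : S.η * Aa * U ^ 38 ≤ q)
    (hDd : Dd * U ^ 76 ≤ q ^ 2) (F : Frame d) (hw : F.w = W) (hFq : F.q = 1 / (4096 * W)) :
    IsTuned S F W Aa Dd := by
  have hη := S.hη
  have hU := R.U_pos
  have hU1 := R.one_le_U
  have hUge := R.U_ge
  have hq := R.q_pos
  have hq1 := R.q_le
  have hn := S.hn
  have hnU := R.n_le
  have hd : (0 : ℝ) < d := by have := S.hd; positivity
  have hWη : W * S.η * q * U ^ 0 ≤ 2 * U ^ 2 := by simpa using hW2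
  have hη0 := R.eta_U_le 0 (by norm_num)
  have hη4 := R.eta_U_le 40 (by norm_num)
  have hA1 : S.η * Aa ≤ 1 := by
    have := mul_pow_le_of_le (a := 0) (by positivity) hU1 (by norm_num) hA
    simp only [pow_zero, mul_one] at this
    linarith
  simp only [pow_zero, mul_one] at hη0
  have big : (2 : ℝ) ^ 60 ≤ U ^ 3 :=
    le_trans (by norm_num) (pow_le_pow_left₀ (by norm_num) hUge 3)
  refine ⟨by have := R.two_le_window hW1; omega, hw, hFq, hA0, hD0, ?_, ?_, ?_, ?_, ?_, ?_, ?_⟩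
  · have h := mul_pow_le_of_le (a := 0) hD0 hU1 (by norm_num) hDd
    simp only [pow_zero, mul_one] at h
    exact h.trans (pow_le_one₀ hq.le hq1)
  · refine le_of_mul_le_mul_right ?_ hη
    have h1 : S.η * Aa ≤ q := by
      have := mul_pow_le_of_le (a := 0) (by positivity) hU1 (by norm_num) hA
      simpa using this
    have h2 : W * S.η * q ≤ W * S.η * 1 := by gcongr
    have h3 := R.one_le_pow 2
    linarith
  · have h := mul_le_mul_of_nonneg_left R.τ_le (by positivity : 0 ≤ 4 * S.η ^ 2)
    unfold B
    linarith
  · calc 512 * (S.η ^ 2 * S.n * Aa) = 512 * (S.η * S.n * (S.η * Aa)) := by ring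
      _ ≤ 512 * (S.η * U ^ 2 * 1) := by gcongr
      _ ≤ U ^ 3 * (S.η * U ^ 2 * 1) := by gcongr; linarith
      _ = S.η * U ^ 5 := by ring
      _ ≤ 1 := R.eta_U_le 5 (by norm_num)
  · have h1 : W * S.η ≤ 2 * U ^ 2 / q := by rw [le_div_iff₀ hq]; exact hW2
    have h2 : S.η * U ^ 40 ≤ q := R.eta_le.trans
      (mul_le_of_le_one_right hq.le S.mu_sq_le)
    have h3 : S.η * U ^ 7 ≤ q := mul_pow_le_of_le hη.le hU1 (by norm_num) h2
    calc 1024 * (S.η ^ 2 * S.n * W) = 1024 * (W * S.η * S.n * S.η) := by ring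
      _ ≤ 1024 * (2 * U ^ 2 / q * U ^ 2 * S.η) := by gcongr
      _ = 2048 * (U ^ 4 * S.η) / q := by ring
      _ ≤ U ^ 3 * (U ^ 4 * S.η) / q := by gcongr; linarith
      _ = S.η * U ^ 7 / q := by ring
      _ ≤ 1 := (div_le_one hq).2 h3
  · rw [R.L_eq]
    have h1 : W * S.η ≤ 2 * U ^ 2 / q := by rw [le_div_iff₀ hq]; exact hW2
    have h3 : S.η * Aa * U ^ 7 ≤ q := mul_pow_le_of_le (by positivity) hU1 (by norm_num) hA
    calc 1024 * (W * (S.η * U) ^ 2 * Aa) = 1024 * (W * S.η * (U ^ 2 * (S.η * Aa))) := by ring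
      _ ≤ 1024 * (2 * U ^ 2 / q * (U ^ 2 * (S.η * Aa))) := by gcongr
      _ = 2048 * (U ^ 4 * (S.η * Aa)) / q := by ring
      _ ≤ U ^ 3 * (U ^ 4 * (S.η * Aa)) / q := by gcongr; linarith
      _ = S.η * Aa * U ^ 7 / q := by ring
      _ ≤ 1 := (div_le_one hq).2 h3
  · rw [R.L_eq]
    have h3 : Dd * U ^ 9 ≤ q ^ 2 := mul_pow_le_of_le hD0 hU1 (by norm_num) hDd
    refine le_of_mul_le_mul_right ?_ (by positivity : 0 < q ^ 2)
    calc 1024 * ((W : ℝ) ^ 2 * (S.η * U) ^ 2 * Dd) * q ^ 2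
        = 1024 * ((W * S.η * q) ^ 2 * (U ^ 2 * Dd)) := by ring
      _ ≤ 1024 * ((2 * U ^ 2) ^ 2 * (U ^ 2 * Dd)) := by gcongr
      _ = 4096 * (U ^ 6 * Dd) := by ring
      _ ≤ U ^ 3 * (U ^ 6 * Dd) := by gcongr; linarith
      _ = Dd * U ^ 9 := by ring
      _ ≤ 1 * q ^ 2 := by linarith

lemma Ef_window_le {z : Vec d × Vec d} (hz : ‖z.2‖ ^ 2 ≤ U * S.V)
    (hsad : IsSaddle S.f (√(S.ρ * q ^ 2)) (S.pt z)) :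
    S.Ef z W ≤ S.f z.1 - q ^ 3 / U ^ 12 := by
  have hη := S.hη
  have hμ := S.hμ
  have hU := R.U_pos
  have hU1 := R.one_le_U
  have hUge := R.U_ge
  have hq := R.q_pos
  have hq1 := R.q_le
  have hV := S.V_nonneg
  have hn := S.hn
  have hd : (0 : ℝ) < d := by have := S.hd; positivity
  have hηγ : S.η * √(S.ρ * q ^ 2) ≤ 1 := by
    have h1 : √(S.ρ * q ^ 2) ≤ U := by
      rw [Real.sqrt_le_iff]
      refine ⟨hU.le, ?_⟩
      calc S.ρ * q ^ 2 ≤ U * 1 := by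
            gcongr
            · exact R.ρ_le
            · exact pow_le_one₀ hq.le hq1
        _ ≤ U ^ 2 := by nlinarith
    have h2 := R.eta_U_le 1 (by norm_num)
    rw [pow_one] at h2
    exact (mul_le_mul_of_nonneg_left h1 hη.le).trans h2
  have hnear := R.near hW1 hW2 (sq_nonneg ‖z.2‖) hz
  have hfar := R.far hW1
  have h2W := R.two_le_window hW1
  have hDd : 144 * (S.L ^ 2 + S.n) * S.η ^ 2 / S.μ ^ 2 * U ^ 77 ≤ 288 * q ^ 2 := by
    rw [R.L_eq, div_mul_eq_mul_div, div_le_iff₀ (by positivity)]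
    have h1 := R.eta_le
    have h3 : S.η ^ 2 * U ^ 80 ≤ q ^ 2 * S.μ ^ 2 := by
      calc S.η ^ 2 * U ^ 80 = (S.η * U ^ 40) ^ 2 := by ring
        _ ≤ (q * S.μ ^ 2) ^ 2 := by gcongr
        _ = q ^ 2 * (S.μ ^ 2 * S.μ ^ 2) := by ring
        _ ≤ q ^ 2 * (S.μ ^ 2 * 1) := by gcongr; exact S.mu_sq_le
        _ = q ^ 2 * S.μ ^ 2 := by ring
    calc 144 * (U ^ 2 + S.n) * S.η ^ 2 * U ^ 77 ≤ 144 * (U ^ 2 + U ^ 2) * S.η ^ 2 * U ^ 77 := by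
          gcongr; exact R.n_le
      _ = 288 * (S.η ^ 2 * U ^ 79) := by ring
      _ ≤ 288 * (S.η ^ 2 * U ^ 80) := by gcongr; norm_num
      _ ≤ _ := by linarith
  rcases R.kind with hP | ⟨hrst, hlin⟩
  · have hr : S.r ≠ 0 := by
      intro h
      have h1 := R.r_sq
      have h2 : 0 < D * U ^ 4 := by have := R.D_ge; positivity
      rw [h] at h1
      norm_num at h1
      rcases h1 with h1 | h1 <;> simp [h1] at h2
    have hA : S.η * ((‖z.2‖ ^ 2 + S.V) * d / S.r ^ 2) * U ^ 38 ≤ q := by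
      refine mul_pow_le_of_succ hU (c := 16) (by linarith) hq.le ?_
      have h1 : (‖z.2‖ ^ 2 + S.V) * d / S.r ^ 2 ≤ 16 * U * P / S.μ ^ 2 := by
        rw [R.r_sq, div_le_div_iff₀ (by have := R.D_ge; positivity) (by positivity)]
        have h2 : ‖z.2‖ ^ 2 + S.V ≤ 2 * U * S.V := by
          have := le_mul_of_one_le_left hV hU1
          linarith
        have h3 : S.V * S.μ ^ 2 ≤ 8 * (D * U ^ 4) := by
          have : S.V * S.μ ^ 2 = 4 * S.N := by unfold V; field_simp
          rw [this]
          linarith [R.N_le]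
        have h4 : (d : ℝ) ≤ P := by exact_mod_cast hP
        calc (‖z.2‖ ^ 2 + S.V) * d * S.μ ^ 2 ≤ 2 * U * S.V * P * S.μ ^ 2 := by gcongr
          _ = 2 * U * P * (S.V * S.μ ^ 2) := by ring
          _ ≤ 2 * U * P * (8 * (D * U ^ 4)) := by gcongr
          _ = _ := by ring
      calc S.η * ((‖z.2‖ ^ 2 + S.V) * d / S.r ^ 2) * U ^ (38 + 1)
          ≤ S.η * (16 * U * P / S.μ ^ 2) * U ^ (38 + 1) := by gcongr
        _ = 16 * (S.η * P * U ^ 40) / S.μ ^ 2 := by ring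
        _ ≤ 16 * (q * S.μ ^ 2) / S.μ ^ 2 :=
          div_le_div_of_nonneg_right (by linarith [R.step_err]) (by positivity)
        _ = 16 * q := by field_simp
    exact Ef_le_of_isSaddle hsad (Real.sqrt_nonneg _) hηγ h2W
      (R.isTuned hW1 hW2 (by positivity) le_rfl hA (by simp; positivity))
      (fun F γ' _ t _ => errBound_of_bd_err hr z t) hnear hfar
  · have hA : S.η * (32 / S.μ ^ 2) * U ^ 38 ≤ q := by
      refine mul_pow_le_of_succ hU (c := 32) (by linarith) hq.le ?_
      calc S.η * (32 / S.μ ^ 2) * U ^ (38 + 1) = 32 * (S.η * U ^ 39) / S.μ ^ 2 := by ring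
        _ ≤ 32 * (S.η * U ^ 40) / S.μ ^ 2 := by gcongr; norm_num
        _ ≤ 32 * (q * S.μ ^ 2) / S.μ ^ 2 :=
          div_le_div_of_nonneg_right (by linarith [R.eta_le]) (by positivity)
        _ = 32 * q := by field_simp
    have hD : 144 * (S.L ^ 2 + S.n) * S.η ^ 2 / S.μ ^ 2 * U ^ 76 ≤ q ^ 2 :=
      mul_pow_le_of_succ hU (c := 288) (by linarith) (sq_nonneg q) hDd
    have hT := R.isTuned hW1 hW2 (by positivity) (by positivity) hA hD
    have hT0 := hT ⟨0, 0, 0, 0, 1 / (4096 * W), W⟩ rfl rfl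
    refine Ef_le_of_isSaddle hsad (Real.sqrt_nonneg _) hηγ h2W hT
      (fun F γ' hF t h => errBound_of_linear hF hrst hlin ?_ hT0.oracle_const z t h) hnear hfar
    have h1 := hT0.Dd_le
    rw [div_le_one (by positivity)] at h1
    have : 0 ≤ (S.L ^ 2 + S.n) * S.η ^ 2 := by positivity
    linarith

end

end Regime

end Setting

namespace Setting

variable {d : ℕ} {Θ : Type u} {Z : Type v} [MeasurableSpace Θ] [MeasurableSpace Z]

variable (S : Setting d Θ Z) in
/-- The states at saddle points. -/
def saddles (γ : ℝ) : Set (Vec d × Vec d) := {z | IsSaddle S.f γ (S.pt z)}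

variable (S : Setting d Θ Z) in
/-- The states with a large gradient. -/
def steep (ε : ℝ) : Set (Vec d × Vec d) := {z | ε < ‖gradient S.f (S.pt z)‖}

lemma measurableSet_saddles (S : Setting d Θ Z) (γ : ℝ) : MeasurableSet (S.saddles γ) :=
  S.measurable_pt (isOpen_isSaddle S.contDiff γ).measurableSet

lemma measurableSet_steep (S : Setting d Θ Z) (ε : ℝ) : MeasurableSet (S.steep ε) :=
  measurableSet_lt measurable_const (S.measurable_gradient.comp S.measurable_pt).norm

namespace Regime

variable {S : Setting d Θ Z} {P : ℕ} {U D q : ℝ} (R : S.Regime P U D q)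

include R

lemma sum_saddles_le {z₀ : Vec d × Vec d} (hz₀ : z₀.2 = 0) {n : ℕ}
    (hn : U ^ 20 ≤ n * P * S.η * q ^ 4) :
    ∑ i ∈ Finset.range n, (iidLaw S.law).real
      {ω | S.path z₀ ω (i * P) ∈ S.saddles √(S.ρ * q ^ 2)} ≤ n * (5 / U) := by
  obtain ⟨j, hW1, hW2⟩ := R.exists_window
  have hη := S.hη
  have hU := R.U_pos
  have hU1 := R.one_le_U
  have hUge := R.U_ge
  have hq := R.q_pos
  have hq1 := R.q_le
  have hV := R.V_pos
  have hL := S.hL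
  have hN := S.N_nonneg
  have hP : (0 : ℝ) < P := by exact_mod_cast R.P_pos
  set Φ := q ^ 3 / U ^ 12 with hΦ
  have hΦ0 : 0 < Φ := by positivity
  set W := j * P with hW
  set a := S.η / 2 * S.L ^ 2 * S.η ^ 2 with ha
  have hslack : ∀ e, S.slack e = a * (e + S.V) + S.L * S.η ^ 2 * S.N := fun e => rfl
  have h : ∀ z, S.Ef z W ≤ S.f z.1 - Φ * (S.saddles √(S.ρ * q ^ 2)).indicator 1 z +
      ((Φ / (U * S.V) + W * a) * ‖z.2‖ ^ 2 + W * (a * S.V + S.L * S.η ^ 2 * S.N)) := by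
    intro z
    by_cases hz : z ∈ S.saddles √(S.ρ * q ^ 2)
    · rw [Set.indicator_of_mem hz, Pi.one_apply, mul_one]
      rcases le_or_gt (‖z.2‖ ^ 2) (U * S.V) with he | he
      · have h1 := R.Ef_window_le hW1 hW2 he hz
        have h2 : 0 ≤ (Φ / (U * S.V) + W * a) * ‖z.2‖ ^ 2 +
          W * (a * S.V + S.L * S.η ^ 2 * S.N) := by positivity
        linarith
      · have h1 := S.Ef_add_sum_le z W
        have h2 : 0 ≤ ∑ i ∈ Finset.range W, S.Eg z i :=
          Finset.sum_nonneg fun i _ => S.Eg_nonneg z i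
        have h3 : 0 ≤ S.η / 2 * ∑ i ∈ Finset.range W, S.Eg z i := by positivity
        have h4 : Φ ≤ Φ / (U * S.V) * ‖z.2‖ ^ 2 := by
          rw [div_mul_eq_mul_div, le_div_iff₀ (by positivity)]
          gcongr
        rw [hslack] at h1
        linarith
    · rw [Set.indicator_of_notMem hz, mul_zero, sub_zero]
      have h1 := S.Ef_add_sum_le z W
      have h2 : 0 ≤ ∑ i ∈ Finset.range W, S.Eg z i :=
        Finset.sum_nonneg fun i _ => S.Eg_nonneg z i
      have h3 : 0 ≤ S.η / 2 * ∑ i ∈ Finset.range W, S.Eg z i := by positivity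
      have h4 : 0 ≤ Φ / (U * S.V) * ‖z.2‖ ^ 2 := by positivity
      rw [hslack] at h1
      linarith
  have h1 := S.sum_measure_le R.periodic hz₀ (S.measurableSet_saddles _) (by positivity) h n
  have hslackW : W * S.slack S.V ≤ 2 * (Φ / U) := by
    have h2 := R.slack_le (e := S.V) (le_mul_of_one_le_left hV.le hU1)
    refine le_of_mul_le_mul_right ?_ (by positivity : 0 < U ^ 33)
    calc W * S.slack S.V * U ^ 33 = W * (S.slack S.V * U ^ 33) := by ring
      _ ≤ W * (S.η * q ^ 4) := by gcongr
      _ = (W * S.η * q) * q ^ 3 := by ring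
      _ ≤ 2 * U ^ 2 * q ^ 3 := by gcongr
      _ = 2 * (Φ / U) * U ^ 15 := by rw [hΦ]; field_simp
      _ ≤ 2 * (Φ / U) * U ^ 33 := by gcongr; norm_num
  have hbc : (Φ / (U * S.V) + W * a) * S.V + W * (a * S.V + S.L * S.η ^ 2 * S.N) ≤
      3 * (Φ / U) := by
    have e1 : (Φ / (U * S.V) + W * a) * S.V + W * (a * S.V + S.L * S.η ^ 2 * S.N) =
        Φ / U + W * S.slack S.V := by rw [hslack]; field_simp; ring
    linarith
  have hj : j * S.fmax ≤ n * (2 * (Φ / U)) := by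
    have h2 : (j : ℝ) * U ≤ n * (2 * (Φ / U)) := by
      have hk : 0 < P * S.η * q * U ^ 17 := by positivity
      refine le_of_mul_le_mul_right ?_ hk
      have h3 : (j : ℝ) * P * S.η * q ≤ 2 * U ^ 2 := by
        have := hW2
        rw [hW] at this
        push_cast at this
        exact this
      calc (j : ℝ) * U * (P * S.η * q * U ^ 17) = j * P * S.η * q * U ^ 18 := by ring
        _ ≤ 2 * U ^ 2 * U ^ 18 := by gcongr
        _ = 2 * U ^ 20 := by ring
        _ ≤ 2 * (n * P * S.η * q ^ 4) := by gcongr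
        _ = n * (2 * (Φ / U)) * (P * S.η * q * U ^ 13) := by rw [hΦ]; field_simp
        _ ≤ n * (2 * (Φ / U)) * (P * S.η * q * U ^ 17) := by gcongr; norm_num
    exact (mul_le_mul_of_nonneg_left R.fmax_le (by positivity)).trans h2
  have h2 := mul_le_mul_of_nonneg_left hbc (by positivity : (0 : ℝ) ≤ n)
  refine le_of_mul_le_mul_left ?_ hΦ0
  have e : Φ * (n * (5 / U)) = n * (5 * (Φ / U)) := by ring
  linarith

lemma sum_steep_le {z₀ : Vec d × Vec d} (hz₀ : z₀.2 = 0) {n : ℕ}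
    (hn : U ^ 20 ≤ n * P * S.η * q ^ 4) :
    ∑ i ∈ Finset.range n, (iidLaw S.law).real
      {ω | S.path z₀ ω (i * P) ∈ S.steep (q ^ 2)} ≤ n * (5 / U) := by
  have hη := S.hη
  have hU := R.U_pos
  have hU1 := R.one_le_U
  have hUge := R.U_ge
  have hq := R.q_pos
  have hq1 := R.q_le
  have hV := R.V_pos
  have hL := S.hL
  have hN := S.N_nonneg
  have hP : (0 : ℝ) < P := by exact_mod_cast R.P_pos
  set Φ := S.η * P * q ^ 4 / 8 with hΦ
  have hΦ0 : 0 < Φ := by positivity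
  set a := S.η / 2 * S.L ^ 2 * S.η ^ 2 with ha
  have hslack : ∀ e, S.slack e = a * (e + S.V) + S.L * S.η ^ 2 * S.N := fun e => rfl
  have hηLP : 6 * (S.η * S.L * P) ≤ 1 := by
    rw [R.L_eq]
    have h1 : S.η * P * U ^ 2 ≤ 1 :=
      mul_pow_le_of_le (by positivity) hU1 (by norm_num) R.eta_P_le
    calc 6 * (S.η * U * P) ≤ U * (S.η * U * P) := by gcongr; linarith
      _ = S.η * P * U ^ 2 := by ring
      _ ≤ 1 := h1
  have h : ∀ z, S.Ef z (1 * P) ≤ S.f z.1 - Φ * (S.steep (q ^ 2)).indicator 1 z +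
      ((P * (a + S.η ^ 3 * S.L ^ 2 * 2)) * ‖z.2‖ ^ 2 +
        P * (a * S.V + S.L * S.η ^ 2 * S.N + S.η ^ 3 * S.L ^ 2 * (3 * (P * S.N) + S.V))) := by
    intro z
    rw [one_mul]
    have h1 := S.Ef_le_of_gradient z R.P_pos hηLP
    rw [hslack] at h1
    have h2 : Φ * (S.steep (q ^ 2)).indicator 1 z ≤
        S.η * P / 8 * ‖gradient S.f (S.pt z)‖ ^ 2 := by
      by_cases hz : z ∈ S.steep (q ^ 2)
      · rw [Set.indicator_of_mem hz, Pi.one_apply, mul_one]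
        have h3 : (q ^ 2) ^ 2 ≤ ‖gradient S.f (S.pt z)‖ ^ 2 :=
          pow_le_pow_left₀ (by positivity) (le_of_lt hz) 2
        calc Φ = S.η * P / 8 * (q ^ 2) ^ 2 := by rw [hΦ]; ring
          _ ≤ _ := by gcongr
      · rw [Set.indicator_of_notMem hz, mul_zero]
        positivity
    linarith
  have h1 := S.sum_measure_le R.periodic hz₀ (S.measurableSet_steep _) (by positivity) h n
  have hbc : (P * (a + S.η ^ 3 * S.L ^ 2 * 2)) * S.V +
      P * (a * S.V + S.L * S.η ^ 2 * S.N + S.η ^ 3 * S.L ^ 2 * (3 * (P * S.N) + S.V)) ≤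
      4 * (Φ / U) := by
    have e1 : (P * (a + S.η ^ 3 * S.L ^ 2 * 2)) * S.V +
        P * (a * S.V + S.L * S.η ^ 2 * S.N + S.η ^ 3 * S.L ^ 2 * (3 * (P * S.N) + S.V)) =
        P * (S.slack S.V + 3 * U ^ 2 * S.η * (S.η * P) * (S.η * S.N) +
          3 * U ^ 2 * S.η * (S.η ^ 2 * S.V)) := by
      rw [hslack, ← R.L_eq]; ring
    have e2 : 4 * (Φ / U) = P * (S.η * q ^ 4 / (2 * U)) := by rw [hΦ]; field_simp; norm_num
    rw [e1, e2]
    refine mul_le_mul_of_nonneg_left ?_ hP.le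
    rw [le_div_iff₀ (by positivity)]
    have f1 : S.slack S.V * U ^ 2 ≤ S.η * q ^ 4 :=
      mul_pow_le_of_le (S.slack_nonneg hV.le) hU1 (by norm_num)
        (R.slack_le (e := S.V) (le_mul_of_one_le_left hV.le hU1))
    have f2 : (S.η * P) * (S.η * S.N) * U ^ 4 ≤ q ^ 4 := by
      have g1 : S.η * P ≤ 1 := by
        have := mul_pow_le_of_le (a := 0) (by positivity) hU1 (by norm_num) R.eta_P_le
        simpa using this
      have g2 := mul_pow_le_of_le (a := 4) (by positivity) hU1 (by norm_num) R.eta_N_le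
      calc (S.η * P) * (S.η * S.N) * U ^ 4 ≤ 1 * (S.η * S.N) * U ^ 4 := by gcongr
        _ ≤ q ^ 4 := by linarith
    have f3 : (S.η ^ 2 * S.V) * U ^ 4 ≤ q ^ 4 :=
      mul_pow_le_of_le (by positivity) hU1 (by norm_num) R.eta_sq_V_le
    refine le_of_mul_le_mul_right ?_ hU
    calc (S.slack S.V + 3 * U ^ 2 * S.η * (S.η * P) * (S.η * S.N) +
          3 * U ^ 2 * S.η * (S.η ^ 2 * S.V)) * (2 * U) * U
        = 2 * (S.slack S.V * U ^ 2) + 6 * S.η * ((S.η * P) * (S.η * S.N) * U ^ 4) +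
          6 * S.η * ((S.η ^ 2 * S.V) * U ^ 4) := by ring
      _ ≤ 2 * (S.η * q ^ 4) + 6 * S.η * q ^ 4 + 6 * S.η * q ^ 4 := by gcongr
      _ = 14 * (S.η * q ^ 4) := by ring
      _ ≤ U * (S.η * q ^ 4) := by gcongr; linarith
      _ = S.η * q ^ 4 * U := by ring
  have hj : ((1 : ℕ) : ℝ) * S.fmax ≤ n * (Φ / U) := by
    rw [Nat.cast_one, one_mul]
    refine R.fmax_le.trans ?_
    have e2 : n * (Φ / U) = n * P * S.η * q ^ 4 / (8 * U) := by rw [hΦ]; field_simp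
    rw [e2, le_div_iff₀ (by positivity)]
    refine le_trans ?_ hn
    calc U * (8 * U) ≤ U * (U * U) := by gcongr; linarith
      _ = U ^ 3 := by ring
      _ ≤ U ^ 20 := pow_le_pow_right₀ hU1 (by norm_num)
  have h2 := mul_le_mul_of_nonneg_left hbc (by positivity : (0 : ℝ) ≤ n)
  refine le_of_mul_le_mul_left ?_ hΦ0
  exact h1.trans ((add_le_add hj h2).trans (le_of_eq (by ring)))

/-- Most of the states at multiples of `P` are neither steep nor at saddle points. -/
lemma measure_half_bad_le {z₀ : Vec d × Vec d} (hz₀ : z₀.2 = 0) {n : ℕ} (hn1 : 1 ≤ n)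
    (hn : U ^ 20 ≤ n * P * S.η * q ^ 4) :
    iidLaw S.law {ω | (n : ℝ) / 2 ≤ ∑ i ∈ Finset.range n,
      {ω | S.path z₀ ω (i * P) ∈ S.steep (q ^ 2) ∪ S.saddles √(S.ρ * q ^ 2)}.indicator 1 ω} ≤
      ENNReal.ofReal (20 / U) := by
  have hm : ∀ i, MeasurableSet
      {ω | S.path z₀ ω (i * P) ∈ S.steep (q ^ 2) ∪ S.saddles √(S.ρ * q ^ 2)} := fun i =>
    S.measurable_path z₀ (i * P) ((S.measurableSet_steep _).union (S.measurableSet_saddles _))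
  refine (measure_half_le _ hm hn1 (p := 10 / U) ?_).trans (le_of_eq (by congr 1; ring))
  have h1 := R.sum_saddles_le hz₀ hn
  have h2 := R.sum_steep_le hz₀ hn
  calc _ ≤ ∑ i ∈ Finset.range n, ((iidLaw S.law).real
        {ω | S.path z₀ ω (i * P) ∈ S.steep (q ^ 2)} + (iidLaw S.law).real
        {ω | S.path z₀ ω (i * P) ∈ S.saddles √(S.ρ * q ^ 2)}) :=
        Finset.sum_le_sum fun i _ => measureReal_union_le _ _
    _ ≤ n * (5 / U) + n * (5 / U) := by
        rw [Finset.sum_add_distrib]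
        linarith
    _ = n * (10 / U) := by ring

end Regime
end Setting

namespace Setting

variable {d : ℕ} {Θ : Type u} [MeasurableSpace Θ] {C : Compressor.{v, w} d}
  {S : Setting d Θ C.Seed} {A : Params}

/-- A step of the algorithm in terms of `x - η e` and the error before a possible reset. -/
lemma gradStep_eq (hη : A.η = S.η) (σ : State d) (z : Vec d × Vec d) (hx : σ.x = S.pt z)
    (he : σ.e = z.2) (t : ℕ) (m : Vec d × Θ × C.Seed)
    (hc : C.apply (compressInput S.g σ m.1 m.2.1) m.2.2 =
      S.comp (compressInput S.g σ m.1 m.2.1) m.2.2) :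
    (gradStep A C S.g σ m).x - A.η • (gradStep A C S.g σ m).e = (S.step t z m).1 ∧
    (S.rst (t + 1) = false → (gradStep A C S.g σ m).e = (S.step t z m).2) := by
  have hin : compressInput S.g σ m.1 m.2.1 = z.2 + (S.g (S.pt z) m.2.1 + m.1) := by
    rw [compressInput, hx, he, add_assoc]
  constructor
  · simp only [gradStep, hc]
    rw [hin, hx, hη]
    simp only [step, pt]
    module
  · intro h
    simp only [gradStep, hc, step, h]
    rw [hin]
    simp

/-- Without resets, the algorithm runs as the chain. -/
lemma stateAt_eq_of_no_reset (hη : A.η = S.η) (hreset : A.resetError = false)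
    (hrst : ∀ t, S.rst t = false) (x₀ : Vec d) (ω : ℕ → Vec d × Θ × C.Seed) {T : ℕ}
    (hc : ∀ t < T, C.apply (inputAt A C S.g x₀ ω t) (ω t).2.2 =
      S.comp (inputAt A C S.g x₀ ω t) (ω t).2.2) {t : ℕ} (ht : t < T) :
    (stateAt A C S.g x₀ ω t).x = S.pt (S.path (x₀, 0) ω t) ∧
      (stateAt A C S.g x₀ ω t).e = (S.path (x₀, 0) ω t).2 := by
  have hno : ∀ t (σ : State d), resetStep A t σ = σ := fun t σ =>
    if_neg (by simp [ResetCond, hreset])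
  induction t with
  | zero => simp [stateAt, hno, run, chain, pt]
  | succ t ih =>
    obtain ⟨h1, h2⟩ := ih (by omega)
    have h := gradStep_eq (S := S) hη (stateAt A C S.g x₀ ω t) (S.path (x₀, 0) ω t) h1 h2 t (ω t)
      (hc t (by omega))
    have h3 := h.2 (hrst _)
    have e1 : stateAt A C S.g x₀ ω (t + 1) = gradStep A C S.g (stateAt A C S.g x₀ ω t) (ω t) := by
      rw [stateAt, hno]; rfl
    have e2 : S.path (x₀, 0) ω (t + 1) = S.step t (S.path (x₀, 0) ω t) (ω t) := rfl
    rw [e1, e2]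
    refine ⟨?_, h3⟩
    rw [pt, ← h.1, ← h3, hη]
    abel

/-- As long as the chain stays in a ball, the algorithm resets the error exactly at the positive
multiples of `P`, and runs as the chain. -/
lemma stateAt_eq_of_reset (hη : A.η = S.η) (hreset : A.resetError = true) {P : ℕ} (hP : 1 ≤ P)
    (hI : A.I = P - 1) (hrst : ∀ t, S.rst t = decide (P ∣ t)) (x₀ : Vec d)
    (ω : ℕ → Vec d × Θ × C.Seed) {T : ℕ}
    (hc : ∀ t < T, C.apply (inputAt A C S.g x₀ ω t) (ω t).2.2 =
      S.comp (inputAt A C S.g x₀ ω t) (ω t).2.2)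
    (hR : ∀ s < T, ∀ t < T, ‖(S.path (x₀, 0) ω s).1 - (S.path (x₀, 0) ω t).1‖ ≤ A.R)
    {t : ℕ} (ht : t < T) :
    ((stateAt A C S.g x₀ ω t).x = S.pt (S.path (x₀, 0) ω t) ∧
      (stateAt A C S.g x₀ ω t).e = (S.path (x₀, 0) ω t).2 ∧
      (stateAt A C S.g x₀ ω t).lastReset = P * (t / P) ∧
      (stateAt A C S.g x₀ ω t).anchor = (S.path (x₀, 0) ω (P * (t / P))).1) ∧
    (ResetCond A t (run A C S.g x₀ ω t) ↔ 0 < t ∧ P ∣ t) := by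
  induction t with
  | zero =>
    have h0 : ¬ ResetCond A 0 (run A C S.g x₀ ω 0) := by
      have := hR 0 ht 0 ht
      simp only [sub_self, norm_zero] at this
      simp [ResetCond, run, this]
    refine ⟨?_, by simp [h0]⟩
    rw [stateAt, resetStep, if_neg h0]
    simp [run, chain, pt]
  | succ t ih =>
    obtain ⟨⟨h1, h2, h3, h4⟩, -⟩ := ih (by omega)
    have h := gradStep_eq (S := S) hη (stateAt A C S.g x₀ ω t) (S.path (x₀, 0) ω t) h1 h2 t (ω t)
      (hc t (by omega))
    have e2 : S.path (x₀, 0) ω (t + 1) = S.step t (S.path (x₀, 0) ω t) (ω t) := rfl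
    have e3 : run A C S.g x₀ ω (t + 1) = gradStep A C S.g (stateAt A C S.g x₀ ω t) (ω t) := rfl
    rw [← e2, ← e3] at h
    have hl : (run A C S.g x₀ ω (t + 1)).lastReset = P * (t / P) := h3
    have ha : (run A C S.g x₀ ω (t + 1)).anchor = (S.path (x₀, 0) ω (P * (t / P))).1 := h4
    have hdiv : P * (t / P) + (P - 1) < t + 1 ↔ P ∣ t + 1 := by
      have h5 := Nat.div_add_mod t P
      have h6 := Nat.mod_lt t (by omega : 0 < P)
      obtain ⟨b, rfl⟩ : ∃ b, P = b + 1 := ⟨P - 1, by omega⟩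
      rw [Nat.dvd_iff_mod_eq_zero, Nat.succ_mod_succ_eq_zero_iff]
      omega
    have hcond : ResetCond A (t + 1) (run A C S.g x₀ ω (t + 1)) ↔ P ∣ t + 1 := by
      have hlt : P * (t / P) ≤ t := Nat.mul_div_le t P
      have h7 := hR (P * (t / P)) (by omega) (t + 1) ht
      rw [ResetCond, hl, hI, ha, h.1, ← hdiv]
      simp [hreset, h7]
    refine ⟨?_, by rw [hcond]; simp⟩
    by_cases hd : P ∣ t + 1
    · have hz : (S.path (x₀, 0) ω (t + 1)).2 = 0 := by
        rw [e2]; simp [step, hrst, hd]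
      have hm : P * ((t + 1) / P) = t + 1 := Nat.mul_div_cancel' hd
      rw [stateAt, resetStep, if_pos (hcond.2 hd), hm, h.1, pt, hz]
      simp
    · have hz := h.2 (by simp [hrst, hd])
      have hm : (t + 1) / P = t / P := Nat.succ_div_of_not_dvd hd
      rw [stateAt, resetStep, if_neg (fun h => hd (hcond.1 h)), hm]
      refine ⟨?_, hz, hl, ha⟩
      rw [pt, ← h.1, ← hz, hη]
      abel

end Setting

namespace Setting

section Radius

variable {d : ℕ} {Θ : Type u} {Z : Type v} [MeasurableSpace Θ] [MeasurableSpace Z]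
  (S : Setting d Θ Z)

/-- The chain stays in a large ball. -/
lemma measure_leave_le (z : Vec d × Vec d) {T : ℕ} (hT : 1 ≤ T) {G N R U : ℝ} (hU : 0 < U)
    (hG : S.G ≤ G) (hN : S.N ≤ N)
    (hR : 1 + 4 * T * (3 * ((1 + T) * S.η ^ 2 * (T * G) + T * (S.η ^ 2 * N))) * U ≤ R) :
    iidLaw S.law {ω | ¬ ∀ s < T, ∀ t < T, ‖(S.path z ω s).1 - (S.path z ω t).1‖ ≤ R} ≤
      ENNReal.ofReal (1 / U) := by
  set K := 3 * ((1 + T) * S.η ^ 2 * (T * G) + T * (S.η ^ 2 * N)) with hK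
  have hG0 := S.hG.trans hG
  have hN0 := S.N_nonneg.trans hN
  have hK0 : 0 ≤ K := by positivity
  have hTU : 0 ≤ 4 * T * K * U := by positivity
  have hR1 : 1 ≤ R := by linarith
  have hd : ∀ t ≤ T, Bd (iidLaw S.law) (fun ω => ‖(S.path z ω t).1 - z.1‖ ^ 2) K := by
    intro t ht
    refine (S.bd_displacement z hT ht).weaken ?_
    have h1 : ∑ i ∈ Finset.range t, S.Eg z i ≤ T * G := by
      calc ∑ i ∈ Finset.range t, S.Eg z i ≤ ∑ i ∈ Finset.range T, S.Eg z i := S.sum_Eg_mono z ht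
        _ ≤ ∑ i ∈ Finset.range T, G := Finset.sum_le_sum fun i _ => (S.Eg_le z i).trans hG
        _ = T * G := by simp
    have h2 : (t : ℝ) ≤ T := by exact_mod_cast ht
    have h3 := S.N_nonneg
    rw [hK]
    gcongr
  have hsub : {ω | ¬ ∀ s < T, ∀ t < T, ‖(S.path z ω s).1 - (S.path z ω t).1‖ ≤ R} ⊆
      ⋃ t ∈ Finset.range T, {ω | R ^ 2 / 4 ≤ ‖(S.path z ω t).1 - z.1‖ ^ 2} := by
    intro ω hω
    by_contra hcon
    simp only [Set.mem_iUnion, Finset.mem_range, Set.mem_ofPred_eq, not_exists, not_le] at hcon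
    refine hω fun s hs t ht => ?_
    have h1 : ∀ t < T, ‖(S.path z ω t).1 - z.1‖ < R / 2 := fun t ht => by
      refine lt_of_pow_lt_pow_left₀ 2 (by linarith) ((hcon t ht).trans_eq (by ring))
    have h2 := norm_sub_le ((S.path z ω s).1 - z.1) ((S.path z ω t).1 - z.1)
    rw [sub_sub_sub_cancel_right] at h2
    linarith [h1 s hs, h1 t ht]
  refine (measure_mono hsub).trans ((measure_biUnion_finset_le _ _).trans ?_)
  have hone : ∀ t ∈ Finset.range T, iidLaw S.law
      {ω | R ^ 2 / 4 ≤ ‖(S.path z ω t).1 - z.1‖ ^ 2} ≤ ENNReal.ofReal (K / (R ^ 2 / 4)) :=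
    fun t ht => (hd t (Finset.mem_range.1 ht).le).measure_le (fun _ => by positivity)
      (by positivity)
  refine (Finset.sum_le_sum hone).trans ?_
  rw [Finset.sum_const, Finset.card_range, nsmul_eq_mul, ← ENNReal.ofReal_natCast,
    ← ENNReal.ofReal_mul (by positivity)]
  apply ENNReal.ofReal_le_ofReal
  rw [le_div_iff₀ hU]
  have h3 : (T : ℝ) * (K / (R ^ 2 / 4)) * U = 4 * T * K * U / R ^ 2 := by field_simp
  rw [h3, div_le_one (by positivity)]
  nlinarith

end Radius

variable {d : ℕ} {Θ : Type u} [MeasurableSpace Θ] {C : Compressor.{v, w} d}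
  {S : Setting d Θ C.Seed} {A : Params}

lemma halfSOSP_of_few_bad {n P a : ℕ} {q : ℝ} {f : Vec d → ℝ} {x₀ : Vec d}
    {ω : ℕ → Vec d × Θ × C.Seed} (ha : a ≤ 1) (han : a < n) (hP : 1 ≤ P)
    (hcand : candidateTimes A C S.g x₀ ω = (Finset.Ico a n).image (· * P))
    (hx : ∀ i < n, (stateAt A C S.g x₀ ω (i * P)).x = S.pt (S.path (x₀, 0) ω (i * P)))
    (hbad : ¬ (n : ℝ) / 2 ≤ ∑ i ∈ Finset.range n,
      {ω | S.path (x₀, 0) ω (i * P) ∈ S.steep (q ^ 2) ∪ S.saddles √(S.ρ * q ^ 2)}.indicator 1 ω)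
    (hf : gradient S.f = gradient f) :
    HalfSOSP A C S.g f S.ρ (q ^ 2) x₀ ω := by
  classical
  set bad := (Finset.range n).filter
    (fun i => S.path (x₀, 0) ω (i * P) ∈ S.steep (q ^ 2) ∪ S.saddles √(S.ρ * q ^ 2)) with hbd
  have hcard : 2 * bad.card < n := by
    have h1 : ∑ i ∈ Finset.range n, {ω | S.path (x₀, 0) ω (i * P) ∈
        S.steep (q ^ 2) ∪ S.saddles √(S.ρ * q ^ 2)}.indicator
          (1 : (ℕ → Vec d × Θ × C.Seed) → ℝ) ω = bad.card := by
      rw [hbd, Finset.card_filter]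
      push_cast
      exact Finset.sum_congr rfl fun i _ => by simp [Set.indicator_apply]
    rw [h1, not_le, lt_div_iff₀ (by norm_num)] at hbad
    have : ((bad.card * 2 : ℕ) : ℝ) < n := by exact_mod_cast hbad
    have : bad.card * 2 < n := by exact_mod_cast this
    omega
  have hinj : Set.InjOn (· * P) ((Finset.Ico a n : Finset ℕ) : Set ℕ) := fun i _ j _ h =>
    Nat.eq_of_mul_eq_mul_right hP h
  have hgood : ((Finset.Ico a n) \ bad).image (· * P) ⊆
      (candidateTimes A C S.g x₀ ω).filter
        (fun t => IsSOSP f S.ρ (q ^ 2) (stateAt A C S.g x₀ ω t).x) := by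
    intro t ht
    obtain ⟨i, hi, rfl⟩ := Finset.mem_image.1 ht
    obtain ⟨hi1, hi2⟩ := Finset.mem_sdiff.1 hi
    refine Finset.mem_filter.2 ⟨?_, ?_⟩
    · rw [hcand]
      exact Finset.mem_image_of_mem _ hi1
    · have hin := (Finset.mem_Ico.1 hi1).2
      rw [hx i hin]
      have h2 : S.path (x₀, 0) ω (i * P) ∉ S.steep (q ^ 2) ∪ S.saddles √(S.ρ * q ^ 2) := fun h =>
        hi2 (Finset.mem_filter.2 ⟨Finset.mem_range.2 hin, h⟩)
      rw [Set.mem_union, not_or] at h2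
      have h3 : IsSOSP S.f S.ρ (q ^ 2) (S.pt (S.path (x₀, 0) ω (i * P))) :=
        isSOSP_of_not_saddle (not_lt.1 h2.1) h2.2
      unfold IsSOSP hessian at h3 ⊢
      rwa [← hf]
  have h1 := Finset.card_le_card hgood
  rw [Finset.card_image_of_injOn (hinj.mono (by simp))] at h1
  have h2 : (Finset.Ico a n).card - bad.card ≤ ((Finset.Ico a n) \ bad).card :=
    Finset.le_card_sdiff _ _
  have h3 : (candidateTimes A C S.g x₀ ω).card = n - a := by
    rw [hcand, Finset.card_image_of_injOn hinj, Nat.card_Ico]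
  rw [Nat.card_Ico] at h2
  unfold HalfSOSP
  have h4 : ((candidateTimes A C S.g x₀ ω).filter
        (fun t => IsSOSP f S.ρ (q ^ 2) (stateAt A C S.g x₀ ω t).x)).card ≥ n - a - bad.card :=
    h2.trans h1
  rw [h3]
  refine ⟨by omega, ?_⟩
  refine le_trans ?_ (Nat.mul_le_mul_left 2 h4)
  omega

/-- The schedule of the resets. -/
inductive Schedule (S : Setting d Θ C.Seed) (A : Params) (P : ℕ) (U D : ℝ) : Prop
  | never (hflag : A.resetError = false) (hP : P = 1) (hrst : ∀ t, S.rst t = false)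
  | periodic (hflag : A.resetError = true) (hP : P = d) (hI : A.I = P - 1)
      (hrst : ∀ t, S.rst t = decide (P ∣ t))
      (hR : A.R = 1 + 4 * A.T * (3 * ((1 + A.T) * S.η ^ 2 * (A.T * (4 * U ^ 2)) +
        A.T * (S.η ^ 2 * (2 * (D * U ^ 4))))) * U)

lemma converges_of_regime {P n : ℕ} {U D q : ℝ} (R : S.Regime P U D q) (hη : A.η = S.η)
    (hr : A.r = S.r) (hQ : S.Q = C.law) {f : Vec d → ℝ} (hf : gradient S.f = gradient f)
    (hT : A.T = n * P) (hn : 2 ≤ n) (hnU : U ^ 20 ≤ n * P * S.η * q ^ 4)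
    (hsch : Schedule S A P U D) (x₀ : Vec d) {m δ comm : ℝ}
    (hcomp : ∀ᵐ ω ∂(sampleLaw A C S.D), ∀ t < A.T,
      C.apply (inputAt A C S.g x₀ ω t) (ω t).2.2 = S.comp (inputAt A C S.g x₀ ω t) (ω t).2.2 ∧
        (C.cost (inputAt A C S.g x₀ ω t) (ω t).2.2 : ℝ) ≤ m)
    (hcomm : A.T * m + (if A.resetError then (A.T : ℝ) else 0) ≤ comm) (hδ : 21 / U ≤ δ) :
    Converges A C S.g S.D f S.ρ (q ^ 2) x₀ δ comm := by
  have hU := R.U_pos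
  have hP := R.P_pos
  have hlaw : sampleLaw A C S.D = iidLaw S.law := by
    unfold sampleLaw iidLaw law
    rw [hr, hQ]
  have hT1 : 1 ≤ A.T := by rw [hT]; exact Nat.mul_pos (by omega) hP
  unfold Converges
  rw [hlaw] at hcomp ⊢
  set E₁ := {ω | (n : ℝ) / 2 ≤ ∑ i ∈ Finset.range n,
      {ω | S.path (x₀, 0) ω (i * P) ∈ S.steep (q ^ 2) ∪ S.saddles √(S.ρ * q ^ 2)}.indicator 1 ω}
  set E₂ := {ω | A.resetError = true ∧
    ¬ ∀ s < A.T, ∀ t < A.T, ‖(S.path (x₀, 0) ω s).1 - (S.path (x₀, 0) ω t).1‖ ≤ A.R}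
  set E₃ := {ω | ¬ ∀ t < A.T, C.apply (inputAt A C S.g x₀ ω t) (ω t).2.2 =
    S.comp (inputAt A C S.g x₀ ω t) (ω t).2.2 ∧
      (C.cost (inputAt A C S.g x₀ ω t) (ω t).2.2 : ℝ) ≤ m}
  have h1 : iidLaw S.law E₁ ≤ ENNReal.ofReal (20 / U) := R.measure_half_bad_le rfl (by omega) hnU
  have h2 : iidLaw S.law E₂ ≤ ENNReal.ofReal (1 / U) := by
    cases hsch with
    | never hflag _ _ =>
      have : E₂ = ∅ := by ext ω; simp [E₂, hflag]
      rw [this]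
      simp
    | periodic hflag hPd hI hrst hR =>
      refine (measure_mono fun ω hω => ?_).trans
        (S.measure_leave_le (x₀, 0) hT1 hU R.G_le R.N_le hR.ge)
      exact hω.2
  have h3 : iidLaw S.law E₃ = 0 := hcomp
  set good := {ω | HalfSOSP A C S.g f S.ρ (q ^ 2) x₀ ω ∧ (totalComm A C S.g x₀ ω : ℝ) ≤ comm}
  have hcover : Set.univ ⊆ good ∪ (E₁ ∪ (E₂ ∪ E₃)) := by
    intro ω _
    by_contra hcon
    simp only [Set.mem_union, not_or] at hcon
    obtain ⟨hg, he1, he2, he3⟩ := hcon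
    simp only [E₃, Set.mem_ofPred_eq, not_not] at he3
    have hc := fun t ht => (he3 t ht).1
    have hcost : (∑ t ∈ Finset.range A.T,
        (C.cost (inputAt A C S.g x₀ ω t) (ω t).2.2 : ℝ)) ≤ A.T * m := by
      have := Finset.sum_le_sum fun t (ht : t ∈ Finset.range A.T) =>
        (he3 t (Finset.mem_range.1 ht)).2
      simpa using this
    have hlt : ∀ i < n, i * P < A.T := fun i hi => by
      rw [hT]; exact Nat.mul_lt_mul_of_pos_right hi hP
    apply hg
    cases hsch with
    | never hflag hP1 hrst =>
      have hst := fun i (hi : i < n) =>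
        (stateAt_eq_of_no_reset hη hflag hrst x₀ ω hc (hlt i hi)).1
      have hcand : candidateTimes A C S.g x₀ ω = (Finset.Ico 0 n).image (· * P) := by
        rw [candidateTimes, if_neg (by simp [hflag]), hT, hP1]
        ext t
        simp
      refine ⟨halfSOSP_of_few_bad (by omega) (by omega) hP hcand hst he1 hf, ?_⟩
      have hno : resetTimes A C S.g x₀ ω = ∅ := by
        ext t; simp [resetTimes, ResetCond, hflag]
      rw [totalComm, hno]
      rw [hflag] at hcomm
      push_cast
      simp only [Finset.card_empty, Nat.cast_zero, mul_zero, add_zero]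
      simp only [Bool.false_eq_true, if_false, add_zero] at hcomm
      exact hcost.trans hcomm
    | periodic hflag hPd hI hrst hR =>
      have hball : ∀ s < A.T, ∀ t < A.T,
          ‖(S.path (x₀, 0) ω s).1 - (S.path (x₀, 0) ω t).1‖ ≤ A.R := by
        by_contra hcon
        exact he2 ⟨hflag, hcon⟩
      have hst := fun t (ht : t < A.T) => stateAt_eq_of_reset hη hflag hP hI hrst x₀ ω hc hball ht
      have hres : resetTimes A C S.g x₀ ω = (Finset.Ico 1 n).image (· * P) := by
        ext t
        simp only [resetTimes, Finset.mem_filter, Finset.mem_range, Finset.mem_image,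
          Finset.mem_Ico]
        constructor
        · rintro ⟨ht, hcond⟩
          obtain ⟨h0, i, rfl⟩ := (hst t ht).2.1 hcond
          rw [hT, mul_comm P i] at ht
          rw [mul_comm P i] at h0
          exact ⟨i, ⟨Nat.pos_of_mul_pos_right h0, Nat.lt_of_mul_lt_mul_right ht⟩, mul_comm _ _⟩
        · rintro ⟨i, ⟨hi1, hi2⟩, rfl⟩
          exact ⟨hlt i hi2, (hst _ (hlt i hi2)).2.2
            ⟨Nat.mul_pos hi1 hP, Nat.dvd_mul_left P i⟩⟩
      have hcand : candidateTimes A C S.g x₀ ω = (Finset.Ico 1 n).image (· * P) := by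
        rw [candidateTimes, if_pos hflag, hres]
      refine ⟨halfSOSP_of_few_bad le_rfl (by omega) hP hcand
        (fun i hi => (hst _ (hlt i hi)).1.1) he1 hf, ?_⟩
      have hcardle : d * (resetTimes A C S.g x₀ ω).card ≤ A.T := by
        rw [hres, hT, ← hPd, mul_comm n P]
        refine Nat.mul_le_mul_left P (Finset.card_image_le.trans ?_)
        rw [Nat.card_Ico]; omega
      have hcardle' : (d : ℝ) * (resetTimes A C S.g x₀ ω).card ≤ A.T := by exact_mod_cast hcardle
      rw [totalComm]
      push_cast
      rw [hflag] at hcomm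
      simp only [if_true] at hcomm
      linarith
  have h4 : (1 : ℝ≥0∞) ≤ iidLaw S.law good + ENNReal.ofReal (21 / U) := by
    have e : (21 / U : ℝ) = 20 / U + 1 / U := by ring
    calc (1 : ℝ≥0∞) = iidLaw S.law Set.univ := measure_univ.symm
      _ ≤ iidLaw S.law (good ∪ (E₁ ∪ (E₂ ∪ E₃))) := measure_mono hcover
      _ ≤ iidLaw S.law good + (iidLaw S.law E₁ + (iidLaw S.law E₂ + iidLaw S.law E₃)) :=
        (measure_union_le _ _).trans (add_le_add le_rfl ((measure_union_le _ _).trans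
          (add_le_add le_rfl (measure_union_le _ _))))
      _ ≤ iidLaw S.law good + (ENNReal.ofReal (20 / U) + (ENNReal.ofReal (1 / U) + 0)) := by
        rw [h3]; gcongr
      _ = iidLaw S.law good + ENNReal.ofReal (21 / U) := by
        rw [add_zero, e, ENNReal.ofReal_add (by positivity) (by positivity)]
  rw [ENNReal.ofReal_sub _ (le_trans (by positivity) hδ), ENNReal.ofReal_one]
  refine tsub_le_iff_right.2 (h4.trans ?_)
  gcongr

end Setting

/-! ### Compressors -/

lemma bd_uniform {α : Type*} [Fintype α] [Nonempty α] {φ : α → ℝ} {c : ℝ}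
    (h : ∑ a, φ a ≤ Fintype.card α * c) :
    @Bd α ⊤ (@PMF.toMeasure α ⊤ (PMF.uniformOfFintype α)) φ c := by
  let _ : MeasurableSpace α := ⊤
  have hc : (0 : ℝ) < Fintype.card α := by exact_mod_cast Fintype.card_pos
  refine ⟨Integrable.of_finite, ?_⟩
  rw [PMF.integral_eq_sum]
  simp only [PMF.uniformOfFintype_apply, ENNReal.toReal_inv, ENNReal.toReal_natCast, smul_eq_mul]
  rw [← Finset.mul_sum, inv_mul_le_iff₀ hc]
  exact h

section Perm

open Finset

variable {d : ℕ}

/-- The position of `i` among the elements of `G` in the order `π`. -/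
def place (G : Finset (Fin d)) (π : Equiv.Perm (Fin d)) (i : Fin d) : ℕ :=
  (G.filter fun j => π j < π i).card

lemma place_lt {G : Finset (Fin d)} {π : Equiv.Perm (Fin d)} {i : Fin d} (hi : i ∈ G) :
    place G π i < G.card := by
  refine card_lt_card ⟨filter_subset _ _, fun h => ?_⟩
  have := (mem_filter.1 (h hi)).2
  exact lt_irrefl _ this

lemma place_lt_place {G : Finset (Fin d)} {π : Equiv.Perm (Fin d)} {i j : Fin d} (hi : i ∈ G)
    (h : π i < π j) : place G π i < place G π j := by
  refine card_lt_card ⟨fun l hl => ?_, fun h2 => ?_⟩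
  · obtain ⟨h1, h2⟩ := mem_filter.1 hl
    exact mem_filter.2 ⟨h1, h2.trans h⟩
  · exact lt_irrefl _ (mem_filter.1 (h2 (mem_filter.2 ⟨hi, h⟩))).2

lemma place_injOn (G : Finset (Fin d)) (π : Equiv.Perm (Fin d)) : Set.InjOn (place G π) G := by
  intro i hi j hj h
  by_contra hne
  rcases lt_or_gt_of_ne (fun h' => hne (π.injective h')) with h1 | h1
  · exact (place_lt_place hi h1).ne h
  · exact (place_lt_place hj h1).ne h.symm

lemma card_place_lt (G : Finset (Fin d)) (π : Equiv.Perm (Fin d)) (r : ℕ) :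
    (G.filter fun i => place G π i < r).card = min r G.card := by
  have himg : G.image (place G π) = range G.card := by
    refine eq_of_subset_of_card_le (fun t ht => ?_) ?_
    · obtain ⟨i, hi, rfl⟩ := mem_image.1 ht
      exact mem_range.2 (place_lt hi)
    · rw [card_image_of_injOn (place_injOn G π), card_range]
  have h2 : (G.filter fun i => place G π i < r).image (place G π) =
      (range G.card).filter (· < r) := by
    rw [← himg, filter_image]
  rw [← card_image_of_injOn ((place_injOn G π).mono fun i hi => (mem_filter.1 hi).1), h2]
  have : (range G.card).filter (· < r) = range (min r G.card) := by
    ext t; simp; tauto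
  rw [this, card_range]

/-- In a random order, all elements of `G` have the same distribution of their place in `G`. -/
lemma card_mul_card_place_lt {G : Finset (Fin d)} {i : Fin d} (hi : i ∈ G) (r : ℕ) :
    G.card * (univ.filter fun π : Equiv.Perm (Fin d) => place G π i < r).card =
      min r G.card * Fintype.card (Equiv.Perm (Fin d)) := by
  have hsym : ∀ j ∈ G, (univ.filter fun π : Equiv.Perm (Fin d) => place G π j < r).card =
      (univ.filter fun π : Equiv.Perm (Fin d) => place G π i < r).card := by
    intro j hj
    have hplace : ∀ π : Equiv.Perm (Fin d), place G (π * Equiv.swap i j) j = place G π i := by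
      intro π
      have hmem : ∀ l ∈ G, Equiv.swap i j l ∈ G := by
        intro l hl
        rw [Equiv.swap_apply_def]
        split_ifs <;> assumption
      unfold place
      refine card_bij' (fun l _ => Equiv.swap i j l) (fun l _ => Equiv.swap i j l) ?_ ?_ ?_ ?_
      · intro l hl
        obtain ⟨h1, h2⟩ := mem_filter.1 hl
        refine mem_filter.2 ⟨hmem l h1, ?_⟩
        simpa using h2
      · intro l hl
        obtain ⟨h1, h2⟩ := mem_filter.1 hl
        refine mem_filter.2 ⟨hmem l h1, ?_⟩
        simpa using h2
      · intro l _; simp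
      · intro l _; simp
    refine card_bij' (fun π _ => π * Equiv.swap i j) (fun π _ => π * Equiv.swap i j) ?_ ?_ ?_ ?_
    · intro π hπ
      have h1 := (mem_filter.1 hπ).2
      refine mem_filter.2 ⟨mem_univ _, ?_⟩
      rw [← hplace]
      simpa [mul_assoc] using h1
    · intro π hπ
      have h1 := (mem_filter.1 hπ).2
      refine mem_filter.2 ⟨mem_univ _, ?_⟩
      rwa [hplace]
    · intro π _; simp [mul_assoc]
    · intro π _; simp [mul_assoc]
  calc G.card * (univ.filter fun π : Equiv.Perm (Fin d) => place G π i < r).card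
      = ∑ j ∈ G, (univ.filter fun π : Equiv.Perm (Fin d) => place G π j < r).card := by
        rw [sum_congr rfl hsym, sum_const, smul_eq_mul]
    _ = ∑ π : Equiv.Perm (Fin d), (G.filter fun j => place G π j < r).card := by
        simp only [card_filter]
        exact sum_comm
    _ = min r G.card * Fintype.card (Equiv.Perm (Fin d)) := by
        simp only [card_place_lt, sum_const, smul_eq_mul, mul_comm, card_univ]

lemma place_univ (π : Equiv.Perm (Fin d)) (i : Fin d) : place univ π i = (π i : ℕ) := by
  unfold place
  have : (univ.filter fun j => π j < π i) = (Iio (π i)).map π.symm.toEmbedding := by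
    ext j
    simp
  rw [this, card_map, Fin.card_Iio]

end Perm

lemma normSq_eq_sum {d : ℕ} (x : Vec d) : ‖x‖ ^ 2 = ∑ i, x i ^ 2 := by
  rw [EuclideanSpace.real_norm_sq_eq]

section RandomK

variable {d k : ℕ}

lemma randomK_cost (hk : k ≤ d) (x : Vec d) (s : (randomK d k).Seed) :
    (randomK d k).cost x s = k := by
  simp [Compressor.cost, randomK, hk]

lemma randomK_apply (x : Vec d) (π : Equiv.Perm (Fin d)) (i : Fin d) :
    (randomK d k).apply x π i = if (π.symm i : ℕ) < k then x i else 0 := by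
  unfold Compressor.apply randomK
  simp only
  split_ifs with h
  · rw [List.getD_eq_getElem _ _ (by simp; omega)]
    simp
  · rw [List.getD_eq_default _ _ (by simp; omega)]

lemma randomK_linear (x y : Vec d) (π : (randomK d k).Seed) :
    (randomK d k).apply (x - y) π = (randomK d k).apply x π - (randomK d k).apply y π := by
  ext i
  have h1 := randomK_apply (k := k) (x - y) π i
  have h2 := randomK_apply (k := k) x π i
  have h3 := randomK_apply (k := k) y π i
  rw [PiLp.sub_apply, h1, h2, h3]
  split_ifs <;> simp

lemma randomK_isMeasurable : (randomK d k).IsMeasurable := by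
  have : Countable (randomK d k).Seed := inferInstanceAs (Countable (Equiv.Perm (Fin d)))
  have : DiscreteMeasurableSpace (randomK d k).Seed :=
    ⟨fun _ => MeasurableSpace.measurableSet_top⟩
  refine measurable_from_prod_countable_left fun π => ?_
  have : (fun x : Vec d => (randomK d k).apply x π) =
      fun x => WithLp.toLp 2 (fun i => if (π.symm i : ℕ) < k then x i else 0) := by
    funext x
    ext i
    exact randomK_apply x π i
  rw [this]
  refine (PiLp.continuous_toLp 2 _).measurable.comp (measurable_pi_lambda _ fun i => ?_)
  split_ifs <;> fun_prop

lemma bd_randomK (hd : 1 ≤ d) (hk : k ≤ d) (x : Vec d) :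
    Bd (randomK d k).law (fun s => ‖x - (randomK d k).apply x s‖ ^ 2)
      ((1 - k / d) * ‖x‖ ^ 2) := by
  have hd0 : (0 : ℝ) < d := by exact_mod_cast hd
  refine bd_uniform (α := Equiv.Perm (Fin d)) ?_
  have hcount : ∀ i : Fin d, ((Finset.univ.filter
      fun π : Equiv.Perm (Fin d) => (π.symm i : ℕ) < k).card : ℝ) =
      k / d * Fintype.card (Equiv.Perm (Fin d)) := by
    intro i
    have h1 := card_mul_card_place_lt (Finset.mem_univ i) k
    have h2 : (Finset.univ.filter fun π : Equiv.Perm (Fin d) => (π.symm i : ℕ) < k).card =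
        (Finset.univ.filter fun π : Equiv.Perm (Fin d) => place Finset.univ π i < k).card := by
      refine Finset.card_bij' (fun π _ => π⁻¹) (fun π _ => π⁻¹) ?_ ?_ ?_ ?_ <;>
        intro π hπ <;> simp [place_univ, Equiv.Perm.inv_def] at hπ ⊢ <;> exact hπ
    rw [Finset.card_univ, Fintype.card_fin, min_eq_left hk] at h1
    rw [h2, div_mul_eq_mul_div, eq_div_iff hd0.ne', mul_comm]
    exact_mod_cast h1
  have hterm : ∀ π : Equiv.Perm (Fin d), ‖x - (randomK d k).apply x π‖ ^ 2 =
      ∑ i, (x i ^ 2 - (if (π.symm i : ℕ) < k then 1 else 0) * x i ^ 2) := by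
    intro π
    rw [normSq_eq_sum]
    refine Finset.sum_congr rfl fun i _ => ?_
    rw [PiLp.sub_apply, randomK_apply]
    split_ifs <;> ring
  have hsum : ∑ π : Equiv.Perm (Fin d), ‖x - (randomK d k).apply x π‖ ^ 2 =
      Fintype.card (Equiv.Perm (Fin d)) * ((1 - k / d) * ‖x‖ ^ 2) := by
    simp only [hterm]
    rw [Finset.sum_comm, normSq_eq_sum, Finset.mul_sum, Finset.mul_sum]
    refine Finset.sum_congr rfl fun i _ => ?_
    rw [Finset.sum_sub_distrib, ← Finset.sum_mul, Finset.sum_boole, hcount, Finset.sum_const,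
      Finset.card_univ, nsmul_eq_mul]
    ring
  exact hsum.le

end RandomK

/-! ### Medians -/

section Median

variable {m : ℕ} (a : Fin m → ℝ)

lemma card_filter_eq_countP (p : ℝ → Prop) [DecidablePred p] :
    (Finset.univ.filter fun i => p (a i)).card =
      ((List.ofFn a).mergeSort (fun s t => decide (s ≤ t))).countP (fun t => decide (p t)) := by
  rw [(List.mergeSort_perm _ _).countP_eq, List.ofFn_eq_map, List.countP_map,
    List.countP_eq_length_filter]
  simp [Finset.card, Finset.filter, Fin.univ_def, Function.comp_def]

lemma pairwise_sorted :
    ((List.ofFn a).mergeSort (fun s t => decide (s ≤ t))).Pairwise (· ≤ ·) := by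
  have h := List.pairwise_mergeSort (le := fun s t : ℝ => decide (s ≤ t))
    (fun x y z h1 h2 => by simp at *; linarith) (fun x y => by simp [le_total]) (List.ofFn a)
  simpa using h

variable {a}

lemma median_eq (hm : 0 < m) : ∃ h : m / 2 <
    ((List.ofFn a).mergeSort (fun s t => decide (s ≤ t))).length,
    median a = ((List.ofFn a).mergeSort (fun s t => decide (s ≤ t)))[m / 2] := by
  have h : m / 2 < ((List.ofFn a).mergeSort (fun s t => decide (s ≤ t))).length := by
    simp; omega
  exact ⟨h, List.getD_eq_getElem _ _ h⟩

lemma card_ge_of_median_of_up (hm : 0 < m) (p : ℝ → Prop) [DecidablePred p]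
    (hp : ∀ s t, s ≤ t → p s → p t) (h : p (median a)) :
    m - m / 2 ≤ (Finset.univ.filter fun i => p (a i)).card := by
  rw [card_filter_eq_countP]
  obtain ⟨hl, he⟩ := median_eq (a := a) hm
  rw [he] at h
  have hs := pairwise_sorted a
  have hlen : ((List.ofFn a).mergeSort (fun s t => decide (s ≤ t))).length = m := by simp
  generalize (List.ofFn a).mergeSort (fun s t => decide (s ≤ t)) = l at *
  have h1 : (l.drop (m / 2)).countP (fun t => decide (p t)) = (l.drop (m / 2)).length := by
    rw [List.countP_eq_length]
    intro t ht
    obtain ⟨j, hj, rfl⟩ := List.getElem_of_mem ht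
    rw [List.getElem_drop]
    refine decide_eq_true (hp _ _ ?_ h)
    rcases Nat.eq_zero_or_pos j with rfl | hj0
    · exact le_rfl
    · exact List.pairwise_iff_getElem.1 hs _ _ _ _ (by omega)
  calc m - m / 2 = (l.drop (m / 2)).countP (fun t => decide (p t)) := by
        rw [h1, List.length_drop, hlen]
    _ ≤ _ := (List.drop_sublist _ _).countP_le

lemma card_ge_of_median_of_down (hm : 0 < m) (p : ℝ → Prop) [DecidablePred p]
    (hp : ∀ s t, s ≤ t → p t → p s) (h : p (median a)) :
    m / 2 + 1 ≤ (Finset.univ.filter fun i => p (a i)).card := by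
  rw [card_filter_eq_countP]
  obtain ⟨hl, he⟩ := median_eq (a := a) hm
  rw [he] at h
  have hs := pairwise_sorted a
  have hlen : ((List.ofFn a).mergeSort (fun s t => decide (s ≤ t))).length = m := by simp
  generalize (List.ofFn a).mergeSort (fun s t => decide (s ≤ t)) = l at *
  have h1 : (l.take (m / 2 + 1)).countP (fun t => decide (p t)) =
      (l.take (m / 2 + 1)).length := by
    rw [List.countP_eq_length]
    intro t ht
    obtain ⟨j, hj, rfl⟩ := List.getElem_of_mem ht
    have hj' : j < m / 2 + 1 := by
      rw [List.length_take] at hj; omega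
    rw [List.getElem_take]
    refine decide_eq_true (hp _ _ ?_ h)
    rcases Nat.lt_succ_iff_lt_or_eq.1 hj' with h2 | rfl
    · exact List.pairwise_iff_getElem.1 hs _ _ _ _ h2
    · exact le_rfl
  calc m / 2 + 1 = (l.take (m / 2 + 1)).countP (fun t => decide (p t)) := by
        rw [h1, List.length_take, hlen]; omega
    _ ≤ _ := (List.take_sublist _ _).countP_le

lemma lt_median_iff (hm : 0 < m) (c : ℝ) :
    c < median a ↔ m - m / 2 ≤ (Finset.univ.filter fun i => c < a i).card := by
  refine ⟨fun h => card_ge_of_median_of_up hm (c < ·) (fun s t h1 h2 => h2.trans_le h1) h,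
    fun h => ?_⟩
  by_contra! hc
  have h1 := card_ge_of_median_of_down hm (· ≤ c) (fun s t h1 h2 => h1.trans h2) hc
  have h2 := Finset.card_filter_add_card_filter_not (s := (Finset.univ : Finset (Fin m)))
    (p := fun i => a i ≤ c)
  simp only [not_le, Finset.card_univ, Fintype.card_fin] at h2
  omega

lemma measurable_median (hm : 0 < m) : Measurable (median (m := m)) := by
  refine measurable_of_Ioi fun c => ?_
  have h : median (m := m) ⁻¹' Set.Ioi c =
      ⋃ I ∈ (Finset.univ.filter fun I : Finset (Fin m) => m - m / 2 ≤ I.card),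
        ⋂ i ∈ I, {a : Fin m → ℝ | c < a i} := by
    ext a
    simp only [Set.mem_preimage, Set.mem_Ioi, lt_median_iff hm, Set.mem_iUnion, Set.mem_iInter,
      Finset.mem_filter, Finset.mem_univ, true_and, exists_prop, Set.mem_ofPred_eq]
    constructor
    · intro h
      exact ⟨_, h, fun i hi => (Finset.mem_filter.1 hi).2⟩
    · rintro ⟨I, hI, hI2⟩
      exact hI.trans (Finset.card_le_card fun i hi => Finset.mem_filter.2 ⟨Finset.mem_univ _, hI2 i hi⟩)
  rw [h]
  exact Finset.measurableSet_biUnion _ fun I _ => Finset.measurableSet_biInter _ fun i _ =>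
    measurableSet_lt measurable_const (measurable_pi_apply i)

/-- If the median is far from `x`, then half of the numbers are far from `x`. -/
lemma card_far_of_median_far (hm : 0 < m) {x r : ℝ} (h : r < |median a - x|) :
    m ≤ 2 * (Finset.univ.filter fun i => r < |a i - x|).card := by
  rcases lt_abs.1 h with h1 | h1
  · have h2 := card_ge_of_median_of_up hm (fun t => r < t - x) (fun s t h1 h2 => by linarith) h1
    have h3 : (Finset.univ.filter fun i => r < a i - x).card ≤
        (Finset.univ.filter fun i => r < |a i - x|).card :=
      Finset.card_le_card fun i hi => by
        simp only [Finset.mem_filter, Finset.mem_univ, true_and] at hi ⊢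
        exact lt_abs.2 (Or.inl hi)
    omega
  · have h2 := card_ge_of_median_of_down hm (fun t => r < -(t - x)) (fun s t h1 h2 => by linarith) h1
    have h3 : (Finset.univ.filter fun i => r < -(a i - x)).card ≤
        (Finset.univ.filter fun i => r < |a i - x|).card :=
      Finset.card_le_card fun i hi => by
        simp only [Finset.mem_filter, Finset.mem_univ, true_and] at hi ⊢
        exact lt_abs.2 (Or.inr hi)
    omega

end Median

/-! ### Random signs and hash functions -/

section Signs

open Finset

variable {d : ℕ}

/-- The number `±1` that belongs to a sign. -/
def sg (b : Bool) : ℝ := if b then 1 else -1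

lemma sg_not (b : Bool) : sg (!b) = -sg b := by cases b <;> simp [sg]

lemma sg_mul_self (b : Bool) : sg b * sg b = 1 := by cases b <;> simp [sg]

lemma sum_eq_zero_of_flip (j : Fin d) {φ : (Fin d → Bool) → ℝ}
    (h : ∀ s, φ (Function.update s j (!s j)) = -φ s) : ∑ s, φ s = 0 := by
  have hinv : Function.Involutive fun s : Fin d → Bool => Function.update s j (!s j) := by
    intro s; ext i
    by_cases hi : i = j
    · subst hi; simp
    · simp [hi]
  have h1 := Equiv.sum_comp hinv.toPerm φ
  simp only [Function.Involutive.coe_toPerm, h, sum_neg_distrib] at h1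
  linarith

lemma sg_update_self (s : Fin d → Bool) (j : Fin d) :
    sg (Function.update s j (!s j) j) = -sg (s j) := by simp [sg_not]

lemma sg_update_of_ne (s : Fin d → Bool) {i j : Fin d} (h : i ≠ j) :
    sg (Function.update s j (!s j) i) = sg (s i) := by simp [h]

lemma sum_sg_two (i j : Fin d) :
    ∑ s : Fin d → Bool, sg (s i) * sg (s j) =
      if i = j then (Fintype.card (Fin d → Bool) : ℝ) else 0 := by
  split_ifs with h
  · subst h
    simp [sg_mul_self]
  · refine sum_eq_zero_of_flip j fun s => ?_
    rw [sg_update_self, sg_update_of_ne s h]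
    ring

lemma sum_sg_four {i j k l : Fin d} (hij : i ≠ j) (hkl : k ≠ l) :
    ∑ s : Fin d → Bool, sg (s i) * sg (s j) * (sg (s k) * sg (s l)) =
      Fintype.card (Fin d → Bool) *
        ((if k = i ∧ l = j then 1 else 0) + (if k = j ∧ l = i then 1 else 0)) := by
  by_cases h1 : k = i ∧ l = j
  · obtain ⟨rfl, rfl⟩ := h1
    have : ¬ (k = l ∧ l = k) := fun h => hij h.1
    rw [if_pos ⟨rfl, rfl⟩, if_neg this, add_zero, mul_one]
    have : ∀ s : Fin d → Bool, sg (s k) * sg (s l) * (sg (s k) * sg (s l)) = 1 := fun s => by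
      rw [mul_mul_mul_comm, sg_mul_self, sg_mul_self, one_mul]
    simp [this]
  by_cases h2 : k = j ∧ l = i
  · obtain ⟨rfl, rfl⟩ := h2
    rw [if_neg h1, if_pos ⟨rfl, rfl⟩, zero_add, mul_one]
    have : ∀ s : Fin d → Bool, sg (s l) * sg (s k) * (sg (s k) * sg (s l)) = 1 := fun s => by
      rw [mul_comm (sg (s k)) (sg (s l)), mul_mul_mul_comm, sg_mul_self, sg_mul_self, one_mul]
    simp [this]
  rw [if_neg h1, if_neg h2, add_zero, mul_zero]
  by_cases hi : i = k ∨ i = l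
  · have hjk : j ≠ k := by
      rintro rfl
      rcases hi with rfl | rfl
      · exact hij rfl
      · exact h2 ⟨rfl, rfl⟩
    have hjl : j ≠ l := by
      rintro rfl
      rcases hi with rfl | rfl
      · exact h1 ⟨rfl, rfl⟩
      · exact hij rfl
    refine sum_eq_zero_of_flip j fun s => ?_
    rw [sg_update_self, sg_update_of_ne s hij, sg_update_of_ne s hjk.symm,
      sg_update_of_ne s hjl.symm]
    ring
  · rw [not_or] at hi
    refine sum_eq_zero_of_flip i fun s => ?_
    rw [sg_update_self, sg_update_of_ne s hij.symm, sg_update_of_ne s (Ne.symm hi.1),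
      sg_update_of_ne s (Ne.symm hi.2)]
    ring

lemma sum_linear_sq (c : Fin d → ℝ) :
    ∑ s : Fin d → Bool, (∑ j, c j * sg (s j)) ^ 2 =
      Fintype.card (Fin d → Bool) * ∑ j, c j ^ 2 := by
  have h : ∀ s : Fin d → Bool, (∑ j, c j * sg (s j)) ^ 2 =
      ∑ i, ∑ j, c i * c j * (sg (s i) * sg (s j)) := by
    intro s
    rw [sq, sum_mul_sum]
    exact sum_congr rfl fun i _ => sum_congr rfl fun j _ => by ring
  simp only [h]
  rw [sum_comm, mul_sum]
  refine sum_congr rfl fun i _ => ?_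
  rw [sum_comm]
  simp only [← mul_sum, sum_sg_two, mul_ite, mul_zero, sum_ite_eq, mem_univ, if_true]
  ring

lemma sum_quadratic_sq (c : Fin d → Fin d → ℝ) (hsym : ∀ i j, c i j = c j i)
    (h0 : ∀ i, c i i = 0) :
    ∑ s : Fin d → Bool, (∑ i, ∑ j, c i j * (sg (s i) * sg (s j))) ^ 2 =
      Fintype.card (Fin d → Bool) * (2 * ∑ i, ∑ j, c i j ^ 2) := by
  have h : ∀ s : Fin d → Bool, (∑ i, ∑ j, c i j * (sg (s i) * sg (s j))) ^ 2 =
      ∑ i, ∑ j, ∑ k, ∑ l, c i j * c k l * (sg (s i) * sg (s j) * (sg (s k) * sg (s l))) := by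
    intro s
    rw [sq, sum_mul]
    refine sum_congr rfl fun i _ => ?_
    rw [sum_mul]
    refine sum_congr rfl fun j _ => ?_
    rw [mul_sum]
    refine sum_congr rfl fun k _ => ?_
    rw [mul_sum]
    exact sum_congr rfl fun l _ => by ring
  simp only [h]
  rw [sum_comm, mul_sum, mul_sum]
  refine sum_congr rfl fun i _ => ?_
  rw [sum_comm, mul_sum, mul_sum]
  refine sum_congr rfl fun j _ => ?_
  rw [sum_comm]
  have hkl : ∀ k l, ∑ s : Fin d → Bool,
      c i j * c k l * (sg (s i) * sg (s j) * (sg (s k) * sg (s l))) =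
      Fintype.card (Fin d → Bool) * (c i j * c k l) *
        ((if k = i ∧ l = j then 1 else 0) + (if k = j ∧ l = i then 1 else 0)) := by
    intro k l
    rw [← mul_sum]
    by_cases hij : i = j
    · subst hij; simp [h0]
    by_cases hk : k = l
    · subst hk; simp [h0]
    rw [sum_sg_four hij hk]
    ring
  have hk : ∀ k, ∑ s : Fin d → Bool, ∑ l,
      c i j * c k l * (sg (s i) * sg (s j) * (sg (s k) * sg (s l))) =
      ∑ l, Fintype.card (Fin d → Bool) * (c i j * c k l) *
        ((if k = i ∧ l = j then 1 else 0) + (if k = j ∧ l = i then 1 else 0)) := by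
    intro k
    rw [sum_comm]
    exact sum_congr rfl fun l _ => hkl k l
  simp only [hk, mul_add, sum_add_distrib, mul_ite, mul_one, mul_zero, ite_and,
    sum_ite_irrel, sum_const_zero, mem_univ, if_true, sum_ite_eq']
  rw [hsym j i]
  ring

variable {B : ℕ} [NeZero B]

lemma card_hash_eq {i j : Fin d} (h : j ≠ i) :
    (B : ℝ) * ∑ f : Fin d → Fin B, (if f j = f i then (1 : ℝ) else 0) =
      Fintype.card (Fin d → Fin B) := by
  have hshift : ∀ c : Fin B, ∑ f : Fin d → Fin B, (if f j = f i + c then (1 : ℝ) else 0) =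
      ∑ f : Fin d → Fin B, (if f j = f i then (1 : ℝ) else 0) := by
    intro c
    rw [← Equiv.sum_comp (Equiv.addRight (Pi.single j c : Fin d → Fin B))]
    refine sum_congr rfl fun f _ => ?_
    simp [h.symm]
  calc (B : ℝ) * ∑ f : Fin d → Fin B, (if f j = f i then (1 : ℝ) else 0)
      = ∑ c : Fin B, ∑ f : Fin d → Fin B, (if f j = f i + c then (1 : ℝ) else 0) := by
        rw [sum_congr rfl fun c _ => hshift c, sum_const, card_univ, Fintype.card_fin,
          nsmul_eq_mul]
    _ = ∑ f : Fin d → Fin B, ∑ c : Fin B, (if f j - f i = c then (1 : ℝ) else 0) := by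
        rw [sum_comm]
        simp only [sub_eq_iff_eq_add']
    _ = Fintype.card (Fin d → Fin B) := by simp

end Signs

/-! ### Rows of a Count Sketch -/

section Rows

open Finset

variable {d B : ℕ}

/-- The randomness of one row of a Count Sketch. -/
abbrev Row (d B : ℕ) : Type := (Fin d → Fin B) × (Fin d → Bool)

namespace Row

/-- The bucket `β` of the row. -/
def bucket (ρ : Row d B) (x : Vec d) (β : Fin B) : ℝ :=
  ∑ i, if ρ.1 i = β then sg (ρ.2 i) * x i else 0

/-- The estimate of a coordinate that is recovered from the row. -/
def est (ρ : Row d B) (x : Vec d) (i : Fin d) : ℝ := sg (ρ.2 i) * ρ.bucket x (ρ.1 i)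

/-- The estimate of the squared norm that is recovered from the row. -/
def normEst (ρ : Row d B) (x : Vec d) : ℝ := ∑ β, ρ.bucket x β ^ 2

lemma est_sub (f : Fin d → Fin B) (s : Fin d → Bool) (x : Vec d) (i : Fin d) :
    est (f, s) x i - x i =
      sg (s i) * ∑ j, (if j ≠ i ∧ f j = f i then x j else 0) * sg (s j) := by
  have h1 : ∑ j, (if f j = f i then sg (s j) * x j else 0) =
      sg (s i) * x i + ∑ j, (if j ≠ i ∧ f j = f i then x j else 0) * sg (s j) := by
    rw [← add_sum_erase _ _ (mem_univ i), ← add_sum_erase (a := i) univ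
      (fun j => (if j ≠ i ∧ f j = f i then x j else 0) * sg (s j)) (mem_univ i)]
    simp only [if_true, ne_eq, not_true_eq_false, false_and, if_false, zero_mul, zero_add]
    congr 1
    refine sum_congr rfl fun j hj => ?_
    have hji := (mem_erase.1 hj).1
    by_cases h : f j = f i
    · simp [h, hji, mul_comm]
    · simp [h]
  simp only [est, bucket]
  rw [h1, mul_add, ← mul_assoc, sg_mul_self]
  ring

lemma normEst_sub (f : Fin d → Fin B) (s : Fin d → Bool) (x : Vec d) :
    normEst (f, s) x - ‖x‖ ^ 2 =
      ∑ i, ∑ j, (if j ≠ i ∧ f j = f i then x i * x j else 0) * (sg (s i) * sg (s j)) := by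
  have h1 : normEst (f, s) x =
      ∑ i, ∑ j, (if f j = f i then x i * x j else 0) * (sg (s i) * sg (s j)) := by
    simp only [normEst, bucket, sq, sum_mul_sum]
    rw [sum_comm]
    refine sum_congr rfl fun i _ => ?_
    rw [sum_comm]
    refine sum_congr rfl fun j _ => ?_
    simp only [ite_mul, zero_mul, sum_ite_eq, mem_univ, if_true]
    split_ifs
    · ring
    · simp
  rw [h1, normSq_eq_sum, ← sum_sub_distrib]
  refine sum_congr rfl fun i _ => ?_
  rw [← add_sum_erase _ _ (mem_univ i), ← add_sum_erase (a := i) univ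
    (fun j => (if j ≠ i ∧ f j = f i then x i * x j else 0) * (sg (s i) * sg (s j))) (mem_univ i)]
  simp only [if_true, ne_eq, not_true_eq_false, false_and, if_false, zero_mul, zero_add,
    sg_mul_self]
  have : ∑ j ∈ univ.erase i, (if f j = f i then x i * x j else 0) * (sg (s i) * sg (s j)) =
      ∑ j ∈ univ.erase i, (if ¬ j = i ∧ f j = f i then x i * x j else 0) *
        (sg (s i) * sg (s j)) := by
    refine sum_congr rfl fun j hj => ?_
    have hji := (mem_erase.1 hj).1
    simp [hji]
  rw [this]
  ring

variable [NeZero B]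

lemma sum_hash_le (i : Fin d) {y : Fin d → ℝ} (hy : ∀ j, 0 ≤ y j) :
    B * ∑ f : Fin d → Fin B, ∑ j, (if j ≠ i ∧ f j = f i then y j else 0) ≤
      Fintype.card (Fin d → Fin B) * ∑ j, y j := by
  rw [sum_comm, mul_sum, mul_sum]
  refine sum_le_sum fun j _ => ?_
  by_cases hji : j = i
  · simp only [hji, ne_eq, not_true_eq_false, false_and, if_false, sum_const_zero, mul_zero]
    exact mul_nonneg (by positivity) (hy _)
  · have e : ∀ f : Fin d → Fin B, (if j ≠ i ∧ f j = f i then y j else 0) =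
        (if f j = f i then (1 : ℝ) else 0) * y j := fun f => by
      by_cases h : f j = f i <;> simp [h, hji]
    simp only [e]
    rw [← sum_mul, ← mul_assoc, card_hash_eq hji]

lemma sum_est_sq_le (x : Vec d) (i : Fin d) :
    B * ∑ ρ : Row d B, (ρ.est x i - x i) ^ 2 ≤ Fintype.card (Row d B) * ‖x‖ ^ 2 := by
  rw [Fintype.sum_prod_type, Fintype.card_prod]
  have h : ∀ f : Fin d → Fin B, ∑ s : Fin d → Bool, (est (f, s) x i - x i) ^ 2 =
      Fintype.card (Fin d → Bool) * ∑ j, (if j ≠ i ∧ f j = f i then x j ^ 2 else 0) := by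
    intro f
    have e : ∀ s : Fin d → Bool, (est (f, s) x i - x i) ^ 2 =
        (∑ j, (if j ≠ i ∧ f j = f i then x j else 0) * sg (s j)) ^ 2 := fun s => by
      rw [est_sub, mul_pow, sq (sg (s i)), sg_mul_self, one_mul]
    simp only [e]
    rw [sum_linear_sq]
    congr 1
    exact sum_congr rfl fun j _ => by split_ifs <;> simp
  simp only [h]
  rw [← mul_sum]
  have h1 := sum_hash_le (B := B) i (y := fun j => x j ^ 2) fun _ => sq_nonneg _
  rw [← normSq_eq_sum] at h1
  have h2 := mul_le_mul_of_nonneg_left h1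
    (by positivity : (0 : ℝ) ≤ Fintype.card (Fin d → Bool))
  push_cast
  linarith

lemma sum_normEst_sq_le (x : Vec d) :
    B * ∑ ρ : Row d B, (ρ.normEst x - ‖x‖ ^ 2) ^ 2 ≤
      Fintype.card (Row d B) * (2 * (‖x‖ ^ 2) ^ 2) := by
  rw [Fintype.sum_prod_type, Fintype.card_prod]
  have h : ∀ f : Fin d → Fin B, ∑ s : Fin d → Bool, (normEst (f, s) x - ‖x‖ ^ 2) ^ 2 =
      Fintype.card (Fin d → Bool) *
        (2 * ∑ i, ∑ j, (if j ≠ i ∧ f j = f i then x i ^ 2 * x j ^ 2 else 0)) := by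
    intro f
    simp only [normEst_sub]
    rw [sum_quadratic_sq]
    · congr 2
      refine sum_congr rfl fun i _ => sum_congr rfl fun j _ => ?_
      split_ifs
      · ring
      · simp
    · intro i j
      by_cases h : i = j
      · subst h; simp
      · by_cases h2 : f i = f j
        · simp [h, Ne.symm h, h2, mul_comm]
        · simp [h2, Ne.symm h2]
    · intro i; simp
  simp only [h]
  have h1 : ∀ i ∈ (univ : Finset (Fin d)), (B : ℝ) * ∑ f : Fin d → Fin B,
      ∑ j, (if j ≠ i ∧ f j = f i then x i ^ 2 * x j ^ 2 else 0) ≤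
      Fintype.card (Fin d → Fin B) * (x i ^ 2 * ‖x‖ ^ 2) := fun i _ => by
    refine (sum_hash_le (B := B) i (y := fun j => x i ^ 2 * x j ^ 2)
      fun _ => by positivity).trans (le_of_eq ?_)
    rw [← mul_sum, ← normSq_eq_sum]
  have h2 := sum_le_sum h1
  rw [← mul_sum, ← mul_sum, ← sum_mul, ← normSq_eq_sum, sum_comm] at h2
  have h3 := mul_le_mul_of_nonneg_left h2
    (by positivity : (0 : ℝ) ≤ Fintype.card (Fin d → Bool) * 2)
  rw [← mul_sum, ← mul_sum]
  push_cast
  linarith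

end Row

lemma card_mul_le_of_sum_sq {α : Type*} [Fintype α] {X : α → ℝ} {r c : ℝ} (hr : 0 ≤ r)
    (h : ∑ a, X a ^ 2 ≤ c) : ((univ.filter fun a => r < |X a|).card : ℝ) * r ^ 2 ≤ c := by
  refine le_trans ?_ h
  calc ((univ.filter fun a => r < |X a|).card : ℝ) * r ^ 2
      = ∑ a ∈ univ.filter fun a => r < |X a|, r ^ 2 := by rw [sum_const, nsmul_eq_mul]
    _ ≤ ∑ a ∈ univ.filter fun a => r < |X a|, X a ^ 2 := by
        refine sum_le_sum fun a ha => ?_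
        rw [← sq_abs (X a)]
        exact pow_le_pow_left₀ hr (mem_filter.1 ha).2.le 2
    _ ≤ ∑ a, X a ^ 2 := sum_le_sum_of_subset_of_nonneg (filter_subset _ _)
        fun _ _ _ => sq_nonneg _

/-- A rare event rarely happens in half of `m` independent trials. -/
lemma card_half_le {α : Type*} [Fintype α] [DecidableEq α] (E : α → Prop) [DecidablePred E]
    (hE : 64 * (univ.filter E).card ≤ Fintype.card α) (m : ℕ) :
    4 ^ m * (univ.filter fun ρ : Fin m → α =>
      m ≤ 2 * (univ.filter fun a => E (ρ a)).card).card ≤ Fintype.card (Fin m → α) := by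
  set w : α → ℕ := fun a => if E a then 64 else 1 with hw
  have h1 : ∑ a, w a ≤ 2 * Fintype.card α := by
    have : ∀ a, w a ≤ 64 * (if E a then 1 else 0) + 1 := fun a => by
      simp only [hw]; split_ifs <;> norm_num
    calc ∑ a, w a ≤ ∑ a, (64 * (if E a then 1 else 0) + 1) := sum_le_sum fun a _ => this a
      _ = 64 * (univ.filter E).card + Fintype.card α := by
        rw [sum_add_distrib, ← mul_sum, sum_boole]; simp
      _ ≤ 2 * Fintype.card α := by omega
  have h2 : ∑ ρ : Fin m → α, ∏ a, w (ρ a) ≤ 2 ^ m * Fintype.card (Fin m → α) := by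
    have := Finset.prod_univ_sum (fun _ : Fin m => (univ : Finset α)) (fun _ a => w a)
    rw [Fintype.piFinset_univ] at this
    rw [← this, prod_const, card_univ, Fintype.card_fin, Fintype.card_fun, Fintype.card_fin,
      ← mul_pow]
    exact Nat.pow_le_pow_left h1 m
  have h3 : 8 ^ m * (univ.filter fun ρ : Fin m → α =>
      m ≤ 2 * (univ.filter fun a => E (ρ a)).card).card ≤ ∑ ρ : Fin m → α, ∏ a, w (ρ a) := by
    rw [mul_comm, ← smul_eq_mul, ← sum_const]
    refine (sum_le_sum fun ρ hρ => ?_).trans (sum_le_sum_of_subset (filter_subset _ _))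
    have hcount := (mem_filter.1 hρ).2
    have : ∏ a, w (ρ a) = 64 ^ (univ.filter fun a => E (ρ a)).card := by
      simp only [hw, prod_ite, prod_const, one_pow, mul_one]
    rw [this, show 64 = 8 ^ 2 by norm_num, ← pow_mul]
    exact Nat.pow_le_pow_right (by norm_num) hcount
  have h4 := h3.trans h2
  rw [show 8 = 2 * 4 by norm_num, mul_pow, mul_assoc] at h4
  exact Nat.le_of_mul_le_mul_left h4 (by positivity)

end Rows

/-! ### Keeping heavy coordinates -/

section Keep

open Finset

variable {d k : ℕ}

/-- The position of `i` when `H` is listed before its complement, either in the order `π`. -/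
def position (H : Finset (Fin d)) (π : Equiv.Perm (Fin d)) (i : Fin d) : ℕ :=
  if i ∈ H then place H π i else H.card + place Hᶜ π i

lemma sum_kept_ge (H : Finset (Fin d)) (hk : 1 ≤ k) (hkd : k ≤ d) {y : Fin d → ℝ}
    (hy : ∀ i, 0 ≤ y i) {s : ℝ} (hs : s = ∑ i, y i) (hH : ∀ i ∈ H, s / 4 ≤ k * y i) :
    k / (8 * d) * s * Fintype.card (Equiv.Perm (Fin d)) ≤
      ∑ π : Equiv.Perm (Fin d), ∑ i, (if position H π i < k then y i else 0) := by
  have hk0 : (0 : ℝ) < k := by exact_mod_cast hk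
  have hd0 : (0 : ℝ) < d := by exact_mod_cast (by omega : 0 < d)
  have hkd' : (k : ℝ) ≤ d := by exact_mod_cast hkd
  have hs0 : 0 ≤ s := hs ▸ sum_nonneg fun i _ => hy i
  set n := Fintype.card (Equiv.Perm (Fin d)) with hn
  have hswap : ∑ π : Equiv.Perm (Fin d), ∑ i, (if position H π i < k then y i else 0) =
      ∑ i, ((univ.filter fun π : Equiv.Perm (Fin d) => position H π i < k).card : ℝ) * y i := by
    rw [sum_comm]
    refine sum_congr rfl fun i _ => ?_
    rw [← sum_filter, sum_const, nsmul_eq_mul]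
  rw [hswap]
  rcases le_or_gt (2 * H.card) k with hle | hgt
  · have hall : ∀ i, k / (2 * d) * n ≤
        ((univ.filter fun π : Equiv.Perm (Fin d) => position H π i < k).card : ℝ) := by
      intro i
      by_cases hi : i ∈ H
      · have : (univ.filter fun π : Equiv.Perm (Fin d) => position H π i < k) = univ := by
          refine filter_true_of_mem fun π _ => ?_
          rw [position, if_pos hi]
          have := place_lt (π := π) hi
          omega
        rw [this, card_univ, ← hn]
        refine mul_le_of_le_one_left (by positivity) ?_
        rw [div_le_one (by positivity)]
        linarith
      · have h1 := card_mul_card_place_lt (mem_compl.2 hi) (k - H.card)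
        have h2 : (univ.filter fun π : Equiv.Perm (Fin d) => position H π i < k) =
            univ.filter fun π : Equiv.Perm (Fin d) => place Hᶜ π i < k - H.card := by
          refine filter_congr fun π _ => ?_
          rw [position, if_neg hi]
          omega
        rw [h2]
        rw [card_compl, Fintype.card_fin, min_eq_left (by omega), ← hn] at h1
        set N := (univ.filter fun π : Equiv.Perm (Fin d) => place Hᶜ π i < k - H.card).card
        have h3 : k * n ≤ 2 * (d * N) :=
          calc k * n ≤ 2 * (k - H.card) * n := by gcongr; omega
            _ = 2 * ((d - H.card) * N) := by rw [h1]; ring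
            _ ≤ 2 * (d * N) := by gcongr; omega
        have h4 : (k : ℝ) * n ≤ 2 * (d * N) := by exact_mod_cast h3
        rw [div_mul_eq_mul_div, div_le_iff₀ (by positivity)]
        linarith
    calc k / (8 * d) * s * n ≤ k / (2 * d) * s * n := by gcongr; norm_num
      _ = ∑ i, k / (2 * d) * n * y i := by rw [← mul_sum, ← hs]; ring
      _ ≤ _ := sum_le_sum fun i _ => mul_le_mul_of_nonneg_right (hall i) (hy i)
  · have hH0 : (0 : ℝ) < H.card := by exact_mod_cast (by omega : 0 < H.card)
    have hall : ∀ i ∈ H, s / (8 * H.card) * n ≤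
        ((univ.filter fun π : Equiv.Perm (Fin d) => position H π i < k).card : ℝ) * y i := by
      intro i hi
      have h1 := card_mul_card_place_lt hi k
      have h2 : (univ.filter fun π : Equiv.Perm (Fin d) => position H π i < k) =
          univ.filter fun π : Equiv.Perm (Fin d) => place H π i < k := by
        refine filter_congr fun π _ => ?_
        rw [position, if_pos hi]
      rw [h2]
      rw [← hn] at h1
      set N := (univ.filter fun π : Equiv.Perm (Fin d) => place H π i < k).card
      have h3 : k * n ≤ 2 * (H.card * N) := by
        rw [h1, ← mul_assoc]
        gcongr
        omega
      have h4 : (k : ℝ) * n ≤ 2 * (H.card * N) := by exact_mod_cast h3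
      rw [div_mul_eq_mul_div, div_le_iff₀ (by positivity)]
      refine le_of_mul_le_mul_left ?_ hk0
      calc k * (s * n) = k * n * s := by ring
        _ ≤ 2 * (H.card * N) * s := by gcongr
        _ = 8 * (H.card * N) * (s / 4) := by ring
        _ ≤ 8 * (H.card * N) * (k * y i) := by gcongr; exact hH i hi
        _ = k * (N * y i * (8 * H.card)) := by ring
    have h8 : (k : ℝ) / (8 * d) ≤ 1 / 8 := by
      rw [div_le_div_iff₀ (by positivity) (by norm_num)]
      linarith
    calc k / (8 * d) * s * n ≤ 1 / 8 * s * n :=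
          mul_le_mul_of_nonneg_right (mul_le_mul_of_nonneg_right h8 hs0) (by positivity)
      _ = ∑ i ∈ H, s / (8 * H.card) * n := by
          rw [sum_const, nsmul_eq_mul]
          field_simp
      _ ≤ ∑ i ∈ H, _ := sum_le_sum hall
      _ ≤ _ := sum_le_sum_of_subset_of_nonneg (subset_univ _)
          fun i _ _ => mul_nonneg (by positivity) (hy i)

end Keep

/-! ### Sketch-based TopK -/

section Position

open Finset

variable {d : ℕ} (H : Finset (Fin d)) (π : Equiv.Perm (Fin d))

lemma position_injective : Function.Injective (position H π) := by
  intro i j h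
  by_cases hi : i ∈ H <;> by_cases hj : j ∈ H <;> simp only [position, hi, hj, if_true, if_false] at h
  · exact place_injOn H π hi hj h
  · have := place_lt (π := π) hi
    omega
  · have := place_lt (π := π) hj
    omega
  · exact place_injOn Hᶜ π (by simpa using hi) (by simpa using hj) (by omega)

end Position

namespace SketchSeed

variable {d k m B : ℕ}

open Classical in
/-- The set of coordinates that are recognized as heavy. -/
noncomputable def heavySet (s : SketchSeed d m B) (k : ℕ) (S : Fin m → Fin B → ℝ) :
    Finset (Fin d) :=
  Finset.univ.filter (s.Heavy k S)

lemma rank_eq (s : SketchSeed d m B) (S : Fin m → Fin B → ℝ) (i : Fin d) :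
    s.rank k S i = position (s.heavySet k S) s.order i := by
  classical
  unfold rank position
  have hmem : ∀ j, j ∈ s.heavySet k S ↔ s.Heavy k S j := fun j => by simp [heavySet]
  by_cases hi : s.Heavy k S i
  · rw [if_pos ((hmem i).2 hi), place]
    congr 1
    ext j
    simp [hmem, hi]
  · rw [if_neg (fun h => hi ((hmem i).1 h)), place, ← Finset.card_union_of_disjoint]
    · congr 1
      ext j
      simp [hmem, hi]
    · rw [Finset.disjoint_left]
      intro j h1 h2
      exact (Finset.mem_compl.1 (Finset.mem_filter.1 h2).1) h1

lemma rank_injective (s : SketchSeed d m B) (S : Fin m → Fin B → ℝ) :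
    Function.Injective (s.rank k S) := by
  intro i j h
  rw [rank_eq, rank_eq] at h
  exact position_injective _ _ h

/-- A seed consists of independent rows and a random order. -/
def equivRows (d m B : ℕ) :
    SketchSeed d m B ≃ (Fin m → Row d B) × Equiv.Perm (Fin d) where
  toFun s := (fun a => (s.hash a, s.sign a), s.order)
  invFun p := ⟨fun a => (p.1 a).1, fun a => (p.1 a).2, p.2⟩
  left_inv _ := rfl
  right_inv _ := rfl

lemma measurable_sketch (s : SketchSeed d m B) (a : Fin m) (β : Fin B) :
    Measurable fun x : Vec d => s.sketch x a β := by
  unfold sketch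
  refine Finset.measurable_sum _ fun i _ => ?_
  split_ifs <;> fun_prop

lemma measurableSet_heavy (hm : 0 < m) (s : SketchSeed d m B) (j : Fin d) :
    MeasurableSet {x : Vec d | s.Heavy k (s.sketch x) j} := by
  unfold Heavy
  refine measurableSet_le (Measurable.div_const ?_ _) (Measurable.pow_const ?_ _)
  · exact (measurable_median hm).comp (measurable_pi_lambda _ fun a =>
      Finset.measurable_sum _ fun β _ => (s.measurable_sketch a β).pow_const 2)
  · exact (measurable_median hm).comp (measurable_pi_lambda _ fun a =>
      (s.measurable_sketch a _).const_mul _)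

lemma measurable_rank (hm : 0 < m) (s : SketchSeed d m B) (i : Fin d) :
    Measurable fun x : Vec d => s.rank k (s.sketch x) i := by
  classical
  unfold rank
  simp only [Finset.card_filter]
  refine Finset.measurable_sum _ fun j _ => Measurable.ite ?_ measurable_const measurable_const
  have hj := s.measurableSet_heavy (k := k) hm j
  have hi := s.measurableSet_heavy (k := k) hm i
  refine (hj.inter hi.compl).union (MeasurableSet.inter ?_ (MeasurableSet.const _))
  have : {x : Vec d | s.Heavy k (s.sketch x) j ↔ s.Heavy k (s.sketch x) i} =
      ({x : Vec d | s.Heavy k (s.sketch x) j} ∩ {x : Vec d | s.Heavy k (s.sketch x) i}) ∪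
      ({x : Vec d | s.Heavy k (s.sketch x) j}ᶜ ∩ {x : Vec d | s.Heavy k (s.sketch x) i}ᶜ) := by
    ext x
    simp only [Set.mem_ofPred_eq, Set.mem_union, Set.mem_inter_iff, Set.mem_compl_iff]
    tauto
  have h := (hj.inter hi).union (hj.compl.inter hi.compl)
  rwa [← this] at h

end SketchSeed

section SketchTopK

open Finset

variable {d k m B : ℕ}

/-- The rows give a bad estimate of a coordinate or of the norm. -/
def BadRows (k : ℕ) (x : Vec d) (ρ : Fin m → Row d B) : Prop :=
  (∃ i, ‖x‖ / (5 * √k) < |median (fun a => (ρ a).est x i) - x i|) ∨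
    ‖x‖ ^ 2 / 2 < |median (fun a => (ρ a).normEst x) - ‖x‖ ^ 2|

lemma heavy_of_not_badRows (hk : 1 ≤ k) {x : Vec d} {s : SketchSeed d m B}
    (hg : ¬ BadRows k x (SketchSeed.equivRows d m B s).1) {i : Fin d}
    (hi : s.Heavy k (s.sketch x) i) : ‖x‖ ^ 2 / 4 ≤ k * x i ^ 2 := by
  have hk0 : (0 : ℝ) < k := by exact_mod_cast hk
  have hg' : (∀ i, |s.estimate (s.sketch x) i - x i| ≤ ‖x‖ / (5 * √k)) ∧
      |SketchSeed.normSqEstimate (s.sketch x) - ‖x‖ ^ 2| ≤ ‖x‖ ^ 2 / 2 := by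
    rw [BadRows, not_or, not_exists] at hg
    exact ⟨fun i => not_lt.1 (hg.1 i), not_lt.1 hg.2⟩
  unfold SketchSeed.Heavy at hi
  have h1 := (abs_le.1 hg'.2).1
  have h2 := hg'.1 i
  set N := SketchSeed.normSqEstimate (s.sketch x)
  set e := s.estimate (s.sketch x) i
  set t := ‖x‖ / √k with ht
  have ht0 : 0 ≤ t := by positivity
  have htk : k * t ^ 2 = ‖x‖ ^ 2 := by
    rw [ht, div_pow, Real.sq_sqrt hk0.le, mul_div_cancel₀ _ hk0.ne']
  have h3 : t ^ 2 / 2 ≤ e ^ 2 := by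
    refine le_trans ?_ hi
    rw [le_div_iff₀ hk0]
    linarith
  have h4 : |e - x i| ≤ t / 5 := by
    refine h2.trans (le_of_eq ?_)
    rw [ht]
    field_simp
  rw [← htk]
  have h5 : t ^ 2 / 4 ≤ x i ^ 2 := by
    by_contra! hlt
    have h6 : |x i| < t / 2 := abs_lt_of_sq_lt_sq (by linarith) (by positivity)
    have h7 : |e| ≤ |e - x i| + |x i| := by
      simpa using abs_add_le (e - x i) (x i)
    have h8 : |e| ≤ 7 / 10 * t := by linarith
    have h9 : |e| ^ 2 ≤ (7 / 10 * t) ^ 2 := pow_le_pow_left₀ (abs_nonneg _) h8 2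
    rw [sq_abs] at h9
    nlinarith [sq_nonneg (x i), sq_nonneg t]
  calc k * t ^ 2 / 4 = k * (t ^ 2 / 4) := by ring
    _ ≤ k * x i ^ 2 := by gcongr

variable [NeZero B]

lemma sketchTopK_cost (hk : k ≤ d) (x : Vec d) (s : (sketchTopK d k m B).Seed) :
    (sketchTopK d k m B).cost x s = m * B + k := by
  simp [Compressor.cost, sketchTopK, hk]

lemma sketchTopK_apply (hk : k ≤ d) (x : Vec d) (s : SketchSeed d m B) (i : Fin d) :
    (sketchTopK d k m B).apply x s i = if s.rank k (s.sketch x) i < k then x i else 0 := by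
  unfold Compressor.apply sketchTopK
  simp only
  set l₁ := List.ofFn (fun q : Fin (m * B) =>
      s.sketch x (finProdFinEquiv.symm q).1 (finProdFinEquiv.symm q).2) with hl
  set l₂ := ((List.finRange d).take k).map (fun r : Fin d =>
      ∑ i, if s.rank k (s.sketch x) i = (r : ℕ) then x i else 0) with hl2
  have hlen : l₁.length = m * B := by simp [hl]
  have hread : SketchSeed.readSketch m B (l₁ ++ l₂) = s.sketch x := by
    funext a β
    unfold SketchSeed.readSketch
    rw [List.getD_append _ _ _ _ (by rw [hlen]; exact Fin.is_lt _),
      List.getD_eq_getElem _ _ (by rw [hlen]; exact Fin.is_lt _)]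
    simp only [hl, List.getElem_ofFn, Fin.eta, Equiv.symm_apply_apply]
  rw [hread, List.drop_left' hlen]
  split_ifs with h
  · rw [List.getD_eq_getElem _ _ (by simp [hl2]; omega)]
    simp only [hl2, List.getElem_map, List.getElem_take, List.getElem_finRange, Fin.val_cast]
    rw [Finset.sum_eq_single i]
    · simp
    · intro j _ hji
      rw [if_neg fun h => hji (s.rank_injective _ h)]
    · simp
  · rw [List.getD_eq_default _ _ (by simp [hl2]; omega)]

lemma sketchTopK_isMeasurable (hm : 0 < m) (hk : k ≤ d) :
    (sketchTopK d k m B).IsMeasurable := by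
  have : Countable (sketchTopK d k m B).Seed := inferInstanceAs (Countable (SketchSeed d m B))
  have : DiscreteMeasurableSpace (sketchTopK d k m B).Seed :=
    ⟨fun _ => MeasurableSpace.measurableSet_top⟩
  refine measurable_from_prod_countable_left fun s => ?_
  have : (fun x : Vec d => (sketchTopK d k m B).apply x s) = fun x => WithLp.toLp 2
      (fun i => if SketchSeed.rank s k (SketchSeed.sketch s x) i < k then x i else 0) := by
    funext x
    ext i
    exact sketchTopK_apply hk x s i
  rw [this]
  refine (PiLp.continuous_toLp 2 _).measurable.comp (measurable_pi_lambda _ fun i => ?_)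
  exact Measurable.ite (measurableSet_lt (SketchSeed.measurable_rank hm s i) measurable_const)
    (by fun_prop) measurable_const

lemma card_far_le (hm : 0 < m) {φ : Row d B → ℝ} {x r c : ℝ} (hr : 0 < r) (hB : 0 < B)
    (h : B * ∑ ρ : Row d B, (φ ρ - x) ^ 2 ≤ Fintype.card (Row d B) * c)
    (hc : 64 * c ≤ B * r ^ 2) :
    4 ^ m * (univ.filter fun ρ : Fin m → Row d B =>
      r < |median (fun a => φ (ρ a)) - x|).card ≤ Fintype.card (Fin m → Row d B) := by
  classical
  have hB0 : (0 : ℝ) < B := by exact_mod_cast hB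
  refine le_trans ?_ (card_half_le (fun ρ => r < |φ ρ - x|) ?_ m)
  · refine Nat.mul_le_mul_left _ (card_le_card fun ρ hρ => ?_)
    exact mem_filter.2 ⟨mem_univ _, card_far_of_median_far hm (mem_filter.1 hρ).2⟩
  · have h1 := card_mul_le_of_sum_sq (X := fun ρ => φ ρ - x) hr.le le_rfl
    have h2 : (B : ℝ) * (((univ.filter fun ρ => r < |φ ρ - x|).card : ℝ) * r ^ 2) ≤
        Fintype.card (Row d B) * c := (mul_le_mul_of_nonneg_left h1 hB0.le).trans h
    have h3 : (64 * ((univ.filter fun ρ => r < |φ ρ - x|).card : ℝ)) * (B * r ^ 2) ≤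
        Fintype.card (Row d B) * (B * r ^ 2) := by
      calc _ = 64 * ((B : ℝ) * (((univ.filter fun ρ => r < |φ ρ - x|).card : ℝ) * r ^ 2)) := by
            ring
        _ ≤ 64 * (Fintype.card (Row d B) * c) := by linarith
        _ = Fintype.card (Row d B) * (64 * c) := by ring
        _ ≤ _ := by gcongr
    exact_mod_cast le_of_mul_le_mul_right h3 (by positivity)

open Classical in
lemma card_badRows_le (hk : 1 ≤ k) (hB : 1600 * k ≤ B) (hm : 2 * (d + 1) ≤ 4 ^ m)
    {x : Vec d} (hx : x ≠ 0) :
    2 * (univ.filter fun ρ : Fin m → Row d B => BadRows k x ρ).card ≤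
      Fintype.card (Fin m → Row d B) := by
  have hk0 : (0 : ℝ) < k := by exact_mod_cast hk
  have hBk : 1600 * (k : ℝ) ≤ B := by exact_mod_cast hB
  have hk1 : (1 : ℝ) ≤ k := by exact_mod_cast hk
  have hB0 : 0 < B := by omega
  have hm0 : 0 < m := by
    rcases Nat.eq_zero_or_pos m with rfl | h
    · simp at hm; omega
    · exact h
  have hx0 : 0 < ‖x‖ := norm_pos_iff.2 hx
  have h1 : ∀ i : Fin d, 4 ^ m * (univ.filter fun ρ : Fin m → Row d B =>
      ‖x‖ / (5 * √k) < |median (fun a => (ρ a).est x i) - x i|).card ≤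
      Fintype.card (Fin m → Row d B) := fun i => by
    refine card_far_le (φ := fun ρ => ρ.est x i) hm0 (by positivity) hB0
      (Row.sum_est_sq_le x i) ?_
    rw [div_pow, mul_pow, Real.sq_sqrt hk0.le, mul_div_assoc', le_div_iff₀ (by positivity)]
    nlinarith [sq_nonneg ‖x‖]
  have h2 : 4 ^ m * (univ.filter fun ρ : Fin m → Row d B =>
      ‖x‖ ^ 2 / 2 < |median (fun a => (ρ a).normEst x) - ‖x‖ ^ 2|).card ≤
      Fintype.card (Fin m → Row d B) := by
    refine card_far_le (φ := fun ρ => ρ.normEst x) hm0 (by positivity) hB0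
      (Row.sum_normEst_sq_le x) ?_
    nlinarith [sq_nonneg (‖x‖ ^ 2)]
  have h3 : (univ.filter fun ρ : Fin m → Row d B => BadRows k x ρ).card ≤
      ∑ i, (univ.filter fun ρ : Fin m → Row d B =>
        ‖x‖ / (5 * √k) < |median (fun a => (ρ a).est x i) - x i|).card +
      (univ.filter fun ρ : Fin m → Row d B =>
        ‖x‖ ^ 2 / 2 < |median (fun a => (ρ a).normEst x) - ‖x‖ ^ 2|).card := by
    refine le_trans ?_ (add_le_add_left card_biUnion_le _)
    refine le_trans (card_le_card fun ρ hρ => ?_) (card_union_le _ _)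
    rcases (mem_filter.1 hρ).2 with ⟨i, hi⟩ | hn
    · exact mem_union_left _ (mem_biUnion.2 ⟨i, mem_univ _, mem_filter.2 ⟨mem_univ _, hi⟩⟩)
    · exact mem_union_right _ (mem_filter.2 ⟨mem_univ _, hn⟩)
  have h4 : 4 ^ m * (univ.filter fun ρ : Fin m → Row d B => BadRows k x ρ).card ≤
      (d + 1) * Fintype.card (Fin m → Row d B) := by
    refine (Nat.mul_le_mul_left _ h3).trans ?_
    rw [mul_add, mul_sum, add_mul, one_mul]
    refine add_le_add ((sum_le_sum fun i _ => h1 i).trans ?_) h2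
    simp
  have h5 := Nat.mul_le_mul_right (univ.filter fun ρ : Fin m → Row d B => BadRows k x ρ).card hm
  have h6 : (d + 1) * (2 * (univ.filter fun ρ : Fin m → Row d B => BadRows k x ρ).card) ≤
      (d + 1) * Fintype.card (Fin m → Row d B) := by
    refine le_trans (le_of_eq ?_) (h5.trans h4)
    ring
  exact Nat.le_of_mul_le_mul_left h6 (by omega)

lemma bd_sketchTopK (hk : 1 ≤ k) (hkd : k ≤ d) (hB : 1600 * k ≤ B) (hm : 2 * (d + 1) ≤ 4 ^ m)
    (x : Vec d) :
    Bd (sketchTopK d k m B).law (fun s => ‖x - (sketchTopK d k m B).apply x s‖ ^ 2)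
      ((1 - k / (16 * d)) * ‖x‖ ^ 2) := by
  classical
  have hd0 : (0 : ℝ) < d := by exact_mod_cast (by omega : 0 < d)
  refine bd_uniform (α := SketchSeed d m B) ?_
  have hterm : ∀ s : SketchSeed d m B, ‖x - (sketchTopK d k m B).apply x s‖ ^ 2 =
      ‖x‖ ^ 2 - ∑ i, (if s.rank k (s.sketch x) i < k then x i ^ 2 else 0) := by
    intro s
    rw [normSq_eq_sum, normSq_eq_sum, ← sum_sub_distrib]
    refine sum_congr rfl fun i _ => ?_
    rw [PiLp.sub_apply, sketchTopK_apply hkd]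
    split_ifs <;> ring
  simp only [hterm]
  rw [sum_sub_distrib, sum_const, card_univ, nsmul_eq_mul]
  suffices h : k / (16 * d) * ‖x‖ ^ 2 * Fintype.card (SketchSeed d m B) ≤
      ∑ s : SketchSeed d m B, ∑ i, (if s.rank k (s.sketch x) i < k then x i ^ 2 else 0) by
    linarith
  by_cases hx : x = 0
  · subst hx; simp
  rw [Fintype.card_congr (SketchSeed.equivRows d m B), Fintype.card_prod,
    ← (SketchSeed.equivRows d m B).symm.sum_comp, Fintype.sum_prod_type]
  set good := univ.filter fun ρ : Fin m → Row d B => ¬ BadRows k x ρ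
  have hgood : (Fintype.card (Fin m → Row d B) : ℝ) ≤ 2 * good.card := by
    have h1 := card_badRows_le hk hB hm hx
    have h2 := Finset.card_filter_add_card_filter_not (s := (univ : Finset (Fin m → Row d B)))
      (p := fun ρ => BadRows k x ρ)
    rw [card_univ] at h2
    have h3 : Fintype.card (Fin m → Row d B) ≤ 2 * good.card := by
      change _ + good.card = _ at h2
      omega
    exact_mod_cast h3
  have hin : ∀ ρ ∈ good, k / (8 * d) * ‖x‖ ^ 2 * Fintype.card (Equiv.Perm (Fin d)) ≤
      ∑ π : Equiv.Perm (Fin d), ∑ i,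
        (if ((SketchSeed.equivRows d m B).symm (ρ, π)).rank k
          (((SketchSeed.equivRows d m B).symm (ρ, π)).sketch x) i < k then x i ^ 2 else 0) := by
    intro ρ hρ
    set s₀ := (SketchSeed.equivRows d m B).symm (ρ, 1)
    refine (sum_kept_ge (s₀.heavySet k (s₀.sketch x)) hk hkd (fun i => sq_nonneg (x i))
      (normSq_eq_sum x) fun i hi => ?_).trans (le_of_eq ?_)
    · refine heavy_of_not_badRows (s := s₀) hk ?_ (by simpa [SketchSeed.heavySet] using hi)
      exact (mem_filter.1 hρ).2
    · refine sum_congr rfl fun π _ => sum_congr rfl fun i _ => ?_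
      rw [SketchSeed.rank_eq]
      rfl
  push_cast
  calc k / (16 * d) * ‖x‖ ^ 2 *
        (Fintype.card (Fin m → Row d B) * Fintype.card (Equiv.Perm (Fin d)))
      ≤ k / (16 * d) * ‖x‖ ^ 2 * (2 * good.card * Fintype.card (Equiv.Perm (Fin d))) := by
        gcongr
    _ = ∑ ρ ∈ good, k / (8 * d) * ‖x‖ ^ 2 * Fintype.card (Equiv.Perm (Fin d)) := by
        rw [sum_const, nsmul_eq_mul]
        field_simp
        ring
    _ ≤ _ := sum_le_sum hin
    _ ≤ _ := sum_le_sum_of_subset_of_nonneg (subset_univ _) fun ρ _ _ =>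
        sum_nonneg fun π _ => sum_nonneg fun i _ => by split_ifs <;> positivity

lemma two_mul_succ_le_four_pow {d m : ℕ} (hd : 1 ≤ d) (hm : 1600 * (1 + Real.log d) ≤ m) :
    2 * (d + 1) ≤ 4 ^ m := by
  have hd1 : (1 : ℝ) ≤ d := by exact_mod_cast hd
  have hlog := Real.log_nonneg hd1
  have he : (2 : ℝ) ≤ Real.exp 1 := by linarith [Real.add_one_le_exp (1 : ℝ)]
  have h1 : (4 : ℝ) * d ≤ 4 ^ m := by
    calc (4 : ℝ) * d ≤ Real.exp 1 * Real.exp 1 * d := by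
          gcongr; nlinarith
      _ = Real.exp (1 + 1 + Real.log d) := by
          rw [Real.exp_add, Real.exp_add, Real.exp_log (by linarith)]
      _ ≤ Real.exp m := Real.exp_le_exp.2 (by linarith)
      _ = Real.exp 1 ^ m := by rw [← Real.exp_nat_mul, mul_one]
      _ ≤ 4 ^ m := by
          gcongr
          linarith [Real.exp_one_lt_d9]
  have h2 : (2 * ((d : ℝ) + 1)) ≤ 4 ^ m := by linarith
  exact_mod_cast h2

end SketchTopK

/-! ### Problems as settings -/

lemma enorm_sq_eq_ofReal {E : Type*} [SeminormedAddCommGroup E] (v : E) :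
    ‖v‖ₑ ^ 2 = ENNReal.ofReal (‖v‖ ^ 2) := by
  rw [ENNReal.ofReal_pow (norm_nonneg _), ofReal_norm]

lemma gradient_sub_const {d : ℕ} (f : Vec d → ℝ) (c : ℝ) :
    gradient (fun x => f x - c) = gradient f := by
  funext x
  simp only [gradient, fderiv_sub_const]

lemma Compressor.CompressesAt.bd {d : ℕ} {C : Compressor.{v, w} d} {μ : ℝ} {x : Vec d}
    (hC : C.IsMeasurable) (hμ : μ ≤ 1) (h : C.CompressesAt μ x) :
    Bd C.law (fun s => ‖x - C.apply x s‖ ^ 2) ((1 - μ) * ‖x‖ ^ 2) := by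
  have h1 : 0 ≤ 1 - μ := by linarith
  refine Bd.of_lintegral ?_ (fun s => sq_nonneg _) (by positivity) ?_
  · have : Measurable fun s => C.apply x s := hC.comp measurable_prodMk_left
    fun_prop
  · unfold CompressesAt at h
    rw [enorm_sq_eq_ofReal, ← ENNReal.ofReal_mul h1] at h
    simpa only [enorm_sq_eq_ofReal] using h

/-- All constants of the problem are bounded by `U`. -/
structure Bounded (lip : Bool) (fmax L ρ σ ℓ U : ℝ) : Prop where
  fmax_nonneg : 0 ≤ fmax
  L_nonneg : 0 ≤ L
  ρ_pos : 0 < ρ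
  σ_nonneg : 0 ≤ σ
  ℓ_nonneg : 0 ≤ ℓ
  size_le : problemSize lip fmax L ρ σ ℓ ≤ U

namespace Bounded

variable {lip : Bool} {fmax L ρ σ ℓ U : ℝ} (h : Bounded lip fmax L ρ σ ℓ U)

include h

lemma le : 1 + fmax + L + ρ + ρ⁻¹ + σ ≤ U := by
  have h1 := h.size_le
  have h2 := h.ℓ_nonneg
  unfold problemSize at h1
  split_ifs at h1 <;> linarith

lemma inv_ρ_pos : 0 < ρ⁻¹ := _root_.inv_pos.2 h.ρ_pos

lemma one_le : 1 ≤ U := by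
  linarith [h.le, h.fmax_nonneg, h.L_nonneg, h.ρ_pos, h.σ_nonneg, h.inv_ρ_pos]

lemma fmax_le : fmax ≤ U := by
  linarith [h.le, h.fmax_nonneg, h.L_nonneg, h.ρ_pos, h.σ_nonneg, h.inv_ρ_pos]

lemma L_le : L ≤ U := by
  linarith [h.le, h.fmax_nonneg, h.L_nonneg, h.ρ_pos, h.σ_nonneg, h.inv_ρ_pos]

lemma ρ_le : ρ ≤ U := by
  linarith [h.le, h.fmax_nonneg, h.L_nonneg, h.ρ_pos, h.σ_nonneg, h.inv_ρ_pos]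

lemma σ_le : σ ≤ U := by
  linarith [h.le, h.fmax_nonneg, h.L_nonneg, h.ρ_pos, h.σ_nonneg, h.inv_ρ_pos]

lemma ρ_ge : 1 ≤ U * ρ := by
  have h1 : ρ⁻¹ ≤ U := by
    linarith [h.le, h.fmax_nonneg, h.L_nonneg, h.ρ_pos, h.σ_nonneg, h.inv_ρ_pos]
  rwa [inv_le_iff_one_le_mul₀ h.ρ_pos] at h1

lemma ℓ_add_L_le (hlip : lip = true) : ℓ + L ≤ U := by
  have h1 := h.size_le
  rw [problemSize, if_pos hlip] at h1
  linarith [h.fmax_nonneg, h.L_nonneg, h.ρ_pos, h.σ_nonneg, h.inv_ρ_pos]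

end Bounded

section OfProblem

variable {d : ℕ} {Θ : Type u} [MeasurableSpace Θ] {D : Measure Θ} {g : Vec d → Θ → Vec d}
  {f : Vec d → ℝ} {lip : Bool} {fmax L ρ σ ℓ U : ℝ}

namespace IsProblem

variable (hp : IsProblem D g f lip fmax L ρ σ ℓ)

include hp

lemma bddBelow : BddBelow (Set.range f) :=
  ⟨f 0 - fmax, by
    rintro _ ⟨x, rfl⟩
    linarith [(abs_le.1 (hp.1.bounded 0 x)).2]⟩

lemma sub_iInf_nonneg (x : Vec d) : 0 ≤ f x - ⨅ y, f y :=
  sub_nonneg.2 (ciInf_le hp.bddBelow x)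

lemma sub_iInf_le (x : Vec d) : f x - ⨅ y, f y ≤ fmax := by
  have : f x - fmax ≤ ⨅ y, f y := le_ciInf fun y => by
    linarith [(abs_le.1 (hp.1.bounded x y)).2]
  linarith

lemma smooth_of_le (hL : L ≤ U) (x y : Vec d) :
    ‖gradient f x - gradient f y‖ ≤ U * ‖x - y‖ :=
  (hp.1.smooth x y).trans (by gcongr)

lemma bd_variance (x : Vec d) : Bd D (fun θ => ‖g x θ - gradient f x‖ ^ 2) (σ ^ 2) := by
  refine Bd.of_lintegral ?_ (fun _ => sq_nonneg _) (sq_nonneg _) ?_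
  · have : Measurable fun θ => g x θ := hp.2.1.measurable.comp measurable_prodMk_left
    fun_prop
  · simpa only [enorm_sq_eq_ofReal] using hp.2.1.variance x

lemma bd_increment [IsProbabilityMeasure D] (x y : Vec d) :
    Bd D (fun θ => ‖(g x θ - gradient f x) - (g y θ - gradient f y)‖ ^ 2)
      ((if lip then (ℓ + L) ^ 2 else 0) * ‖x - y‖ ^ 2 + (if lip then 0 else 4 * σ ^ 2)) := by
  have hx : Measurable fun θ => g x θ := hp.2.1.measurable.comp measurable_prodMk_left
  have hy : Measurable fun θ => g y θ := hp.2.1.measurable.comp measurable_prodMk_left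
  cases hl : lip with
  | true =>
    refine (Bd.const ((ℓ + L) ^ 2 * ‖x - y‖ ^ 2)).mono (by fun_prop) (fun _ => sq_nonneg _)
      (fun θ => ?_) (by simp)
    rw [← mul_pow]
    refine pow_le_pow_left₀ (norm_nonneg _) ?_ 2
    rw [sub_sub_sub_comm, add_mul]
    exact (norm_sub_le _ _).trans (add_le_add (hp.2.2 hl x y θ) (hp.1.smooth x y))
  | false =>
    refine (((hp.bd_variance x).const_mul (k := 2) (by norm_num)).add
      ((hp.bd_variance y).const_mul (k := 2) (by norm_num))).mono (by fun_prop)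
      (fun _ => sq_nonneg _) (fun θ => norm_sub_sq_le_two _ _) ?_
    simp
    linarith

end IsProblem

/-- The setting in which a problem is treated with the compression map `comp`. -/
noncomputable def IsProblem.setting [IsProbabilityMeasure D]
    (hp : IsProblem D g f lip fmax L ρ σ ℓ) (hb : Bounded lip fmax L ρ σ ℓ U) (hd : 1 ≤ d)
    {Z : Type v} [MeasurableSpace Z] (Q : Measure Z) [IsProbabilityMeasure Q]
    {comp : Vec d → Z → Vec d} (hm : Measurable fun p : Vec d × Z => comp p.1 p.2)
    {μ : ℝ} (hμ0 : 0 < μ) (hμ1 : μ ≤ 1)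
    (hc : ∀ x, Bd Q (fun s => ‖x - comp x s‖ ^ 2) ((1 - μ) * ‖x‖ ^ 2))
    {η : ℝ} (hη : 0 < η) (hηU : η * U ≤ 1) (r : ℝ) (rst : ℕ → Bool) : Setting d Θ Z where
  f x := f x - ⨅ y, f y
  g := g
  comp := comp
  D := D
  Q := Q
  probD := inferInstance
  probQ := inferInstance
  η := η
  r := r
  μ := μ
  L := U
  ρ := ρ
  fmax := fmax
  G := 4 * U * fmax
  s := σ ^ 2
  n := if lip then (ℓ + L) ^ 2 else 0
  τ := if lip then 0 else 4 * σ ^ 2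
  rst := rst
  hd := hd
  hη := hη
  hμ := hμ0
  hμ1 := hμ1
  hL := by linarith [hb.one_le]
  hρ := hb.ρ_pos.le
  hηL := hηU
  hG := by have := hb.one_le; have := hb.fmax_nonneg; positivity
  hs := sq_nonneg _
  hn := by split_ifs <;> positivity
  hτ := by split_ifs <;> positivity
  contDiff := hp.1.contDiff.sub contDiff_const
  f_nonneg := hp.sub_iInf_nonneg
  f_le := hp.sub_iInf_le
  smooth := by
    rw [gradient_sub_const]
    exact hp.smooth_of_le hb.L_le
  hessLip := by
    unfold hessian
    rw [gradient_sub_const]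
    exact hp.1.hessianLipschitz
  gradBound := by
    rw [gradient_sub_const]
    exact gradient_normSq_le hp.1.contDiff (by linarith [hb.one_le]) hp.1.bounded
      (hp.smooth_of_le hb.L_le)
  measurable_g := hp.2.1.measurable
  integrable_g := hp.2.1.integrable
  unbiased := by
    rw [gradient_sub_const]
    exact hp.2.1.unbiased
  variance := by
    rw [gradient_sub_const]
    exact hp.bd_variance
  increment := by
    rw [gradient_sub_const]
    exact hp.bd_increment
  measurable_comp := hm
  compress := hc

/-- The parameters of the algorithm, when errors are reset every `P` steps or never. -/
noncomputable def tunedParams (U D η q : ℝ) (P : ℕ) (reset : Bool) : Params where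
  η := η
  T := (⌈U ^ 20 / (η * P * q ^ 4)⌉₊ + 2) * P
  r := √D * U ^ 2
  resetError := reset
  I := P - 1
  R := 1 + 4 * ((⌈U ^ 20 / (η * P * q ^ 4)⌉₊ + 2) * P : ℕ) *
    (3 * ((1 + ((⌈U ^ 20 / (η * P * q ^ 4)⌉₊ + 2) * P : ℕ)) * η ^ 2 *
      (((⌈U ^ 20 / (η * P * q ^ 4)⌉₊ + 2) * P : ℕ) * (4 * U ^ 2)) +
        ((⌈U ^ 20 / (η * P * q ^ 4)⌉₊ + 2) * P : ℕ) * (η ^ 2 * (2 * (D * U ^ 4))))) * U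

/-- The relations between the size `U` of the constants, the step size `η`, the quality `μ` of
the compressor and the accuracy `ε = q²` under which the algorithm converges. -/
structure Tuned (lip : Bool) (d : ℕ) (U D η q μ : ℝ) (P : ℕ) : Prop where
  U_ge : 2 ^ 20 ≤ U
  q_pos : 0 < q
  q_le : q ≤ 1
  D_eq : D = if lip then 1 else (d : ℝ)
  P_pos : 1 ≤ P
  d_pos : 1 ≤ d
  η_pos : 0 < η
  μ_pos : 0 < μ
  μ_le : μ ≤ 1
  step_noise : η * D * U ^ 40 ≤ q ^ 4
  step_err : η * P * U ^ 40 ≤ q * μ ^ 2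
  step_ge : q ^ 4 ≤ η * d * U ^ 42
  exp_ge : (d : ℝ) ^ 3 * U ^ 84 ≤ q ^ 8 * Real.exp (U / 2)

namespace Tuned

variable {D' η q μ : ℝ} {P : ℕ} (t : Tuned lip d U D' η q μ P)

include t

lemma one_le_d : (1 : ℝ) ≤ d := by exact_mod_cast t.d_pos

lemma D_ge : 1 ≤ D' := by
  rw [t.D_eq]
  split_ifs
  · exact le_rfl
  · exact t.one_le_d

lemma eta_mul_le : η * U ≤ 1 := by
  have hU : 1 ≤ U := by linarith [t.U_ge]
  have hη := t.η_pos
  calc η * U = η * 1 * U ^ 1 := by ring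
    _ ≤ η * D' * U ^ 40 :=
        mul_le_mul (mul_le_mul_of_nonneg_left t.D_ge hη.le) (pow_le_pow_right₀ hU (by norm_num))
          (by positivity) (mul_nonneg hη.le (by linarith [t.D_ge]))
    _ ≤ q ^ 4 := t.step_noise
    _ ≤ 1 := pow_le_one₀ t.q_pos.le t.q_le

lemma T_le (reset : Bool) : ((tunedParams U D' η q P reset).T : ℝ) * (η * q ^ 4) ≤ U ^ 21 := by
  have hU := t.U_ge
  have hη := t.η_pos
  have hq := t.q_pos
  have hP : (0 : ℝ) < P := by exact_mod_cast t.P_pos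
  have hc := (Nat.ceil_lt_add_one (by positivity : 0 ≤ U ^ 20 / (η * P * q ^ 4))).le
  have h1 : (η * P) ≤ 1 := by
    have hU1 : (1 : ℝ) ≤ U ^ 40 := one_le_pow₀ (by linarith)
    calc η * P = η * P * 1 := by ring
      _ ≤ η * P * U ^ 40 := by gcongr
      _ ≤ q * μ ^ 2 := t.step_err
      _ ≤ 1 * 1 := by
          gcongr
          · exact t.q_le
          · exact pow_le_one₀ t.μ_pos.le t.μ_le
      _ = 1 := by ring
  have hq4 : q ^ 4 ≤ 1 := pow_le_one₀ t.q_pos.le t.q_le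
  have hU20 : (1 : ℝ) ≤ U ^ 20 := one_le_pow₀ (by linarith)
  simp only [tunedParams]
  push_cast
  calc ((⌈U ^ 20 / (η * P * q ^ 4)⌉₊ : ℝ) + 2) * P * (η * q ^ 4)
      ≤ (U ^ 20 / (η * P * q ^ 4) + 1 + 2) * P * (η * q ^ 4) := by gcongr
    _ = U ^ 20 + 3 * (η * P * q ^ 4) := by field_simp; ring
    _ ≤ U ^ 20 + 3 * (1 * 1) := by gcongr
    _ ≤ 4 * U ^ 20 := by linarith
    _ ≤ U * U ^ 20 := by gcongr; linarith
    _ = U ^ 21 := by ring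

variable [IsProbabilityMeasure D]

lemma converges {C : Compressor.{v, w} d} (hp : IsProblem D g f lip fmax L ρ σ ℓ)
    (hb : Bounded lip fmax L ρ σ ℓ U) {comp : Vec d → C.Seed → Vec d}
    (hm : Measurable fun p : Vec d × C.Seed => comp p.1 p.2)
    (hc : ∀ x, Bd C.law (fun s => ‖x - comp x s‖ ^ 2) ((1 - μ) * ‖x‖ ^ 2))
    {reset : Bool}
    (hkind : (reset = true ∧ P = d) ∨ (reset = false ∧ P = 1 ∧
      ∀ x y s, comp (x - y) s = comp x s - comp y s)) (x₀ : Vec d) {m δ comm : ℝ}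
    (hcomp : ∀ᵐ ω ∂(sampleLaw (tunedParams U D' η q P reset) C D),
      ∀ i < (tunedParams U D' η q P reset).T,
      C.apply (inputAt (tunedParams U D' η q P reset) C g x₀ ω i) (ω i).2.2 =
        comp (inputAt (tunedParams U D' η q P reset) C g x₀ ω i) (ω i).2.2 ∧
        (C.cost (inputAt (tunedParams U D' η q P reset) C g x₀ ω i) (ω i).2.2 : ℝ) ≤ m)
    (hcomm : (tunedParams U D' η q P reset).T * m +
      (if reset then ((tunedParams U D' η q P reset).T : ℝ) else 0) ≤ comm) (hδ : 21 / U ≤ δ) :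
    Converges (tunedParams U D' η q P reset) C g D f ρ (q ^ 2) x₀ δ comm := by
  have hU := t.U_ge
  have hq := t.q_pos
  have hη := t.η_pos
  have hP : (0 : ℝ) < P := by exact_mod_cast t.P_pos
  have hD := t.D_ge
  have hd := t.one_le_d
  have hσ : σ ^ 2 ≤ U ^ 2 := pow_le_pow_left₀ hb.σ_nonneg hb.σ_le 2
  set S := hp.setting hb t.d_pos C.law hm t.μ_pos t.μ_le hc hη t.eta_mul_le
    (√D' * U ^ 2) (fun i => reset && decide (P ∣ i)) with hS
  have hr2 : S.r ^ 2 = D' * U ^ 4 := by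
    change (√D' * U ^ 2) ^ 2 = _
    rw [mul_pow, Real.sq_sqrt (by linarith)]
    ring
  have R : S.Regime P U D' q :=
    { U_ge := hU
      q_pos := hq
      q_le := t.q_le
      D_ge := hD
      P_pos := t.P_pos
      L_eq := rfl
      fmax_le := hb.fmax_le
      ρ_le := hb.ρ_le
      ρ_ge := hb.ρ_ge
      G_le := by
        change 4 * U * fmax ≤ 4 * U ^ 2
        nlinarith [hb.fmax_le]
      s_le := hσ
      r_sq := hr2
      n_le := by
        change (if lip then (ℓ + L) ^ 2 else 0) ≤ U ^ 2
        split_ifs with hl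
        · exact pow_le_pow_left₀ (add_nonneg hb.ℓ_nonneg hb.L_nonneg) (hb.ℓ_add_L_le hl) 2
        · positivity
      τ_le := by
        rw [hr2]
        change 64 * (if lip then 0 else 4 * σ ^ 2) ≤ D' * U ^ 4 / d
        split_ifs with hl
        · rw [mul_zero]
          have : 0 < D' := by linarith
          positivity
        · have hDd : D' = d := by rw [t.D_eq, if_neg hl]
          rw [hDd, mul_div_cancel_left₀ _ (by positivity)]
          have h1 : (256 : ℝ) ≤ U ^ 2 := by nlinarith
          nlinarith [mul_le_mul_of_nonneg_right h1 (sq_nonneg U)]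
      step_noise := t.step_noise
      step_err := t.step_err
      step_ge := t.step_ge
      exp_ge := t.exp_ge
      periodic := fun i => by
        change (reset && decide (P ∣ i + P)) = (reset && decide (P ∣ i))
        simp
      kind := by
        rcases hkind with ⟨-, h⟩ | ⟨h, -, hl⟩
        · exact Or.inl h.ge
        · refine Or.inr ⟨fun i => ?_, hl⟩
          change (reset && decide (P ∣ i)) = false
          simp [h] }
  refine Setting.converges_of_regime R (A := tunedParams U D' η q P reset)
    (n := ⌈U ^ 20 / (η * P * q ^ 4)⌉₊ + 2) rfl rfl rfl (gradient_sub_const f _) rfl (by omega) ?_ ?_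
    x₀ hcomp hcomm hδ
  · have h1 := Nat.le_ceil (U ^ 20 / (η * P * q ^ 4))
    rw [div_le_iff₀ (by positivity)] at h1
    change U ^ 20 ≤ ((⌈U ^ 20 / (η * P * q ^ 4)⌉₊ + 2 : ℕ) : ℝ) * P * η * q ^ 4
    push_cast
    have : 0 ≤ η * P * q ^ 4 := by positivity
    linarith
  · rcases hkind with ⟨h, h2⟩ | ⟨h, h2, -⟩
    · refine Setting.Schedule.periodic h h2 rfl (fun i => ?_) rfl
      change (reset && decide (P ∣ i)) = decide (P ∣ i)
      simp [h]
    · refine Setting.Schedule.never h h2 fun i => ?_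
      change (reset && decide (P ∣ i)) = false
      simp [h]

end Tuned

end OfProblem

/-! ### The choice of the parameters -/

lemma pow_le_exp_quarter {U : ℝ} (hU : 2 ^ 20 ≤ U) : U ^ 84 ≤ Real.exp (U / 4) := by
  have hU0 : 0 < U := by linarith
  have hs : (2 : ℝ) ^ 10 ≤ √U := Real.le_sqrt_of_sq_le (by norm_num at hU ⊢; linarith)
  have h1 : Real.log U ≤ 2 * √U := by
    have h2 := Real.log_le_sub_one_of_pos (Real.sqrt_pos.2 hU0)
    rw [Real.log_sqrt hU0.le] at h2
    linarith
  have h3 : 84 * Real.log U ≤ U / 4 := by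
    have h4 := Real.mul_self_sqrt hU0.le
    nlinarith
  calc U ^ 84 = Real.exp (84 * Real.log U) := by
        rw [show (84 : ℝ) = ((84 : ℕ) : ℝ) by norm_num, Real.exp_nat_mul, Real.exp_log hU0]
    _ ≤ _ := Real.exp_le_exp.2 h3

lemma dim_pow_le_exp {d : ℕ} {ε U : ℝ} (hd : 1 ≤ d) (hε : 0 < ε)
    (hU : 2 ^ 20 ≤ U) (hlog : 16 * Real.log (d / ε) ≤ U) :
    (d : ℝ) ^ 3 * U ^ 84 ≤ ε ^ 4 * Real.exp (U / 2) := by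
  have hd1 : (1 : ℝ) ≤ d := by exact_mod_cast hd
  have h1 : (d / ε) ^ 4 ≤ Real.exp (U / 4) := by
    calc (d / ε) ^ 4 = Real.exp (4 * Real.log (d / ε)) := by
          rw [show (4 : ℝ) = ((4 : ℕ) : ℝ) by norm_num, Real.exp_nat_mul,
            Real.exp_log (by positivity)]
      _ ≤ _ := Real.exp_le_exp.2 (by linarith)
  calc (d : ℝ) ^ 3 * U ^ 84 ≤ d ^ 4 * U ^ 84 := by
        have := pow_le_pow_right₀ hd1 (by norm_num : 3 ≤ 4)
        have : (0 : ℝ) ≤ U ^ 84 := by positivity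
        gcongr
    _ = ε ^ 4 * ((d / ε) ^ 4 * U ^ 84) := by field_simp
    _ ≤ ε ^ 4 * (Real.exp (U / 4) * Real.exp (U / 4)) := by
        gcongr
        exact pow_le_exp_quarter hU
    _ = ε ^ 4 * Real.exp (U / 2) := by rw [← Real.exp_add]; ring_nf

section Tuning

variable {lip : Bool} {d k P : ℕ} {U D q μ c : ℝ}

/-- The step size for a compressor whose quality matches the accuracy. -/
lemma tuned_of_quality (hU : 2 ^ 20 ≤ U) (hq : 0 < q) (hq1 : q ≤ 1)
    (hD : D = if lip then 1 else (d : ℝ)) (hP : 1 ≤ P) (hd : 1 ≤ d) (hμ : 0 < μ) (hμ1 : μ ≤ 1)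
    (hexp : (d : ℝ) ^ 3 * U ^ 84 ≤ q ^ 8 * Real.exp (U / 2))
    (hPq : P * q ^ 3 ≤ 256 * (μ ^ 2 * D)) :
    Tuned lip d U D (q ^ 4 / (D * U ^ 41)) q μ P := by
  have hd1 : (1 : ℝ) ≤ d := by exact_mod_cast hd
  have hD1 : 1 ≤ D := by rw [hD]; split_ifs <;> linarith
  have hDd : D ≤ d := by rw [hD]; split_ifs <;> linarith
  have hD0 : 0 < D := by linarith
  have hU0 : 0 < U := by linarith
  refine ⟨hU, hq, hq1, hD, hP, hd, by positivity, hμ, hμ1, ?_, ?_, ?_, hexp⟩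
  · have e : q ^ 4 / (D * U ^ 41) * D * U ^ 40 = q ^ 4 / U := by field_simp
    rw [e]
    exact div_le_self (by positivity) (by linarith)
  · have e : q ^ 4 / (D * U ^ 41) * P * U ^ 40 = q * (P * q ^ 3) / (D * U) := by field_simp
    rw [e, div_le_iff₀ (by positivity)]
    calc q * (P * q ^ 3) ≤ q * (256 * (μ ^ 2 * D)) := by gcongr
      _ = q * μ ^ 2 * D * 256 := by ring
      _ ≤ q * μ ^ 2 * D * U := by gcongr; linarith
      _ = q * μ ^ 2 * (D * U) := by ring
  · have e : q ^ 4 / (D * U ^ 41) * d * U ^ 42 = q ^ 4 * (d * U / D) := by field_simp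
    rw [e]
    refine le_mul_of_one_le_right (by positivity) ?_
    rw [le_div_iff₀ hD0]
    nlinarith

/-- The step size for a constant compressor. -/
lemma tuned_of_constant (hU : 2 ^ 20 ≤ U) (hq : 0 < q) (hq1 : q ≤ 1)
    (hD : D = if lip then 1 else (d : ℝ)) (hd : 1 ≤ d) (hc : 0 < c) (hc1 : c ≤ 1)
    (hcU : c⁻¹ ≤ U) (hexp : (d : ℝ) ^ 3 * U ^ 84 ≤ q ^ 8 * Real.exp (U / 2)) :
    Tuned lip d U D (min (q ^ 4 / D) (q * c ^ 2 / d) / U ^ 40) q c d := by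
  have hd1 : (1 : ℝ) ≤ d := by exact_mod_cast hd
  have hD1 : 1 ≤ D := by rw [hD]; split_ifs <;> linarith
  have hDd : D ≤ d := by rw [hD]; split_ifs <;> linarith
  have hD0 : 0 < D := by linarith
  have hU0 : 0 < U := by linarith
  have hcU' : 1 ≤ c * U := by
    rw [inv_le_iff_one_le_mul₀ hc] at hcU
    linarith
  refine ⟨hU, hq, hq1, hD, hd, hd, by positivity, hc, hc1, ?_, ?_, ?_, hexp⟩
  · have e : min (q ^ 4 / D) (q * c ^ 2 / d) / U ^ 40 * D * U ^ 40 =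
        min (q ^ 4 / D) (q * c ^ 2 / d) * D := by field_simp
    rw [e, ← le_div_iff₀ hD0]
    exact min_le_left _ _
  · have e : min (q ^ 4 / D) (q * c ^ 2 / d) / U ^ 40 * d * U ^ 40 =
        min (q ^ 4 / D) (q * c ^ 2 / d) * d := by field_simp
    rw [e, ← le_div_iff₀ (by positivity)]
    exact min_le_right _ _
  · have e : min (q ^ 4 / D) (q * c ^ 2 / d) / U ^ 40 * d * U ^ 42 =
        min (q ^ 4 / D) (q * c ^ 2 / d) * (d * U ^ 2) := by field_simp
    have hU2 : 1 ≤ U ^ 2 := one_le_pow₀ (by linarith)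
    rw [e, ← div_le_iff₀ (by positivity), le_min_iff]
    constructor
    · gcongr
      nlinarith
    · rw [div_le_div_iff₀ (by positivity) (by positivity)]
      have h1 : q ^ 4 ≤ q := by
        have := pow_le_of_le_one hq.le hq1 (by norm_num : 4 ≠ 0)
        exact this
      have h2 : 1 ≤ (c * U) ^ 2 := one_le_pow₀ hcU'
      calc q ^ 4 * d ≤ q * d * 1 := by rw [mul_one]; gcongr
        _ ≤ q * d * (c * U) ^ 2 := by gcongr
        _ = q * c ^ 2 * (d * U ^ 2) := by ring

lemma Tuned.T_le_of_quality (t : Tuned lip d U D (q ^ 4 / (D * U ^ 41)) q μ P) (reset : Bool) :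
    ((tunedParams U D (q ^ 4 / (D * U ^ 41)) q P reset).T : ℝ) ≤ U ^ 62 * (D / (q ^ 2) ^ 4) := by
  have h := t.T_le reset
  have hU0 : 0 < U := by linarith [t.U_ge]
  have hD0 : 0 < D := by linarith [t.D_ge]
  have hq := t.q_pos
  rw [← le_div_iff₀ (mul_pos t.η_pos (by positivity))] at h
  refine h.trans (le_of_eq ?_)
  field_simp

lemma Tuned.T_le_of_constant
    (t : Tuned lip d U D (min (q ^ 4 / D) (q * c ^ 2 / d) / U ^ 40) q c d) (hcU : c⁻¹ ≤ U)
    (reset : Bool) :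
    ((tunedParams U D (min (q ^ 4 / D) (q * c ^ 2 / d) / U ^ 40) q d reset).T : ℝ) ≤
      2 * U ^ 63 * (if lip then 1 / (q ^ 2) ^ 4 + d / ((q ^ 2) ^ 2 * q) else d / (q ^ 2) ^ 4) := by
  have h := t.T_le reset
  have hU1 : 1 ≤ U := by linarith [t.U_ge]
  have hD0 : 0 < D := by linarith [t.D_ge]
  have hq := t.q_pos
  have hc := t.μ_pos
  have hd := t.one_le_d
  rw [← le_div_iff₀ (mul_pos t.η_pos (by positivity))] at h
  have hmin : 1 / min (q ^ 4 / D) (q * c ^ 2 / d) ≤ D / q ^ 4 + d / (q * c ^ 2) := by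
    rcases min_choice (q ^ 4 / D) (q * c ^ 2 / d) with h1 | h1 <;> rw [h1, one_div_div]
    · have : 0 ≤ d / (q * c ^ 2) := by positivity
      linarith
    · have : 0 ≤ D / q ^ 4 := by positivity
      linarith
  have hc2 : (c⁻¹) ^ 2 ≤ U ^ 2 := pow_le_pow_left₀ (by positivity) hcU 2
  have hU2 : 1 ≤ U ^ 2 := one_le_pow₀ hU1
  have h2 : U ^ 21 / (min (q ^ 4 / D) (q * c ^ 2 / d) / U ^ 40 * q ^ 4) ≤
      U ^ 63 * (D / (q ^ 2) ^ 4 + d / ((q ^ 2) ^ 2 * q)) := by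
    calc U ^ 21 / (min (q ^ 4 / D) (q * c ^ 2 / d) / U ^ 40 * q ^ 4)
        = U ^ 61 / q ^ 4 * (1 / min (q ^ 4 / D) (q * c ^ 2 / d)) := by field_simp
      _ ≤ U ^ 61 / q ^ 4 * (D / q ^ 4 + d / (q * c ^ 2)) := by gcongr
      _ = U ^ 61 * (D / (q ^ 2) ^ 4 * 1 + d / ((q ^ 2) ^ 2 * q) * c⁻¹ ^ 2) := by field_simp
      _ ≤ U ^ 61 * (D / (q ^ 2) ^ 4 * U ^ 2 + d / ((q ^ 2) ^ 2 * q) * U ^ 2) := by gcongr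
      _ = _ := by ring
  refine (h.trans h2).trans ?_
  have hD := t.D_eq
  split_ifs at hD ⊢ with hl
  · rw [hD]
    have : 0 ≤ U ^ 63 * (1 / (q ^ 2) ^ 4 + d / ((q ^ 2) ^ 2 * q)) := by positivity
    linarith
  · rw [hD]
    have h3 : d / ((q ^ 2) ^ 2 * q) ≤ d / (q ^ 2) ^ 4 := by
      gcongr
      calc (q ^ 2) ^ 4 = (q ^ 2) ^ 2 * q * q ^ 3 := by ring
        _ ≤ (q ^ 2) ^ 2 * q * 1 := by gcongr; exact pow_le_one₀ hq.le t.q_le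
        _ = _ := by ring
    calc U ^ 63 * (d / (q ^ 2) ^ 4 + d / ((q ^ 2) ^ 2 * q))
        ≤ U ^ 63 * (d / (q ^ 2) ^ 4 + d / (q ^ 2) ^ 4) := by gcongr
      _ = _ := by ring

end Tuning

/-! ### Powers of the accuracy -/

lemma rpow_three_quarters_sq {ε : ℝ} (hε : 0 < ε) : (ε ^ (3 / 4 : ℝ)) ^ 2 = √ε ^ 3 := by
  rw [Real.sqrt_eq_rpow, ← Real.rpow_natCast, ← Real.rpow_natCast, ← Real.rpow_mul hε.le,
    ← Real.rpow_mul hε.le]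
  norm_num

lemma rpow_three_quarters_div {ε : ℝ} (hε : 0 < ε) :
    ε ^ (3 / 4 : ℝ) / ε ^ 4 = 1 / ε ^ (3 + 1 / 4 : ℝ) := by
  rw [div_eq_div_iff (by positivity) (by positivity), one_mul, ← Real.rpow_natCast ε 4,
    ← Real.rpow_add hε]
  norm_num

lemma natCeil_le_two_mul {x : ℝ} (hx : 1 ≤ x) : (⌈x⌉₊ : ℝ) ≤ 2 * x := by
  have := (Nat.ceil_lt_add_one (by linarith : 0 ≤ x)).le
  linarith

section Parts

variable {lip : Bool} {d : ℕ} {ε fmax L ρ σ ℓ U Dim δ : ℝ} {Θ : Type u} [MeasurableSpace Θ]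
  {D : Measure Θ} [IsProbabilityMeasure D] {g : Vec d → Θ → Vec d} {f : Vec d → ℝ}

/-- The number `U` is large in comparison with all other quantities. -/
structure Dominates (δ : ℝ) (d : ℕ) (ε U : ℝ) : Prop where
  ge : 2 ^ 20 ≤ U
  δ_le : 21 / U ≤ δ
  exp_ge : (d : ℝ) ^ 3 * U ^ 84 ≤ √ε ^ 8 * Real.exp (U / 2)

/-- The parameters for a compressor whose quality matches the accuracy. -/
noncomputable def qualityParams (U Dim ε : ℝ) (P : ℕ) (reset : Bool) : Params :=
  tunedParams U Dim (√ε ^ 4 / (Dim * U ^ 41)) √ε P reset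

lemma T_le_soft_of_quality {μ : ℝ} {P : ℕ}
    (t : Tuned lip d U Dim (√ε ^ 4 / (Dim * U ^ 41)) √ε μ P) (hε : 0 < ε) (reset : Bool) :
    ((qualityParams U Dim ε P reset).T : ℝ) ≤
      U ^ 64 * (if lip then 1 / ε ^ 4 else d / ε ^ 4) := by
  have h := t.T_le_of_quality reset
  rw [Real.sq_sqrt hε.le] at h
  have hU1 : 1 ≤ U := by linarith [t.U_ge]
  have hD := t.D_ge
  have e : Dim / ε ^ 4 = if lip then 1 / ε ^ 4 else d / ε ^ 4 := by
    rw [t.D_eq]; split_ifs <;> rfl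
  rw [← e]
  refine h.trans ?_
  gcongr
  norm_num

lemma tuned_topK (hU : Dominates δ d ε U) (hDim : Dim = if lip then 1 else (d : ℝ))
    (hd : 1 ≤ d) (hε : 0 < ε) (hε1 : ε ≤ 1) {μ : ℝ} {k : ℕ}
    (hμ : μ = if lip then √d * ε ^ (3 / 4 : ℝ) else ε ^ (3 / 4 : ℝ)) (hμd : 1 ≤ d * μ)
    (hμ1 : μ ≤ 1) (hk : k = ⌈d * μ⌉₊) :
    Tuned lip d U Dim (√ε ^ 4 / (Dim * U ^ 41)) √ε (k / (16 * d)) d := by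
  have hd1 : (1 : ℝ) ≤ d := by exact_mod_cast hd
  have hw := rpow_three_quarters_sq hε
  have hk1 : d * μ ≤ k := hk ▸ Nat.le_ceil _
  have hkd : (k : ℝ) ≤ d := by
    have : k ≤ d := hk ▸ Nat.ceil_le.2 (by nlinarith)
    exact_mod_cast this
  have hk0 : (1 : ℝ) ≤ k := hμd.trans hk1
  have hμ0 : 0 < μ := by
    by_contra! h
    nlinarith
  have hDim1 : 1 ≤ Dim := by rw [hDim]; split_ifs <;> linarith
  refine tuned_of_quality hU.ge (by positivity) (Real.sqrt_le_one.2 hε1) hDim hd hd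
    (by positivity) ?_ hU.exp_ge ?_
  · rw [div_le_one (by positivity)]
    linarith
  · have h1 : μ / 16 ≤ k / (16 * d) := by
      rw [div_le_div_iff₀ (by norm_num) (by positivity)]
      linarith
    have h2 : (d : ℝ) * √ε ^ 3 = μ ^ 2 * Dim := by
      rw [hμ, hDim, ← hw]
      split_ifs
      · rw [mul_pow, Real.sq_sqrt (by linarith)]
        ring
      · ring
    calc (d : ℝ) * √ε ^ 3 = 256 * ((μ / 16) ^ 2 * Dim) := by rw [h2]; ring
      _ ≤ 256 * ((k / (16 * d)) ^ 2 * Dim) := by gcongr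

lemma converges_topK (hU : Dominates δ d ε U) (hDim : Dim = if lip then 1 else (d : ℝ))
    (hd : 1 ≤ d) (hε : 0 < ε) (hε1 : ε ≤ 1) (hb : Bounded lip fmax L ρ σ ℓ U)
    (hp : IsProblem D g f lip fmax L ρ σ ℓ) {μ : ℝ} {k : ℕ}
    (hμ : μ = if lip then √d * ε ^ (3 / 4 : ℝ) else ε ^ (3 / 4 : ℝ)) (hμd : 1 ≤ d * μ)
    (hμ1 : μ ≤ 1) (hk : k = ⌈d * μ⌉₊) {C : Compressor.{v, w} d} (hm : C.IsMeasurable)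
    (hc : ∀ x, Bd C.law (fun s => ‖x - C.apply x s‖ ^ 2) ((1 - k / (16 * d)) * ‖x‖ ^ 2))
    {b : ℝ} (hb1 : 1 ≤ b) (hcost : ∀ x s, (C.cost x s : ℝ) ≤ 2 * (b * k)) (x₀ : Vec d) :
    Converges (qualityParams U Dim ε d true) C g D f ρ ε x₀ δ
      (b * U ^ 64 * (if lip then d * √d / ε ^ (3 + 1 / 4 : ℝ) else d ^ 2 / ε ^ (3 + 1 / 4 : ℝ))) := by
  have hd1 : (1 : ℝ) ≤ d := by exact_mod_cast hd
  have hU0 := hU.ge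
  have hq2 : √ε ^ 2 = ε := Real.sq_sqrt hε.le
  have hw2 := rpow_three_quarters_div hε
  have hwpos : 0 < ε ^ (3 / 4 : ℝ) := by positivity
  have hk1 : d * μ ≤ k := hk ▸ Nat.le_ceil _
  have hk2 : (k : ℝ) ≤ 2 * (d * μ) := hk ▸ natCeil_le_two_mul hμd
  have hk0 : (1 : ℝ) ≤ k := hμd.trans hk1
  have hμ0 : 0 < μ := by
    by_contra! h
    nlinarith
  have hDim1 : 1 ≤ Dim := by rw [hDim]; split_ifs <;> linarith
  have ht := tuned_topK hU hDim hd hε hε1 hμ hμd hμ1 hk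
  have hT := ht.T_le_of_quality true
  rw [hq2] at hT
  have hB : d * μ * (Dim / ε ^ 4) =
      if lip then d * √d / ε ^ (3 + 1 / 4 : ℝ) else d ^ 2 / ε ^ (3 + 1 / 4 : ℝ) := by
    rw [hμ, hDim]
    split_ifs
    · calc d * (√d * ε ^ (3 / 4 : ℝ)) * (1 / ε ^ 4) = d * √d * (ε ^ (3 / 4 : ℝ) / ε ^ 4) := by ring
        _ = _ := by rw [hw2]; ring
    · calc d * ε ^ (3 / 4 : ℝ) * (d / ε ^ 4) = d ^ 2 * (ε ^ (3 / 4 : ℝ) / ε ^ 4) := by ring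
        _ = _ := by rw [hw2]; ring
  rw [← hB]
  have h := ht.converges hp hb hm hc (reset := true) (Or.inl ⟨rfl, rfl⟩) x₀ (m := 2 * (b * k))
    (comm := b * U ^ 64 * (d * μ * (Dim / ε ^ 4))) (δ := δ)
    (Filter.Eventually.of_forall fun ω i _ => ⟨rfl, hcost _ _⟩) ?_ hU.δ_le
  · rwa [hq2] at h
  · rw [if_pos rfl]
    have hbk : 1 ≤ b * k := one_le_mul_of_one_le_of_one_le hb1 hk0
    set T : ℝ := ((tunedParams U Dim (√ε ^ 4 / (Dim * U ^ 41)) √ε d true).T : ℝ) with hTdef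
    have hT0 : 0 ≤ T := by positivity
    calc T * (2 * (b * k)) + T ≤ T * (2 * (b * k)) + T * (b * k) := by
          gcongr
          exact le_mul_of_one_le_right hT0 hbk
      _ = 3 * b * T * k := by ring
      _ ≤ 3 * b * (U ^ 62 * (Dim / ε ^ 4)) * (2 * (d * μ)) := by gcongr
      _ = 6 * (b * U ^ 62 * (d * μ * (Dim / ε ^ 4))) := by ring
      _ ≤ U ^ 2 * (b * U ^ 62 * (d * μ * (Dim / ε ^ 4))) := by
          gcongr
          nlinarith
      _ = _ := by ring

lemma tuned_randomK (hU : Dominates δ d ε U) (hDim : Dim = if lip then 1 else (d : ℝ))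
    (hd : 1 ≤ d) (hε : 0 < ε) (hε1 : ε ≤ 1) {μ : ℝ} {k : ℕ}
    (hμ : μ = if lip then ε ^ (3 / 4 : ℝ) else ε ^ (3 / 4 : ℝ) / √d) (hμd : 1 ≤ d * μ)
    (hk : k = ⌈d * μ⌉₊) :
    k ≤ d ∧ Tuned lip d U Dim (√ε ^ 4 / (Dim * U ^ 41)) √ε (k / d) 1 := by
  have hd1 : (1 : ℝ) ≤ d := by exact_mod_cast hd
  have hd2 : 1 ≤ √(d : ℝ) := Real.one_le_sqrt.2 hd1
  have hd3 : √(d : ℝ) ^ 2 = d := Real.sq_sqrt (by linarith)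
  have hw := rpow_three_quarters_sq hε
  have hwpos : 0 < ε ^ (3 / 4 : ℝ) := by positivity
  have hw1 : ε ^ (3 / 4 : ℝ) ≤ 1 := Real.rpow_le_one hε.le hε1 (by norm_num)
  have hμ1 : μ ≤ 1 := by
    rw [hμ]
    split_ifs
    · exact hw1
    · exact (div_le_self hwpos.le hd2).trans hw1
  have hk1 : d * μ ≤ k := hk ▸ Nat.le_ceil _
  have hkd : k ≤ d := hk ▸ Nat.ceil_le.2 (by nlinarith)
  have hkd' : (k : ℝ) ≤ d := by exact_mod_cast hkd
  have hk0 : (1 : ℝ) ≤ k := hμd.trans hk1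
  have hμ0 : 0 < μ := by
    by_contra! h
    nlinarith
  have hDim1 : 1 ≤ Dim := by rw [hDim]; split_ifs <;> linarith
  refine ⟨hkd, ?_⟩
  refine tuned_of_quality hU.ge (by positivity) (Real.sqrt_le_one.2 hε1) hDim le_rfl hd
    (by positivity) ?_ hU.exp_ge ?_
  · rw [div_le_one (by positivity)]
    linarith
  · have h1 : μ ≤ k / d := by
      rw [le_div_iff₀ (by positivity)]
      linarith
    have h2 : √ε ^ 3 = μ ^ 2 * Dim := by
      rw [hμ, hDim, ← hw]
      split_ifs
      · ring
      · rw [div_pow, hd3]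
        field_simp
    have h3 : μ ^ 2 * Dim ≤ (k / d) ^ 2 * Dim := by gcongr
    have h4 : 0 ≤ (k / d : ℝ) ^ 2 * Dim := by positivity
    rw [Nat.cast_one, one_mul, h2]
    linarith

lemma converges_randomK (hU : Dominates δ d ε U) (hDim : Dim = if lip then 1 else (d : ℝ))
    (hd : 1 ≤ d) (hε : 0 < ε) (hε1 : ε ≤ 1) (hb : Bounded lip fmax L ρ σ ℓ U)
    (hp : IsProblem D g f lip fmax L ρ σ ℓ) {μ : ℝ} {k : ℕ}
    (hμ : μ = if lip then ε ^ (3 / 4 : ℝ) else ε ^ (3 / 4 : ℝ) / √d) (hμd : 1 ≤ d * μ)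
    (hk : k = ⌈d * μ⌉₊) (x₀ : Vec d) :
    Converges (qualityParams U Dim ε 1 false) (randomK d k) g D f ρ ε x₀ δ
      (U ^ 64 * (if lip then d / ε ^ (3 + 1 / 4 : ℝ) else d * √d / ε ^ (3 + 1 / 4 : ℝ))) := by
  have hd1 : (1 : ℝ) ≤ d := by exact_mod_cast hd
  have hd3 : √(d : ℝ) ^ 2 = d := Real.sq_sqrt (by linarith)
  have hU0 := hU.ge
  have hq2 : √ε ^ 2 = ε := Real.sq_sqrt hε.le
  have hw2 := rpow_three_quarters_div hε
  have hwpos : 0 < ε ^ (3 / 4 : ℝ) := by positivity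
  have hk2 : (k : ℝ) ≤ 2 * (d * μ) := hk ▸ natCeil_le_two_mul hμd
  have hμ0 : 0 < μ := by
    by_contra! h
    nlinarith
  have hDim1 : 1 ≤ Dim := by rw [hDim]; split_ifs <;> linarith
  obtain ⟨hkd, ht⟩ := tuned_randomK hU hDim hd hε hε1 hμ hμd hk
  have hT := ht.T_le_of_quality false
  rw [hq2] at hT
  have hB : d * μ * (Dim / ε ^ 4) =
      if lip then d / ε ^ (3 + 1 / 4 : ℝ) else d * √d / ε ^ (3 + 1 / 4 : ℝ) := by
    rw [hμ, hDim]
    split_ifs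
    · calc d * (ε ^ (3 / 4 : ℝ)) * (1 / ε ^ 4) = d * (ε ^ (3 / 4 : ℝ) / ε ^ 4) := by ring
        _ = _ := by rw [hw2]; ring
    · calc d * (ε ^ (3 / 4 : ℝ) / √d) * (d / ε ^ 4)
          = d * (√d ^ 2 / √d) * (ε ^ (3 / 4 : ℝ) / ε ^ 4) := by rw [hd3]; ring
        _ = d * √d * (ε ^ (3 / 4 : ℝ) / ε ^ 4) := by field_simp
        _ = _ := by rw [hw2]; ring
  rw [← hB]
  have h := ht.converges hp hb (C := randomK d k) randomK_isMeasurable (bd_randomK hd hkd)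
    (reset := false) (Or.inr ⟨rfl, rfl, randomK_linear⟩) x₀ (m := k)
    (comm := U ^ 64 * (d * μ * (Dim / ε ^ 4))) (δ := δ)
    (Filter.Eventually.of_forall fun ω i _ => ⟨rfl, by rw [randomK_cost hkd]⟩) ?_ hU.δ_le
  · rwa [hq2] at h
  · rw [if_neg (by simp), add_zero]
    calc ((tunedParams U Dim (√ε ^ 4 / (Dim * U ^ 41)) √ε 1 false).T : ℝ) * k
        ≤ (U ^ 62 * (Dim / ε ^ 4)) * (2 * (d * μ)) := by gcongr
      _ = 2 * (U ^ 62 * (d * μ * (Dim / ε ^ 4))) := by ring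
      _ ≤ U ^ 2 * (U ^ 62 * (d * μ * (Dim / ε ^ 4))) := by
          gcongr
          nlinarith
      _ = _ := by ring

/-- The parameters for a `c`-compressor. -/
noncomputable def constantParams (U Dim ε c : ℝ) (d : ℕ) : Params :=
  tunedParams U Dim (min (√ε ^ 4 / Dim) (√ε * c ^ 2 / d) / U ^ 40) √ε d true

lemma measurableSet_compressesAt {C : Compressor.{v, w} d} (hm : C.IsMeasurable) (c : ℝ) :
    MeasurableSet {x | C.CompressesAt c x} := by
  refine measurableSet_le ?_ (by fun_prop)
  have h : Measurable fun p : Vec d × C.Seed => ‖p.1 - C.apply p.1 p.2‖ₑ ^ 2 :=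
    (measurable_fst.sub hm).enorm.pow_const 2
  exact h.lintegral_prod_right'

open Classical in
lemma converges_constant (hU : Dominates δ d ε U) (hDim : Dim = if lip then 1 else (d : ℝ))
    (hd : 1 ≤ d) (hε : 0 < ε) (hε1 : ε ≤ 1) (hb : Bounded lip fmax L ρ σ ℓ U)
    (hp : IsProblem D g f lip fmax L ρ σ ℓ) {c : ℝ} (hc0 : 0 < c) (hc1 : c ≤ 1) (hcU : c⁻¹ ≤ U)
    {C : Compressor.{v, w} d} (hm : C.IsMeasurable) {b : ℝ} (hb1 : 1 ≤ b) (x₀ : Vec d)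
    (hC : ∀ᵐ ω ∂(sampleLaw (constantParams U Dim ε c d) C D),
      ∀ t < (constantParams U Dim ε c d).T,
        C.CompressesAt c (inputAt (constantParams U Dim ε c d) C g x₀ ω t) ∧
          (C.cost (inputAt (constantParams U Dim ε c d) C g x₀ ω t) (ω t).2.2 : ℝ) ≤ b) :
    Converges (constantParams U Dim ε c d) C g D f ρ ε x₀ δ
      (b * U ^ 64 * (if lip then 1 / ε ^ 4 + d / (ε ^ 2 * √ε) else d / ε ^ 4)) := by
  have hU0 := hU.ge
  have hq2 : √ε ^ 2 = ε := Real.sq_sqrt hε.le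
  have ht := tuned_of_constant hU.ge (by positivity) (Real.sqrt_le_one.2 hε1) hDim hd hc0 hc1 hcU
    hU.exp_ge
  have hT := ht.T_le_of_constant hcU true
  rw [hq2] at hT
  set B : ℝ := if lip then 1 / ε ^ 4 + d / (ε ^ 2 * √ε) else d / ε ^ 4 with hB
  have hB0 : 0 ≤ B := by rw [hB]; split_ifs <;> positivity
  set comp : Vec d → C.Seed → Vec d := fun x s => if C.CompressesAt c x then C.apply x s else x
    with hcomp
  have hmeas : Measurable fun p : Vec d × C.Seed => comp p.1 p.2 :=
    Measurable.ite (measurable_fst (measurableSet_compressesAt hm c)) hm measurable_fst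
  have hbd : ∀ x, Bd C.law (fun s => ‖x - comp x s‖ ^ 2) ((1 - c) * ‖x‖ ^ 2) := by
    intro x
    by_cases hx : C.CompressesAt c x
    · simp only [hcomp, if_pos hx]
      exact hx.bd hm hc1
    · simp only [hcomp, if_neg hx, sub_self, norm_zero]
      refine (Bd.const _).weaken ?_
      have : 0 ≤ 1 - c := by linarith
      rw [zero_pow two_ne_zero]
      positivity
  have h := ht.converges hp hb hmeas hbd (reset := true) (Or.inl ⟨rfl, rfl⟩) x₀ (m := b)
    (comm := b * U ^ 64 * B) (δ := δ) ?_ ?_ hU.δ_le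
  · rwa [hq2] at h
  · filter_upwards [hC] with ω hω i hi
    refine ⟨?_, (hω i hi).2⟩
    have := (hω i hi).1
    exact (if_pos this).symm
  · rw [if_pos rfl]
    set T : ℝ := ((tunedParams U Dim (min (√ε ^ 4 / Dim) (√ε * c ^ 2 / d) / U ^ 40) √ε d true).T : ℝ)
      with hTdef
    have hT0 : 0 ≤ T := by positivity
    calc T * b + T = T * b + T * 1 := by ring
      _ ≤ T * b + T * b := by gcongr
      _ = 2 * b * T := by ring
      _ ≤ 2 * b * (2 * U ^ 63 * B) := by gcongr
      _ = 4 * (b * U ^ 63 * B) := by ring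
      _ ≤ U * (b * U ^ 63 * B) := by gcongr; linarith
      _ = _ := by ring

end Parts

/-! ### The size of the constants -/

/-- A number that dominates all constants and logarithms of a problem of size `s`. -/
noncomputable def scale (δ s : ℝ) (d : ℕ) (ε : ℝ) : ℝ :=
  (2 ^ 20 + 21 / δ) * s * (1 + Real.log (d / ε))

section Scale

variable {δ s ε : ℝ} {d : ℕ}

lemma softFactor_eq_scale_pow (δ s : ℝ) (d : ℕ) (ε : ℝ) :
    softFactor ((2 ^ 20 + 21 / δ) ^ 64) 64 s d ε = scale δ s d ε ^ 64 := by
  rw [softFactor, scale, mul_pow, mul_pow]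

lemma log_div_nonneg (hd : 1 ≤ d) (hε : 0 < ε) (hε1 : ε ≤ 1) : 0 ≤ Real.log (d / ε) := by
  have hd1 : (1 : ℝ) ≤ d := by exact_mod_cast hd
  refine Real.log_nonneg ?_
  rw [le_div_iff₀ hε]
  linarith

lemma le_scale (hδ : 0 < δ) (hs : 1 ≤ s) (hd : 1 ≤ d) (hε : 0 < ε) (hε1 : ε ≤ 1) :
    s ≤ scale δ s d ε := by
  have hl := log_div_nonneg hd hε hε1
  have h1 : 0 < 21 / δ := by positivity
  unfold scale
  calc s = 1 * s * 1 := by ring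
    _ ≤ _ := by gcongr <;> linarith

lemma dominates_scale (hδ : 0 < δ) (hs : 1 ≤ s) (hd : 1 ≤ d) (hε : 0 < ε) (hε1 : ε ≤ 1) :
    Dominates δ d ε (scale δ s d ε) := by
  have hl := log_div_nonneg hd hε hε1
  have h1 : 0 < 21 / δ := by positivity
  have hc : 2 ^ 20 + 21 / δ ≤ scale δ s d ε := by
    unfold scale
    calc 2 ^ 20 + 21 / δ = (2 ^ 20 + 21 / δ) * 1 * 1 := by ring
      _ ≤ _ := by gcongr; linarith
  have hlog : 16 * Real.log (d / ε) ≤ scale δ s d ε := by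
    unfold scale
    calc 16 * Real.log (d / ε) = 16 * 1 * Real.log (d / ε) := by ring
      _ ≤ _ := by gcongr <;> linarith
  have hU : 2 ^ 20 ≤ scale δ s d ε := by linarith
  refine ⟨hU, ?_, ?_⟩
  · rw [div_le_iff₀ (by linarith)]
    have h2 : 21 / δ ≤ scale δ s d ε := by linarith
    rw [div_le_iff₀ hδ] at h2
    linarith
  · have e : √ε ^ 8 = ε ^ 4 := by
      rw [show √ε ^ 8 = (√ε ^ 2) ^ 4 by ring, Real.sq_sqrt hε.le]
    rw [e]
    exact dim_pow_le_exp hd hε hU hlog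

lemma one_le_problemSize {lip : Bool} {fmax L ρ σ ℓ : ℝ} (hf : 0 ≤ fmax) (hL : 0 ≤ L)
    (hρ : 0 < ρ) (hσ : 0 ≤ σ) (hℓ : 0 ≤ ℓ) : 1 ≤ problemSize lip fmax L ρ σ ℓ := by
  have := inv_pos.2 hρ
  unfold problemSize
  split_ifs <;> linarith

end Scale

end CompressedSGD
open CompressedSGD in
theorem mainTheorem5 (δ : ℝ) (hδ₀ : 0 < δ) (hδ₁ : δ < 1) :
    ∃ (K : ℝ) (p : ℕ) (κ : ℝ), 0 < K ∧ 0 < κ ∧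
    ∀ (lip : Bool) (d : ℕ) (ε fmax L ρ σ ℓ : ℝ), 1 ≤ d → 0 < ε → ε ≤ 1 →
      0 ≤ fmax → 0 ≤ L → 0 < ρ → 0 ≤ σ → 0 ≤ ℓ →
    -- TopK-type compressors, `μ = √d ε^{3/4}` or `μ = ε^{3/4}`, and `k = ⌈d μ⌉`
    (∀ (μ : ℝ) (k : ℕ),
      μ = (if lip then √d * ε ^ (3 / 4 : ℝ) else ε ^ (3 / 4 : ℝ)) →
      1 ≤ d * μ → μ ≤ 1 → k = ⌈d * μ⌉₊ →
      ∃ A : Params, 0 < A.η ∧ 0 ≤ A.r ∧ A.resetError = true ∧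
        (A.T : ℝ) ≤ softFactor K p (problemSize lip fmax L ρ σ ℓ) d ε *
          (if lip then 1 / ε ^ 4 else d / ε ^ 4) ∧
        -- sketch-based TopK
        (∀ (m B : ℕ) [NeZero B] (b : ℝ), κ * (1 + Real.log d) ≤ m → κ * k ≤ B → 1 ≤ b →
          m * B ≤ b * k →
          ∀ (Θ : Type u) [MeasurableSpace Θ] (D : MeasureTheory.Measure Θ)
            [MeasureTheory.IsProbabilityMeasure D] (g : Vec d → Θ → Vec d) (f : Vec d → ℝ)
            (x₀ : Vec d), IsProblem D g f lip fmax L ρ σ ℓ →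
            Converges A (sketchTopK d k m B) g D f ρ ε x₀ δ
              (b * softFactor K p (problemSize lip fmax L ρ σ ℓ) d ε *
                (if lip then d * √d / ε ^ (3 + 1 / 4 : ℝ) else d ^ 2 / ε ^ (3 + 1 / 4 : ℝ)))) ∧
        -- every `k/d`-compressor whose messages consist of at most `b k` symbols
        (∀ (C : Compressor.{v, w} d) (b : ℝ), C.IsMeasurable →
          (∀ x, C.CompressesAt (k / d) x) → 1 ≤ b → (∀ x s, (C.cost x s : ℝ) ≤ b * k) →
          ∀ (Θ : Type u) [MeasurableSpace Θ] (D : MeasureTheory.Measure Θ)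
            [MeasureTheory.IsProbabilityMeasure D] (g : Vec d → Θ → Vec d) (f : Vec d → ℝ)
            (x₀ : Vec d), IsProblem D g f lip fmax L ρ σ ℓ →
            Converges A C g D f ρ ε x₀ δ
              (b * softFactor K p (problemSize lip fmax L ρ σ ℓ) d ε *
                (if lip then d * √d / ε ^ (3 + 1 / 4 : ℝ)
                  else d ^ 2 / ε ^ (3 + 1 / 4 : ℝ))))) ∧
    -- RandomK, `μ = ε^{3/4}` or `μ = ε^{3/4} / √d`, and `k = ⌈d μ⌉`
    (∀ (μ : ℝ) (k : ℕ),
      μ = (if lip then ε ^ (3 / 4 : ℝ) else ε ^ (3 / 4 : ℝ) / √d) →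
      1 ≤ d * μ → k = ⌈d * μ⌉₊ →
      ∃ A : Params, 0 < A.η ∧ 0 ≤ A.r ∧ A.resetError = false ∧
        (A.T : ℝ) ≤ softFactor K p (problemSize lip fmax L ρ σ ℓ) d ε *
          (if lip then 1 / ε ^ 4 else d / ε ^ 4) ∧
        ∀ (Θ : Type u) [MeasurableSpace Θ] (D : MeasureTheory.Measure Θ)
          [MeasureTheory.IsProbabilityMeasure D] (g : Vec d → Θ → Vec d) (f : Vec d → ℝ)
          (x₀ : Vec d), IsProblem D g f lip fmax L ρ σ ℓ →
          Converges A (randomK d k) g D f ρ ε x₀ δ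
            (softFactor K p (problemSize lip fmax L ρ σ ℓ) d ε *
              (if lip then d / ε ^ (3 + 1 / 4 : ℝ)
                else d * √d / ε ^ (3 + 1 / 4 : ℝ)))) ∧
    -- a compressor that provides `c`-compression of all compressed vectors, with messages of
    -- at most `b` symbols
    (∀ c : ℝ, 0 < c → c < 1 →
      ∃ A : Params, 0 < A.η ∧ 0 ≤ A.r ∧ A.resetError = true ∧
        (A.T : ℝ) ≤ softFactor K p (c⁻¹ + problemSize lip fmax L ρ σ ℓ) d ε *
          (if lip then 1 / ε ^ 4 + d / (ε ^ 2 * √ε) else d / ε ^ 4) ∧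
        ∀ (C : Compressor.{v, w} d) (b : ℝ), C.IsMeasurable → 1 ≤ b →
        ∀ (Θ : Type u) [MeasurableSpace Θ] (D : MeasureTheory.Measure Θ)
          [MeasureTheory.IsProbabilityMeasure D] (g : Vec d → Θ → Vec d) (f : Vec d → ℝ)
          (x₀ : Vec d), IsProblem D g f lip fmax L ρ σ ℓ →
          (∀ᵐ ω ∂(sampleLaw A C D), ∀ t < A.T,
            C.CompressesAt c (inputAt A C g x₀ ω t) ∧
              (C.cost (inputAt A C g x₀ ω t) (ω t).2.2 : ℝ) ≤ b) →
          Converges A C g D f ρ ε x₀ δ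
            (b * softFactor K p (c⁻¹ + problemSize lip fmax L ρ σ ℓ) d ε *
              (if lip then 1 / ε ^ 4 + d / (ε ^ 2 * √ε) else d / ε ^ 4))) := by
  have hκ : (0 : ℝ) < 1600 := by norm_num
  refine ⟨(2 ^ 20 + 21 / δ) ^ 64, 64, 1600, by positivity, hκ, ?_⟩
  intro lip d ε fmax L ρ σ ℓ hd hε hε1 hf hL hρ hσ hℓ
  have hd1 : (1 : ℝ) ≤ d := by exact_mod_cast hd
  have hs := one_le_problemSize (lip := lip) hf hL hρ hσ hℓ
  have hU := dominates_scale hδ₀ hs hd hε hε1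
  have hb : Bounded lip fmax L ρ σ ℓ (scale δ (problemSize lip fmax L ρ σ ℓ) d ε) :=
    ⟨hf, hL, hρ, hσ, hℓ, le_scale hδ₀ hs hd hε hε1⟩
  simp only [softFactor_eq_scale_pow]
  obtain ⟨Dim, hDim⟩ : ∃ Dim : ℝ, Dim = if lip then 1 else (d : ℝ) := ⟨_, rfl⟩
  refine ⟨?_, ?_, ?_⟩
  · intro μ k hμ hμd hμ1 hk
    have ht := tuned_topK hU hDim hd hε hε1 hμ hμd hμ1 hk
    have hkd : k ≤ d := hk ▸ Nat.ceil_le.2 (by nlinarith)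
    have hk1 : 1 ≤ k := by
      have : (1 : ℝ) ≤ k := hμd.trans (hk ▸ Nat.le_ceil _)
      exact_mod_cast this
    refine ⟨qualityParams _ Dim ε d true, ht.η_pos, ?_, rfl, T_le_soft_of_quality ht hε true,
      ?_, ?_⟩
    · exact mul_nonneg (Real.sqrt_nonneg _) (sq_nonneg _)
    · intro m B _ b hm hB hb1 hmB Θ _ D _ g f x₀ hp
      have hm4 := two_mul_succ_le_four_pow hd hm
      have hm0 : 0 < m := by
        rcases Nat.eq_zero_or_pos m with rfl | h
        · simp at hm4; omega
        · exact h
      refine converges_topK hU hDim hd hε hε1 hb hp hμ hμd hμ1 hk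
        (sketchTopK_isMeasurable hm0 hkd)
        (bd_sketchTopK hk1 hkd (by exact_mod_cast hB) hm4) hb1 (fun x s => ?_) x₀
      rw [sketchTopK_cost hkd]
      push_cast
      have : (k : ℝ) ≤ b * k := le_mul_of_one_le_left (by positivity) hb1
      linarith
    · intro C b hm hC hb1 hcost Θ _ D _ g f x₀ hp
      have hkd' : (k : ℝ) ≤ d := by exact_mod_cast hkd
      refine converges_topK hU hDim hd hε hε1 hb hp hμ hμd hμ1 hk hm (fun x => ?_) hb1
        (fun x s => ?_) x₀
      · refine ((hC x).bd hm ((div_le_one (by positivity)).2 hkd')).weaken ?_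
        have : (k : ℝ) / (16 * d) ≤ k / d := by
          gcongr
          linarith
        gcongr
      · have : 0 ≤ b * k := by positivity
        linarith [hcost x s]
  · intro μ k hμ hμd hk
    have ht := (tuned_randomK hU hDim hd hε hε1 hμ hμd hk).2
    refine ⟨qualityParams _ Dim ε 1 false, ht.η_pos, ?_, rfl, T_le_soft_of_quality ht hε false,
      ?_⟩
    · exact mul_nonneg (Real.sqrt_nonneg _) (sq_nonneg _)
    · intro Θ _ D _ g f x₀ hp
      exact converges_randomK hU hDim hd hε hε1 hb hp hμ hμd hk x₀
  · intro c hc hc1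
    have hci := inv_pos.2 hc
    have hs' : 1 ≤ c⁻¹ + problemSize lip fmax L ρ σ ℓ := by linarith
    have hU' := dominates_scale hδ₀ hs' hd hε hε1
    have hle := le_scale hδ₀ hs' hd hε hε1
    have hb' : Bounded lip fmax L ρ σ ℓ (scale δ (c⁻¹ + problemSize lip fmax L ρ σ ℓ) d ε) :=
      ⟨hf, hL, hρ, hσ, hℓ, by linarith⟩
    have hcU : c⁻¹ ≤ scale δ (c⁻¹ + problemSize lip fmax L ρ σ ℓ) d ε := by linarith
    have ht := tuned_of_constant hU'.ge (Real.sqrt_pos.2 hε) (Real.sqrt_le_one.2 hε1) hDim hd hc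
      hc1.le hcU hU'.exp_ge
    refine ⟨constantParams _ Dim ε c d, ht.η_pos, ?_, rfl, ?_, ?_⟩
    · exact mul_nonneg (Real.sqrt_nonneg _) (sq_nonneg _)
    · have h := ht.T_le_of_constant hcU true
      rw [Real.sq_sqrt hε.le] at h
      refine h.trans ?_
      have h1 : (2 : ℝ) * scale δ (c⁻¹ + problemSize lip fmax L ρ σ ℓ) d ε ^ 63 ≤
          scale δ (c⁻¹ + problemSize lip fmax L ρ σ ℓ) d ε ^ 64 := by
        rw [pow_succ _ 63, mul_comm]
        have := hU'.ge
        gcongr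
        linarith
      refine mul_le_mul_of_nonneg_right h1 ?_
      split_ifs <;> positivity
    · intro C b hm hb1 Θ _ D _ g f x₀ hp hC
      exact converges_constant hU' hDim hd hε hε1 hb' hp hc hc1.le hcU hm hb1 x₀ hC
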